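/- Let $n\ge 0$ and let $\Sigma=\{\sigma_0,\sigma_1,\dots,\sigma_n\}\subset\mathbb{C}$ be distinct points with $\sigma_0=0$; put $X_\Sigma=\mathbb{A}^1\setminus\Sigma$, $\omega_k=\frac{dz}{z-\sigma_k}$, and let $\overline\Sigma$ be the complex conjugate configuration. For $\underline{s}=(s_0,\dots,s_n)\in\mathbb{R}^{n+1}$ let $\nabla_{\underline s}=d+\sum_k s_k\omega_k\wedge$ on $\mathcal{O}(X_\Sigma)$, let $H^1_{\mathrm{dR}}(X_\Sigma,\nabla_{\underline s})=\operatorname{coker}\big(\nabla_{\underline s}:\mathcal{O}(X_\Sigma)\to\Omega^1(X_\Sigma)\big)$, let $\mathcal{L}_{\underline s}$ be the rank one local system on $\mathbb{C}\setminus\Sigma$ whose dual $\mathcal{L}_{\underline s}^\vee$ is generated by the branches of $x^{s_0}\prod_{k\ge1}(1-x\sigma_k^{-1})^{s_k}$, and let $H^1_{\mathrm B}(X_\Sigma,\mathcal{L}_{\underline s})=H^1(\mathbb{C}\setminus\Sigma,\mathcal{L}_{\underline s})$ (complex coefficients), with the comparison map $\mathrm{comp}_{\mathrm{B,dR}}(\underline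 s):H^1_{\mathrm{dR}}(X_\Sigma,\nabla_{\underline s})\to H^1_{\mathrm B}(X_\Sigma,\mathcal{L}_{\underline s})$ given by integration. Let $F_\infty:H^1_{\mathrm B}(X_\Sigma,\mathcal{L}_{\underline s})\to H^1_{\mathrm B}(X_{\overline\Sigma},\mathcal{L}_{-\underline s})$ be the real Frobenius: it is induced by complex conjugation $\mathbb{C}\setminus\overline\Sigma\to\mathbb{C}\setminus\Sigma$ and by multiplication of sections with $|z|^{2s_0}\prod_{k\ge1}|1-z\sigma_k^{-1}|^{2s_k}$. Let $$\langle\ ,\ \rangle:H^1_{\mathrm{dR}}(X_{\overline\Sigma},\nabla_{\underline s})\times H^1_{\mathrm{dR}}(X_{\overline\Sigma},\nabla_{-\underline s})\to\mathbb{C}$$ be the de Rham intersection pairing $\langle\nu,\eta\rangle=\frac1{2\pi i}\iint\widetilde\nu\wedge\eta$, where $\widetilde\nu$ is a smooth compactly supported form on $\mathbb{C}\setminus\overline\Sigma$ that is $\nabla_{\underline s}$-cohomologous to $\nu$. Assume from now on that $s_k>0$ for all $k$ and $\sum_k s_k<\frac12$ (so that $\underline s$ is generic: no $s_k$, and not $\sum_k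 s_k$, is an integer). Then the following hold. **(i)** $\mathrm{comp}_{\mathrm{B,dR}}(\underline s)$ on $X_\Sigma$ and $\mathrm{comp}_{\overline{\mathrm B},\mathrm{dR}}(-\underline s)$ on $X_{\overline\Sigma}$ are isomorphisms, and the pairing above is defined. Thus there is the single-valued period map $$\mathbf{s}=\mathrm{comp}_{\overline{\mathrm B},\mathrm{dR}}(-\underline s)^{-1}\circ F_\infty\circ\mathrm{comp}_{\mathrm{B,dR}}(\underline s):H^1_{\mathrm{dR}}(X_\Sigma,\nabla_{\underline s})\to H^1_{\mathrm{dR}}(X_{\overline\Sigma},\nabla_{-\underline s}).$$ **(ii)** For all $\omega=\sum_k a_k\omega_k$ and $\nu=\sum_k b_k\omega_k$ with $a_k,b_k\in\mathbb{C}$ and $\sum_k b_k=0$ (logarithmic forms, $\nu$ without pole at $\infty$), the single-valued pairing of the classes of $\nu$ and $\omega$ (where $\nu$ is placed in $H^1_{\mathrm{dR}}(X_{\overline\Sigma},\nabla_{\underline s})$ by conjugating its coefficients $b_k$ and the points $\sigma_k$) is given by an absolutely convergent integral $$\langle\nu,\mathbf{s}\,\omega\rangle=-\frac1{2\pi i}\iint_{\mathbb{C}}|z|^{2s_0}\prod_{k=1}^n|1-z\sigma_k^{-1}|^{2s_k}\;\overline\nu\wedge\omega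 .$$ **(iii)** Define the single-valued Lauricella matrix, for $1\le i,j\le n$, by $$L^{\mathbf s}_\Sigma(\underline s)_{ij}=\frac{s_j}{2\pi i}\iint_{\mathbb{C}}|z|^{2s_0}\prod_{k=1}^n|1-z\sigma_k^{-1}|^{2s_k}\Big(\frac{d\overline z}{\overline z-\overline\sigma_i}-\frac{d\overline z}{\overline z}\Big)\wedge\frac{dz}{z-\sigma_j}.$$ Let $\delta_i$ ($1\le i\le n$) be paths from $0$ to $\sigma_i$, smooth with interior in $\mathbb{C}\setminus\Sigma$, equipped with continuous branches of the logarithms of $x$ and $1-x\sigma_k^{-1}$, and use the complex conjugate paths and branches for $\overline\Sigma$. Let $L_\Sigma(\underline s)$ and $L_{\overline\Sigma}(-\underline s)$ be the Lauricella matrices: the $(i,j)$ entry of $L_\Sigma(\underline s)$ is the pairing of the image under $\mathrm{comp}_{\mathrm{B,dR}}(\underline s)$ of the class of $-s_j\omega_j$ with the class of $\delta_i\otimes x^{s_0}\prod_{k\ge1}(1-x\sigma_k^{-1})^{s_k}$ in the locally finite homology $H_1^{\mathrm{lf}}(\mathbb{C}\setminus\Sigma,\mathcal{L}_{\underline s}^\vee)$,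 the dual of $H^1_{\mathrm B}(X_\Sigma,\mathcal{L}_{\underline s})$; $L_{\overline\Sigma}(-\underline s)$ is the same with $(\Sigma,\underline s,\delta_i)$ replaced by $(\overline\Sigma,-\underline s,\overline{\delta_i})$. Then $$L_\Sigma(\underline s)_{ij}=-s_j\int_{\delta_i}x^{s_0}\prod_{k=1}^n(1-x\sigma_k^{-1})^{s_k}\frac{dx}{x-\sigma_j}$$ (improper integral), and $$L_{\overline\Sigma}(-\underline s)_{ij}=\lim\Big(s_j\int_{a}^{b}x^{-s_0}\prod_{k=1}^n(1-x\overline\sigma_k^{-1})^{-s_k}\frac{dx}{x-\overline\sigma_j}+\mathbf 1_{i=j}\;b^{-s_0}\prod_{k=1}^n(1-b\,\overline\sigma_k^{-1})^{-s_k}\Big),$$ where the integral is along the portion of $\overline{\delta_i}$ between its points $a$ and $b$, and $a,b$ tend along the path to $0$ and $\overline\sigma_i$. Moreover, for all such paths, $$L_{\overline\Sigma}(-\underline s)\,L^{\mathbf s}_\Sigma(\underline s)=L_\Sigma(\underline s).$$ There exist paths $\delta_1,\dots,\delta_n$ whose classes $\delta_i\otimes x^{s_0}\prod_{k\ge1}(1-x\sigma_k^{-1})^{s_k}$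 form a basis of $H_1^{\mathrm{lf}}(\mathbb{C}\setminus\Sigma,\mathcal{L}_{\underline s}^\vee)$, and whenever they form a basis, $L_{\overline\Sigma}(-\underline s)$ is invertible and $$L^{\mathbf s}_\Sigma(\underline s)=L_{\overline\Sigma}(-\underline s)^{-1}L_\Sigma(\underline s).$$ -/

import Mathlib

open Filter Topology MeasureTheory Set

namespace Lauricella

open scoped ContDiff

noncomputable section

/-- A complex differential 1-form `dz dz + dzbar dz̄` on the plane, given by its two coefficient
functions. -/
structure Form where
  /-- The coefficient of `dz`. -/
  dz : ℂ → ℂ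
  /-- The coefficient of `dz̄`. -/
  dzbar : ℂ → ℂ

/-- The density of `α ∧ β` with respect to Lebesgue measure `dx dy`, for the standard orientation:
`dz ∧ dz̄ = -2i dx ∧ dy`. -/
def wedgeDensity (α β : Form) (z : ℂ) : ℂ :=
  (α.dz z * β.dzbar z - α.dzbar z * β.dz z) * (-2 * Complex.I)

/-- The integral `∬_ℂ α ∧ β`. -/
def wedgeIntegral (α β : Form) : ℂ := ∫ z : ℂ, wedgeDensity α β z

/-- The form `f dz`. -/
def holForm (f : ℂ → ℂ) : Form := ⟨f, 0⟩

/-- The complex conjugate of the form `f dz`. -/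
def conjForm (f : ℂ → ℂ) : Form := ⟨0, fun z => (starRingEnd ℂ) (f z)⟩


/-- A configuration `Σ = {σ₀, σ₁, …, σₙ}` of distinct points of `ℂ` with `σ₀ = 0`. -/
structure PointConfig (n : ℕ) where
  /-- The points `σ_k`. -/
  pt : Fin (n + 1) → ℂ
  injective : Function.Injective pt
  pt_zero : pt 0 = 0

namespace PointConfig

variable {n : ℕ} (S : PointConfig n)

/-- The complex points `ℂ \ Σ` of the punctured line `X_Σ`. -/
def compl : Set ℂ := {z | ∀ k, z ≠ S.pt k}

/-- The conjugate configuration `Σ̄`. -/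
def bar : PointConfig n where
  pt k := (starRingEnd ℂ) (S.pt k)
  injective := (starRingEnd ℂ).injective.comp S.injective
  pt_zero := by simp [S.pt_zero]

/-- The functions `z` (for `k = 0`) and `1 - z σ_k⁻¹` (for `k ≥ 1`). -/
def factor (k : Fin (n + 1)) (z : ℂ) : ℂ := if k = 0 then z else 1 - z * (S.pt k)⁻¹

/-- The derivative of `factor k`, a nonzero constant. -/
def factorDeriv (k : Fin (n + 1)) : ℂ := if k = 0 then 1 else -(S.pt k)⁻¹

theorem pt_ne_zero {k : Fin (n + 1)} (hk : k ≠ 0) : S.pt k ≠ 0 := fun h =>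
  hk (S.injective (h.trans S.pt_zero.symm))

theorem factor_eq (k : Fin (n + 1)) (z : ℂ) :
    S.factor k z = S.factorDeriv k * (z - S.pt k) := by
  unfold factor factorDeriv
  split_ifs with h
  · simp [h, S.pt_zero]
  · have := S.pt_ne_zero h
    field_simp
    ring

theorem factorDeriv_ne_zero (k : Fin (n + 1)) : S.factorDeriv k ≠ 0 := by
  unfold factorDeriv
  split_ifs with h
  · simp
  · simpa using S.pt_ne_zero h

theorem factor_bar (k : Fin (n + 1)) (z : ℂ) :
    S.bar.factor k z = (starRingEnd ℂ) (S.factor k ((starRingEnd ℂ) z)) := by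
  unfold factor bar
  split_ifs <;> simp

theorem isOpen_compl : IsOpen S.compl := by
  have : S.compl = (range S.pt)ᶜ := by
    ext z; simp [compl, eq_comm]
  rw [this]
  exact (finite_range S.pt).isClosed.isOpen_compl

theorem mem_compl_bar {z : ℂ} : z ∈ S.bar.compl ↔ (starRingEnd ℂ) z ∈ S.compl := by
  refine forall_congr' fun k => not_congr ?_
  constructor
  · rintro rfl; simp [bar]
  · intro h; simp [bar, ← h]

/-- The function `|z|^{2 s₀} ∏_{k ≥ 1} |1 - z σ_k⁻¹|^{2 s_k}`. -/
def weight (s : Fin (n + 1) → ℝ) (z : ℂ) : ℝ := ∏ k, ‖S.factor k z‖ ^ (2 * s k)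

/-- The coefficient of `dz` in the connection form `∑ s_k dz / (z - σ_k)`. -/
def connForm (s : Fin (n + 1) → ℝ) (z : ℂ) : ℂ := ∑ k, (s k : ℂ) / (z - S.pt k)

/-! ### dR -/

/-- `∏ (z - σ_k)`. -/
def denom (z : ℂ) : ℂ := ∏ k, (z - S.pt k)

theorem denom_ne_zero {z : ℂ} (hz : z ∈ S.compl) : S.denom z ≠ 0 :=
  Finset.prod_ne_zero_iff.2 fun k _ => sub_ne_zero.2 (hz k)

theorem denom_eq_zero {z : ℂ} (hz : z ∉ S.compl) : S.denom z = 0 := by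
  simp only [compl, mem_ofPred_eq, not_forall, not_not] at hz
  obtain ⟨k, rfl⟩ := hz
  exact Finset.prod_eq_zero (Finset.mem_univ k) (sub_self _)

/-- `∏ (X - σ_k)`. -/
def denomPoly : Polynomial ℂ := ∏ k, (Polynomial.X - Polynomial.C (S.pt k))

theorem eval_denomPoly (z : ℂ) : S.denomPoly.eval z = S.denom z := by
  simp [denomPoly, denom, Polynomial.eval_prod]

/-- The ring `𝒪(X_Σ)` of algebraic regular functions on `X_Σ`, i.e. rational functions whose poles
lie in `Σ ∪ {∞}`. They are represented as functions on `ℂ` extended by zero to `Σ` (this is what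
division by zero gives below), so that equality of representatives is equality on `ℂ \ Σ`.
An algebraic 1-form on `X_Σ` is `f dz` with `f` in `𝒪(X_Σ)`, and is represented by `f`. -/
def regularFunctions : Submodule ℂ (ℂ → ℂ) where
  carrier := {f | ∃ (p : Polynomial ℂ) (m : ℕ), ∀ z, f z = p.eval z / S.denom z ^ (m + 1)}
  zero_mem' := ⟨0, 0, by simp⟩
  smul_mem' := by
    rintro c f ⟨p, m, h⟩
    exact ⟨Polynomial.C c * p, m, fun z => by simp [h, mul_div_assoc]⟩
  add_mem' := by
    rintro f g ⟨p, m, h⟩ ⟨q, l, h'⟩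
    refine ⟨p * S.denomPoly ^ (l + 1) + q * S.denomPoly ^ (m + 1), m + l + 1, fun z => ?_⟩
    simp only [Pi.add_apply, h, h', Polynomial.eval_add, Polynomial.eval_mul,
      Polynomial.eval_pow, eval_denomPoly]
    by_cases hz : S.denom z = 0
    · simp [hz]
    · field_simp
      ring

theorem regularFunctions_apply_of_notMem (f : S.regularFunctions) {z : ℂ} (hz : z ∉ S.compl) :
    f.1 z = 0 := by
  obtain ⟨p, m, h⟩ := f.2
  simp [h, S.denom_eq_zero hz]

theorem mem_regularFunctions_of_eqOn {f : ℂ → ℂ} (p : Polynomial ℂ) (m : ℕ)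
    (h0 : ∀ z ∉ S.compl, f z = 0)
    (h : ∀ z ∈ S.compl, f z = p.eval z / S.denom z ^ (m + 1)) : f ∈ S.regularFunctions := by
  refine ⟨p, m, fun z => ?_⟩
  by_cases hz : z ∈ S.compl
  · exact h z hz
  · simp [h0 z hz, S.denom_eq_zero hz]

theorem regularFunctions_differentiableAt (f : S.regularFunctions) {z : ℂ} (hz : z ∈ S.compl) :
    DifferentiableAt ℂ f.1 z := by
  obtain ⟨p, m, h⟩ := f.2
  have : f.1 = fun z => p.eval z / S.denomPoly.eval z ^ (m + 1) := by
    ext z; rw [h, eval_denomPoly]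
  rw [this]
  refine DifferentiableAt.div p.differentiableAt (S.denomPoly.differentiableAt.pow _) ?_
  rw [eval_denomPoly]
  exact pow_ne_zero _ (S.denom_ne_zero hz)

/-- The numerator of `∑ a_k / (z - σ_k)`. -/
def coPoly (a : Fin (n + 1) → ℂ) : Polynomial ℂ :=
  ∑ k, Polynomial.C (a k) * ∏ j ∈ Finset.univ.erase k, (Polynomial.X - Polynomial.C (S.pt j))

theorem sum_div_eq (a : Fin (n + 1) → ℂ) {z : ℂ} (hz : z ∈ S.compl) :
    ∑ k, a k / (z - S.pt k) = (S.coPoly a).eval z / S.denom z := by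
  rw [eq_div_iff (S.denom_ne_zero hz), Finset.sum_mul, coPoly, Polynomial.eval_finsetSum]
  refine Finset.sum_congr rfl fun k _ => ?_
  have := sub_ne_zero.2 (hz k)
  rw [denom, ← Finset.mul_prod_erase _ _ (Finset.mem_univ k)]
  simp only [Polynomial.eval_mul, Polynomial.eval_C, Polynomial.eval_prod, Polynomial.eval_sub,
    Polynomial.eval_X]
  field_simp

theorem covariantDeriv_mem (s : Fin (n + 1) → ℝ) (f : S.regularFunctions) :
    S.compl.indicator (fun z => deriv f.1 z + S.connForm s z * f.1 z) ∈ S.regularFunctions := by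
  obtain ⟨p, m, h⟩ := f.2
  refine S.mem_regularFunctions_of_eqOn
    (Polynomial.derivative p * S.denomPoly - (m + 1 : ℕ) * p * Polynomial.derivative S.denomPoly
      + S.coPoly (fun k => (s k : ℂ)) * p) (m + 1) (fun z hz => indicator_of_notMem hz _)
    fun z hz => ?_
  have hf : f.1 = fun z => p.eval z / S.denomPoly.eval z ^ (m + 1) := by
    ext z; rw [h, eval_denomPoly]
  have hd := S.denom_ne_zero hz
  have hd' : S.denomPoly.eval z ≠ 0 := by rwa [eval_denomPoly]
  have hder : deriv f.1 z = ((Polynomial.derivative p).eval z * S.denom z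
      - (m + 1 : ℕ) * p.eval z * (Polynomial.derivative S.denomPoly).eval z)
        / S.denom z ^ (m + 2) := by
    rw [hf]
    have := (p.hasDerivAt z).div ((S.denomPoly.hasDerivAt z).fun_pow (m + 1)) (pow_ne_zero _ hd')
    refine this.deriv.trans ?_
    simp only [eval_denomPoly, Nat.add_sub_cancel]
    field_simp
    ring
  rw [indicator_of_mem hz, hder, connForm, S.sum_div_eq _ hz, h]
  simp only [Polynomial.eval_add, Polynomial.eval_sub, Polynomial.eval_mul, eval_denomPoly,
    Polynomial.eval_natCast]
  field_simp
  ring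

/-- The connection `∇_s : 𝒪(X_Σ) → Ω¹(X_Σ)`, `f ↦ df + f ∑ s_k dz / (z - σ_k)`. -/
def covariantDeriv (s : Fin (n + 1) → ℝ) : S.regularFunctions →ₗ[ℂ] S.regularFunctions where
  toFun f := ⟨_, S.covariantDeriv_mem s f⟩
  map_add' f g := by
    ext z
    by_cases hz : z ∈ S.compl
    · simp only [Submodule.coe_add, indicator_of_mem hz, Pi.add_apply]
      rw [deriv_add (S.regularFunctions_differentiableAt f hz)
        (S.regularFunctions_differentiableAt g hz)]
      ring
    · simp [hz]
  map_smul' c f := by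
    ext z
    by_cases hz : z ∈ S.compl
    · simp only [Submodule.coe_smul, indicator_of_mem hz, Pi.smul_apply, RingHom.id_apply,
        smul_eq_mul]
      rw [deriv_const_smul _ (S.regularFunctions_differentiableAt f hz)]
      simp only [smul_eq_mul]
      ring
    · simp [hz]

/-- Algebraic de Rham cohomology `H¹_dR(X_Σ, ∇_s)` of the affine curve `X_Σ`: the cokernel of
`∇_s : 𝒪(X_Σ) → Ω¹(X_Σ)`. -/
abbrev DeRham (s : Fin (n + 1) → ℝ) : Type :=
  S.regularFunctions ⧸ LinearMap.range (S.covariantDeriv s)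

/-- The global logarithmic form `∑ a_k ω_k`, with `ω_k = dz / (z - σ_k)`. These are all the global
sections of `Ω¹_{ℙ¹}(log Σ ∪ ∞)`; such a form has residue `-∑ a_k` at `∞`. -/
def logForm (a : Fin (n + 1) → ℂ) : S.regularFunctions :=
  ⟨S.compl.indicator fun z => ∑ k, a k / (z - S.pt k),
    S.mem_regularFunctions_of_eqOn (S.coPoly a) 0 (fun z hz => indicator_of_notMem hz _)
      fun z hz => by rw [indicator_of_mem hz, S.sum_div_eq a hz, zero_add, pow_one]⟩

theorem conj_mem (f : S.regularFunctions) :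
    (fun w => (starRingEnd ℂ) (f.1 ((starRingEnd ℂ) w))) ∈ S.bar.regularFunctions := by
  obtain ⟨p, m, h⟩ := f.2
  refine ⟨p.map (starRingEnd ℂ), m, fun z => ?_⟩
  have h1 : (starRingEnd ℂ) (S.denom ((starRingEnd ℂ) z)) = S.bar.denom z := by
    simp [denom, bar]
  have h2 : (p.map (starRingEnd ℂ)).eval z = (starRingEnd ℂ) (p.eval ((starRingEnd ℂ) z)) := by
    conv_lhs => rw [← Complex.conj_conj z]
    rw [Polynomial.eval_map_apply]
  simp only [h, map_div₀, map_pow, h1, h2]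

/-- `f ↦ conj ∘ f ∘ conj`: the coefficients of `f` and the points of `Σ` are conjugated. -/
def conjRegular : S.regularFunctions →ₛₗ[starRingEnd ℂ] S.bar.regularFunctions where
  toFun f := ⟨_, S.conj_mem f⟩
  map_add' f g := by ext; simp
  map_smul' c f := by ext; simp

theorem conjRegular_covariantDeriv (s : Fin (n + 1) → ℝ) (f : S.regularFunctions) :
    S.conjRegular (S.covariantDeriv s f) = S.bar.covariantDeriv s (S.conjRegular f) := by
  ext z
  simp only [conjRegular, covariantDeriv, LinearMap.coe_mk, AddHom.coe_mk]
  by_cases hz : z ∈ S.bar.compl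
  · rw [indicator_of_mem hz, indicator_of_mem (S.mem_compl_bar.1 hz)]
    have h1 := congrFun (deriv_conj_conj (f := f.1)) z
    have h2 : (starRingEnd ℂ) (S.connForm s ((starRingEnd ℂ) z)) = S.bar.connForm s z := by
      simp [connForm, bar]
    rw [map_add, map_mul, h2]
    exact congrArg (· + _) h1.symm
  · rw [indicator_of_notMem hz, indicator_of_notMem (fun h => hz (S.mem_compl_bar.2 h)), map_zero]

/-- The canonical semilinear map `H¹_dR(X_Σ, ∇_s) → H¹_dR(X_Σ̄, ∇_s)` for real `s`, conjugating the
coefficients of an algebraic form; it identifies `H¹_dR(X_Σ, ∇_s) ⊗ ℂ̄` with `H¹_dR(X_Σ̄, ∇_s)`. -/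
def conjDeRham (s : Fin (n + 1) → ℝ) : S.DeRham s →ₛₗ[starRingEnd ℂ] S.bar.DeRham s :=
  Submodule.mapQ _ _ S.conjRegular (by
    rintro _ ⟨f, rfl⟩
    exact ⟨S.conjRegular f, (S.conjRegular_covariantDeriv s f).symm⟩)


/-! ### Betti -/

/-- The standard simplex of dimension `m`. -/
abbrev Simplex (m : ℕ) : Type := stdSimplex ℝ (Fin (m + 1))

/-- The inclusion of the `i`-th face. -/
def faceMap {m : ℕ} (i : Fin (m + 2)) : Simplex m → Simplex (m + 1) :=
  stdSimplex.map i.succAbove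

theorem continuous_faceMap {m : ℕ} (i : Fin (m + 2)) : Continuous (faceMap i) :=
  stdSimplex.continuous_map _

/-- `u` is a section along `γ` of the local system `ℂ · x^{s₀} ∏ (1 - x σ_k⁻¹)^{s_k}`, the dual `𝓛_s^∨`
of `𝓛_s`: up to a constant it is `exp (∑ s_k l_k)` with `l_k` a continuous logarithm along `γ` of
the `k`-th function. -/
def IsFlatSection (s : Fin (n + 1) → ℝ) {D : Type*} [TopologicalSpace D]
    (γ : D → ℂ) (u : D → ℂ) : Prop :=
  ∃ (c : ℂ) (l : Fin (n + 1) → D → ℂ), (∀ k, Continuous (l k)) ∧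
    (∀ k t, Complex.exp (l k t) = S.factor k (γ t)) ∧
    ∀ t, u t = c * Complex.exp (∑ k, (s k : ℂ) * l k t)

/-- A smooth singular `m`-simplex in `ℂ \ Σ` together with a section of `𝓛_s^∨` along it. -/
structure TwistedSimplex (s : Fin (n + 1) → ℝ) (m : ℕ) where
  map : Simplex m → ℂ
  smooth : ∃ (U : Set (Fin (m + 1) → ℝ)) (g : (Fin (m + 1) → ℝ) → ℂ), IsOpen U ∧
    stdSimplex ℝ (Fin (m + 1)) ⊆ U ∧ ContDiffOn ℝ ∞ g U ∧ ∀ p : Simplex m, map p = g p.1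
  mem : ∀ p, map p ∈ S.compl
  sec : Simplex m → ℂ
  flat : S.IsFlatSection s map sec

variable {S} {s : Fin (n + 1) → ℝ} {m : ℕ}

/-- Multiplication of the section by a scalar. -/
def TwistedSimplex.smul (c : ℂ) (T : S.TwistedSimplex s m) : S.TwistedSimplex s m where
  map := T.map
  smooth := T.smooth
  mem := T.mem
  sec p := c * T.sec p
  flat := by
    obtain ⟨c', l, h1, h2, h3⟩ := T.flat
    exact ⟨c * c', l, h1, h2, fun t => by simp only [h3, mul_assoc]⟩

/-- The `i`-th face of a simplex, with the restricted section. -/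
def TwistedSimplex.face (i : Fin (m + 2)) (T : S.TwistedSimplex s (m + 1)) :
    S.TwistedSimplex s m where
  map p := T.map (faceMap i p)
  smooth := by
    obtain ⟨U, g, hU, hsub, hg, h⟩ := T.smooth
    let A := (FunOnFinite.linearMap ℝ ℝ i.succAbove).toContinuousLinearMap
    refine ⟨A ⁻¹' U, g ∘ A, hU.preimage A.continuous, fun p hp => hsub (faceMap i ⟨p, hp⟩).2,
      hg.comp A.contDiff.contDiffOn (fun _ h => h), fun p => h _⟩
  mem p := T.mem _
  sec p := T.sec (faceMap i p)
  flat := by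
    obtain ⟨c, l, h1, h2, h3⟩ := T.flat
    exact ⟨c, fun k p => l k (faceMap i p), fun k => (h1 k).comp (continuous_faceMap i),
      fun k p => h2 k _, fun p => h3 _⟩

variable (S s m)

/-- Smooth singular cochains with coefficients in `𝓛_s`: linear forms on twisted chains. Sections of
`𝓛_s^∨` along a simplex form a line, so that linearity in the section is homogeneity. -/
def cochainSubmodule : Submodule ℂ (S.TwistedSimplex s m → ℂ) where
  carrier := {φ | ∀ (c : ℂ) (T : S.TwistedSimplex s m), φ (T.smul c) = c * φ T}
  zero_mem' := by simp
  add_mem' h h' c T := by simp only [Pi.add_apply, h c T, h' c T]; ring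
  smul_mem' a φ h c T := by simp only [Pi.smul_apply, h c T, smul_eq_mul]; ring

/-- The vector space of smooth singular `m`-cochains of `ℂ \ Σ` with coefficients in `𝓛_s`. -/
def Cochain : Type := S.cochainSubmodule s m

instance : AddCommGroup (S.Cochain s m) := inferInstanceAs (AddCommGroup (S.cochainSubmodule s m))

instance : Module ℂ (S.Cochain s m) := inferInstanceAs (Module ℂ (S.cochainSubmodule s m))

variable {S s m} in
instance : CoeFun (S.Cochain s m) fun _ => S.TwistedSimplex s m → ℂ := ⟨fun φ => φ.1⟩

variable {S s m} in
@[ext]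
theorem Cochain.ext {φ ψ : S.Cochain s m} (h : ∀ T, φ T = ψ T) : φ = ψ :=
  Subtype.ext (funext h)

variable {S s m} in
theorem Cochain.add_apply (φ ψ : S.Cochain s m) (T : S.TwistedSimplex s m) :
    (φ + ψ) T = φ T + ψ T := rfl

variable {S s m} in
theorem Cochain.smul_apply (c : ℂ) (φ : S.Cochain s m) (T : S.TwistedSimplex s m) :
    (c • φ) T = c * φ T := rfl

/-- The coboundary of singular cochains. -/
def coboundary : S.Cochain s m →ₗ[ℂ] S.Cochain s (m + 1) where
  toFun φ := ⟨fun T => ∑ i : Fin (m + 2), (-1) ^ (i : ℕ) * φ.1 (T.face i), fun c T => by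
    rw [Finset.mul_sum]
    refine Finset.sum_congr rfl fun i _ => ?_
    rw [show (T.smul c).face i = (T.face i).smul c from rfl, φ.2]
    ring⟩
  map_add' φ ψ := by
    refine Cochain.ext fun T => ?_
    refine Eq.trans ?_ Finset.sum_add_distrib
    change ∑ i : Fin (m + 2), (-1 : ℂ) ^ (i : ℕ) * (φ (T.face i) + ψ (T.face i)) = _
    exact Finset.sum_congr rfl fun (i : Fin (m + 2)) _ =>
      mul_add ((-1 : ℂ) ^ (i : ℕ)) (φ (T.face i)) (ψ (T.face i))
  map_smul' c φ := by
    refine Cochain.ext fun T => ?_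
    refine Eq.trans ?_ (Finset.mul_sum _ _ c).symm
    change ∑ i : Fin (m + 2), (-1 : ℂ) ^ (i : ℕ) * (c * φ (T.face i)) = _
    exact Finset.sum_congr rfl fun (i : Fin (m + 2)) _ =>
      mul_left_comm ((-1 : ℂ) ^ (i : ℕ)) c (φ (T.face i))

/-- The space of 1-cocycles. -/
abbrev Cocycle : Submodule ℂ (S.Cochain s 1) := LinearMap.ker (S.coboundary s 1)

/-- The coboundaries, inside the space of 1-cocycles. -/
abbrev Coboundaries : Submodule ℂ (S.Cocycle s) :=
  Submodule.comap (S.Cocycle s).subtype (LinearMap.range (S.coboundary s 0))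

/-- Betti cohomology `H¹_B(X_Σ, 𝓛_s) ⊗ ℂ = H¹(ℂ \ Σ, 𝓛_s)`, as smooth singular cohomology with
coefficients in the local system `𝓛_s`. -/
abbrev Betti : Type := S.Cocycle s ⧸ S.Coboundaries s

variable {S s m}

theorem norm_factor_rpow (s : Fin (n + 1) → ℝ) {z : ℂ} {l : Fin (n + 1) → ℂ}
    (h : ∀ k, Complex.exp (l k) = S.factor k z) :
    ((S.weight s z : ℝ) : ℂ) = Complex.exp (∑ k, (s k : ℂ) * (l k + (starRingEnd ℂ) (l k))) := by
  rw [weight, Complex.ofReal_prod, Complex.exp_sum]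
  refine Finset.prod_congr rfl fun k _ => ?_
  rw [← h k, Complex.norm_exp, ← Real.exp_mul, Complex.ofReal_exp, Complex.add_conj]
  congr 1
  push_cast
  ring

/-- Complex conjugation sends a simplex of `ℂ \ Σ̄` with a section of `𝓛_{-s}^∨` to the conjugate
simplex of `ℂ \ Σ` with a section of `𝓛_s^∨`, via the trivialisation of `conj^* 𝓛_s ⊗ 𝓛_s`. -/
def TwistedSimplex.bar (T : S.bar.TwistedSimplex (-s) m) : S.TwistedSimplex s m where
  map p := (starRingEnd ℂ) (T.map p)
  smooth := by
    obtain ⟨U, g, hU, hsub, hg, h⟩ := T.smooth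
    exact ⟨U, fun p => (starRingEnd ℂ) (g p), hU, hsub,
      Complex.conjCLE.contDiff.comp_contDiffOn hg, fun p => by rw [h]⟩
  mem p := S.mem_compl_bar.1 (T.mem p)
  sec p := T.sec p * (S.weight s ((starRingEnd ℂ) (T.map p)) : ℝ)
  flat := by
    obtain ⟨c, l, h1, h2, h3⟩ := T.flat
    have h4 : ∀ k t, Complex.exp ((starRingEnd ℂ) (l k t))
        = S.factor k ((starRingEnd ℂ) (T.map t)) := fun k t => by
      rw [Complex.exp_conj, h2, factor_bar, Complex.conj_conj]
    refine ⟨c, fun k t => (starRingEnd ℂ) (l k t),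
      fun k => Complex.continuous_conj.comp (h1 k), h4, fun t => ?_⟩
    simp only [h3]
    rw [norm_factor_rpow s fun k => h4 k t, mul_assoc, ← Complex.exp_add,
      ← Finset.sum_add_distrib]
    congr 2
    refine Finset.sum_congr rfl fun k _ => ?_
    simp only [Pi.neg_apply, Complex.ofReal_neg, Complex.conj_conj]
    ring

variable (S s m)

/-- The real Frobenius on cochains. -/
def frobeniusCochain : S.Cochain s m →ₗ[ℂ] S.bar.Cochain (-s) m where
  toFun φ := ⟨fun T => φ.1 T.bar, fun c T => by
    rw [← φ.2]
    simp only [TwistedSimplex.bar, TwistedSimplex.smul, mul_assoc]⟩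
  map_add' _ _ := rfl
  map_smul' _ _ := rfl

theorem frobeniusCochain_coboundary (φ : S.Cochain s m) :
    S.frobeniusCochain s (m + 1) (S.coboundary s m φ)
      = S.bar.coboundary (-s) m (S.frobeniusCochain s m φ) := rfl

/-- The real Frobenius on cocycles. -/
def frobeniusCocycle : S.Cocycle s →ₗ[ℂ] S.bar.Cocycle (-s) :=
  (S.frobeniusCochain s 1).restrict (fun φ hφ => by
    rw [LinearMap.mem_ker] at hφ ⊢
    rw [← frobeniusCochain_coboundary, hφ, map_zero])

/-- The real Frobenius `F_∞ : H¹_B(ℂ \ Σ, 𝓛_s) → H¹_B(ℂ \ Σ̄, 𝓛_{-s})`. -/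
def frobenius : S.Betti s →ₗ[ℂ] S.bar.Betti (-s) :=
  Submodule.mapQ _ _ (S.frobeniusCocycle s) (by
    rintro φ ⟨f, hf⟩
    exact ⟨S.frobeniusCochain s 0 f, by
      rw [← frobeniusCochain_coboundary, hf]; rfl⟩)


/-! ### comparison -/

variable {S s m}

theorem hasFDerivWithinAt_of_exp_eq {E : Type*} [NormedAddCommGroup E] [NormedSpace ℝ E]
    {D : Set E} {L F : E → ℂ} {F' : E →L[ℝ] ℂ} {p : E} (hp : p ∈ D)
    (hL : ContinuousWithinAt L D p) (h : ∀ q ∈ D, Complex.exp (L q) = F q)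
    (hF : HasFDerivWithinAt F F' D p) : HasFDerivWithinAt L ((F p)⁻¹ • F') D p := by
  have hFp : F p ≠ 0 := by rw [← h p hp]; exact Complex.exp_ne_zero _
  have h1 : HasFDerivWithinAt (fun q => L p + Complex.log ((F p)⁻¹ * F q)) ((F p)⁻¹ • F') D p := by
    have h2 : HasFDerivWithinAt (fun q => Complex.log ((F p)⁻¹ * F q))
        (((F p)⁻¹ * F p)⁻¹ • (F p)⁻¹ • F') D p :=
      (Complex.hasStrictDerivAt_log
        (by rw [inv_mul_cancel₀ hFp]; exact Complex.one_mem_slitPlane)).hasDerivAt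
        |>.comp_hasFDerivWithinAt p (hF.const_mul (F p)⁻¹)
    refine (h2.const_add (L p)).congr_fderiv ?_
    rw [inv_mul_cancel₀ hFp, inv_one, one_smul]
  refine h1.congr_of_eventuallyEq ?_ (by simp [inv_mul_cancel₀ hFp])
  have h3 : Tendsto (fun q => (L q - L p).im) (𝓝[D] p) (𝓝 0) := by
    have := (Complex.continuous_im.tendsto _).comp (hL.tendsto.sub_const (L p))
    rwa [sub_self, Complex.zero_im] at this
  filter_upwards [h3.eventually (Ioo_mem_nhds (neg_lt_zero.2 Real.pi_pos) Real.pi_pos),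
    self_mem_nhdsWithin] with q hq hqD
  rw [← h q hqD, ← h p hp, ← Complex.exp_neg, ← Complex.exp_add, neg_add_eq_sub,
    Complex.log_exp hq.1 hq.2.le]
  ring

open Classical in
def TwistedSimplex.secExt (T : S.TwistedSimplex s m) (p : Fin (m + 1) → ℝ) : ℂ :=
  if h : p ∈ stdSimplex ℝ (Fin (m + 1)) then T.sec ⟨p, h⟩ else 0

theorem TwistedSimplex.secExt_apply (T : S.TwistedSimplex s m) (p : Simplex m) :
    T.secExt p.1 = T.sec p := by
  simp [secExt, p.2]

theorem TwistedSimplex.hasFDerivWithinAt_secExt (T : S.TwistedSimplex s m)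
    {g : (Fin (m + 1) → ℝ) → ℂ} (hg : ∀ p : Simplex m, T.map p = g p.1)
    {g' : (Fin (m + 1) → ℝ) →L[ℝ] ℂ} {p : Fin (m + 1) → ℝ}
    (hp : p ∈ stdSimplex ℝ (Fin (m + 1)))
    (hg' : HasFDerivWithinAt g g' (stdSimplex ℝ (Fin (m + 1))) p) :
    HasFDerivWithinAt T.secExt ((T.secExt p * S.connForm s (g p)) • g')
      (stdSimplex ℝ (Fin (m + 1))) p := by
  classical
  obtain ⟨c, l, h1, h2, h3⟩ := T.flat
  set D := stdSimplex ℝ (Fin (m + 1)) with hD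
  let L : Fin (n + 1) → (Fin (m + 1) → ℝ) → ℂ := fun k p => if h : p ∈ D then l k ⟨p, h⟩ else 0
  have hLc : ∀ k, ContinuousWithinAt (L k) D p := fun k => by
    have : ContinuousOn (L k) D := by
      rw [continuousOn_iff_continuous_domRestrict]
      convert h1 k using 1
      ext q
      simp [L, q.2]
    exact this p hp
  have hLe : ∀ k, ∀ q ∈ D, Complex.exp (L k q) = S.factorDeriv k * (g q - S.pt k) := fun k q hq => by
    have := h2 k ⟨q, hq⟩
    rw [S.factor_eq, hg] at this
    simp only [L, hq, dif_pos, this]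
  have hLd : ∀ k, HasFDerivWithinAt (L k) ((g p - S.pt k)⁻¹ • g') D p := fun k => by
    have := hasFDerivWithinAt_of_exp_eq hp (hLc k) (hLe k)
      ((hg'.sub_const (S.pt k)).const_mul (S.factorDeriv k))
    refine this.congr_fderiv ?_
    rw [smul_smul, mul_inv, mul_comm (S.factorDeriv k)⁻¹, mul_assoc,
      inv_mul_cancel₀ (S.factorDeriv_ne_zero k), mul_one]
  have hsum : HasFDerivWithinAt (fun q => ∑ k, (s k : ℂ) * L k q) (S.connForm s (g p) • g') D p := by
    have := HasFDerivWithinAt.fun_sum (u := Finset.univ)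
      fun k _ => (hLd k).const_mul (s k : ℂ)
    refine this.congr_fderiv ?_
    ext v
    simp only [connForm, div_eq_mul_inv, sum_apply, smul_apply, smul_eq_mul, Finset.sum_mul,
      mul_assoc]
  have hu : ∀ q ∈ D, T.secExt q = c * Complex.exp (∑ k, (s k : ℂ) * L k q) := fun q hq => by
    simp only [secExt, L, ← hD, hq, dif_pos, h3]
  have := (hsum.cexp.const_mul c).congr hu (hu p hp)
  refine this.congr_fderiv ?_
  rw [hu p hp, smul_smul, smul_smul, mul_assoc]

theorem TwistedSimplex.exists_primitive (f : S.regularFunctions) (T : S.TwistedSimplex s m)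
    {U : Set (Fin (m + 1) → ℝ)} {g : (Fin (m + 1) → ℝ) → ℂ} (hU : IsOpen U)
    (hsub : stdSimplex ℝ (Fin (m + 1)) ⊆ U) (hgU : ContDiffOn ℝ ∞ g U)
    (hg : ∀ p : Simplex m, T.map p = g p.1) :
    ∃ H : (Fin (m + 1) → ℝ) → ℂ, ∀ p ∈ stdSimplex ℝ (Fin (m + 1)),
      HasFDerivWithinAt H ((T.secExt p * f.1 (g p)) • fderiv ℝ g p)
        (stdSimplex ℝ (Fin (m + 1))) p := by
  set D := stdSimplex ℝ (Fin (m + 1)) with hD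
  have hgc : ∀ p ∈ D, ContDiffAt ℝ ∞ g p := fun p hp => hgU.contDiffAt (hU.mem_nhds (hsub hp))
  have hgd : ∀ p ∈ D, HasFDerivAt g (fderiv ℝ g p) p := fun p hp =>
    ((hgc p hp).differentiableAt (by simp)).hasFDerivAt
  have hgm : ∀ p ∈ D, g p ∈ S.compl := fun p hp => hg ⟨p, hp⟩ ▸ T.mem ⟨p, hp⟩
  have hg2 : ∀ p ∈ D, HasFDerivAt (fderiv ℝ g) (fderiv ℝ (fderiv ℝ g) p) p := fun p hp =>
    (((hgc p hp).fderiv_right (m := ∞) (by simp)).differentiableAt (by simp)).hasFDerivAt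
  refine (convex_stdSimplex ℝ (Fin (m + 1))).exists_forall_hasFDerivWithinAt_of_hasFDerivWithinAt_symmetric
    (dω := fun p => (T.secExt p * f.1 (g p)) • fderiv ℝ (fderiv ℝ g) p +
      ((T.secExt p * (deriv f.1 (g p) + S.connForm s (g p) * f.1 (g p))) • fderiv ℝ g p).smulRight
        (fderiv ℝ g p)) ?_ ?_
  · intro p hp
    have h1 := T.hasFDerivWithinAt_secExt hg hp (hgd p hp).hasFDerivWithinAt
    have h2 : HasFDerivAt (fun q => f.1 (g q)) (deriv f.1 (g p) • fderiv ℝ g p) p :=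
      (S.regularFunctions_differentiableAt f (hgm p hp)).hasDerivAt.comp_hasFDerivAt_of_eq p
        (hgd p hp) rfl
    have h3 := (h1.mul h2.hasFDerivWithinAt).smul (hg2 p hp).hasFDerivWithinAt
    refine h3.congr_fderiv ?_
    ext x y
    simp only [add_apply, smul_apply, ContinuousLinearMap.smulRight_apply, smul_eq_mul,
      Pi.mul_apply]
    ring
  · intro p hp x _ y _
    have h1 := (hgc p hp).isSymmSndFDerivAt (by simp only [minSmoothness_of_isRCLikeNormedField]; exact WithTop.coe_le_coe.2 le_top) x y
    simp only [add_apply, smul_apply, h1,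
      ContinuousLinearMap.smulRight_apply, smul_eq_mul]
    ring


/-- The parametrisation `t ↦ (1 - t, t)` of the standard 1-simplex, from vertex 0 to vertex 1. -/
def edge (t : ℝ) : Simplex 1 :=
  stdSimplexHomeomorphUnitInterval.symm (projIcc 0 1 zero_le_one t)

/-- The integral `∫_γ u f dz` of the form `f dz` along a path `γ` with section `u`. -/
def TwistedSimplex.integral (T : S.TwistedSimplex s 1) (f : ℂ → ℂ) : ℂ :=
  ∫ t in (0 : ℝ)..1, T.sec (edge t) * f (T.map (edge t)) * deriv (fun t => T.map (edge t)) t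

theorem edge_coe {t : ℝ} (ht : t ∈ Icc (0 : ℝ) 1) : (edge t).1 = ![1 - t, t] := by
  rw [edge, projIcc_of_mem _ ht]
  rfl

/-- The coordinates of `edge t`. -/
def segmentPoint (t : ℝ) : Fin 2 → ℝ := ![1 - t, t]

theorem hasDerivAt_segmentPoint (t : ℝ) : HasDerivAt segmentPoint ![-1, 1] t := by
  rw [hasDerivAt_pi]
  intro i
  fin_cases i
  · simpa [segmentPoint] using (hasDerivAt_id t).const_sub 1
  · exact hasDerivAt_id t

theorem segmentPoint_mem {t : ℝ} (ht : t ∈ Icc (0 : ℝ) 1) :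
    segmentPoint t ∈ stdSimplex ℝ (Fin 2) := by
  rw [show segmentPoint t = (edge t).1 from (edge_coe ht).symm]
  exact (edge t).2

theorem TwistedSimplex.continuousOn_integrand (f : S.regularFunctions) (T : S.TwistedSimplex s 1)
    {U : Set (Fin 2 → ℝ)} {g : (Fin 2 → ℝ) → ℂ} (hU : IsOpen U)
    (hsub : stdSimplex ℝ (Fin 2) ⊆ U) (hgU : ContDiffOn ℝ ∞ g U)
    (hg : ∀ p : Simplex 1, T.map p = g p.1) :
    ContinuousOn (fun t => T.secExt (segmentPoint t) * f.1 (g (segmentPoint t)) *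
      fderiv ℝ g (segmentPoint t) ![-1, 1]) (Icc 0 1) := by
  have hgd : ∀ p ∈ stdSimplex ℝ (Fin 2), HasFDerivAt g (fderiv ℝ g p) p := fun p hp =>
    ((hgU.contDiffAt (hU.mem_nhds (hsub hp))).differentiableAt (by simp)).hasFDerivAt
  have h1 : ContinuousOn T.secExt (stdSimplex ℝ (Fin 2)) := fun p hp =>
    (T.hasFDerivWithinAt_secExt hg hp (hgd p hp).hasFDerivWithinAt).continuousWithinAt
  have h2 : ContinuousOn (fun p => f.1 (g p)) (stdSimplex ℝ (Fin 2)) := fun p hp =>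
    (ContinuousAt.comp (f := g) (S.regularFunctions_differentiableAt f
      (hg ⟨p, hp⟩ ▸ T.mem ⟨p, hp⟩)).continuousAt (hgd p hp).continuousAt).continuousWithinAt
  have h3 : ContinuousOn (fun p => fderiv ℝ g p ![-1, 1]) (stdSimplex ℝ (Fin 2)) :=
    ((hgU.continuousOn_fderiv_of_isOpen hU (by simp)).mono hsub).clm_apply continuousOn_const
  have hc : Continuous segmentPoint :=
    continuous_iff_continuousAt.2 fun t => (hasDerivAt_segmentPoint t).continuousAt
  exact ((h1.mul h2).mul h3).comp hc.continuousOn fun t ht => segmentPoint_mem ht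

theorem TwistedSimplex.eqOn_integrand (f : ℂ → ℂ) (T : S.TwistedSimplex s 1)
    {U : Set (Fin 2 → ℝ)} {g : (Fin 2 → ℝ) → ℂ} (hU : IsOpen U)
    (hsub : stdSimplex ℝ (Fin 2) ⊆ U) (hgU : ContDiffOn ℝ ∞ g U)
    (hg : ∀ p : Simplex 1, T.map p = g p.1) :
    EqOn (fun t => T.sec (edge t) * f (T.map (edge t)) * deriv (fun t => T.map (edge t)) t)
      (fun t => T.secExt (segmentPoint t) * f (g (segmentPoint t)) *
        fderiv ℝ g (segmentPoint t) ![-1, 1]) (Ioo 0 1) := fun t ht => by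
  have ht' := Ioo_subset_Icc_self ht
  have hmap : ∀ r ∈ Icc (0 : ℝ) 1, T.map (edge r) = g (segmentPoint r) := fun r hr => by
    rw [hg, edge_coe hr]
    rfl
  have hgd := ((hgU.contDiffAt (hU.mem_nhds (hsub (segmentPoint_mem ht')))).differentiableAt
    (by simp)).hasFDerivAt
  have hder : deriv (fun t => T.map (edge t)) t = fderiv ℝ g (segmentPoint t) ![-1, 1] := by
    refine HasDerivAt.deriv
      ((hgd.comp_hasDerivAt t (hasDerivAt_segmentPoint t)).congr_of_eventuallyEq ?_)
    filter_upwards [Icc_mem_nhds ht.1 ht.2] with r hr using hmap r hr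
  simp only [hder, hmap t ht']
  rw [← T.secExt_apply, edge_coe ht']
  rfl

theorem TwistedSimplex.intervalIntegrable (T : S.TwistedSimplex s 1) (f : S.regularFunctions) :
    IntervalIntegrable (fun t => T.sec (edge t) * f.1 (T.map (edge t)) *
      deriv (fun t => T.map (edge t)) t) volume 0 1 := by
  obtain ⟨U, g, hU, hsub, hgU, hg⟩ := T.smooth
  have h := (T.continuousOn_integrand f hU hsub hgU hg).intervalIntegrable_of_Icc (μ := volume)
    zero_le_one
  refine h.congr_uIoo ?_
  rw [uIoo_of_le zero_le_one]
  exact (T.eqOn_integrand f.1 hU hsub hgU hg).symm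

theorem TwistedSimplex.integral_eq_sub (f : S.regularFunctions) (T : S.TwistedSimplex s 1)
    {U : Set (Fin 2 → ℝ)} {g : (Fin 2 → ℝ) → ℂ} (hU : IsOpen U)
    (hsub : stdSimplex ℝ (Fin 2) ⊆ U) (hgU : ContDiffOn ℝ ∞ g U)
    (hg : ∀ p : Simplex 1, T.map p = g p.1) {H : (Fin 2 → ℝ) → ℂ}
    (hH : ∀ p ∈ stdSimplex ℝ (Fin 2),
      HasFDerivWithinAt H ((T.secExt p * f.1 (g p)) • fderiv ℝ g p) (stdSimplex ℝ (Fin 2)) p) :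
    T.integral f.1 = H (Pi.single 1 1) - H (Pi.single 0 1) := by
  have hF : ∀ t ∈ Icc (0 : ℝ) 1, HasDerivWithinAt (fun t => H (segmentPoint t))
      (T.secExt (segmentPoint t) * f.1 (g (segmentPoint t)) *
        fderiv ℝ g (segmentPoint t) ![-1, 1]) (Icc 0 1) t := fun t ht =>
    (hH _ (segmentPoint_mem ht)).comp_hasDerivWithinAt t
      (hasDerivAt_segmentPoint t).hasDerivWithinAt fun r hr => segmentPoint_mem hr
  have hint := intervalIntegral.integral_eq_sub_of_hasDerivAt_of_le zero_le_one
    (fun t ht => (hF t ht).continuousWithinAt)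
    (fun t ht => (hF t (Ioo_subset_Icc_self ht)).hasDerivAt (Icc_mem_nhds ht.1 ht.2))
    ((T.continuousOn_integrand f hU hsub hgU hg).intervalIntegrable_of_Icc zero_le_one)
  have hE1 : segmentPoint 1 = Pi.single 1 1 := by ext i; fin_cases i <;> simp [segmentPoint]
  have hE0 : segmentPoint 0 = Pi.single 0 1 := by ext i; fin_cases i <;> simp [segmentPoint]
  rw [hE1, hE0] at hint
  rw [← hint, integral]
  exact intervalIntegral.integral_congr_Ioo_of_le zero_le_one
    (T.eqOn_integrand f.1 hU hsub hgU hg)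

theorem TwistedSimplex.integral_faces (T : S.TwistedSimplex s 2)
    (f : S.regularFunctions) :
    (T.face 0).integral f.1 - (T.face 1).integral f.1 + (T.face 2).integral f.1 = 0 := by
  obtain ⟨U, g, hU, hsub, hgU, hg⟩ := T.smooth
  obtain ⟨H, hH⟩ := T.exists_primitive f hU hsub hgU hg
  have key : ∀ i : Fin 3, (T.face i).integral f.1 =
      H (Pi.single (i.succAbove 1) 1) - H (Pi.single (i.succAbove 0) 1) := fun i => by
    let A := (FunOnFinite.linearMap ℝ ℝ i.succAbove).toContinuousLinearMap
    have hA : MapsTo A (stdSimplex ℝ (Fin 2)) (stdSimplex ℝ (Fin 3)) :=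
      fun p hp => (faceMap i ⟨p, hp⟩).2
    rw [← FunOnFinite.linearMap_piSingle ℝ ℝ i.succAbove 1,
      ← FunOnFinite.linearMap_piSingle ℝ ℝ i.succAbove 0]
    refine (T.face i).integral_eq_sub f (U := A ⁻¹' U) (g := g ∘ A) (H := H ∘ A)
      (hU.preimage A.continuous) (fun p hp => hsub (hA hp))
      (hgU.comp A.contDiff.contDiffOn fun _ h => h) (fun p => hg _) fun p hp => ?_
    have h1 := (hH (A p) (hA hp)).comp p A.hasFDerivAt.hasFDerivWithinAt hA
    refine h1.congr_fderiv ?_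
    have h2 : fderiv ℝ (g ∘ A) p = (fderiv ℝ g (A p)).comp A := by
      have := ((hgU.contDiffAt (hU.mem_nhds (hsub (hA hp)))).differentiableAt (by simp)).hasFDerivAt
      exact (this.comp p A.hasFDerivAt).fderiv
    have h3 : (T.face i).secExt p = T.secExt (A p) :=
      ((T.face i).secExt_apply ⟨p, hp⟩).trans (T.secExt_apply (faceMap i ⟨p, hp⟩)).symm
    rw [h2, h3]
    rfl
  rw [key, key, key]
  rw [show (0 : Fin 3).succAbove (0 : Fin 2) = 1 from rfl,
    show (0 : Fin 3).succAbove (1 : Fin 2) = 2 from rfl,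
    show (1 : Fin 3).succAbove (0 : Fin 2) = 0 from rfl,
    show (1 : Fin 3).succAbove (1 : Fin 2) = 2 from rfl,
    show (2 : Fin 3).succAbove (0 : Fin 2) = 0 from rfl,
    show (2 : Fin 3).succAbove (1 : Fin 2) = 1 from rfl]
  ring

variable (S s)

/-- The cochain `(γ, u) ↦ ∫_γ u f dz`. -/
def periodCochain : S.regularFunctions →ₗ[ℂ] S.Cochain s 1 where
  toFun f := ⟨fun T => T.integral f.1, fun c T => by
    simp only [TwistedSimplex.integral]
    rw [← intervalIntegral.integral_const_mul]
    simp only [TwistedSimplex.smul, mul_assoc]⟩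
  map_add' f g := by
    refine Cochain.ext fun T => ?_
    refine Eq.trans ?_ (intervalIntegral.integral_add (T.intervalIntegrable f)
      (T.intervalIntegrable g))
    refine intervalIntegral.integral_congr fun t _ => ?_
    simp only [Submodule.coe_add, Pi.add_apply]
    ring
  map_smul' c f := by
    refine Cochain.ext fun T => ?_
    refine Eq.trans ?_ (intervalIntegral.integral_const_mul c _)
    refine intervalIntegral.integral_congr fun t _ => ?_
    simp only [Submodule.coe_smul, Pi.smul_apply, smul_eq_mul]
    ring

theorem periodCochain_mem (f : S.regularFunctions) : S.periodCochain s f ∈ S.Cocycle s := by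
  rw [LinearMap.mem_ker]
  refine Cochain.ext fun T => ?_
  refine Eq.trans ?_ (T.integral_faces f)
  change ∑ i : Fin 3, (-1 : ℂ) ^ (i : ℕ) * (T.face i).integral f.1 = _
  rw [Fin.sum_univ_three]
  simp only [Fin.coe_ofNat_eq_mod]
  norm_num
  ring

theorem periodCochain_covariantDeriv (f : S.regularFunctions) :
    S.periodCochain s (S.covariantDeriv s f) ∈ LinearMap.range (S.coboundary s 0) := by
  refine ⟨⟨fun T => T.sec default * f.1 (T.map default), fun c T => ?_⟩, ?_⟩
  · simp only [TwistedSimplex.smul, mul_assoc]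
  · refine Cochain.ext fun T => ?_
    change ∑ i : Fin 2, (-1 : ℂ) ^ (i : ℕ) *
      (T.sec (faceMap i default) * f.1 (T.map (faceMap i default))) =
        T.integral (S.covariantDeriv s f).1
    obtain ⟨U, g, hU, hsub, hgU, hg⟩ := T.smooth
    have hgd : ∀ p ∈ stdSimplex ℝ (Fin 2), HasFDerivAt g (fderiv ℝ g p) p := fun p hp =>
      ((hgU.contDiffAt (hU.mem_nhds (hsub hp))).differentiableAt (by simp)).hasFDerivAt
    have hgm : ∀ p ∈ stdSimplex ℝ (Fin 2), g p ∈ S.compl :=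
      fun p hp => hg ⟨p, hp⟩ ▸ T.mem ⟨p, hp⟩
    rw [T.integral_eq_sub (S.covariantDeriv s f) hU hsub hgU hg
      (H := fun p => T.secExt p * f.1 (g p))]
    · have h : ∀ i : Fin 2, (faceMap i (default : Simplex 0)).1 = Pi.single (i.succAbove 0) 1 := by
        intro i
        rw [← FunOnFinite.linearMap_piSingle ℝ ℝ i.succAbove 0]
        refine congrArg (FunOnFinite.linearMap ℝ ℝ i.succAbove) ?_
        ext j
        rw [show j = (0 : Fin 1) from Fin.ext (by omega)]
        simp
      rw [Fin.sum_univ_two, ← T.secExt_apply, ← T.secExt_apply, hg, hg, h, h,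
        show (0 : Fin 2).succAbove (0 : Fin 1) = 1 from rfl,
        show (1 : Fin 2).succAbove (0 : Fin 1) = 0 from rfl]
      simp
      ring
    · intro p hp
      have h1 := T.hasFDerivWithinAt_secExt hg hp (hgd p hp).hasFDerivWithinAt
      have h2 : HasFDerivAt (fun q => f.1 (g q)) (deriv f.1 (g p) • fderiv ℝ g p) p :=
        (S.regularFunctions_differentiableAt f (hgm p hp)).hasDerivAt.comp_hasFDerivAt_of_eq p
          (hgd p hp) rfl
      refine (h1.mul h2.hasFDerivWithinAt).congr_fderiv ?_
      ext v
      simp only [covariantDeriv, LinearMap.coe_mk, AddHom.coe_mk, indicator_of_mem (hgm p hp),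
        add_apply, smul_apply, smul_eq_mul]
      ring

/-- The comparison map `comp_{B,dR}(s) : H¹_dR(X_Σ, ∇_s) → H¹_B(X_Σ, 𝓛_s)`, given by integration. -/
def comparison : S.DeRham s →ₗ[ℂ] S.Betti s :=
  Submodule.mapQ _ _ ((S.periodCochain s).codRestrict (S.Cocycle s) (S.periodCochain_mem s)) (by
    rintro _ ⟨f, rfl⟩
    exact S.periodCochain_covariantDeriv s f)


/-! ### Single-valued period map and de Rham pairing -/

/-- The single-valued period map
`𝐬 = comp_{B̄,dR}(-s)⁻¹ ∘ F_∞ ∘ comp_{B,dR}(s) : H¹_dR(X_Σ, ∇_s) → H¹_dR(X_Σ̄, ∇_{-s})`. -/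
def svPeriodMap (η : S.DeRham s) : S.bar.DeRham (-s) :=
  Function.invFun (S.bar.comparison (-s)) (S.frobenius s (S.comparison s η))

/-- The smooth form `f dz + ∇_s φ`, with `∇_s φ = dφ + φ ∑ s_k dz / (z - σ_k)` and
`dφ = ∂φ/∂z dz + ∂φ/∂z̄ dz̄`. -/
def addCovariantDeriv (f φ : ℂ → ℂ) : Form where
  dz z := f z + (fderiv ℝ φ z 1 - Complex.I * fderiv ℝ φ z Complex.I) / 2 + S.connForm s z * φ z
  dzbar z := (fderiv ℝ φ z 1 + Complex.I * fderiv ℝ φ z Complex.I) / 2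

/-- `v` is the value at `(ν, η)` of the de Rham intersection pairing
`H¹_dR(X_Σ, ∇_s) × H¹_dR(X_Σ, ∇_{-s}) → ℂ`: lift `ν` to a smooth compactly supported form `ν̃` on
`ℂ \ Σ`, cohomologous to `ν`, and take `(2πi)⁻¹ ∬ ν̃ ∧ η`. -/
def IsDeRhamPairing (ν : S.DeRham s) (η : S.DeRham (-s)) (v : ℂ) : Prop :=
  ∃ (f h : S.regularFunctions) (φ : ℂ → ℂ) (K : Set ℂ),
    Submodule.Quotient.mk f = ν ∧ Submodule.Quotient.mk h = η ∧
    ContDiffOn ℝ ∞ φ S.compl ∧ IsCompact K ∧ K ⊆ S.compl ∧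
    (∀ z ∈ S.compl \ K, (S.addCovariantDeriv s f.1 φ).dz z = 0 ∧
      (S.addCovariantDeriv s f.1 φ).dzbar z = 0) ∧
    v = 1 / (2 * Real.pi * Complex.I) *
      wedgeIntegral (S.addCovariantDeriv s f.1 φ) (holForm h.1)

/-- The de Rham intersection pairing (for generic `s` the value exists and does not depend on
choices). -/
def deRhamPairing (ν : S.DeRham s) (η : S.DeRham (-s)) : ℂ :=
  Classical.epsilon (S.IsDeRhamPairing s ν η)

/-- The single-valued period pairing `(ν, η) ↦ ⟨ν, 𝐬 η⟩^dR`, where `ν` is placed in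
`H¹_dR(X_Σ̄, ∇_s)` by conjugation of its coefficients. -/
def svPairing (ν η : S.DeRham s) : ℂ :=
  S.bar.deRhamPairing s (S.conjDeRham s ν) (S.svPeriodMap s η)

/-! ### Paths -/

/-- A locally finite path from `0` to `σ_i` in `ℂ \ Σ`, together with continuous branches along it of
the logarithms of `x` and of `1 - x σ_k⁻¹`. -/
structure BranchedPath (i : Fin n) where
  path : ℝ → ℂ
  smooth : ContDiffOn ℝ ∞ path (Ioo 0 1)
  mem : ∀ t ∈ Ioo (0 : ℝ) 1, path t ∈ S.compl
  tendsto_zero : Tendsto path (𝓝[>] 0) (𝓝 0)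
  tendsto_one : Tendsto path (𝓝[<] 1) (𝓝 (S.pt i.succ))
  log : Fin (n + 1) → ℝ → ℂ
  continuousOn_log : ∀ k, ContinuousOn (log k) (Ioo 0 1)
  exp_log : ∀ k, ∀ t ∈ Ioo (0 : ℝ) 1, Complex.exp (log k t) = S.factor k (path t)

variable {S}

namespace BranchedPath

variable {i : Fin n} (δ : S.BranchedPath i)

/-- The branch of `x^{s₀} ∏ (1 - x σ_k⁻¹)^{s_k}` along the path. -/
def branch (t : ℝ) : ℂ := Complex.exp (∑ k, (s k : ℂ) * δ.log k t)

/-- The complex conjugate path, with the conjugate branches. -/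
def bar : S.bar.BranchedPath i where
  path t := (starRingEnd ℂ) (δ.path t)
  smooth := Complex.conjCLE.contDiff.comp_contDiffOn δ.smooth
  mem t ht := S.mem_compl_bar.2 (by simpa using δ.mem t ht)
  tendsto_zero := by
    have h := (Complex.continuous_conj.tendsto 0).comp δ.tendsto_zero
    rwa [map_zero] at h
  tendsto_one := (Complex.continuous_conj.tendsto _).comp δ.tendsto_one
  log k t := (starRingEnd ℂ) (δ.log k t)
  continuousOn_log k := Complex.continuous_conj.comp_continuousOn (δ.continuousOn_log k)
  exp_log k t ht := by rw [Complex.exp_conj, δ.exp_log k t ht, factor_bar, Complex.conj_conj]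

theorem combo_mem {a b : ℝ} (ha : 0 < a) (hab : a ≤ b) (hb : b < 1) (p : Simplex 1) :
    a * p.1 0 + b * p.1 1 ∈ Ioo (0 : ℝ) 1 := by
  have h0 := p.2.1 0
  have h1 := p.2.1 1
  have h2 : p.1 0 + p.1 1 = 1 := by
    have := p.2.2
    rwa [Fin.sum_univ_two] at this
  constructor <;> nlinarith

/-- The portion of the path between the parameters `a` and `b`, as a twisted simplex. -/
def segment (a b : ℝ) (ha : 0 < a) (hab : a ≤ b) (hb : b < 1) : S.TwistedSimplex s 1 where
  map p := δ.path (a * p.1 0 + b * p.1 1)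
  smooth := by
    have hc : ContDiff ℝ ∞ fun p : Fin 2 → ℝ => a * p 0 + b * p 1 := by fun_prop
    exact ⟨(fun p : Fin 2 → ℝ => a * p 0 + b * p 1) ⁻¹' Ioo 0 1,
      fun p => δ.path (a * p 0 + b * p 1), isOpen_Ioo.preimage hc.continuous,
      fun p hp => combo_mem ha hab hb ⟨p, hp⟩, δ.smooth.comp hc.contDiffOn fun _ h => h,
      fun _ => rfl⟩
  mem p := δ.mem _ (combo_mem ha hab hb p)
  sec p := δ.branch s (a * p.1 0 + b * p.1 1)
  flat := by
    refine ⟨1, fun k p => δ.log k (a * p.1 0 + b * p.1 1), fun k => ?_,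
      fun k p => δ.exp_log k _ (combo_mem ha hab hb p), fun p => by rw [one_mul]; rfl⟩
    refine (δ.continuousOn_log k).comp_continuous ?_ (combo_mem ha hab hb)
    have h : ∀ j : Fin 2, Continuous fun p : Simplex 1 => p.1 j := fun j =>
      (continuous_apply j).comp continuous_subtype_val
    exact (continuous_const.mul (h 0)).add (continuous_const.mul (h 1))

/-- `v` is the pairing of the class of `δ ⊗ x^{s₀} ∏ (1 - x σ_k⁻¹)^{s_k}` in locally finite homology
`H₁^lf(ℂ \ Σ, 𝓛_s^∨)` with `c` in `H¹_B(X_Σ, 𝓛_s)`: represent `c` by a cocycle that vanishes outside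
a compact subset of `ℂ \ Σ`, and evaluate it on the portion of `δ` that meets this subset. -/
def IsPairing (c : S.Betti s) (v : ℂ) : Prop :=
  ∃ (φ : S.Cocycle s) (K : Set ℂ), Submodule.Quotient.mk φ = c ∧ IsCompact K ∧ K ⊆ S.compl ∧
    (∀ T : S.TwistedSimplex s 1, (∀ p, T.map p ∉ K) → φ.1 T = 0) ∧
    ∃ (a b : ℝ) (ha : 0 < a) (hab : a ≤ b) (hb : b < 1),
      (∀ t ∈ Ioc 0 a, δ.path t ∉ K) ∧ (∀ t ∈ Ico b 1, δ.path t ∉ K) ∧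
      v = φ.1 (δ.segment s a b ha hab hb)

/-- The pairing of a locally finite path with Betti cohomology (for generic `s` the value exists
and does not depend on choices). -/
def pairing (c : S.Betti s) : ℂ := Classical.epsilon (δ.IsPairing s c)

end BranchedPath

/-- The classes `δ_i ⊗ x^{s₀} ∏ (1 - x σ_k⁻¹)^{s_k}` form a basis of locally finite homology, the dual
of `H¹_B(X_Σ, 𝓛_s)`. -/
def IsBettiBasis (δ : ∀ i : Fin n, S.BranchedPath i) : Prop :=
  Function.Bijective fun (c : S.Betti s) (i : Fin n) => (δ i).pairing s c

/-- The Lauricella matrix `L_Σ(s)`: the matrix of the comparison isomorphism in the bases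
`-s_j ω_j` and `δ_i ⊗ x^{s₀} ∏ (1 - x σ_k⁻¹)^{s_k}`. -/
def lauricella (δ : ∀ i : Fin n, S.BranchedPath i) : Matrix (Fin n) (Fin n) ℂ :=
  Matrix.of fun i j => (δ i).pairing s (S.comparison s
    (Submodule.Quotient.mk (S.logForm (-(s j.succ : ℂ) • Pi.single j.succ 1))))

variable (S)

/-- The single-valued Lauricella matrix `L^𝐬_Σ(s)`, defined by complex integrals. -/
def svLauricella : Matrix (Fin n) (Fin n) ℂ :=
  Matrix.of fun i j => (s j.succ : ℂ) / (2 * Real.pi * Complex.I) *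
    wedgeIntegral (conjForm fun z => 1 / (z - S.pt i.succ) - 1 / z)
      (holForm fun z => S.weight s z * (1 / (z - S.pt j.succ)))

end PointConfig
end
end Lauricella

/-! The link between cohomology and analysis is the notion of a primitive (`IsPrimitiveOn`). A Betti
1-cocycle on a star-shaped part of ℂ \ Σ is the boundary of a function F, and the cocycle is exact
when such an F exists on all of ℂ \ Σ. For the period cocycle of f dz a primitive is a solution of
F' + F ∑ s_k/(z - σ_k) = f, which has simple poles at the σ_k and at infinity. Since |s_k| < 1 and
|∑ s_k| < 1, a single-valued solution near a pole grows too slowly to be singular there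
(`exists_extension_of_simple_pole`); for the logarithmic form ∑ a_k ω_k its value at σ_k is a_k/s_k.

Comparison is injective: lowering pole orders makes every de Rham class logarithmic
(`exists_logForm`), and a global primitive of a logarithmic form is entire with a limit at infinity,
hence constant by Liouville, so that the form is a multiple of ∑ s_k ω_k = ∇1
(`exists_eq_smul_of_primitive`). Comparison is surjective: cut the plane along rays issuing from the
σ_k. A cocycle has a primitive on the slit plane and, the local monodromy being nontrivial, one on a
punctured disc around each σ_k. The differences are n + 1 constants, the jumps, defined up to a
common constant. Zero jumps mean exactness, and a dimension count shows that logarithmic forms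
realise every vector of jumps (`exists_logForm_isJump`).

The pairings are defined by choosing a value, so existence and uniqueness must be supplied. Both
come from cutting off the local solutions near the poles, which gives compactly supported
representatives (`exists_cutoff`). Along a path, every value of the pairing with ∑ a_k ω_k is the
limit of the integral corrected by the boundary terms a_k/s_k (`BranchedPath.IsPairing.tendsto`).

For the single-valued pairing, let h dz represent the image of ω. The cocycle of h dz minus the
Frobenius transform of that of ω is exact, so there is a single-valued F whose ∇_{-s}-derivative is
h dz minus the weighted conjugate of ω (`exists_frobenius_primitive`). Stokes' formula replaces h by
this antiholomorphic form (`wedgeIntegral_eq_of_primitive`), and then the compactly supported form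
may be replaced by the logarithmic one, because positivity of the s_k and ∑ s_k < 1/2 make all
boundary terms vanish (`integral_mul_weightedConj`). The change of variables z ↦ z̄ gives (ii).

For the matrix identity, the residue theorem evaluates the intersection pairing of logarithmic forms
as ∑ b_k c_k/s_k (`isDeRhamPairing_logForm`). Pairing with ω_i - ω_0 therefore identifies the
single-valued Lauricella matrix with the matrix of 𝐬 (`svLauricella_apply`). Since the Frobenius
preserves pairings with conjugate paths (`BranchedPath.pairing_bar`), evaluating comp ∘ 𝐬 = F_∞ ∘
comp on the conjugate paths is the identity `lauricella_mul_svLauricella`. A basis of paths is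
obtained by going inside the slit plane from 0 through the base point to σ_i: the periods are then
differences of jumps (`exists_isBettiBasis`). -/

namespace Lauricella

open scoped ContDiff
open Asymptotics

noncomputable section

/-! ### Linear differential equations with a simple pole -/

/-- Radial Gronwall estimate for a linear differential equation with a simple pole. -/
theorem exists_norm_le_of_simple_pole {F A B : ℂ → ℂ} {c : ℂ} {r K C : ℝ} (hr : 0 < r)
    (hK : 0 < K)
    (hF : ∀ z ∈ Metric.ball c r \ {c}, HasDerivAt F ((B z - A z * F z) / (z - c)) z)
    (hA : ∀ z ∈ Metric.ball c r \ {c}, ‖A z‖ ≤ K)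
    (hB : ∀ z ∈ Metric.ball c r \ {c}, ‖B z‖ ≤ C) :
    ∃ M, ∀ z ∈ Metric.ball c (r / 2) \ {c}, ‖F z‖ ≤ M * ‖z - c‖ ^ (-K) := by
  have hr2 : 0 < r / 2 := half_pos hr
  have hmem : ∀ z, ‖z - c‖ < r → z ≠ c → z ∈ Metric.ball c r \ {c} := fun z h1 h2 =>
    ⟨by rwa [Metric.mem_ball, dist_eq_norm], h2⟩
  have hcont : ContinuousOn F (Metric.sphere c (r / 2)) := fun z hz => by
    rw [mem_sphere_iff_norm] at hz
    refine (hF z (hmem z (by linarith) ?_)).continuousAt.continuousWithinAt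
    rintro rfl
    simp at hz
    linarith
  obtain ⟨M₀, hM₀⟩ := (isCompact_sphere c (r / 2)).exists_bound_of_continuousOn hcont
  have hC : 0 ≤ C := (norm_nonneg _).trans (hB (c + (r / 2 : ℝ)) (hmem _ (by
    simp only [add_sub_cancel_left, Complex.norm_real, Real.norm_eq_abs, abs_of_pos hr2]; linarith) (by
    simpa using hr.ne')))
  refine ⟨(M₀ + C / K) * (r / 2) ^ K, fun z hz => ?_⟩
  have hz0 : z - c ≠ 0 := sub_ne_zero.2 hz.2
  have hρ : 0 < ‖z - c‖ := norm_pos_iff.2 hz0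
  have hzr : ‖z - c‖ < r / 2 := by simpa [dist_eq_norm] using hz.1
  -- The point z is reached along the ray from the circle of radius r/2, parametrised as c + e^{-t}
  -- w. In this parameter the pole disappears, the equation being d/dt F = A F - B. Gronwall with
  -- constant K over the time T = log((r/2)/|z - c|) produces the power |z - c|^{-K}.
  set w : ℂ := (z - c) * ((r / 2 / ‖z - c‖ : ℝ) : ℂ) with hw
  have hwn : ‖w‖ = r / 2 := by
    rw [hw, norm_mul, Complex.norm_real, Real.norm_eq_abs, abs_of_pos (by positivity)]
    field_simp
  have hw0 : w ≠ 0 := norm_pos_iff.1 (by rw [hwn]; exact hr2)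
  set T := Real.log (r / 2 / ‖z - c‖) with hT
  have hT0 : 0 ≤ T := Real.log_nonneg ((one_le_div hρ).2 hzr.le)
  let γ : ℝ → ℂ := fun t => c + (Real.exp (-t) : ℂ) * w
  have hγn : ∀ t, ‖γ t - c‖ = Real.exp (-t) * (r / 2) := fun t => by
    simp only [γ, add_sub_cancel_left, norm_mul, Complex.norm_real, Real.norm_eq_abs, Real.abs_exp,
      hwn]
  have hγm : ∀ t, 0 ≤ t → γ t ∈ Metric.ball c r \ {c} := fun t ht => by
    refine hmem _ ?_ ?_
    · rw [hγn]
      have : Real.exp (-t) ≤ 1 := Real.exp_le_one_iff.2 (by linarith)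
      nlinarith
    · intro h
      have := hγn t
      rw [h, sub_self, norm_zero] at this
      have := Real.exp_pos (-t)
      nlinarith
  have hγd : ∀ t, HasDerivAt γ (-(γ t - c)) t := fun t => by
    have h1 : HasDerivAt (fun t : ℝ => Real.exp (-t)) (-Real.exp (-t)) t := by
      simpa using (hasDerivAt_neg t).exp
    refine ((h1.ofReal_comp.mul_const w).const_add c).congr_deriv ?_
    simp [γ]
  have hd : ∀ t, 0 ≤ t → HasDerivAt (fun t => F (γ t)) (-(B (γ t) - A (γ t) * F (γ t))) t :=
    fun t ht => by
    refine ((hF _ (hγm t ht)).comp t (hγd t)).congr_deriv ?_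
    have : γ t - c ≠ 0 := sub_ne_zero.2 (hγm t ht).2
    field_simp
  have hG := norm_le_gronwallBound_of_norm_deriv_right_le (f := fun t => F (γ t)) (δ := M₀) (K := K)
    (ε := C) (a := 0) (b := T)
    (fun t ht => (hd t ht.1).continuousAt.continuousWithinAt)
    (fun t ht => (hd t ht.1).hasDerivWithinAt)
    (hM₀ _ (by rw [mem_sphere_iff_norm, hγn]; simp)) (fun t ht => by
      rw [norm_neg]
      refine (norm_sub_le _ _).trans ?_
      rw [norm_mul, add_comm]
      exact add_le_add (mul_le_mul_of_nonneg_right (hA _ (hγm t ht.1)) (norm_nonneg _))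
        (hB _ (hγm t ht.1))) T ⟨hT0, le_rfl⟩
  have hγT : γ T = z := by
    have : Real.exp (-T) * (r / 2 / ‖z - c‖) = 1 := by
      rw [Real.exp_neg, hT, Real.exp_log (by positivity)]
      field_simp
    have h2 : (Real.exp (-T) : ℂ) * ((r / 2 / ‖z - c‖ : ℝ) : ℂ) = 1 := by
      exact_mod_cast congrArg (fun x : ℝ => (x : ℂ)) this
    simp only [γ, hw]
    linear_combination (z - c) * h2
  rw [hγT, sub_zero, gronwallBound_of_K_ne_0 hK.ne'] at hG
  refine hG.trans ?_
  have hexp : Real.exp (K * T) = (r / 2) ^ K * ‖z - c‖ ^ (-K) := by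
    rw [mul_comm, Real.exp_mul, hT, Real.exp_log (by positivity), Real.div_rpow hr2.le hρ.le,
      Real.rpow_neg hρ.le, div_eq_mul_inv]
  simp only [hexp]
  rw [mul_assoc]
  have : 0 ≤ C / K := by positivity
  nlinarith

/-- Removable singularities of solutions of a linear differential equation with a simple pole. -/
theorem exists_extension_of_simple_pole {F A B : ℂ → ℂ} {c : ℂ} {r : ℝ} (hr : 0 < r)
    (hA : DifferentiableOn ℂ A (Metric.ball c r)) (hB : DifferentiableOn ℂ B (Metric.ball c r))
    (hAc : ‖A c‖ < 1)
    (hF : ∀ z ∈ Metric.ball c r \ {c}, HasDerivAt F ((B z - A z * F z) / (z - c)) z) :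
    ∃ G : ℂ → ℂ, DifferentiableOn ℂ G (Metric.ball c r) ∧ A c * G c = B c ∧
      ∀ z ∈ Metric.ball c r \ {c}, G z = F z := by
  have hball : Metric.ball c r ∈ 𝓝 c := Metric.ball_mem_nhds c hr
  have hAcont := (hA.differentiableAt hball).continuousAt
  have hBcont := (hB.differentiableAt hball).continuousAt
  -- An exponent K < 1 that bounds A near c makes F grow more slowly than 1/|z - c|, so the
  -- singularity is removable.
  obtain ⟨K, hK1, hK2⟩ := exists_between hAc
  have hK0 : 0 < K := (norm_nonneg _).trans_lt hK1
  have h1 : ∀ᶠ z in 𝓝 c, ‖A z‖ < K ∧ ‖B z‖ < ‖B c‖ + 1 :=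
    (hAcont.norm.eventually_lt_const hK1).and (hBcont.norm.eventually_lt_const (by linarith))
  obtain ⟨ρ, hρ, hρ'⟩ := Metric.eventually_nhds_iff_ball.1 (h1.and hball)
  obtain ⟨M, hM⟩ := exists_norm_le_of_simple_pole (C := ‖B c‖ + 1) hρ hK0
    (fun z hz => hF z ⟨(hρ' z hz.1).2, hz.2⟩)
    (fun z hz => (hρ' z hz.1).1.1.le) (fun z hz => (hρ' z hz.1).1.2.le)
  have hsub : Tendsto (fun z => ‖z - c‖) (𝓝[≠] c) (𝓝[>] 0) := by
    refine tendsto_nhdsWithin_iff.2 ⟨?_, ?_⟩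
    · have : Continuous fun z => ‖z - c‖ := by fun_prop
      simpa using (this.tendsto c).mono_left nhdsWithin_le_nhds
    · filter_upwards [self_mem_nhdsWithin] with z hz
      exact norm_pos_iff.2 (sub_ne_zero.2 hz)
  have hlim : Tendsto (fun z => (F z - F c) * (z - c)) (𝓝[≠] c) (𝓝 0) := by
    have h2 : Tendsto (fun x : ℝ => M * x ^ (1 - K)) (𝓝[>] 0) (𝓝 0) := by
      have := (Real.continuous_rpow_const (q := 1 - K) (by linarith)).tendsto 0
      rw [Real.zero_rpow (by linarith)] at this
      simpa using (this.mono_left nhdsWithin_le_nhds).const_mul M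
    have h3 : Tendsto (fun z => F z * (z - c)) (𝓝[≠] c) (𝓝 0) := by
      refine squeeze_zero_norm' ?_ (h2.comp hsub)
      filter_upwards [self_mem_nhdsWithin, nhdsWithin_le_nhds (Metric.ball_mem_nhds c (half_pos hρ))]
        with z hz hz'
      have hpos : 0 < ‖z - c‖ := norm_pos_iff.2 (sub_ne_zero.2 hz)
      rw [norm_mul]
      refine (mul_le_mul_of_nonneg_right (hM z ⟨hz', hz⟩) hpos.le).trans_eq ?_
      simp only [Function.comp]
      rw [mul_assoc, show (1 - K) = -K + 1 by ring, Real.rpow_add_one hpos.ne']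
    have h4 : Tendsto (fun z => F c * (z - c)) (𝓝[≠] c) (𝓝 0) := by
      have : Continuous fun z => F c * (z - c) := by fun_prop
      simpa using (this.tendsto c).mono_left nhdsWithin_le_nhds
    simpa [sub_mul] using h3.sub h4
  have ho : (fun z => F z - F c) =o[𝓝[≠] c] fun z => (z - c)⁻¹ := by
    rw [Asymptotics.isLittleO_iff_tendsto']
    · simpa using hlim
    · filter_upwards [self_mem_nhdsWithin] with z hz h
      exact absurd (inv_eq_zero.1 h) (sub_ne_zero.2 hz)
  have hG := Complex.differentiableOn_update_limUnder_of_isLittleO hball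
    (fun z hz => (hF z hz).differentiableAt.differentiableWithinAt) ho
  set G := Function.update F c (limUnder (𝓝[≠] c) F) with hGdef
  have hGF : ∀ z ∈ Metric.ball c r \ {c}, G z = F z := fun z hz =>
    Function.update_of_ne hz.2 _ _
  refine ⟨G, hG, ?_, hGF⟩
  -- Letting z tend to c in (z - c) G' = B - A G gives the relation at c.
  have hGa : AnalyticAt ℂ G c := hG.analyticAt hball
  have hd : Tendsto (fun z => (z - c) * deriv G z) (𝓝[≠] c) (𝓝 0) := by
    have h2 : Tendsto (fun z => (z - c) * deriv G z) (𝓝 c) (𝓝 ((c - c) * deriv G c)) :=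
      (((continuous_sub_right c).tendsto c).mul hGa.deriv.continuousAt)
    simpa using h2.mono_left nhdsWithin_le_nhds
  have h2 : Tendsto (fun z => B z - A z * G z) (𝓝[≠] c) (𝓝 (B c - A c * G c)) :=
    (hBcont.sub (hAcont.mul hGa.continuousAt)).tendsto.mono_left nhdsWithin_le_nhds
  have h3 := tendsto_nhds_unique (hd.congr' ?_) h2
  · exact (sub_eq_zero.1 h3.symm).symm
  · filter_upwards [self_mem_nhdsWithin, nhdsWithin_le_nhds hball] with z hz hz'
    have h4 : deriv G z = (B z - A z * F z) / (z - c) := by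
      refine ((hF z ⟨hz', hz⟩).congr_of_eventuallyEq ?_).deriv
      filter_upwards [isOpen_compl_singleton.mem_nhds hz, Metric.isOpen_ball.mem_nhds hz']
        with y hy hy' using hGF y ⟨hy', hy⟩
    rw [h4, hGF z ⟨hz', hz⟩, mul_div_cancel₀ _ (sub_ne_zero.2 hz)]

/-- The solution is J(w) = ∫₀¹ t^s q(t w) dt: the t-derivative of t^{s+1} q(t w) is the integrand of
(1 + s) J + w J'. The bound s > -1 makes the integral converge and kills the boundary term at t = 0.
-/
theorem exists_euler_solution {q : ℂ → ℂ} {R s : ℝ} (hq : DifferentiableOn ℂ q (Metric.ball 0 R))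
    (hs : -1 < s) : ∃ J : ℂ → ℂ, ∀ w ∈ Metric.ball (0 : ℂ) R, ∃ J' : ℂ, HasDerivAt J J' w ∧
      (1 + s) * J w + w * J' = q w := by
  refine ⟨fun w => ∫ t in (0 : ℝ)..1, ((t ^ s : ℝ) : ℂ) * q (t * w), fun w hw => ?_⟩
  have hwR : ‖w‖ < R := by simpa using hw
  obtain ⟨ρ, hρ1, hρ2⟩ := exists_between hwR
  have hρ0 : 0 < ρ := (norm_nonneg w).trans_lt hρ1
  have hsub : Metric.closedBall (0 : ℂ) ρ ⊆ Metric.ball 0 R := fun z hz => by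
    simp at hz ⊢; linarith
  have hqd : DifferentiableOn ℂ (deriv q) (Metric.ball 0 R) := hq.deriv Metric.isOpen_ball
  obtain ⟨M, hM⟩ := (isCompact_closedBall (0 : ℂ) ρ).exists_bound_of_continuousOn
    (hqd.continuousOn.mono hsub)
  have hmem : ∀ z : ℂ, ‖z‖ ≤ ρ → ∀ t ∈ Icc (0 : ℝ) 1, (t : ℂ) * z ∈ Metric.closedBall (0 : ℂ) ρ :=
    fun z hz t ht => by
    rw [mem_closedBall_zero_iff, norm_mul, Complex.norm_real, Real.norm_eq_abs, abs_of_nonneg ht.1]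
    exact (mul_le_of_le_one_left (norm_nonneg z) ht.2).trans hz
  have hcont : ∀ (p : ℂ → ℂ), ContinuousOn p (Metric.ball 0 R) → ∀ z : ℂ, ‖z‖ ≤ ρ →
      ContinuousOn (fun t : ℝ => p (t * z)) (Icc 0 1) := fun p hp z hz =>
    hp.comp (by fun_prop) fun t ht => hsub (hmem z hz t ht)
  have hint : IntervalIntegrable (fun t : ℝ => ((t ^ s : ℝ) : ℂ)) volume 0 1 :=
    have h := intervalIntegral.intervalIntegrable_rpow' (a := 0) (b := 1) hs
    ⟨h.1.ofReal, h.2.ofReal⟩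
  have hu : uIcc (0 : ℝ) 1 = Icc 0 1 := uIcc_of_le zero_le_one
  have huo : uIoc (0 : ℝ) 1 ⊆ Icc 0 1 := by
    rw [uIoc_of_le zero_le_one]; exact Ioc_subset_Icc_self
  have hint' : ∀ (p : ℂ → ℂ), ContinuousOn p (Metric.ball 0 R) → ∀ z : ℂ, ‖z‖ ≤ ρ →
      IntervalIntegrable (fun t : ℝ => ((t ^ s : ℝ) : ℂ) * p (t * z)) volume 0 1 :=
    fun p hp z hz => hint.mul_continuousOn (by rw [hu]; exact hcont p hp z hz)
  have hid : DifferentiableOn ℂ (fun z => z * deriv q z) (Metric.ball 0 R) :=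
    differentiableOn_id.mul hqd
  have hmeas : ∀ (p : ℂ → ℂ), ContinuousOn p (Metric.ball 0 R) → ∀ z : ℂ, ‖z‖ ≤ ρ →
      AEStronglyMeasurable (fun t : ℝ => ((t ^ s : ℝ) : ℂ) * p (t * z))
        (volume.restrict (uIoc (0 : ℝ) 1)) := fun p hp z hz => by
    have := (hint' p hp z hz).1.aestronglyMeasurable
    rwa [uIoc_of_le zero_le_one]
  have hdiff := intervalIntegral.hasDerivAt_integral_of_dominated_loc_of_deriv_le (𝕜 := ℂ)
    (μ := volume) (a := 0) (b := 1) (x₀ := w) (s := Metric.ball 0 ρ)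
    (F := fun z (t : ℝ) => ((t ^ s : ℝ) : ℂ) * q (t * z))
    (F' := fun z (t : ℝ) => ((t ^ s : ℝ) : ℂ) * (deriv q (t * z) * t))
    (bound := fun t => t ^ s * M) (Metric.isOpen_ball.mem_nhds (by simpa using hρ1))
    ?_ (hint' q hq.continuousOn w hρ1.le) ?_ ?_ ?_ ?_
  · refine ⟨_, hdiff.2, ?_⟩
    have hF : ∀ t ∈ Icc (0 : ℝ) 1, 0 < t → HasDerivAt (fun t : ℝ => ((t ^ (s + 1) : ℝ) : ℂ) * q (t * w))
        ((1 + s) * (((t ^ s : ℝ) : ℂ) * q (t * w)) +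
          w * (((t ^ s : ℝ) : ℂ) * (deriv q (t * w) * t))) t := fun t ht ht0 => by
      have h1 : HasDerivAt (fun t : ℝ => ((t ^ (s + 1) : ℝ) : ℂ)) (((s + 1) * t ^ s : ℝ) : ℂ) t := by
        have := (Real.hasDerivAt_rpow_const (p := s + 1) (Or.inl ht0.ne')).ofReal_comp
        simpa using this
      have h2 : HasDerivAt (fun t : ℝ => q (t * w)) (deriv q (t * w) * w) t := by
        have h3 := (hq.differentiableAt (Metric.isOpen_ball.mem_nhds
          (hsub (hmem w hρ1.le t ht)))).hasDerivAt
        have h4 : HasDerivAt (fun t : ℝ => (t : ℂ) * w) w t := by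
          simpa using (HasDerivAt.ofReal_comp (hasDerivAt_id t)).mul_const w
        exact h3.comp t h4
      refine (h1.mul h2).congr_deriv ?_
      have h5 : ((t ^ (s + 1) : ℝ) : ℂ) = ((t ^ s : ℝ) : ℂ) * t := by
        rw [Real.rpow_add_one ht0.ne']; push_cast; rfl
      rw [h5]
      push_cast
      ring
    have hi1 := (hint' q hq.continuousOn w hρ1.le).const_mul ((1 : ℂ) + s)
    have hi2 := hdiff.1.const_mul w
    have hftc := intervalIntegral.integral_eq_sub_of_hasDerivAt_of_le zero_le_one
      (f := fun t : ℝ => ((t ^ (s + 1) : ℝ) : ℂ) * q (t * w)) (f' := fun t : ℝ =>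
        (1 + s) * (((t ^ s : ℝ) : ℂ) * q (t * w)) +
          w * (((t ^ s : ℝ) : ℂ) * (deriv q (t * w) * t)))
      ((Complex.continuous_ofReal.comp_continuousOn
        (Real.continuous_rpow_const (by linarith)).continuousOn).mul
        (hcont q hq.continuousOn w hρ1.le))
      (fun t ht => hF t (Ioo_subset_Icc_self ht) ht.1) (hi1.add hi2)
    rw [intervalIntegral.integral_add hi1 hi2, intervalIntegral.integral_const_mul,
      intervalIntegral.integral_const_mul] at hftc
    rw [hftc, Real.zero_rpow (by linarith)]
    simp
  · filter_upwards [Metric.isOpen_ball.mem_nhds (show w ∈ Metric.ball (0 : ℂ) ρ by simpa using hρ1)]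
      with z hz
    exact hmeas q hq.continuousOn z (by simpa using (Metric.mem_ball.1 hz).le)
  · have := (hint.mul_continuousOn (g := fun t : ℝ => deriv q (t * w) * t) (by
      rw [hu]; exact (hcont _ hqd.continuousOn w hρ1.le).mul (by fun_prop))).1.aestronglyMeasurable
    rwa [uIoc_of_le zero_le_one]
  · refine Eventually.of_forall fun t ht z hz => ?_
    have ht' := huo ht
    have h1 := hM _ (hmem z (by simpa using (Metric.mem_ball.1 hz).le) t ht')
    have h2 : (0 : ℝ) ≤ t ^ s := Real.rpow_nonneg ht'.1 s
    rw [norm_mul, norm_mul, Complex.norm_real, Complex.norm_real, Real.norm_eq_abs,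
      Real.norm_eq_abs, abs_of_nonneg h2, abs_of_nonneg ht'.1]
    refine mul_le_mul_of_nonneg_left ?_ h2
    exact (mul_le_of_le_one_right (norm_nonneg _) ht'.2).trans h1
  · exact (intervalIntegral.intervalIntegrable_rpow' hs).mul_const M
  · refine Eventually.of_forall fun t ht z hz => ?_
    have ht' := huo ht
    have h3 := (hq.differentiableAt (Metric.isOpen_ball.mem_nhds
      (hsub (hmem z (by simpa using (Metric.mem_ball.1 hz).le) t ht')))).hasDerivAt
    have h4 : HasDerivAt (fun z : ℂ => (t : ℂ) * z) (t : ℂ) z := by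
      simpa using (hasDerivAt_id z).const_mul (t : ℂ)
    exact (h3.comp z h4).const_mul _

/-- Holomorphic solutions of a linear differential equation with a regular singular point. -/
theorem exists_solution_of_simple_pole {A B : ℂ → ℂ} {c : ℂ} {R s : ℝ} (hR : 0 < R)
    (hA : DifferentiableOn ℂ A (Metric.ball c R)) (hB : DifferentiableOn ℂ B (Metric.ball c R))
    (hAs : A c = s) (hs : -1 < s) (hs0 : s ≠ 0) :
    ∃ h : ℂ → ℂ, ∀ z ∈ Metric.ball c R, ∃ h', HasDerivAt h h' z ∧
      (z - c) * h' + A z * h z = B z := by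
  have hball : Metric.ball c R ∈ 𝓝 c := Metric.ball_mem_nhds c hR
  -- P is a primitive of (A - s)/(z - c), extended over c by `dslope`. With y = e^P h the equation
  -- becomes (z - c) y' + s y = q, where q = e^P B.
  obtain ⟨P, hP⟩ := ((Complex.differentiableOn_dslope hball).2 hA).isExactOn_ball
  have hPd : DifferentiableOn ℂ P (Metric.ball c R) := fun z hz =>
    (hP z hz).differentiableAt.differentiableWithinAt
  have hq : DifferentiableOn ℂ (fun z => Complex.exp (P z) * B z) (Metric.ball c R) :=
    hPd.cexp.mul hB
  set q := fun z => Complex.exp (P z) * B z with hqdef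
  have hq1 := (Complex.differentiableOn_dslope hball).2 hq
  have hq2 : DifferentiableOn ℂ (fun w => dslope q c (c + w)) (Metric.ball 0 R) :=
    hq1.comp (by fun_prop) fun w hw => by simpa [dist_eq_norm] using hw
  obtain ⟨J, hJ⟩ := exists_euler_solution hq2 hs
  have hs0' : (s : ℂ) ≠ 0 := by exact_mod_cast hs0
  -- The constant term of q is solved by q(c)/s, which needs s ≠ 0. The rest is divisible by z - c,
  -- and after division the integral for J involves t^s instead of t^{s-1}, so that s > -1 suffices.
  refine ⟨fun z => Complex.exp (-P z) * (q c / s + (z - c) * J (z - c)), fun z hz => ?_⟩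
  obtain ⟨J', hJ', hJq⟩ := hJ (z - c) (by simpa [dist_eq_norm] using hz)
  have hd1 : HasDerivAt (fun z => z - c) 1 z := (hasDerivAt_id z).sub_const c
  have hJc : HasDerivAt (fun z => J (z - c)) J' z :=
    (hJ'.comp z hd1).congr_deriv (mul_one _)
  refine ⟨_, (hP z hz).fun_neg.cexp.mul ((hd1.mul hJc).const_add (q c / s)), ?_⟩
  have e1 : (z - c) * dslope A c z = A z - s := by
    rw [← smul_eq_mul, sub_smul_dslope, hAs]
  have e2 : (z - c) * dslope q c z = q z - q c := by
    rw [← smul_eq_mul, sub_smul_dslope]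
  rw [add_sub_cancel] at hJq
  have e3 : Complex.exp (-P z) * Complex.exp (P z) = 1 := by
    rw [← Complex.exp_add]; simp
  have e4 : B z = Complex.exp (-P z) * q z := by
    rw [hqdef]; linear_combination -(B z) * e3
  have e5 : q c / s * s = q c := div_mul_cancel₀ _ hs0'
  rw [e4]
  linear_combination (-Complex.exp (-P z)) * (q c / s + (z - c) * J (z - c)) * e1 +
    Complex.exp (-P z) * (z - c) * hJq + Complex.exp (-P z) * e2 + Complex.exp (-P z) * e5

/-! ### Wirtinger derivatives and integration by parts -/

/-- The operator `∂/∂z̄`. -/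
def dbar (φ : ℂ → ℂ) (z : ℂ) : ℂ :=
  (fderiv ℝ φ z 1 + Complex.I * fderiv ℝ φ z Complex.I) / 2

/-- The operator `∂/∂z`. -/
def del (φ : ℂ → ℂ) (z : ℂ) : ℂ :=
  (fderiv ℝ φ z 1 - Complex.I * fderiv ℝ φ z Complex.I) / 2

theorem fderiv_apply_eq (φ : ℂ → ℂ) (z v : ℂ) :
    fderiv ℝ φ z v = del φ z * v + dbar φ z * (starRingEnd ℂ) v := by
  have h : v = v.re • (1 : ℂ) + v.im • Complex.I := by
    simp [Complex.re_add_im]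
  conv_lhs => rw [h, map_add, map_smul, map_smul]
  have h1 : v = v.re + v.im * Complex.I := (Complex.re_add_im v).symm
  have h2 : (starRingEnd ℂ) v = v.re - v.im * Complex.I := by
    conv_lhs => rw [h1]
    simp [-Complex.re_add_im]
    ring
  rw [h2]
  conv_rhs => rw [h1]
  simp only [del, dbar, Complex.real_smul]
  simp only [Complex.add_re, Complex.add_im, Complex.ofReal_re, Complex.ofReal_im, Complex.mul_re,
    Complex.mul_im, Complex.I_re, Complex.I_im, mul_zero, mul_one, sub_zero, add_zero, zero_add]
  linear_combination (v.im : ℂ) * fderiv ℝ φ z Complex.I * Complex.I_sq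

theorem dbar_eq_of_hasFDerivAt {φ : ℂ → ℂ} {L : ℂ →L[ℝ] ℂ} {z : ℂ} (h : HasFDerivAt φ L z) :
    dbar φ z = (L 1 + Complex.I * L Complex.I) / 2 := by
  rw [dbar, h.fderiv]

theorem del_eq_of_hasFDerivAt {φ : ℂ → ℂ} {L : ℂ →L[ℝ] ℂ} {z : ℂ} (h : HasFDerivAt φ L z) :
    del φ z = (L 1 - Complex.I * L Complex.I) / 2 := by
  rw [del, h.fderiv]

theorem dbar_mul {φ ψ : ℂ → ℂ} {z : ℂ} (hφ : DifferentiableAt ℝ φ z)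
    (hψ : DifferentiableAt ℝ ψ z) :
    dbar (fun z => φ z * ψ z) z = φ z * dbar ψ z + dbar φ z * ψ z := by
  rw [dbar_eq_of_hasFDerivAt (φ := fun z => φ z * ψ z) (hφ.hasFDerivAt.mul hψ.hasFDerivAt)]
  simp only [dbar, add_apply, smul_apply, smul_eq_mul]
  ring

theorem dbar_eq_zero_of_differentiableAt {φ : ℂ → ℂ} {z : ℂ} (h : DifferentiableAt ℂ φ z) :
    dbar φ z = 0 := by
  rw [dbar_eq_of_hasFDerivAt (h.hasDerivAt.hasFDerivAt.restrictScalars ℝ)]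
  simp only [ContinuousLinearMap.coe_restrictScalars', ContinuousLinearMap.toSpanSingleton_apply,
    smul_eq_mul, one_mul]
  linear_combination (deriv φ z / 2) * Complex.I_sq

theorem del_eq_deriv {φ : ℂ → ℂ} {z : ℂ} (h : DifferentiableAt ℂ φ z) : del φ z = deriv φ z := by
  rw [del_eq_of_hasFDerivAt (h.hasDerivAt.hasFDerivAt.restrictScalars ℝ)]
  simp only [ContinuousLinearMap.coe_restrictScalars', ContinuousLinearMap.toSpanSingleton_apply,
    smul_eq_mul, one_mul]
  linear_combination (-deriv φ z / 2) * Complex.I_sq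

theorem hasDerivAt_of_dbar_eq_zero {φ : ℂ → ℂ} {z : ℂ} (hφ : DifferentiableAt ℝ φ z)
    (h : dbar φ z = 0) : HasDerivAt φ (del φ z) z := by
  rw [hasDerivAt_iff_hasFDerivAt]
  refine HasFDerivAt.of_isLittleO ((hφ.hasFDerivAt.isLittleO).congr_left fun y => ?_)
  rw [fderiv_apply_eq, h]
  simp [mul_comm]

theorem del_conj_conj {φ : ℂ → ℂ} {z : ℂ} (hφ : DifferentiableAt ℝ φ z) :
    del φ z = (starRingEnd ℂ) (dbar (fun z => (starRingEnd ℂ) (φ z)) z) := by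
  have h := (Complex.conjCLE.toContinuousLinearMap.hasFDerivAt (x := φ z)).comp z hφ.hasFDerivAt
  rw [dbar_eq_of_hasFDerivAt (φ := fun z => (starRingEnd ℂ) (φ z)) h]
  simp [del, sub_eq_add_neg, Complex.conj_ofNat]

theorem continuousOn_dbar {ψ : ℂ → ℂ} {U : Set ℂ} (hU : IsOpen U) (hψ : ContDiffOn ℝ 1 ψ U) :
    ContinuousOn (dbar ψ) U := by
  have h := hψ.continuousOn_fderiv_of_isOpen hU (by simp)
  exact ((h.clm_apply continuousOn_const).add
    (continuousOn_const.mul (h.clm_apply continuousOn_const))).div_const 2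

theorem integrable_mul_of_hasCompactSupport {χ ψ : ℂ → ℂ} {U : Set ℂ} (hχ : Continuous χ)
    (hc : HasCompactSupport χ) (hU : tsupport χ ⊆ U) (hψ : ContinuousOn ψ U) :
    Integrable fun z => χ z * ψ z := by
  have h : IntegrableOn (fun z => χ z * ψ z) (tsupport χ) :=
    (hχ.continuousOn.mul (hψ.mono hU)).integrableOn_compact hc
  rwa [integrableOn_iff_integrable_of_support_subset] at h
  intro z hz
  refine subset_tsupport χ fun h0 => hz ?_
  simp [h0]

theorem hasCompactSupport_fderiv_apply {χ : ℂ → ℂ} (hc : HasCompactSupport χ) (v : ℂ) :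
    HasCompactSupport (fun z => fderiv ℝ χ z v) ∧ tsupport (fun z => fderiv ℝ χ z v) ⊆ tsupport χ := by
  have h := hc.fderiv_apply ℝ v
  refine ⟨h, closure_minimal (fun z hz => ?_) (isClosed_tsupport χ)⟩
  by_contra h0
  refine hz ?_
  have := (notMem_tsupport_iff_eventuallyEq.1 h0).fderiv_eq (𝕜 := ℝ)
  simp [this]

/-- ψ may be singular off U: the compact support of χ inside U makes both products integrable on the
whole plane, and there is no boundary term. -/
theorem integral_mul_fderiv {χ ψ : ℂ → ℂ} {U : Set ℂ} (hU : IsOpen U) (hχ : ContDiff ℝ 1 χ)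
    (hc : HasCompactSupport χ) (hχU : tsupport χ ⊆ U) (hψ : ContDiffOn ℝ 1 ψ U) (v : ℂ) :
    Integrable (fun z => χ z * fderiv ℝ ψ z v) ∧ Integrable (fun z => fderiv ℝ χ z v * ψ z) ∧
    ∫ z, χ z * fderiv ℝ ψ z v = -∫ z, fderiv ℝ χ z v * ψ z := by
  have h0 := hψ.continuousOn_fderiv_of_isOpen hU (by simp)
  have h1 := hasCompactSupport_fderiv_apply hc v
  have h2 : Continuous fun z => fderiv ℝ χ z v :=
    (hχ.continuous_fderiv (by simp)).clm_apply continuous_const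
  have i1 := integrable_mul_of_hasCompactSupport (ψ := fun z => fderiv ℝ ψ z v) hχ.continuous hc hχU
    (h0.clm_apply continuousOn_const)
  have i2 := integrable_mul_of_hasCompactSupport h2 h1.1 (h1.2.trans hχU) hψ.continuousOn
  refine ⟨i1, i2, ?_⟩
  exact integral_bilinear_hasFDerivAt_right_eq_neg_left_of_integrable
    (B := ContinuousLinearMap.mul ℝ ℂ) (f := χ) (g := ψ) i2 i1
    (integrable_mul_of_hasCompactSupport hχ.continuous hc hχU hψ.continuousOn)
    (fun z _ => ((hχ.differentiable (by simp)) z).hasFDerivAt)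
    (fun z hz => ((hψ.contDiffAt (hU.mem_nhds (hχU hz))).differentiableAt (by simp)).hasFDerivAt)

theorem integral_mul_dbar {χ ψ : ℂ → ℂ} {U : Set ℂ} (hU : IsOpen U) (hχ : ContDiff ℝ 1 χ)
    (hc : HasCompactSupport χ) (hχU : tsupport χ ⊆ U) (hψ : ContDiffOn ℝ 1 ψ U) :
    ∫ z, χ z * dbar ψ z = -∫ z, dbar χ z * ψ z := by
  obtain ⟨a1, a2, a3⟩ := integral_mul_fderiv hU hχ hc hχU hψ 1
  obtain ⟨b1, b2, b3⟩ := integral_mul_fderiv hU hχ hc hχU hψ Complex.I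
  have e1 : (fun z => χ z * dbar ψ z) = fun z =>
      (1 / 2) * (χ z * fderiv ℝ ψ z 1) + (Complex.I / 2) * (χ z * fderiv ℝ ψ z Complex.I) := by
    ext z; simp only [dbar]; ring
  have e2 : (fun z => dbar χ z * ψ z) = fun z =>
      (1 / 2) * (fderiv ℝ χ z 1 * ψ z) + (Complex.I / 2) * (fderiv ℝ χ z Complex.I * ψ z) := by
    ext z; simp only [dbar]; ring
  rw [e1, e2, integral_add (a1.const_mul _) (b1.const_mul _),
    integral_add (a2.const_mul _) (b2.const_mul _)]
  simp only [integral_const_mul, a3, b3]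
  ring

theorem integral_mul_del {χ ψ : ℂ → ℂ} {U : Set ℂ} (hU : IsOpen U) (hχ : ContDiff ℝ 1 χ)
    (hc : HasCompactSupport χ) (hχU : tsupport χ ⊆ U) (hψ : ContDiffOn ℝ 1 ψ U) :
    ∫ z, χ z * del ψ z = -∫ z, del χ z * ψ z := by
  obtain ⟨a1, a2, a3⟩ := integral_mul_fderiv hU hχ hc hχU hψ 1
  obtain ⟨b1, b2, b3⟩ := integral_mul_fderiv hU hχ hc hχU hψ Complex.I
  have e1 : (fun z => χ z * del ψ z) = fun z =>
      (1 / 2) * (χ z * fderiv ℝ ψ z 1) + (-Complex.I / 2) * (χ z * fderiv ℝ ψ z Complex.I) := by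
    ext z; simp only [del]; ring
  have e2 : (fun z => del χ z * ψ z) = fun z =>
      (1 / 2) * (fderiv ℝ χ z 1 * ψ z) + (-Complex.I / 2) * (fderiv ℝ χ z Complex.I * ψ z) := by
    ext z; simp only [del]; ring
  rw [e1, e2, integral_add (a1.const_mul _) (b1.const_mul _),
    integral_add (a2.const_mul _) (b2.const_mul _)]
  simp only [integral_const_mul, a3, b3]
  ring

/-! ### Radial cutoff functions -/

theorem continuous_deriv_smoothTransition : Continuous (deriv Real.smoothTransition) :=
  (Real.smoothTransition.contDiff (n := 1)).continuous_deriv le_rfl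

/-- The function attains its minimum here, which also covers the end point 0, where it is not
locally constant. -/
theorem deriv_smoothTransition_of_nonpos {x : ℝ} (hx : x ≤ 0) :
    deriv Real.smoothTransition x = 0 :=
  IsLocalMin.deriv_eq_zero (Eventually.of_forall fun y => by
    rw [Real.smoothTransition.zero_of_nonpos hx]; exact Real.smoothTransition.nonneg y)

theorem deriv_smoothTransition_of_one_le {x : ℝ} (hx : 1 ≤ x) :
    deriv Real.smoothTransition x = 0 :=
  IsLocalMax.deriv_eq_zero (Eventually.of_forall fun y => by
    rw [Real.smoothTransition.one_of_one_le hx]; exact Real.smoothTransition.le_one y)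

/-- A smooth function, equal to `1` for `|z - σ| ≤ R` and to `0` for `|z - σ|² ≥ 2 R²`. -/
def radialCutoff (σ : ℂ) (R : ℝ) (z : ℂ) : ℂ :=
  (Real.smoothTransition (2 - ‖z - σ‖ ^ 2 / R ^ 2) : ℝ)

/-- The density of `∂χ/∂z̄ / z` for the radial cutoff `χ` of radius `1`. -/
def radialDensity (w : ℂ) : ℂ := (-deriv Real.smoothTransition (2 - ‖w‖ ^ 2) : ℝ)

theorem continuous_radialDensity : Continuous radialDensity :=
  Complex.continuous_ofReal.comp (continuous_deriv_smoothTransition.comp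
    (continuous_const.sub (continuous_norm.pow 2))).neg

theorem radialDensity_eq_zero_of_le {w : ℂ} (h : ‖w‖ ≤ 1) : radialDensity w = 0 := by
  have : 1 ≤ 2 - ‖w‖ ^ 2 := by nlinarith [norm_nonneg w]
  simp [radialDensity, deriv_smoothTransition_of_one_le this]

theorem radialDensity_eq_zero_of_ge {w : ℂ} (h : 2 ≤ ‖w‖) : radialDensity w = 0 := by
  have : 2 - ‖w‖ ^ 2 ≤ 0 := by nlinarith [norm_nonneg w]
  simp [radialDensity, deriv_smoothTransition_of_nonpos this]

theorem hasCompactSupport_radialDensity : HasCompactSupport radialDensity :=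
  HasCompactSupport.intro (isCompact_closedBall 0 2) fun w hw =>
    radialDensity_eq_zero_of_ge (by simpa using (not_le.1 fun h => hw (by simpa using h)).le)

/-- With g the transition function, polar coordinates give 2π ∫ y (-g'(2 - y²)) dy over y > 0. The
integrand is the derivative of g(2 - y²)/2, which falls from 1/2 to 0. -/
theorem integral_radialDensity : ∫ w, radialDensity w = -Real.pi := by
  have h := integral_fun_norm_addHaar (E := ℂ) (F := ℝ) volume
    fun y => -deriv Real.smoothTransition (2 - y ^ 2)
  have hd : ∀ y ∈ Ici (0 : ℝ), HasDerivAt (fun y : ℝ => Real.smoothTransition (2 - y ^ 2) / 2)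
      (y * -deriv Real.smoothTransition (2 - y ^ 2)) y := fun y _ => by
    have h1 : HasDerivAt (fun y : ℝ => 2 - y ^ 2) (-(2 * y)) y := by
      simpa using ((hasDerivAt_id y).pow 2).const_sub 2
    have h2 := (((Real.smoothTransition.contDiff (n := 1)).differentiable (by simp)
      (2 - y ^ 2)).hasDerivAt.comp y h1).div_const 2
    refine h2.congr_deriv ?_
    ring
  have hcont : Continuous fun y : ℝ => y * -deriv Real.smoothTransition (2 - y ^ 2) :=
    continuous_id.mul (continuous_deriv_smoothTransition.comp (by fun_prop)).neg
  have hsupp : HasCompactSupport fun y : ℝ => y * -deriv Real.smoothTransition (2 - y ^ 2) :=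
    HasCompactSupport.intro (isCompact_closedBall 0 2) fun y hy => by
      have hy' : 2 < |y| := by simpa using hy
      have : 2 - y ^ 2 ≤ 0 := by nlinarith [sq_abs y, abs_nonneg y]
      simp [deriv_smoothTransition_of_nonpos this]
  have hlim : Tendsto (fun y : ℝ => Real.smoothTransition (2 - y ^ 2) / 2) atTop (𝓝 0) := by
    refine tendsto_const_nhds.congr' ?_
    filter_upwards [eventually_ge_atTop 2] with y hy
    rw [Real.smoothTransition.zero_of_nonpos (by nlinarith), zero_div]
  have hI := integral_Ioi_of_hasDerivAt_of_tendsto' hd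
    ((hcont.integrable_of_hasCompactSupport hsupp).integrableOn) hlim
  have hvol : volume.real (Metric.ball (0 : ℂ) 1) = Real.pi := by
    simp [Measure.real, Complex.volume_ball]
  simp only [Complex.finrank_real_complex, smul_eq_mul, hvol, pow_one, Nat.add_one_sub_one, hI] at h
  simp only [radialDensity]
  rw [integral_complex_ofReal, h]
  have : Real.smoothTransition (2 - 0 ^ 2) = 1 := Real.smoothTransition.one_of_one_le (by norm_num)
  rw [this]
  simp
  ring

theorem contDiff_radialCutoff (σ : ℂ) (R : ℝ) : ContDiff ℝ 1 (radialCutoff σ R) := by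
  refine Complex.ofRealCLM.contDiff.comp (Real.smoothTransition.contDiff.comp
    (contDiff_const.sub (ContDiff.div_const ?_ _)))
  exact (contDiff_id.sub contDiff_const).norm_sq ℝ

/-- The derivative of |z|² in z̄ is z. In the rescaled coordinate w the result depends on R only
through the factor 1/R, which makes limits in R tractable. -/
theorem dbar_radialCutoff (σ : ℂ) {R : ℝ} (hR : R ≠ 0) (w : ℂ) :
    dbar (radialCutoff σ R) (σ + R * w) = (R : ℂ)⁻¹ * (w * radialDensity w) := by
  have h1 : HasFDerivAt (fun z : ℂ => ‖z - σ‖ ^ 2) (2 • (innerSL ℝ (R * w : ℂ))) (σ + R * w) := by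
    have := ((hasFDerivAt_id (𝕜 := ℝ) (σ + R * w)).sub_const σ).norm_sq
    simpa using this
  have h2 : HasFDerivAt (fun z : ℂ => 2 - ‖z - σ‖ ^ 2 / R ^ 2)
      (-((R ^ 2)⁻¹ • (2 • (innerSL ℝ (R * w : ℂ))))) (σ + R * w) := by
    simpa [div_eq_mul_inv] using (h1.mul_const ((R ^ 2)⁻¹)).const_sub 2
  have h3 := ((Real.smoothTransition.contDiff (n := 1)).differentiable (by simp)
    (2 - ‖(σ + R * w) - σ‖ ^ 2 / R ^ 2)).hasDerivAt.comp_hasFDerivAt (σ + R * w) h2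
  have h4 := Complex.ofRealCLM.hasFDerivAt.comp (σ + R * w) h3
  have h5 : 2 - ‖(σ + R * w) - σ‖ ^ 2 / R ^ 2 = 2 - ‖w‖ ^ 2 := by
    rw [add_sub_cancel_left, norm_mul, Complex.norm_real, mul_pow, Real.norm_eq_abs, sq_abs]
    field_simp
  rw [dbar_eq_of_hasFDerivAt (φ := radialCutoff σ R) h4, h5]
  have hw : w = w.re + w.im * Complex.I := (Complex.re_add_im w).symm
  simp only [radialDensity, ContinuousLinearMap.comp_apply, smul_apply,
    neg_apply, innerSL_apply_apply, Complex.ofRealCLM_apply, smul_eq_mul,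
    Complex.inner]
  simp only [nsmul_eq_mul, map_mul, Complex.conj_ofReal, Complex.mul_re, Complex.mul_im, Complex.ofReal_re,
    Complex.ofReal_im, Complex.conj_re, Complex.conj_im, Complex.one_re, Complex.one_im,
    Complex.I_re, Complex.I_im]
  generalize deriv Real.smoothTransition (2 - ‖w‖ ^ 2) = D
  conv_rhs => rw [hw]
  have hR' : (R : ℂ) ≠ 0 := by exact_mod_cast hR
  push_cast
  field_simp
  simp only [mul_zero, add_zero]
  ring

theorem radialCutoff_eq_one {σ : ℂ} {R : ℝ} (hR : 0 < R) {z : ℂ} (h : ‖z - σ‖ ≤ R) :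
    radialCutoff σ R z = 1 := by
  have : ‖z - σ‖ ^ 2 / R ^ 2 ≤ 1 := by
    rw [div_le_one (by positivity)]
    exact pow_le_pow_left₀ (norm_nonneg _) h 2
  rw [radialCutoff, Real.smoothTransition.one_of_one_le (by linarith), Complex.ofReal_one]

theorem radialCutoff_eq_zero {σ : ℂ} {R : ℝ} (hR : 0 < R) {z : ℂ} (h : 2 * R ≤ ‖z - σ‖) :
    radialCutoff σ R z = 0 := by
  have : 2 ≤ ‖z - σ‖ ^ 2 / R ^ 2 := by
    rw [le_div_iff₀ (by positivity)]
    nlinarith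
  rw [radialCutoff, Real.smoothTransition.zero_of_nonpos (by linarith), Complex.ofReal_zero]

theorem norm_radialCutoff_le (σ : ℂ) (R : ℝ) (z : ℂ) : ‖radialCutoff σ R z‖ ≤ 1 := by
  rw [radialCutoff, Complex.norm_real, Real.norm_eq_abs,
    abs_of_nonneg (Real.smoothTransition.nonneg _)]
  exact Real.smoothTransition.le_one _

theorem integral_dbar_radialCutoff_mul (ψ : ℂ → ℂ) (σ : ℂ) {R : ℝ} (hR : 0 < R) :
    ∫ z, dbar (radialCutoff σ R) z * ψ z =
      ∫ w : ℂ, (R * w) * ψ (σ + R * w) * radialDensity w := by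
  have h1 := integral_add_left_eq_self (μ := (volume : Measure ℂ))
    (fun z => dbar (radialCutoff σ R) z * ψ z) σ
  have h2 := Measure.integral_comp_smul (volume : Measure ℂ)
    (fun z => dbar (radialCutoff σ R) (σ + z) * ψ (σ + z)) R
  rw [h1] at h2
  simp only [Complex.finrank_real_complex, Complex.real_smul] at h2
  have h3 : ∫ z, dbar (radialCutoff σ R) z * ψ z = (R : ℂ) ^ 2 *
      ∫ x : ℂ, dbar (radialCutoff σ R) (σ + R * x) * ψ (σ + R * x) := by
    rw [h2, abs_of_pos (by positivity)]
    push_cast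
    have : (R : ℂ) ≠ 0 := by exact_mod_cast hR.ne'
    field_simp
  rw [h3, ← integral_const_mul]
  congr 1
  ext w
  rw [dbar_radialCutoff σ hR.ne']
  have : (R : ℂ) ≠ 0 := by exact_mod_cast hR.ne'
  field_simp

/-- After rescaling, the integral is taken against a fixed density of mass -π carried by the annulus
1 ≤ |w| ≤ 2, where the remaining factor tends uniformly to c. The filter is left free so that the
same statement serves R → 0 at a point and R → ∞. -/
theorem tendsto_integral_dbar_radialCutoff {ψ : ℂ → ℂ} (hψ : AEStronglyMeasurable ψ)
    {σ c : ℂ} {l : Filter ℝ} [l.IsCountablyGenerated] (hl : ∀ᶠ R in l, 0 < R)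
    (h : ∀ ε > 0, ∀ᶠ R in l, ∀ y : ℂ, R ≤ ‖y‖ → ‖y‖ ≤ 2 * R → ‖y * ψ (σ + y) - c‖ < ε) :
    Tendsto (fun R : ℝ => ∫ z, dbar (radialCutoff σ R) z * ψ z) l (𝓝 (-Real.pi * c)) := by
  have h0 : ∫ w : ℂ, c * radialDensity w = -Real.pi * c := by
    rw [integral_const_mul, integral_radialDensity, mul_comm]
  rw [← h0]
  have h1 : Tendsto (fun R : ℝ => ∫ w : ℂ, (R * w) * ψ (σ + R * w) * radialDensity w) l
      (𝓝 (∫ w, c * radialDensity w)) := by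
    have key : ∀ ε > 0, ∀ᶠ R : ℝ in l, ∀ w : ℂ,
        ‖(R * w) * ψ (σ + R * w) * radialDensity w - c * radialDensity w‖
          ≤ ε * ‖radialDensity w‖ := fun ε hε => by
      filter_upwards [h ε hε, hl] with R hR hR0 w
      rw [← sub_mul, norm_mul]
      by_cases hw1 : ‖w‖ ≤ 1
      · simp [radialDensity_eq_zero_of_le hw1]
      by_cases hw2 : 2 ≤ ‖w‖
      · simp [radialDensity_eq_zero_of_ge hw2]
      refine mul_le_mul_of_nonneg_right (hR _ ?_ ?_).le (norm_nonneg _)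
      · rw [norm_mul, Complex.norm_real, Real.norm_eq_abs, abs_of_pos hR0]
        nlinarith
      · rw [norm_mul, Complex.norm_real, Real.norm_eq_abs, abs_of_pos hR0]
        nlinarith
    have hint : Integrable radialDensity :=
      continuous_radialDensity.integrable_of_hasCompactSupport hasCompactSupport_radialDensity
    refine tendsto_integral_filter_of_dominated_convergence
      (fun w => (‖c‖ + 1) * ‖radialDensity w‖) ?_ ?_ (hint.norm.const_mul _) ?_
    · filter_upwards [hl] with R hR
      have hR' : (R : ℂ) ≠ 0 := by exact_mod_cast hR.ne'
      have hq : Measure.QuasiMeasurePreserving (fun w : ℂ => σ + R * w) volume volume := by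
        refine ⟨by fun_prop, ?_⟩
        have e : (fun w : ℂ => σ + R * w) = (fun w => σ + w) ∘ fun w => R • w := by
          ext; simp
        rw [e, ← Measure.map_map (by fun_prop) (by fun_prop), Measure.map_addHaar_smul _ hR.ne',
          Measure.map_smul]
        refine (Measure.smul_absolutelyContinuous).trans ?_
        rw [map_add_left_eq_self]
      have h2 := hψ.comp_quasiMeasurePreserving hq
      have h3 : Continuous fun w : ℂ => (R : ℂ) * w := by fun_prop
      exact (h3.aestronglyMeasurable.mul h2).mul continuous_radialDensity.aestronglyMeasurable
    · filter_upwards [key 1 one_pos] with R hR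
      refine Eventually.of_forall fun w => ?_
      have h2 := norm_sub_norm_le ((R * w) * ψ (σ + R * w) * radialDensity w) (c * radialDensity w)
      rw [norm_mul c] at h2
      linarith [hR w]
    · refine Eventually.of_forall fun w => ?_
      rw [Metric.tendsto_nhds]
      intro ε hε
      have hpos : 0 < ε / (‖radialDensity w‖ + 1) := by positivity
      filter_upwards [key _ hpos] with R hR
      rw [dist_eq_norm]
      refine (hR w).trans_lt ?_
      rw [div_mul_eq_mul_div, div_lt_iff₀ (by positivity)]
      nlinarith [norm_nonneg (radialDensity w)]
  refine h1.congr' ?_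
  filter_upwards [hl] with R hR using (integral_dbar_radialCutoff_mul ψ σ hR).symm

/-! ### The residue theorem in the plane -/

/-- The residue theorem for the integral of `∂ψ/∂z̄` over the plane. -/
theorem integral_dbar_eq_of_residues {ι : Type*} [Fintype ι] {σ : ι → ℂ}
    (hσ : Function.Injective σ) {ψ : ℂ → ℂ} (hψ : ContDiffOn ℝ 1 ψ {z | ∀ k, z ≠ σ k})
    (hint : Integrable (dbar ψ)) {c : ι → ℂ} {d : ℂ}
    (hc : ∀ k, Tendsto (fun z => (z - σ k) * ψ z) (𝓝[≠] (σ k)) (𝓝 (c k)))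
    (hd : Tendsto (fun z => z * ψ z) (cocompact ℂ) (𝓝 d)) :
    ∫ z, dbar ψ z = Real.pi * (d - ∑ k, c k) := by
  classical
  set U : Set ℂ := {z | ∀ k, z ≠ σ k} with hUdef
  have hUc : U = (range σ)ᶜ := by
    ext z; simp [hUdef, eq_comm]
  have hU : IsOpen U := by
    rw [hUc]; exact (finite_range σ).isClosed.isOpen_compl
  have hae : ∀ᵐ z : ℂ, z ∈ U := by
    rw [hUc]
    exact (finite_range σ).countable.ae_notMem volume
  have hψm : AEStronglyMeasurable ψ := by
    have h1 := hψ.continuousOn.aestronglyMeasurable (μ := volume) hU.measurableSet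
    rwa [Measure.restrict_eq_self_of_ae_mem hae] at h1
  -- For small ε this vanishes near every σ_k and far out, and it tends to 1 elsewhere. Integrating
  -- by parts against it moves ∂/∂z̄ onto the radial cutoffs, whose contributions are the residues
  -- at the points and at infinity.
  let cut : ℝ → ℂ → ℂ := fun ε z =>
    radialCutoff 0 ε⁻¹ z - ∑ k, radialCutoff (σ k) ε z
  have hcutd : ∀ ε, ContDiff ℝ 1 (cut ε) := fun ε =>
    (contDiff_radialCutoff _ _).sub (ContDiff.sum fun k _ => contDiff_radialCutoff _ _)
  -- the contribution of the points
  have hk : ∀ k, Tendsto (fun R : ℝ => ∫ z, dbar (radialCutoff (σ k) R) z * ψ z) (𝓝[>] 0)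
      (𝓝 (-Real.pi * c k)) := fun k =>
    tendsto_integral_dbar_radialCutoff hψm self_mem_nhdsWithin fun ε hε => by
      obtain ⟨r, hr, hr'⟩ := Metric.mem_nhdsWithin_iff.1 ((Metric.tendsto_nhds.1 (hc k)) ε hε)
      filter_upwards [Ioo_mem_nhdsGT (half_pos hr)] with R hR y hy1 hy2
      have hy0 : y ≠ 0 := norm_pos_iff.1 (hR.1.trans_le hy1)
      have := hr' (show σ k + y ∈ Metric.ball (σ k) r ∩ {σ k}ᶜ from
        ⟨by simp only [Metric.mem_ball, dist_eq_norm, add_sub_cancel_left]; linarith [hR.2], by simpa using hy0⟩)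
      simpa [dist_eq_norm] using this
  have hinf : Tendsto (fun R : ℝ => ∫ z, dbar (radialCutoff 0 R) z * ψ z) atTop
      (𝓝 (-Real.pi * d)) :=
    tendsto_integral_dbar_radialCutoff hψm (eventually_gt_atTop 0) fun ε hε => by
      have h1 := (Metric.tendsto_nhds.1 hd) ε hε
      rw [← Metric.cobounded_eq_cocompact, ← comap_norm_atTop, eventually_comap] at h1
      obtain ⟨R₀, hR₀⟩ := eventually_atTop.1 h1
      filter_upwards [eventually_ge_atTop R₀] with R hR y hy1 _
      simpa [dist_eq_norm] using hR₀ ‖y‖ (hR.trans hy1) y rfl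
  have hinf' := hinf.comp tendsto_inv_nhdsGT_zero
  have hlim1 := (tendsto_finsetSum Finset.univ fun k _ => hk k).sub hinf'
  -- for small radii the cutoff function is supported away from the points
  have hsep : ∀ᶠ ε : ℝ in 𝓝[>] 0, ∀ k, ε * (‖σ k‖ + 1) < 1 ∧ ∀ j, j ≠ k → 3 * ε < ‖σ k - σ j‖ := by
    rw [eventually_all]
    refine fun k => Eventually.and ?_ ?_
    · have h1 : Tendsto (fun ε : ℝ => ε * (‖σ k‖ + 1)) (𝓝[>] 0) (𝓝 0) := by
        have : Continuous fun ε : ℝ => ε * (‖σ k‖ + 1) := by fun_prop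
        simpa using (this.tendsto 0).mono_left nhdsWithin_le_nhds
      exact h1.eventually_lt_const one_pos
    · rw [eventually_all]
      intro j
      by_cases hj : j = k
      · simp [hj]
      · have h1 : Tendsto (fun ε : ℝ => 3 * ε) (𝓝[>] 0) (𝓝 0) := by
          have : Continuous fun ε : ℝ => 3 * ε := by fun_prop
          simpa using (this.tendsto 0).mono_left nhdsWithin_le_nhds
        filter_upwards [h1.eventually_lt_const
          (norm_pos_iff.2 (sub_ne_zero.2 fun h => hj (hσ h).symm))] with ε hε _ using hε
  have hone : ∀ᶠ ε : ℝ in 𝓝[>] 0, ε < 1 :=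
    nhdsWithin_le_nhds (eventually_lt_nhds one_pos)
  have hcutU : ∀ᶠ ε : ℝ in 𝓝[>] 0, HasCompactSupport (cut ε) ∧ tsupport (cut ε) ⊆ U ∧
      ∀ k, Integrable fun z => dbar (radialCutoff (σ k) ε) z * ψ z := by
    filter_upwards [hsep, self_mem_nhdsWithin, hone] with ε hε hε0 hε1
    have hε0' : (0 : ℝ) < ε := hε0
    have hcomp : ∀ k z, (2 * ε⁻¹ + 2 + ‖σ k‖) ≤ ‖z‖ → radialCutoff (σ k) ε z = 0 := fun k z hz => by
      refine radialCutoff_eq_zero hε0' ?_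
      have := norm_sub_norm_le z (σ k)
      have h2 : 0 < ε⁻¹ := by positivity
      linarith
    refine ⟨?_, ?_, ?_⟩
    · refine HasCompactSupport.intro
        (isCompact_closedBall (0 : ℂ) (2 * ε⁻¹ + 2 + ∑ k, ‖σ k‖)) fun z hz => ?_
      have hz' : 2 * ε⁻¹ + 2 + ∑ k, ‖σ k‖ < ‖z‖ := by simpa using hz
      have h3 : 0 ≤ ∑ k, ‖σ k‖ := Finset.sum_nonneg fun k _ => norm_nonneg _
      simp only [cut]
      rw [radialCutoff_eq_zero (by positivity) (by rw [sub_zero]; linarith),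
        Finset.sum_eq_zero, sub_zero]
      intro k _
      refine hcomp k z ?_
      have := Finset.single_le_sum (f := fun k => ‖σ k‖) (fun k _ => norm_nonneg _) (Finset.mem_univ k)
      linarith
    · intro z hz k hzk
      subst hzk
      refine notMem_tsupport_iff_eventuallyEq.2 ?_ hz
      filter_upwards [Metric.ball_mem_nhds (σ k) hε0'] with z hz
      rw [Metric.mem_ball, dist_eq_norm] at hz
      have e1 : radialCutoff 0 ε⁻¹ z = 1 := by
        refine radialCutoff_eq_one (by positivity) ?_
        rw [sub_zero, ← one_div, le_div_iff₀ hε0']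
        have h4 : ‖z‖ ≤ ‖σ k‖ + 1 := by
          have := norm_sub_norm_le z (σ k)
          linarith
        nlinarith [(hε k).1]
      have e2 : ∑ j, radialCutoff (σ j) ε z = 1 := by
        rw [Finset.sum_eq_single k]
        · exact radialCutoff_eq_one hε0' hz.le
        · intro j _ hj
          refine radialCutoff_eq_zero hε0' ?_
          have h5 := (hε k).2 j hj
          have h6 : ‖σ k - σ j‖ ≤ ‖z - σ j‖ + ‖z - σ k‖ := by
            rw [← norm_neg (z - σ k)]
            refine le_trans (le_of_eq ?_) (norm_add_le _ _)
            congr 1; ring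
          linarith
        · simp
      simp [cut, e1, e2]
    · intro k
      have hK : IsCompact {z : ℂ | ε ≤ ‖z - σ k‖ ∧ ‖z - σ k‖ ≤ 2 * ε} := by
        have hcl : IsClosed {z : ℂ | ε ≤ ‖z - σ k‖ ∧ ‖z - σ k‖ ≤ 2 * ε} := by
          have hn : Continuous fun z => ‖z - σ k‖ := by fun_prop
          exact (isClosed_le continuous_const hn).inter (isClosed_le hn continuous_const)
        refine (isCompact_closedBall (σ k) (2 * ε)).of_isClosed_subset hcl fun z hz => ?_
        simpa [dist_eq_norm] using hz.2
      have hKU : {z : ℂ | ε ≤ ‖z - σ k‖ ∧ ‖z - σ k‖ ≤ 2 * ε} ⊆ U := by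
        rintro z ⟨hz1, hz2⟩ j rfl
        by_cases hj : j = k
        · subst hj; simp at hz1; linarith
        · have := (hε k).2 j hj
          rw [norm_sub_rev] at this
          linarith
      have hχ := continuousOn_dbar isOpen_univ (contDiff_radialCutoff (σ k) ε).contDiffOn
      have h7 : IntegrableOn (fun z => dbar (radialCutoff (σ k) ε) z * ψ z)
          {z : ℂ | ε ≤ ‖z - σ k‖ ∧ ‖z - σ k‖ ≤ 2 * ε} :=
        ((hχ.mono (subset_univ _)).mul (hψ.continuousOn.mono hKU)).integrableOn_compact hK
      rwa [integrableOn_iff_integrable_of_support_subset] at h7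
      intro z hz
      by_contra hzn
      refine hz ?_
      have hε0c : (ε : ℂ) ≠ 0 := by exact_mod_cast hε0'.ne'
      have hzw : z = σ k + ε * ((z - σ k) / ε) := by field_simp; ring
      have hn : ‖(z - σ k) / ε‖ = ‖z - σ k‖ / ε := by
        rw [norm_div, Complex.norm_real, Real.norm_eq_abs, abs_of_pos hε0']
      have h8 : radialDensity ((z - σ k) / ε) = 0 := by
        rcases lt_or_ge ‖z - σ k‖ ε with h | h
        · exact radialDensity_eq_zero_of_le (by rw [hn, div_le_one hε0']; exact h.le)
        · have : 2 * ε < ‖z - σ k‖ := not_le.1 fun h' => hzn ⟨h, h'⟩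
          exact radialDensity_eq_zero_of_ge (by rw [hn, le_div_iff₀ hε0']; exact this.le)
      have h9 := dbar_radialCutoff (σ k) hε0'.ne' ((z - σ k) / ε)
      rw [← hzw, h8] at h9
      simp only [h9, mul_zero, zero_mul]
  have hdbarcut : ∀ ε z, dbar (cut ε) z =
      dbar (radialCutoff 0 ε⁻¹) z - ∑ k, dbar (radialCutoff (σ k) ε) z := fun ε z => by
    have hd := fun σ' R' => ((contDiff_radialCutoff σ' R').differentiable (by simp) z).hasFDerivAt
    have h := (hd 0 ε⁻¹).sub (HasFDerivAt.fun_sum (u := Finset.univ) fun k _ => hd (σ k) ε)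
    rw [dbar_eq_of_hasFDerivAt (φ := cut ε) h]
    simp only [dbar, sub_apply, sum_apply, ← Finset.sum_div]
    rw [Finset.sum_add_distrib, ← Finset.mul_sum]
    ring
  have hlim2 : Tendsto (fun ε : ℝ => ∫ z, cut ε z * dbar ψ z) (𝓝[>] 0)
      (𝓝 (∑ k, -Real.pi * c k - -Real.pi * d)) := by
    refine hlim1.congr' ?_
    filter_upwards [hcutU] with ε hε
    rw [integral_mul_dbar hU (hcutd ε) hε.1 hε.2.1 hψ]
    have i1 : Integrable fun z => dbar (cut ε) z * ψ z :=
      integrable_mul_of_hasCompactSupport (U := U)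
        (continuousOn_univ.1 (continuousOn_dbar isOpen_univ (hcutd ε).contDiffOn))
        (HasCompactSupport.intro hε.1 fun z hz => by
          have := (notMem_tsupport_iff_eventuallyEq.1 hz).fderiv_eq (𝕜 := ℝ)
          simp [dbar, this])
        (closure_minimal (fun z hz => by
          by_contra h0
          refine hz ?_
          have := (notMem_tsupport_iff_eventuallyEq.1 h0).fderiv_eq (𝕜 := ℝ)
          simp [dbar, this]) (isClosed_tsupport _) |>.trans hε.2.1) hψ.continuousOn
    have i2 : Integrable fun z => ∑ k, dbar (radialCutoff (σ k) ε) z * ψ z :=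
      integrable_finsetSum _ fun k _ => hε.2.2 k
    have e : (fun z => dbar (radialCutoff 0 ε⁻¹) z * ψ z) = fun z =>
        dbar (cut ε) z * ψ z + ∑ k, dbar (radialCutoff (σ k) ε) z * ψ z := by
      ext z
      rw [hdbarcut, ← Finset.sum_mul]
      ring
    simp only [Function.comp]
    rw [e, integral_add i1 i2, integral_finsetSum _ fun k _ => hε.2.2 k]
    ring
  -- Dominated convergence: the cutoffs are bounded by one plus the number of points, and at each
  -- point other than the σ_k they are eventually 1.
  have hlim3 : Tendsto (fun ε : ℝ => ∫ z, cut ε z * dbar ψ z) (𝓝[>] 0) (𝓝 (∫ z, dbar ψ z)) := by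
    refine tendsto_integral_filter_of_dominated_convergence
      (fun z => (1 + Fintype.card ι) * ‖dbar ψ z‖) ?_ ?_ (hint.norm.const_mul _) ?_
    · exact Eventually.of_forall fun ε =>
        (hcutd ε).continuous.aestronglyMeasurable.mul hint.aestronglyMeasurable
    · refine Eventually.of_forall fun ε => Eventually.of_forall fun z => ?_
      rw [norm_mul]
      refine mul_le_mul_of_nonneg_right ?_ (norm_nonneg _)
      refine (norm_sub_le _ _).trans (add_le_add (norm_radialCutoff_le _ _ _) ?_)
      refine (norm_sum_le_of_le _ fun k _ => norm_radialCutoff_le _ _ _).trans ?_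
      simp
    · filter_upwards [hae] with z hz
      refine tendsto_const_nhds.congr' ?_
      have h1 : ∀ᶠ ε : ℝ in 𝓝[>] 0, ∀ k, 2 * ε < ‖z - σ k‖ := by
        rw [eventually_all]
        intro k
        have h1 : Tendsto (fun ε : ℝ => 2 * ε) (𝓝[>] 0) (𝓝 0) := by
          have : Continuous fun ε : ℝ => 2 * ε := by fun_prop
          simpa using (this.tendsto 0).mono_left nhdsWithin_le_nhds
        exact h1.eventually_lt_const (norm_pos_iff.2 (sub_ne_zero.2 (hz k)))
      filter_upwards [h1, self_mem_nhdsWithin, tendsto_inv_nhdsGT_zero.eventually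
        (eventually_ge_atTop ‖z‖)] with ε hε hε0 hε2
      have hε0' : (0 : ℝ) < ε := hε0
      simp only [cut]
      rw [radialCutoff_eq_one (by positivity) (by simpa using hε2), Finset.sum_eq_zero, sub_zero,
        one_mul]
      exact fun k _ => radialCutoff_eq_zero hε0' (hε k).le
  rw [tendsto_nhds_unique hlim3 hlim2, ← Finset.mul_sum]
  ring

/-! ### Branches of logarithms and twisted simplices -/

theorem eq_of_exp_eq_one {w : ℂ} (h : Complex.exp w = 1) (hw : ‖w‖ < 2 * Real.pi) : w = 0 := by
  obtain ⟨m, hm⟩ := Complex.exp_eq_one_iff.1 h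
  have hpi := Real.pi_pos
  have h1 : ‖w‖ = |(m : ℝ)| * (2 * Real.pi) := by
    rw [hm, norm_mul, norm_mul, norm_mul, Complex.norm_I, Complex.norm_real, Complex.norm_intCast]
    simp [abs_of_pos hpi]
  have h2 : |(m : ℝ)| < 1 := by
    by_contra h3
    nlinarith [not_lt.1 h3]
  have h3 : m = 0 := by
    rw [← Int.abs_lt_one_iff]
    exact_mod_cast h2
  simp [hm, h3]

/-- Two continuous logarithms on a connected space differ by a constant. -/
theorem sub_eq_sub_of_exp_eq {D : Type*} [TopologicalSpace D] [PreconnectedSpace D] {l l' : D → ℂ}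
    (hl : Continuous l) (hl' : Continuous l') (h : ∀ x, Complex.exp (l x) = Complex.exp (l' x))
    (x y : D) : l x - l' x = l y - l' y := by
  have hc : IsLocallyConstant fun x => l x - l' x := by
    rw [IsLocallyConstant.iff_eventually_eq]
    intro x
    have hcont : Continuous fun y => l y - l' y := hl.sub hl'
    have h2 : ∀ᶠ y in 𝓝 x, ‖(l y - l' y) - (l x - l' x)‖ < 2 * Real.pi := by
      have := (hcont.tendsto x).eventually (Metric.ball_mem_nhds _ Real.two_pi_pos)
      simpa [dist_eq_norm] using this
    filter_upwards [h2] with y hy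
    refine sub_eq_zero.1 (eq_of_exp_eq_one ?_ hy)
    rw [Complex.exp_sub, Complex.exp_sub, Complex.exp_sub, h, h]
    simp
  exact hc.apply_eq_of_preconnectedSpace x y

namespace PointConfig

variable {n : ℕ} {S : PointConfig n} {s : Fin (n + 1) → ℝ} {m : ℕ}

instance instPreconnectedSpaceSimplex (m : ℕ) : PreconnectedSpace (Simplex m) :=
  Subtype.preconnectedSpace (convex_stdSimplex ℝ (Fin (m + 1))).isPreconnected

theorem factor_ne_zero {k : Fin (n + 1)} {z : ℂ} (hz : z ∈ S.compl) : S.factor k z ≠ 0 := by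
  rw [factor_eq]
  exact mul_ne_zero (S.factorDeriv_ne_zero k) (sub_ne_zero.2 (hz k))

/-- The point `(1 - r, r)` of the standard `1`-simplex, depending on `q`. -/
theorem simplexOne_eq {q : Fin 2 → ℝ} (hq : q ∈ stdSimplex ℝ (Fin 2)) : q = ![1 - q 1, q 1] := by
  have h := hq.2
  rw [Fin.sum_univ_two] at h
  ext j
  fin_cases j
  · simp; linarith
  · simp

theorem segmentPoint_mem_iff {r : ℝ} : (![1 - r, r] : Fin 2 → ℝ) ∈ stdSimplex ℝ (Fin 2) ↔
    r ∈ Icc (0 : ℝ) 1 := by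
  constructor
  · intro h
    have h0 := h.1 0
    have h1 := h.1 1
    simp at h0 h1
    exact ⟨h1, h0⟩
  · exact fun h => segmentPoint_mem h

theorem faceMap_coe_one (i : Fin 3) (q : Simplex 1) : (faceMap i q).1 =
    (![![0, q.1 0, q.1 1], ![q.1 0, 0, q.1 1], ![q.1 0, q.1 1, 0]] : Fin 3 → Fin 3 → ℝ) i := by
  change FunOnFinite.linearMap ℝ ℝ i.succAbove q.1 = _
  ext j
  rw [FunOnFinite.linearMap_apply_apply, Finset.sum_filter, Fin.sum_univ_two]
  fin_cases i <;> fin_cases j <;> simp [Fin.succAbove, Fin.lt_def]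

theorem faceMap_zero_default : faceMap 0 (default : Simplex 0) = stdSimplex.vertex (S := ℝ) (1 : Fin 2) := by
  have : (default : Simplex 0) = stdSimplex.vertex 0 := Subsingleton.elim _ _
  rw [this, faceMap, stdSimplex.map_vertex]
  rfl

theorem faceMap_one_default : faceMap 1 (default : Simplex 0) = stdSimplex.vertex (S := ℝ) (0 : Fin 2) := by
  have : (default : Simplex 0) = stdSimplex.vertex 0 := Subsingleton.elim _ _
  rw [this, faceMap, stdSimplex.map_vertex]
  rfl

theorem TwistedSimplex.ext_of {T T' : S.TwistedSimplex s m} (h1 : ∀ p, T.map p = T'.map p)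
    (h2 : ∀ p, T.sec p = T'.sec p) : T = T' := by
  have h1' := funext h1
  have h2' := funext h2
  cases T
  cases T'
  simp only at h1' h2'
  subst h1' h2'
  rfl

/-- Reparametrisation of a twisted simplex. -/
def TwistedSimplex.comp (T : S.TwistedSimplex s m) {m' : ℕ}
    (A : (Fin (m' + 1) → ℝ) → (Fin (m + 1) → ℝ)) (hA : ContDiff ℝ ∞ A)
    (hm : MapsTo A (stdSimplex ℝ (Fin (m' + 1))) (stdSimplex ℝ (Fin (m + 1)))) :
    S.TwistedSimplex s m' where
  map p := T.map ⟨A p.1, hm p.2⟩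
  smooth := by
    obtain ⟨U, g, hU, hsub, hg, h⟩ := T.smooth
    exact ⟨A ⁻¹' U, g ∘ A, hU.preimage hA.continuous, fun p hp => hsub (hm hp),
      hg.comp hA.contDiffOn fun _ h => h, fun p => h _⟩
  mem p := T.mem _
  sec p := T.sec ⟨A p.1, hm p.2⟩
  flat := by
    obtain ⟨c, l, h1, h2, h3⟩ := T.flat
    exact ⟨c, fun k p => l k ⟨A p.1, hm p.2⟩, fun k => (h1 k).comp
      ((hA.continuous.comp continuous_subtype_val).subtype_mk _), fun k p => h2 k _, fun p => h3 _⟩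

variable (S) in
/-- Continuous branches on `W` of the logarithms of `z` and of `1 - z σ_k⁻¹`. -/
structure LogSystem (W : Set ℂ) where
  log : Fin (n + 1) → ℂ → ℂ
  continuousOn_log : ∀ k, ContinuousOn (log k) W
  exp_log : ∀ k, ∀ z ∈ W, Complex.exp (log k z) = S.factor k z

namespace LogSystem

variable {W : Set ℂ} (l : S.LogSystem W)

/-- The branch of `z^{s₀} ∏ (1 - z σ_k⁻¹)^{s_k}` defined by a system of logarithms. -/
def sec (s : Fin (n + 1) → ℝ) (z : ℂ) : ℂ := Complex.exp (∑ k, (s k : ℂ) * l.log k z)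

theorem sec_ne_zero (z : ℂ) : l.sec s z ≠ 0 := Complex.exp_ne_zero _

include l in
theorem subset_compl : W ⊆ S.compl := by
  rintro z hz k rfl
  have h := l.exp_log k _ hz
  rw [factor_eq, sub_self, mul_zero] at h
  exact Complex.exp_ne_zero _ h

/-- Restriction of a system of logarithms. -/
def mono {W' : Set ℂ} (h : W' ⊆ W) : S.LogSystem W' where
  log := l.log
  continuousOn_log k := (l.continuousOn_log k).mono h
  exp_log k z hz := l.exp_log k z (h hz)

variable (S) in
/-- A system of logarithms given by logarithms of `z - σ_k`. -/
def ofSub (L : Fin (n + 1) → ℂ → ℂ) (hL : ∀ k, ContinuousOn (L k) W)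
    (h : ∀ k, ∀ z ∈ W, Complex.exp (L k z) = z - S.pt k) : S.LogSystem W where
  log k z := L k z + Complex.log (S.factorDeriv k)
  continuousOn_log k := (hL k).add continuousOn_const
  exp_log k z hz := by
    rw [Complex.exp_add, h k z hz, Complex.exp_log (S.factorDeriv_ne_zero k), factor_eq, mul_comm]

/-- Along a simplex, which is connected, any logarithms differ by constants from those of the
system. So every section is a scalar multiple of the branch, and cochains on W can be treated as if
the coefficients were trivial. -/
theorem exists_sec_eq (T : S.TwistedSimplex s m) (hT : ∀ p, T.map p ∈ W)
    (hc : Continuous T.map) : ∃ c, ∀ p, T.sec p = c * l.sec s (T.map p) := by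
  obtain ⟨c, l', h1, h2, h3⟩ := T.flat
  obtain ⟨p₀⟩ : Nonempty (Simplex m) := inferInstance
  refine ⟨c * Complex.exp (∑ k, (s k : ℂ) * (l' k p₀ - l.log k (T.map p₀))), fun p => ?_⟩
  rw [h3, sec, mul_assoc, ← Complex.exp_add, ← Finset.sum_add_distrib]
  congr 2
  refine Finset.sum_congr rfl fun k _ => ?_
  have := sub_eq_sub_of_exp_eq (h1 k) ((l.continuousOn_log k).comp_continuous hc hT)
    (fun x => by rw [h2, Function.comp, l.exp_log k _ (hT x)]) p p₀
  simp only [Function.comp] at this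
  linear_combination (s k : ℂ) * this

end LogSystem

theorem TwistedSimplex.continuous_map (T : S.TwistedSimplex s m) : Continuous T.map := by
  obtain ⟨U, g, hU, hsub, hg, h⟩ := T.smooth
  rw [funext h]
  exact (hg.continuousOn.mono hsub).comp_continuous continuous_subtype_val fun p => p.2

/-- Smoothness in a neighbourhood of the standard simplex. -/
def SmoothNearSimplex (m : ℕ) (g : (Fin (m + 1) → ℝ) → ℂ) : Prop :=
  ∃ U : Set (Fin (m + 1) → ℝ), IsOpen U ∧ stdSimplex ℝ (Fin (m + 1)) ⊆ U ∧ ContDiffOn ℝ ∞ g U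

theorem SmoothNearSimplex.of_contDiff {g : (Fin (m + 1) → ℝ) → ℂ} (h : ContDiff ℝ ∞ g) :
    SmoothNearSimplex m g := ⟨univ, isOpen_univ, subset_univ _, h.contDiffOn⟩

/-- The twisted simplex defined by a map to a set with a system of logarithms. -/
def LogSystem.simplex {W : Set ℂ} (l : S.LogSystem W) (s : Fin (n + 1) → ℝ)
    (g : (Fin (m + 1) → ℝ) → ℂ) (hg : SmoothNearSimplex m g)
    (hW : ∀ p ∈ stdSimplex ℝ (Fin (m + 1)), g p ∈ W) : S.TwistedSimplex s m where
  map p := g p.1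
  smooth := by
    obtain ⟨U, hU, hsub, h⟩ := hg
    exact ⟨U, g, hU, hsub, h, fun _ => rfl⟩
  mem p := l.subset_compl (hW _ p.2)
  sec p := l.sec s (g p.1)
  flat := by
    obtain ⟨U, hU, hsub, h⟩ := hg
    refine ⟨1, fun k p => l.log k (g p.1), fun k => ?_, fun k p => l.exp_log k _ (hW _ p.2),
      fun p => by rw [one_mul]; rfl⟩
    exact (l.continuousOn_log k).comp_continuous ((h.continuousOn.mono hsub).comp_continuous
      continuous_subtype_val fun p => p.2) fun p => hW _ p.2

theorem cocycle_face_eq {φ : S.Cochain s 1} (hφ : φ ∈ S.Cocycle s) (T : S.TwistedSimplex s 2) :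
    φ (T.face 0) - φ (T.face 1) + φ (T.face 2) = 0 := by
  rw [LinearMap.mem_ker] at hφ
  have h : ∑ i : Fin 3, (-1 : ℂ) ^ (i : ℕ) * φ.1 (T.face i) = 0 :=
    congrArg (fun ψ : S.Cochain s 2 => ψ T) hφ
  rw [Fin.sum_univ_three] at h
  simp only [Fin.coe_ofNat_eq_mod] at h
  norm_num at h
  linear_combination h

/-! ### Primitives of cochains -/

/-- The `0`-cochain given by a function `F`, evaluated on the boundary of a `1`-simplex. -/
def bdry (F : ℂ → ℂ) (T : S.TwistedSimplex s 1) : ℂ :=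
  T.sec (stdSimplex.vertex 1) * F (T.map (stdSimplex.vertex 1)) -
    T.sec (stdSimplex.vertex 0) * F (T.map (stdSimplex.vertex 0))

/-- `F` is a primitive of the cochain `φ` on `W`. -/
def IsPrimitiveOn (φ : S.Cochain s 1) (F : ℂ → ℂ) (W : Set ℂ) : Prop :=
  ∀ T : S.TwistedSimplex s 1, (∀ p, T.map p ∈ W) → φ T = bdry F T

variable (S s) in
/-- The `0`-cochain given by a function. -/
def zeroCochain (F : ℂ → ℂ) : S.Cochain s 0 :=
  ⟨fun T => T.sec default * F (T.map default), fun c T => by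
    simp only [TwistedSimplex.smul, mul_assoc]⟩

theorem coboundary_zero_apply (ψ : S.Cochain s 0) (T : S.TwistedSimplex s 1) :
    S.coboundary s 0 ψ T = ψ (T.face 0) - ψ (T.face 1) := by
  change ∑ i : Fin 2, (-1 : ℂ) ^ (i : ℕ) * ψ (T.face i) = _
  rw [Fin.sum_univ_two]
  simp
  ring

theorem coboundary_zeroCochain (F : ℂ → ℂ) (T : S.TwistedSimplex s 1) :
    S.coboundary s 0 (S.zeroCochain s F) T = bdry F T := by
  rw [coboundary_zero_apply, bdry, ← faceMap_zero_default, ← faceMap_one_default]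
  rfl

/-- By homogeneity a 0-cochain is determined by its value on each point of ℂ \ Σ with section 1, and
any nonzero number is the value of a section there. -/
theorem exists_eq_zeroCochain (ψ : S.Cochain s 0) : ∃ F, ψ = S.zeroCochain s F := by
  classical
  let P : ∀ z ∈ S.compl, S.TwistedSimplex s 0 := fun z hz =>
    { map := fun _ => z
      smooth := ⟨univ, fun _ => z, isOpen_univ, subset_univ _, contDiffOn_const, fun _ => rfl⟩
      mem := fun _ => hz
      sec := fun _ => 1
      flat := by
        refine ⟨Complex.exp (-∑ k, (s k : ℂ) * Complex.log (S.factor k z)),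
          fun k _ => Complex.log (S.factor k z), fun k => continuous_const,
          fun k _ => Complex.exp_log (factor_ne_zero hz), fun _ => ?_⟩
        rw [← Complex.exp_add, neg_add_cancel, Complex.exp_zero] }
  refine ⟨fun z => if hz : z ∈ S.compl then ψ (P z hz) else 0, Cochain.ext fun T => ?_⟩
  have hT : T = (P (T.map default) (T.mem _)).smul (T.sec default) :=
    TwistedSimplex.ext_of (fun p => by rw [Subsingleton.elim p default]; rfl)
      (fun p => by rw [Subsingleton.elim p default]; exact (mul_one _).symm)
  change _ = T.sec default * (if hz : T.map default ∈ S.compl then ψ (P (T.map default) hz) else 0)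
  rw [dif_pos (T.mem _), ← ψ.2, ← hT]

/-- Since 0-cochains are functions on ℂ \ Σ, exactness becomes a question about the existence of a
function, to which complex analysis applies. -/
theorem mem_range_coboundary_iff {φ : S.Cochain s 1} :
    φ ∈ LinearMap.range (S.coboundary s 0) ↔ ∃ F, IsPrimitiveOn φ F S.compl := by
  constructor
  · rintro ⟨ψ, rfl⟩
    obtain ⟨F, rfl⟩ := exists_eq_zeroCochain ψ
    exact ⟨F, fun T _ => coboundary_zeroCochain F T⟩
  · rintro ⟨F, hF⟩
    exact ⟨S.zeroCochain s F, Cochain.ext fun T => by rw [coboundary_zeroCochain, hF T T.mem]⟩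

theorem IsPrimitiveOn.mono {φ : S.Cochain s 1} {F : ℂ → ℂ} {W W' : Set ℂ}
    (h : IsPrimitiveOn φ F W) (hW : W' ⊆ W) : IsPrimitiveOn φ F W' :=
  fun T hT => h T fun p => hW (hT p)

theorem IsPrimitiveOn.congr {φ : S.Cochain s 1} {F F' : ℂ → ℂ} {W : Set ℂ}
    (h : IsPrimitiveOn φ F W) (hF : ∀ z ∈ W, F' z = F z) : IsPrimitiveOn φ F' W := fun T hT => by
  rw [h T hT, bdry, bdry, hF _ (hT _), hF _ (hT _)]

/-- The function 1 / sec is a flat section of 𝓛_s on W: its product with any section of the dual is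
constant, so its boundary vanishes. This is the freedom in the choice of a primitive. -/
theorem IsPrimitiveOn.add_const_div {φ : S.Cochain s 1} {F : ℂ → ℂ} {W : Set ℂ}
    (h : IsPrimitiveOn φ F W) (l : S.LogSystem W) (a : ℂ) :
    IsPrimitiveOn φ (fun z => F z + a / l.sec s z) W := fun T hT => by
  obtain ⟨c, hc⟩ := l.exists_sec_eq T hT T.continuous_map
  rw [h T hT, bdry, bdry, hc, hc]
  have h1 := l.sec_ne_zero (s := s) (T.map (stdSimplex.vertex 1))
  have h0 := l.sec_ne_zero (s := s) (T.map (stdSimplex.vertex 0))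
  field_simp
  ring

/-- The straight segment. -/
def LogSystem.segment {W : Set ℂ} (l : S.LogSystem W) (s : Fin (n + 1) → ℝ) {p z : ℂ}
    (hW : StarConvex ℝ p W) (hz : z ∈ W) : S.TwistedSimplex s 1 :=
  l.simplex s (fun q => p + (q 1 : ℂ) * (z - p))
    (.of_contDiff (by
      have : ContDiff ℝ ∞ fun q : Fin 2 → ℝ => (q 1 : ℂ) :=
        Complex.ofRealCLM.contDiff.comp (contDiff_apply ℝ ℝ (1 : Fin 2))
      exact contDiff_const.add (this.mul contDiff_const)))
    (fun q hq => by
      have h := hq.2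
      rw [Fin.sum_univ_two] at h
      have := hW hz (hq.1 0) (hq.1 1) h
      convert this using 1
      rw [Complex.real_smul, Complex.real_smul, show q 0 = 1 - q 1 by linarith]
      push_cast
      ring)

theorem bdry_segment {W : Set ℂ} (l : S.LogSystem W) {p z : ℂ}
    (hW : StarConvex ℝ p W) (hz : z ∈ W) (F : ℂ → ℂ) :
    bdry F (l.segment s hW hz) = l.sec s z * F z - l.sec s p * F p := by
  simp [bdry, LogSystem.segment, LogSystem.simplex]

/-- Both primitives compute the value of φ on the segment from p to z. Hence their difference is a
multiple of the flat section 1 / sec. -/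
theorem IsPrimitiveOn.sub_eq_sub {φ : S.Cochain s 1} {F F' : ℂ → ℂ} {W : Set ℂ}
    (h : IsPrimitiveOn φ F W) (h' : IsPrimitiveOn φ F' W) (l : S.LogSystem W) {p z : ℂ}
    (hW : StarConvex ℝ p W) (hz : z ∈ W) :
    l.sec s z * (F z - F' z) = l.sec s p * (F p - F' p) := by
  have hT : ∀ q, (l.segment s hW hz).map q ∈ W := fun q => by
    have h2 := q.2.2
    rw [Fin.sum_univ_two] at h2
    have := hW hz (q.2.1 0) (q.2.1 1) h2
    convert this using 1
    change p + ((q.1 1 : ℝ) : ℂ) * (z - p) = _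
    rw [Complex.real_smul, Complex.real_smul, show q.1 0 = 1 - q.1 1 by linarith]
    push_cast
    ring
  have h1 := h _ hT
  rw [h' _ hT, bdry_segment, bdry_segment] at h1
  linear_combination -h1

theorem IsPrimitiveOn.eqOn {φ : S.Cochain s 1} {F F' : ℂ → ℂ} {W : Set ℂ}
    (h : IsPrimitiveOn φ F W) (h' : IsPrimitiveOn φ F' W) (l : S.LogSystem W) {p : ℂ}
    (hW : StarConvex ℝ p W) (hp : F p = F' p) : EqOn F F' W := fun z hz => by
  have := h.sub_eq_sub h' l hW hz
  rw [hp, sub_self, mul_zero] at this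
  exact sub_eq_zero.1 ((mul_eq_zero.1 this).resolve_left (l.sec_ne_zero z))

/-- A cocycle has a primitive on a star-shaped set. -/
theorem exists_isPrimitiveOn {φ : S.Cochain s 1} (hφ : φ ∈ S.Cocycle s) {W : Set ℂ}
    (l : S.LogSystem W) {p : ℂ} (hW : StarConvex ℝ p W) (hp : p ∈ W) :
    ∃ F, IsPrimitiveOn φ F W := by
  classical
  -- The candidate at z is the value of φ on the straight segment from p to z, normalised by the
  -- section at z. The value off W plays no role.
  refine ⟨fun z => if hz : z ∈ W then φ (l.segment s hW hz) / l.sec s z else 0, fun T hT => ?_⟩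
  obtain ⟨c, hc⟩ := l.exists_sec_eq T hT T.continuous_map
  obtain ⟨U, g, hU, hsub, hg, h⟩ := T.smooth
  have hgW : ∀ r ∈ Icc (0 : ℝ) 1, g ![1 - r, r] ∈ W := fun r hr => by
    have := hT ⟨_, segmentPoint_mem_iff.2 hr⟩
    rwa [h] at this
  have hlin : ∀ t ∈ Icc (0 : ℝ) 1, ∀ z ∈ W, p + (t : ℂ) * (z - p) ∈ W := fun t ht z hz => by
    have := hW hz (sub_nonneg.2 ht.2) ht.1 (by ring)
    convert this using 1
    rw [Complex.real_smul, Complex.real_smul]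
    push_cast
    ring
  have hsm : ∀ (a b : (Fin 3 → ℝ) → ℝ), ContDiff ℝ ∞ a → ContDiff ℝ ∞ b →
      (∀ x ∈ stdSimplex ℝ (Fin 3), b x ∈ Icc (0 : ℝ) 1) →
      SmoothNearSimplex 2 fun x => p + (a x : ℂ) * (g ![1 - b x, b x] - p) :=
    fun a b ha hb hb' => by
      have hbc : ContDiff ℝ ∞ fun x => (![1 - b x, b x] : Fin 2 → ℝ) := by
        rw [contDiff_pi]
        intro i
        fin_cases i
        · exact contDiff_const.sub hb
        · exact hb
      refine ⟨(fun x => (![1 - b x, b x] : Fin 2 → ℝ)) ⁻¹' U, hU.preimage hbc.continuous,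
        fun x hx => hsub (segmentPoint_mem_iff.2 (hb' x hx)), ?_⟩
      exact contDiffOn_const.add (((Complex.ofRealCLM.contDiff.comp ha).contDiffOn).mul
        ((hg.comp hbc.contDiffOn fun _ h => h).sub contDiffOn_const))
  have hco : ∀ i : Fin 3, ContDiff ℝ ∞ fun x : Fin 3 → ℝ => x i := fun i => contDiff_apply ℝ ℝ i
  have hx1 : ∀ x ∈ stdSimplex ℝ (Fin 3), x 2 ∈ Icc (0 : ℝ) 1 ∧ x 1 + x 2 ∈ Icc (0 : ℝ) 1 :=
    fun x hx => by
      have h0 := hx.1 0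
      have h1 := hx.1 1
      have h2 := hx.1 2
      have h3 := hx.2
      rw [Fin.sum_univ_three] at h3
      exact ⟨⟨by linarith, by linarith⟩, by linarith, by linarith⟩
  -- The cone over T with apex p is parametrised by the square (a, b) ↦ p + a (T(b) - p), cut along
  -- its diagonal into the triangles A and B; a cone map on a single triangle would not be smooth at
  -- the apex. The side a = 1 is T, the sides b = 0 and b = 1 are the segments to the end points of
  -- T, and the side a = 0 is the constant simplex at p. On the latter φ vanishes by the cocycle
  -- condition for the constant triangle C, whose three faces agree.
  let A : S.TwistedSimplex s 2 := l.simplex s _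
    (hsm (fun x => x 1 + x 2) (fun x => x 2) ((hco 1).add (hco 2)) (hco 2) fun x hx => (hx1 x hx).1)
    fun x hx => hlin _ (hx1 x hx).2 _ (hgW _ (hx1 x hx).1)
  let B : S.TwistedSimplex s 2 := l.simplex s _
    (hsm (fun x => x 2) (fun x => x 1 + x 2) (hco 2) ((hco 1).add (hco 2)) fun x hx => (hx1 x hx).2)
    fun x hx => hlin _ (hx1 x hx).1 _ (hgW _ (hx1 x hx).2)
  let C : S.TwistedSimplex s 2 := l.simplex s (fun _ => p) (.of_contDiff contDiff_const) fun _ _ => hp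
  have hA := cocycle_face_eq hφ A
  have hB := cocycle_face_eq hφ B
  have hC := cocycle_face_eq hφ C
  have hcomp : ∀ (G : S.TwistedSimplex s 2) (i j : Fin 3), (∀ q, (G.face i).map q = (G.face j).map q) →
      (∀ x, G.sec x = l.sec s (G.map x)) → G.face i = G.face j := fun G i j h1 h2 =>
    TwistedSimplex.ext_of h1 fun q => by
      change G.sec _ = G.sec _
      rw [h2, h2]
      exact congrArg _ (h1 q)
  have key : ∀ (T₁ T₂ : S.TwistedSimplex s 1), (∀ q, T₁.sec q = l.sec s (T₁.map q)) →
      (∀ q, T₂.sec q = l.sec s (T₂.map q)) → (∀ q, T₁.map q = T₂.map q) → T₁ = T₂ :=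
    fun T₁ T₂ h1 h2 h3 => TwistedSimplex.ext_of h3 fun q => by rw [h1, h2, h3]
  have hd : A.face 1 = B.face 1 := key _ _ (fun _ => rfl) (fun _ => rfl) fun q => by
    change p + (((faceMap 1 q).1 1 + (faceMap 1 q).1 2 : ℝ) : ℂ) *
        (g ![1 - (faceMap 1 q).1 2, (faceMap 1 q).1 2] - p) =
      p + (((faceMap 1 q).1 2 : ℝ) : ℂ) * (g ![1 - ((faceMap 1 q).1 1 + (faceMap 1 q).1 2),
        (faceMap 1 q).1 1 + (faceMap 1 q).1 2] - p)
    rw [faceMap_coe_one]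
    simp
  have hC1 : C.face 1 = C.face 0 := key _ _ (fun _ => rfl) (fun _ => rfl) fun q => rfl
  have hC2 : C.face 2 = C.face 0 := key _ _ (fun _ => rfl) (fun _ => rfl) fun q => rfl
  have hB2 : B.face 2 = C.face 0 := key _ _ (fun _ => rfl) (fun _ => rfl) fun q => by
    change p + (((faceMap 2 q).1 2 : ℝ) : ℂ) * (g ![1 - ((faceMap 2 q).1 1 + (faceMap 2 q).1 2),
        (faceMap 2 q).1 1 + (faceMap 2 q).1 2] - p) = p
    rw [faceMap_coe_one]
    simp
  have hv0 : T.map (stdSimplex.vertex 0) = g ![1, 0] := by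
    rw [h]; congr 1; ext j; fin_cases j <;> simp
  have hv1 : T.map (stdSimplex.vertex 1) = g ![0, 1] := by
    rw [h]; congr 1; ext j; fin_cases j <;> simp
  have hB0 : B.face 0 = l.segment s hW (hT (stdSimplex.vertex 1)) :=
    key _ _ (fun _ => rfl) (fun _ => rfl) fun q => by
      change p + (((faceMap 0 q).1 2 : ℝ) : ℂ) * (g ![1 - ((faceMap 0 q).1 1 + (faceMap 0 q).1 2),
          (faceMap 0 q).1 1 + (faceMap 0 q).1 2] - p) =
        p + ((q.1 1 : ℝ) : ℂ) * (T.map (stdSimplex.vertex 1) - p)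
      have := q.2.2
      rw [Fin.sum_univ_two] at this
      rw [faceMap_coe_one, hv1]
      simp [this]
  have hA2 : A.face 2 = l.segment s hW (hT (stdSimplex.vertex 0)) :=
    key _ _ (fun _ => rfl) (fun _ => rfl) fun q => by
      change p + (((faceMap 2 q).1 1 + (faceMap 2 q).1 2 : ℝ) : ℂ) *
        (g ![1 - (faceMap 2 q).1 2, (faceMap 2 q).1 2] - p) =
        p + ((q.1 1 : ℝ) : ℂ) * (T.map (stdSimplex.vertex 0) - p)
      rw [faceMap_coe_one, hv0]
      simp
  have hA0m : ∀ q, (A.face 0).map q = T.map q := fun q => by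
    change p + (((faceMap 0 q).1 1 + (faceMap 0 q).1 2 : ℝ) : ℂ) *
        (g ![1 - (faceMap 0 q).1 2, (faceMap 0 q).1 2] - p) = T.map q
    have := q.2.2
    rw [Fin.sum_univ_two] at this
    rw [faceMap_coe_one, h, simplexOne_eq q.2]
    simp
  have hA0 : T = (A.face 0).smul c := TwistedSimplex.ext_of (fun q => (hA0m q).symm) fun q => by
    rw [hc, ← hA0m]
    rfl
  have hφT : φ T = c * φ (A.face 0) := by
    conv_lhs => rw [hA0]
    exact φ.2 _ _
  rw [hd, hA2] at hA
  rw [hB0, hB2] at hB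
  rw [hC1, hC2] at hC
  rw [hφT, bdry, hc, hc, dif_pos (hT _), dif_pos (hT _)]
  have h1 := l.sec_ne_zero (s := s) (T.map (stdSimplex.vertex 1))
  have h0 := l.sec_ne_zero (s := s) (T.map (stdSimplex.vertex 0))
  field_simp
  linear_combination c * hA - c * hB + c * hC

/-- A local primitive is a primitive. -/
theorem IsPrimitiveOn.of_local {φ : S.Cochain s 1} (hφ : φ ∈ S.Cocycle s) {F : ℂ → ℂ} {W : Set ℂ}
    (h : ∀ z ∈ W, ∃ N, IsOpen N ∧ z ∈ N ∧ IsPrimitiveOn φ F (N ∩ W)) : IsPrimitiveOn φ F W := by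
  intro T hT
  choose! N hNo hzN hN using h
  have hmem : ∀ r : Icc (0 : ℝ) 1, (![1 - r.1, r.1] : Fin 2 → ℝ) ∈ stdSimplex ℝ (Fin 2) :=
    fun r => segmentPoint_mem_iff.2 r.2
  let e : Icc (0 : ℝ) 1 → Simplex 1 := fun r => ⟨![1 - r.1, r.1], hmem r⟩
  have he : Continuous e := by
    refine Continuous.subtype_mk (continuous_pi fun i => ?_) _
    fin_cases i
    · exact continuous_const.sub continuous_subtype_val
    · exact continuous_subtype_val
  -- The simplex is cut into finitely many pieces, each lying in one of the given neighbourhoods.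
  obtain ⟨t, ht0, htm, ⟨M, hM⟩, hcov⟩ := exists_monotone_Icc_subset_open_cover_Icc
    (zero_le_one (α := ℝ)) (c := fun r : Icc (0 : ℝ) 1 => (fun r => T.map (e r)) ⁻¹' N (T.map (e r)))
    (fun r => (hNo _ (hT _)).preimage (T.continuous_map.comp he))
    (fun r _ => mem_iUnion.2 ⟨r, hzN _ (hT _)⟩)
  have hsub : ∀ {m' : ℕ} (a : Fin (m' + 1) → Icc (0 : ℝ) 1) (x : Fin (m' + 1) → ℝ),
      x ∈ stdSimplex ℝ (Fin (m' + 1)) → ∑ i, x i * (a i).1 ∈ Icc (0 : ℝ) 1 := fun a x hx =>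
    ⟨Finset.sum_nonneg fun i _ => mul_nonneg (hx.1 i) (a i).2.1, by
      refine le_trans (Finset.sum_le_sum fun i _ => ?_) hx.2.le
      exact mul_le_of_le_one_right (hx.1 i) (a i).2.2⟩
  -- The affine simplex in the parameter interval with vertices a i, mapped by T. With three
  -- vertices it is a degenerate triangle, and the cocycle condition on it is additivity of φ under
  -- subdivision.
  let sub : ∀ {m' : ℕ} (a : Fin (m' + 1) → Icc (0 : ℝ) 1), S.TwistedSimplex s m' := fun a =>
    T.comp (fun x => ![1 - ∑ i, x i * (a i).1, ∑ i, x i * (a i).1]) (by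
      rw [contDiff_pi]
      intro i
      have : ContDiff ℝ ∞ fun x : Fin (_ + 1) → ℝ => ∑ i, x i * (a i).1 :=
        ContDiff.sum fun i _ => (contDiff_apply ℝ ℝ i).mul contDiff_const
      fin_cases i
      · exact contDiff_const.sub this
      · exact this)
      fun x hx => segmentPoint_mem_iff.2 (hsub a x hx)
  have hsubmap : ∀ {m' : ℕ} (a : Fin (m' + 1) → Icc (0 : ℝ) 1) (x : Simplex m'),
      (sub a).map x = T.map (e ⟨_, hsub a x.1 x.2⟩) := fun a x => rfl
  have hsubsec : ∀ {m' : ℕ} (a : Fin (m' + 1) → Icc (0 : ℝ) 1) (x : Simplex m'),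
      (sub a).sec x = T.sec (e ⟨_, hsub a x.1 x.2⟩) := fun a x => rfl
  have hext : ∀ (T₁ T₂ : S.TwistedSimplex s 1) (ρ₁ ρ₂ : Simplex 1 → Icc (0 : ℝ) 1),
      (∀ q, T₁.map q = T.map (e (ρ₁ q)) ∧ T₁.sec q = T.sec (e (ρ₁ q))) →
      (∀ q, T₂.map q = T.map (e (ρ₂ q)) ∧ T₂.sec q = T.sec (e (ρ₂ q))) →
      (∀ q, (ρ₁ q).1 = (ρ₂ q).1) → T₁ = T₂ := fun T₁ T₂ ρ₁ ρ₂ h1 h2 h3 =>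
    TwistedSimplex.ext_of (fun q => by rw [(h1 q).1, (h2 q).1, Subtype.ext (h3 q)])
      fun q => by rw [(h1 q).2, (h2 q).2, Subtype.ext (h3 q)]
  have hadd : ∀ a b c : Icc (0 : ℝ) 1, φ (sub ![a, c]) = φ (sub ![a, b]) + φ (sub ![b, c]) :=
    fun a b c => by
      have hf := cocycle_face_eq hφ (sub ![a, b, c])
      have h0 : (sub ![a, b, c]).face 0 = sub ![b, c] :=
        hext _ _ (fun q => ⟨_, hsub ![a, b, c] _ (faceMap 0 q).2⟩)
          (fun q => ⟨_, hsub ![b, c] _ q.2⟩) (fun q => ⟨rfl, rfl⟩) (fun q => ⟨rfl, rfl⟩) fun q => by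
          simp [faceMap_coe_one, Fin.sum_univ_three]
      have h1 : (sub ![a, b, c]).face 1 = sub ![a, c] :=
        hext _ _ (fun q => ⟨_, hsub ![a, b, c] _ (faceMap 1 q).2⟩)
          (fun q => ⟨_, hsub ![a, c] _ q.2⟩) (fun q => ⟨rfl, rfl⟩) (fun q => ⟨rfl, rfl⟩) fun q => by
          simp [faceMap_coe_one, Fin.sum_univ_three]
      have h2 : (sub ![a, b, c]).face 2 = sub ![a, b] :=
        hext _ _ (fun q => ⟨_, hsub ![a, b, c] _ (faceMap 2 q).2⟩)
          (fun q => ⟨_, hsub ![a, b] _ q.2⟩) (fun q => ⟨rfl, rfl⟩) (fun q => ⟨rfl, rfl⟩) fun q => by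
          simp [faceMap_coe_one, Fin.sum_univ_three]
      rw [h0, h1, h2] at hf
      linear_combination -hf
  have hbd : ∀ a b : Icc (0 : ℝ) 1, bdry F (sub ![a, b]) =
      T.sec (e b) * F (T.map (e b)) - T.sec (e a) * F (T.map (e a)) := fun a b => by
    have e1 : (⟨_, hsub ![a, b] _ (stdSimplex.vertex (S := ℝ) (1 : Fin 2)).2⟩ : Icc (0 : ℝ) 1) = b :=
      Subtype.ext (by simp)
    have e0 : (⟨_, hsub ![a, b] _ (stdSimplex.vertex (S := ℝ) (0 : Fin 2)).2⟩ : Icc (0 : ℝ) 1) = a :=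
      Subtype.ext (by simp)
    rw [bdry, hsubmap, hsubmap, hsubsec, hsubsec, e1, e0]
  have hstep : ∀ k, φ (sub ![t 0, t k]) = bdry F (sub ![t 0, t k]) := fun k => by
    induction k with
    | zero =>
      have := hadd (t 0) (t 0) (t 0)
      rw [hbd, sub_self]
      linear_combination -this
    | succ k ih =>
      have hloc : φ (sub ![t k, t (k + 1)]) = bdry F (sub ![t k, t (k + 1)]) := by
        obtain ⟨r, hr⟩ := hcov k
        refine hN _ (hT (e r)) _ fun q => ⟨?_, hT _⟩
        rw [hsubmap]
        refine hr ⟨?_, ?_⟩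
        · change (t k).1 ≤ ∑ i, q.1 i * ((![t k, t (k + 1)] : Fin 2 → Icc (0 : ℝ) 1) i).1
          have h2 := q.2.2
          rw [Fin.sum_univ_two] at h2
          have h3 : (t k).1 ≤ (t (k + 1)).1 := htm (Nat.le_succ k)
          have h4 : 0 ≤ q.1 1 := q.2.1 1
          have h5 : q.1 0 = 1 - q.1 1 := by linarith
          rw [Fin.sum_univ_two, h5]
          simp only [Matrix.cons_val_zero, Matrix.cons_val_one]
          nlinarith
        · change ∑ i, q.1 i * ((![t k, t (k + 1)] : Fin 2 → Icc (0 : ℝ) 1) i).1 ≤ (t (k + 1)).1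
          have h2 := q.2.2
          rw [Fin.sum_univ_two] at h2
          have h3 : (t k).1 ≤ (t (k + 1)).1 := htm (Nat.le_succ k)
          have h4 : 0 ≤ q.1 0 := q.2.1 0
          have h5 : q.1 1 = 1 - q.1 0 := by linarith
          rw [Fin.sum_univ_two, h5]
          simp only [Matrix.cons_val_zero, Matrix.cons_val_one]
          nlinarith
      rw [hadd _ (t k), ih, hloc, hbd, hbd, hbd]
      ring
  have hfin : sub ![t 0, t M] = T := by
    refine TwistedSimplex.ext_of (fun q => ?_) fun q => ?_ <;>
    · have : e ⟨_, hsub ![t 0, t M] q.1 q.2⟩ = q := by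
        refine Subtype.ext ?_
        change ![1 - ∑ i, q.1 i * ((![t 0, t M] : Fin 2 → Icc (0 : ℝ) 1) i).1,
          ∑ i, q.1 i * ((![t 0, t M] : Fin 2 → Icc (0 : ℝ) 1) i).1] = q.1
        conv_rhs => rw [simplexOne_eq q.2]
        rw [Fin.sum_univ_two]
        simp [hM M le_rfl, ht0]
      first
        | rw [hsubmap, this]
        | rw [hsubsec, this]
  have := hstep M
  rwa [hfin] at this

/-- If the quotient were a nonpositive real number, σ would lie on the segment from p to z, which is
contained in W. -/
theorem div_mem_slitPlane_of_starConvex {W : Set ℂ} {p σ z : ℂ} (hW : StarConvex ℝ p W)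
    (hσ : σ ∉ W) (hp : p ∈ W) (hz : z ∈ W) : (z - σ) / (p - σ) ∈ Complex.slitPlane := by
  have hpσ : p - σ ≠ 0 := sub_ne_zero.2 fun h => hσ (h ▸ hp)
  by_contra h
  rw [Complex.mem_slitPlane_iff, not_or, not_lt, not_not] at h
  obtain ⟨t, ht, hzt⟩ : ∃ t : ℝ, 0 ≤ t ∧ z - σ = -t * (p - σ) := by
    refine ⟨-((z - σ) / (p - σ)).re, by linarith [h.1], ?_⟩
    have : (z - σ) / (p - σ) = (((z - σ) / (p - σ)).re : ℂ) := Complex.ext (by simp) (by simp [h.2])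
    rw [Complex.ofReal_neg, neg_neg, ← this, div_mul_cancel₀ _ hpσ]
  refine hσ ?_
  have h1 : (0 : ℝ) < 1 + t := by linarith
  have := hW hz (a := t / (1 + t)) (b := 1 / (1 + t)) (by positivity) (by positivity) (by field_simp; ring)
  convert this using 1
  rw [Complex.real_smul, Complex.real_smul]
  have h2 : (1 + t : ℂ) ≠ 0 := by exact_mod_cast h1.ne'
  push_cast
  field_simp
  linear_combination -hzt

theorem exists_log_of_starConvex {W : Set ℂ} {p σ : ℂ} (hW : StarConvex ℝ p W)
    (hp : p ∈ W) (hσ : σ ∉ W) :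
    ∃ L : ℂ → ℂ, ContinuousOn L W ∧ ∀ z ∈ W, Complex.exp (L z) = z - σ := by
  have hpσ : p - σ ≠ 0 := sub_ne_zero.2 fun h => hσ (h ▸ hp)
  refine ⟨fun z => Complex.log ((z - σ) / (p - σ)) + Complex.log (p - σ), ?_, fun z hz => ?_⟩
  · exact (ContinuousOn.clog (by fun_prop) fun z hz =>
      div_mem_slitPlane_of_starConvex hW hσ hp hz).add continuousOn_const
  · have := div_mem_slitPlane_of_starConvex hW hσ hp hz
    rw [Complex.exp_add, Complex.exp_log (Complex.slitPlane_ne_zero this), Complex.exp_log hpσ,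
      div_mul_cancel₀ _ hpσ]

theorem exists_logSystem {W : Set ℂ} {p : ℂ} (hW : StarConvex ℝ p W) (hp : p ∈ W)
    (hWS : W ⊆ S.compl) : Nonempty (S.LogSystem W) := by
  choose L h1 h2 using fun k => exists_log_of_starConvex hW hp (σ := S.pt k)
    fun h => hWS h k rfl
  exact ⟨LogSystem.ofSub S L h1 h2⟩

theorem IsPrimitiveOn.eqOn' {φ : S.Cochain s 1} {F F' : ℂ → ℂ} {W : Set ℂ}
    (h : IsPrimitiveOn φ F W) (h' : IsPrimitiveOn φ F' W) {p : ℂ}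
    (hW : StarConvex ℝ p W) (hp : p ∈ W) (hWS : W ⊆ S.compl) (hpF : F p = F' p) :
    EqOn F F' W := by
  obtain ⟨l⟩ := exists_logSystem hW hp hWS
  exact h.eqOn h' l hW hpF

/-- A primitive on a star-shaped set with a prescribed value. -/
theorem exists_isPrimitiveOn_eq {φ : S.Cochain s 1} (hφ : φ ∈ S.Cocycle s) {W : Set ℂ}
    {p : ℂ} (hW : StarConvex ℝ p W) (hp : p ∈ W) (hWS : W ⊆ S.compl) (a : ℂ) :
    ∃ F, IsPrimitiveOn φ F W ∧ F p = a := by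
  obtain ⟨l⟩ := exists_logSystem hW hp hWS
  obtain ⟨F, hF⟩ := exists_isPrimitiveOn hφ l hW hp
  refine ⟨_, hF.add_const_div l ((a - F p) * l.sec s p), ?_⟩
  rw [mul_div_cancel_right₀ _ (l.sec_ne_zero p)]
  ring

/-! ### Primitives around a puncture -/

variable (S) in
/-- The punctured disc of radius `ε` around `σ_k`. -/
def punctured (k : Fin (n + 1)) (ε : ℝ) : Set ℂ := Metric.ball (S.pt k) ε \ {S.pt k}

variable (S) in
theorem exists_radius : ∃ ε > 0, ∀ j k, j ≠ k → ε ≤ dist (S.pt j) (S.pt k) := by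
  have h : ∀ᶠ ε : ℝ in 𝓝[>] 0, ∀ j k, j ≠ k → ε ≤ dist (S.pt j) (S.pt k) := by
    simp only [eventually_all]
    intro j k hjk
    exact nhdsWithin_le_nhds (eventually_le_nhds (dist_pos.2 fun h => hjk (S.injective h)))
  obtain ⟨ε, h1, h2⟩ := (h.and self_mem_nhdsWithin).exists
  exact ⟨ε, h2, h1⟩

theorem notMem_ball {ε : ℝ} (hε : ∀ j k, j ≠ k → ε ≤ dist (S.pt j) (S.pt k)) {j k : Fin (n + 1)}
    (hjk : j ≠ k) : S.pt j ∉ Metric.ball (S.pt k) ε := fun h =>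
  absurd (Metric.mem_ball.1 h) (not_lt.2 (hε j k hjk))

theorem punctured_subset {ε : ℝ} (hε : ∀ j k, j ≠ k → ε ≤ dist (S.pt j) (S.pt k))
    (k : Fin (n + 1)) : S.punctured k ε ⊆ S.compl := by
  rintro z ⟨hz, hzk⟩ j rfl
  by_cases hjk : j = k
  · exact hzk (by rw [hjk]; rfl)
  · exact notMem_ball hε hjk hz

theorem exp_two_pi_ne_one {x : ℝ} (hx0 : x ≠ 0) (hx1 : |x| < 1) :
    Complex.exp (x * (2 * Real.pi * Complex.I)) ≠ 1 := fun h => by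
  have hpi := Real.pi_pos
  have hn : ‖(x : ℂ) * (2 * Real.pi * Complex.I)‖ = |x| * (2 * Real.pi) := by
    simp [abs_of_pos hpi]
  have := eq_of_exp_eq_one h (by rw [hn]; nlinarith)
  simp [hx0, hpi.ne'] at this

theorem starConvex_preimage_affine {T : Set ℂ} {a b p : ℂ} (h : StarConvex ℝ ((p - a) / b) T) :
    StarConvex ℝ p {z | (z - a) / b ∈ T} := by
  intro z hz α β hα hβ hαβ
  have := h hz hα hβ hαβ
  simp only [mem_ofPred_eq]
  convert this using 1
  simp only [Complex.real_smul]
  have : (α : ℂ) + β = 1 := by exact_mod_cast hαβ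
  by_cases hb : b = 0
  · simp [hb]
  · field_simp
    linear_combination a * this

/-- A cocycle has a primitive on a small punctured disc around `σ_k` if the local monodromy is
nontrivial. -/
theorem exists_isPrimitiveOn_punctured {φ : S.Cochain s 1} (hφ : φ ∈ S.Cocycle s) {ε : ℝ}
    (hε0 : 0 < ε) (hε : ∀ j k, j ≠ k → ε ≤ dist (S.pt j) (S.pt k)) (k : Fin (n + 1))
    (hs0 : s k ≠ 0) (hs1 : |s k| < 1) : ∃ F, IsPrimitiveOn φ F (S.punctured k ε) := by
  classical
  set σ := S.pt k with hσ
  set B := Metric.ball σ ε with hB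
  have hconv : Convex ℝ B := convex_ball σ ε
  have hσB : σ ∈ B := Metric.mem_ball_self hε0
  choose! L hL hLe using fun (j : Fin (n + 1)) (hj : j ≠ k) =>
    exists_log_of_starConvex (hconv.starConvex hσB) hσB (notMem_ball hε hj)
  -- The punctured disc is covered by two slit discs, with slits in opposite directions. The
  -- logarithms are chosen so that the two branches agree on the upper half disc and differ by the
  -- monodromy factor q on the lower one.
  set W₁ : Set ℂ := {z ∈ B | z - σ ∈ Complex.slitPlane} with hW₁
  set W₂ : Set ℂ := {z ∈ B | -(z - σ) ∈ Complex.slitPlane} with hW₂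
  let l₁ : S.LogSystem W₁ := LogSystem.ofSub S
    (fun j z => if j = k then Complex.log (z - σ) else L j z)
    (fun j => by
      by_cases hj : j = k
      · simp only [hj, if_true]
        exact ContinuousOn.clog (by fun_prop) fun z hz => hz.2
      · simp only [hj, if_false]
        exact (hL j hj).mono fun z hz => hz.1)
    (fun j z hz => by
      by_cases hj : j = k
      · simp only [hj, if_true]
        exact Complex.exp_log (Complex.slitPlane_ne_zero hz.2)
      · simp only [hj, if_false]
        exact hLe j hj z hz.1)
  let l₂ : S.LogSystem W₂ := LogSystem.ofSub S
    (fun j z => if j = k then Complex.log (-(z - σ)) + Real.pi * Complex.I else L j z)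
    (fun j => by
      by_cases hj : j = k
      · simp only [hj, if_true]
        exact (ContinuousOn.clog (by fun_prop) fun z hz => hz.2).add continuousOn_const
      · simp only [hj, if_false]
        exact (hL j hj).mono fun z hz => hz.1)
    (fun j z hz => by
      by_cases hj : j = k
      · simp only [hj, if_true]
        rw [Complex.exp_add, Complex.exp_log (Complex.slitPlane_ne_zero hz.2), Complex.exp_pi_mul_I]
        ring
      · simp only [hj, if_false]
        exact hLe j hj z hz.1)
  set q : ℂ := Complex.exp (s k * (2 * Real.pi * Complex.I)) with hq
  have hq1 : q ≠ 1 := exp_two_pi_ne_one hs0 hs1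
  have hq0 : q ≠ 0 := Complex.exp_ne_zero _
  have hsec : ∀ z, ∀ m : ℂ, Complex.log (-(z - σ)) + Real.pi * Complex.I = Complex.log (z - σ) + m →
      l₂.sec s z = Complex.exp (s k * m) * l₁.sec s z := fun z m hm => by
    simp only [LogSystem.sec]
    rw [← Complex.exp_add]
    congr 1
    rw [← Finset.add_sum_erase _ _ (Finset.mem_univ k), ← Finset.add_sum_erase _ _ (Finset.mem_univ k),
      Finset.sum_congr rfl (g := fun j => (s j : ℂ) * l₁.log j z) fun j hj => by
        simp [l₁, l₂, LogSystem.ofSub, Finset.ne_of_mem_erase hj]]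
    simp only [l₁, l₂, LogSystem.ofSub, if_true, hm]
    ring
  have hsecp : ∀ z, 0 < (z - σ).im → l₂.sec s z = l₁.sec s z := fun z hz => by
    rw [hsec z 0 (by
      rw [Complex.log, Complex.log, norm_neg, Complex.arg_neg_eq_arg_sub_pi_of_im_pos hz]
      push_cast
      ring)]
    simp
  have hsecm : ∀ z, (z - σ).im < 0 → l₂.sec s z = q * l₁.sec s z := fun z hz => by
    rw [hsec z (2 * Real.pi * Complex.I) (by
      rw [Complex.log, Complex.log, norm_neg, Complex.arg_neg_eq_arg_add_pi_of_im_neg hz]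
      push_cast
      ring)]
  have hmemB : ∀ w : ℂ, ‖w‖ < ε → σ + w ∈ B := fun w hw => by
    rw [hB, Metric.mem_ball, dist_eq_norm, add_sub_cancel_left]
    exact hw
  have hε2 : ‖((ε / 2 : ℝ) : ℂ)‖ < ε := by
    rw [Complex.norm_real, Real.norm_eq_abs, abs_of_pos (half_pos hε0)]; linarith
  have hp1 : σ + (ε / 2 : ℝ) ∈ W₁ := ⟨hmemB _ hε2, by
    rw [add_sub_cancel_left, Complex.ofReal_mem_slitPlane]; linarith⟩
  have hp2 : σ - (ε / 2 : ℝ) ∈ W₂ := ⟨by rw [sub_eq_add_neg]; exact hmemB _ (by rwa [norm_neg]), by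
    rw [sub_sub_cancel_left, neg_neg, Complex.ofReal_mem_slitPlane]; linarith⟩
  have hst1 : StarConvex ℝ (σ + (ε / 2 : ℝ)) W₁ := by
    refine (hconv.starConvex hp1.1).inter ?_
    have := starConvex_preimage_affine (a := σ) (b := 1) (p := σ + (ε / 2 : ℝ)) (T := Complex.slitPlane)
      (by rw [add_sub_cancel_left, div_one]; exact Complex.starConvex_ofReal_slitPlane (by linarith))
    simp only [div_one] at this
    exact this
  have hst2 : StarConvex ℝ (σ - (ε / 2 : ℝ)) W₂ := by
    refine (hconv.starConvex hp2.1).inter ?_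
    have := starConvex_preimage_affine (a := σ) (b := -1) (p := σ - (ε / 2 : ℝ)) (T := Complex.slitPlane)
      (by
        rw [sub_sub_cancel_left, neg_div_neg_eq, div_one]
        exact Complex.starConvex_ofReal_slitPlane (by linarith))
    simp only [div_neg, div_one] at this
    exact this
  obtain ⟨F₁, hF₁⟩ := exists_isPrimitiveOn hφ l₁ hst1 hp1
  obtain ⟨F₂, hF₂⟩ := exists_isPrimitiveOn hφ l₂ hst2 hp2
  -- On each half disc, which is convex, the difference of the two primitives is a constant multiple
  -- of the flat section.
  have hhalf : ∀ δ : ℝ, δ ≠ 0 → ∃ d : ℂ, ∀ z ∈ B, 0 < δ * (z - σ).im →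
      l₁.sec s z * (F₁ z - F₂ z) = d := fun δ hδ => by
    set H : Set ℂ := {z ∈ B | 0 < δ * (z - σ).im} with hH
    have hHc : Convex ℝ H := by
      refine hconv.inter ?_
      intro x hx y hy a b ha hb hab
      change 0 < δ * (x - σ).im at hx
      change 0 < δ * (y - σ).im at hy
      change 0 < δ * (a • x + b • y - σ).im
      simp only [Complex.sub_im, Complex.add_im, Complex.smul_im, smul_eq_mul] at hx hy ⊢
      have e : δ * (a * x.im + b * y.im - σ.im) = a * (δ * (x.im - σ.im)) + b * (δ * (y.im - σ.im)) := by
        linear_combination (δ * σ.im) * hab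
      rw [e]
      rcases ha.eq_or_lt with rfl | ha
      · have : b = 1 := by linarith
        subst this; simpa using hy
      · exact add_pos_of_pos_of_nonneg (mul_pos ha hx) (mul_nonneg hb hy.le)
    have hH1 : H ⊆ W₁ := fun z hz => ⟨hz.1, Complex.mem_slitPlane_iff.2 (Or.inr fun h => by
      have := hz.2; rw [h, mul_zero] at this; exact lt_irrefl _ this)⟩
    have hH2 : H ⊆ W₂ := fun z hz => ⟨hz.1, Complex.mem_slitPlane_iff.2 (Or.inr fun h => by
      have := hz.2
      rw [Complex.neg_im, neg_eq_zero] at h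
      rw [h, mul_zero] at this; exact lt_irrefl _ this)⟩
    by_cases hne : H.Nonempty
    · obtain ⟨p, hp⟩ := hne
      exact ⟨_, fun z hz hz' => (hF₁.mono hH1).sub_eq_sub (hF₂.mono hH2) (l₁.mono hH1)
        (hHc.starConvex hp) ⟨hz, hz'⟩⟩
    · exact ⟨0, fun z hz hz' => absurd ⟨z, hz, hz'⟩ hne⟩
  obtain ⟨dp, hdp⟩ := hhalf 1 one_ne_zero
  obtain ⟨dm, hdm⟩ := hhalf (-1) (by norm_num)
  -- Adding a/sec₁ to F₁ and b/sec₂ to F₂ makes them agree on both halves when dp + a - b = 0 and dm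
  -- + a - b/q = 0. This system is solvable because the monodromy q is not 1.
  set b : ℂ := (dp - dm) / (1 - 1 / q) with hb
  have hbq : b * (1 - 1 / q) = dp - dm := by
    refine div_mul_cancel₀ _ (sub_ne_zero.2 fun h => hq1 ?_)
    field_simp at h
    exact h
  set a : ℂ := b - dp with ha
  have hF₁' := hF₁.add_const_div l₁ a
  have hF₂' := hF₂.add_const_div l₂ b
  set G₁ := fun z => F₁ z + a / l₁.sec s z with hG₁
  set G₂ := fun z => F₂ z + b / l₂.sec s z with hG₂
  have hEq : ∀ z ∈ B, (z - σ).im ≠ 0 → G₁ z = G₂ z := fun z hz him => by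
    have h1 := l₁.sec_ne_zero (s := s) z
    rcases lt_or_gt_of_ne him with him | him
    · have h2 := hdm z hz (by linarith)
      simp only [hG₁, hG₂, hsecm z him]
      have h3 : l₁.sec s z * (F₁ z - F₂ z) + a - b / q = 0 := by
        rw [h2, ha]
        linear_combination hbq
      field_simp
      field_simp at h3
      linear_combination h3
    · have h2 := hdp z hz (by linarith)
      simp only [hG₁, hG₂, hsecp z him]
      field_simp
      linear_combination h2 + ha
  let F : ℂ → ℂ := fun z => if z ∈ W₁ then G₁ z else G₂ z
  have hFW₁ : ∀ z ∈ W₁, F z = G₁ z := fun z hz => if_pos hz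
  have hFW₂ : ∀ z ∈ W₂, F z = G₂ z := fun z hz => by
    by_cases h : z ∈ W₁
    · rw [hFW₁ z h]
      refine hEq z hz.1 fun him => ?_
      have h1 := Complex.mem_slitPlane_iff.1 h.2
      have h2 := Complex.mem_slitPlane_iff.1 hz.2
      rw [Complex.neg_re, Complex.neg_im, him] at h2
      rw [him] at h1
      simp at h1 h2
      linarith
    · exact if_neg h
  have ho1 : IsOpen W₁ := Metric.isOpen_ball.inter
    (Complex.isOpen_slitPlane.preimage (by fun_prop : Continuous fun z : ℂ => z - σ))
  have ho2 : IsOpen W₂ := Metric.isOpen_ball.inter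
    (Complex.isOpen_slitPlane.preimage (by fun_prop : Continuous fun z : ℂ => -(z - σ)))
  refine ⟨F, IsPrimitiveOn.of_local hφ fun z hz => ?_⟩
  rcases Complex.mem_slitPlane_or_neg_mem_slitPlane (sub_ne_zero.2 hz.2) with h | h
  · exact ⟨W₁, ho1, ⟨hz.1, h⟩, (hF₁'.congr hFW₁).mono inter_subset_left⟩
  · exact ⟨W₂, ho2, ⟨hz.1, h⟩, (hF₂'.congr hFW₂).mono inter_subset_left⟩

/-! ### The slit plane -/

variable (S) in
/-- A base point from which the points `σ_k` are seen in distinct directions. -/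
def IsGenericBase (p : ℂ) : Prop :=
  (∀ k, p ≠ S.pt k) ∧ ∀ j k, j ≠ k → ((S.pt j - p) / (S.pt k - p)).im ≠ 0

-- On the parabola t + i t² the condition that p be collinear with σ_j and σ_k is a polynomial
-- equation of degree at most two in t, since the cubic terms cancel. It is not identically
-- satisfied because σ_j ≠ σ_k, so only finitely many t are excluded.
variable (S) in
theorem exists_isGenericBase : ∃ p, S.IsGenericBase p := by
  have hpar : ∀ j k, j ≠ k → {t : ℝ | ((S.pt j - (t + t ^ 2 * Complex.I)) *
      (starRingEnd ℂ) (S.pt k - (t + t ^ 2 * Complex.I))).im = 0}.Finite := fun j k hjk => by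
    set a := S.pt j
    set b := S.pt k
    have hab : a ≠ b := fun h => hjk (S.injective h)
    let P : Polynomial ℝ := Polynomial.C (a.im * b.re - a.re * b.im) +
      Polynomial.C (b.im - a.im) * Polynomial.X + Polynomial.C (a.re - b.re) * Polynomial.X ^ 2
    have hP : P ≠ 0 := fun h => hab (by
      have h0 := congrArg (fun Q => Polynomial.eval 0 Q) h
      have h1 := congrArg (fun Q => Polynomial.eval 1 Q) h
      have h2 := congrArg (fun Q => Polynomial.eval (-1) Q) h
      simp only [P, Polynomial.eval_add, Polynomial.eval_mul, Polynomial.eval_C,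
        Polynomial.eval_X, Polynomial.eval_pow, Polynomial.eval_zero] at h0 h1 h2
      exact Complex.ext (by linarith) (by linarith))
    refine (P.roots.toFinset.finite_toSet).subset fun t ht => ?_
    simp only [Finset.mem_coe, Multiset.mem_toFinset, Polynomial.mem_roots hP, Polynomial.IsRoot]
    simp only [mem_ofPred_eq, Complex.mul_im, Complex.sub_re, Complex.sub_im, Complex.conj_re,
      Complex.conj_im, Complex.add_re, Complex.add_im, Complex.ofReal_re, Complex.ofReal_im,
      ← Complex.ofReal_pow, Complex.mul_re, Complex.I_re, Complex.I_im] at ht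
    simp only [P, Polynomial.eval_add, Polynomial.eval_mul, Polynomial.eval_C, Polynomial.eval_X,
      Polynomial.eval_pow]
    linear_combination ht
  have hpt : ∀ k, {t : ℝ | ((t : ℂ) + t ^ 2 * Complex.I) = S.pt k}.Finite := fun k => by
    refine (finite_singleton (S.pt k).re).subset fun t ht => ?_
    have := congrArg Complex.re ht
    simpa [← Complex.ofReal_pow] using this
  have hfin : (⋃ k, {t : ℝ | ((t : ℂ) + t ^ 2 * Complex.I) = S.pt k}) ∪
      (⋃ j, ⋃ k, ⋃ (_ : j ≠ k), {t : ℝ | ((S.pt j - (t + t ^ 2 * Complex.I)) *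
      (starRingEnd ℂ) (S.pt k - (t + t ^ 2 * Complex.I))).im = 0}) |>.Finite :=
    (finite_iUnion hpt).union (finite_iUnion fun j => finite_iUnion fun k => finite_iUnion (hpar j k))
  obtain ⟨t, ht⟩ := hfin.exists_notMem
  simp only [mem_union, mem_iUnion, not_or, not_exists] at ht
  refine ⟨t + t ^ 2 * Complex.I, ht.1, fun j k hjk h => ht.2 j k hjk ?_⟩
  have hk : S.pt k - (t + t ^ 2 * Complex.I) ≠ 0 := sub_ne_zero.2 fun h => ht.1 k h.symm
  rw [div_eq_mul_inv, Complex.inv_def, ← mul_assoc, Complex.im_mul_ofReal, mul_eq_zero] at h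
  refine h.resolve_right fun h0 => hk ?_
  simpa using h0

variable (S) in
/-- The plane slit along the rays from the `σ_k` in the direction opposite to `p`. -/
def slitDomain (p : ℂ) : Set ℂ := {z | ∀ k, (z - S.pt k) / (p - S.pt k) ∈ Complex.slitPlane}

theorem isOpen_slitDomain (p : ℂ) : IsOpen (S.slitDomain p) := by
  have : S.slitDomain p = ⋂ k, (fun z => (z - S.pt k) / (p - S.pt k)) ⁻¹' Complex.slitPlane := by
    ext z; simp [slitDomain]
  rw [this]
  exact isOpen_iInter_of_finite fun k => Complex.isOpen_slitPlane.preimage (by fun_prop)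

theorem slitDomain_subset (p : ℂ) : S.slitDomain p ⊆ S.compl := by
  rintro z hz k rfl
  have := hz k
  rw [sub_self, zero_div] at this
  exact Complex.zero_notMem_slitPlane this

variable {p : ℂ} (hp : S.IsGenericBase p)
include hp

theorem IsGenericBase.mem_slitDomain : p ∈ S.slitDomain p := fun k => by
  rw [div_self (sub_ne_zero.2 (hp.1 k))]
  exact Complex.one_mem_slitPlane

/-- The removed rays point away from p, so a segment from p meets one of them only if its end point
does. -/
theorem IsGenericBase.starConvex : StarConvex ℝ p (S.slitDomain p) := by
  intro z hz a b ha hb hab k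
  refine starConvex_preimage_affine (a := S.pt k) (b := p - S.pt k) (p := p) (T := Complex.slitPlane)
    ?_ (hz k) ha hb hab
  rw [div_self (sub_ne_zero.2 (hp.1 k))]
  exact Complex.starConvex_one_slitPlane

/-- Near `σ_k`, the slit plane is a slit disc. -/
theorem IsGenericBase.exists_slitDisc (k : Fin (n + 1)) : ∃ ε > 0, ∀ ε' ≤ ε, 0 < ε' →
    ∃ c ∈ S.slitDomain p ∩ S.punctured k ε',
      StarConvex ℝ c (S.slitDomain p ∩ S.punctured k ε') := by
  have hpk : p - S.pt k ≠ 0 := sub_ne_zero.2 (hp.1 k)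
  have h1 : ∀ᶠ z in 𝓝 (S.pt k), ∀ j, j ≠ k → (z - S.pt j) / (p - S.pt j) ∈ Complex.slitPlane := by
    simp only [eventually_all]
    intro j hj
    have hc : Continuous fun z => (z - S.pt j) / (p - S.pt j) := by fun_prop
    refine hc.continuousAt.eventually (Complex.isOpen_slitPlane.mem_nhds ?_)
    -- σ_k is not on the ray of σ_j because the two points are seen from p in different directions.
    refine Complex.mem_slitPlane_iff.2 (Or.inr ?_)
    have h2 : (S.pt k - S.pt j) / (p - S.pt j) = 1 - (S.pt k - p) / (S.pt j - p) := by
      have h3 : p - S.pt j ≠ 0 := sub_ne_zero.2 (hp.1 j)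
      have h4 : S.pt j - p ≠ 0 := sub_ne_zero.2 (hp.1 j).symm
      field_simp
      ring
    change ((S.pt k - S.pt j) / (p - S.pt j)).im ≠ 0
    rw [h2, Complex.sub_im, Complex.one_im, zero_sub, neg_ne_zero]
    exact hp.2 k j hj.symm
  obtain ⟨ε, hε, hball⟩ := Metric.eventually_nhds_iff_ball.1 h1
  refine ⟨ε, hε, fun ε' hε' hε0 => ?_⟩
  have hset : S.slitDomain p ∩ S.punctured k ε' =
      Metric.ball (S.pt k) ε' ∩ {z | (z - S.pt k) / (p - S.pt k) ∈ Complex.slitPlane} := by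
    ext z
    constructor
    · rintro ⟨h, h'⟩
      exact ⟨h'.1, h k⟩
    · rintro ⟨h, h'⟩
      refine ⟨fun j => ?_, h, ?_⟩
      · by_cases hj : j = k
        · exact hj ▸ h'
        · exact hball z (Metric.ball_subset_ball hε' h) j hj
      · rintro rfl
        simp at h'
  have hn : 0 < ‖p - S.pt k‖ := norm_pos_iff.2 hpk
  set δ : ℝ := ε' / (2 * ‖p - S.pt k‖) with hδ
  have hδ0 : 0 < δ := by positivity
  have hcoord : (S.pt k + δ * (p - S.pt k) - S.pt k) / (p - S.pt k) = δ := by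
    rw [add_sub_cancel_left, mul_div_cancel_right₀ _ hpk]
  have hcb : S.pt k + δ * (p - S.pt k) ∈ Metric.ball (S.pt k) ε' := by
    rw [Metric.mem_ball, dist_eq_norm, add_sub_cancel_left, norm_mul, Complex.norm_real,
      Real.norm_eq_abs, abs_of_pos hδ0, hδ]
    field_simp
    linarith
  refine ⟨S.pt k + δ * (p - S.pt k), ?_, ?_⟩
  · rw [hset]
    refine ⟨hcb, ?_⟩
    simp only [mem_ofPred_eq, hcoord]
    exact Complex.ofReal_mem_slitPlane.2 hδ0
  · rw [hset]
    refine ((convex_ball _ _).starConvex hcb).inter (starConvex_preimage_affine ?_)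
    rw [hcoord]
    exact Complex.starConvex_ofReal_slitPlane hδ0

/-- A primitive on the slit plane that is compatible with primitives near the `σ_k` extends to all
of `ℂ \ Σ`. -/
theorem IsGenericBase.exists_global_primitive {φ : S.Cochain s 1} (hφ : φ ∈ S.Cocycle s)
    {F : ℂ → ℂ} (hF : IsPrimitiveOn φ F (S.slitDomain p))
    (hloc : ∀ k, ∃ ε > 0, ∃ G, IsPrimitiveOn φ G (S.punctured k ε) ∧
      ∀ z ∈ S.slitDomain p ∩ S.punctured k ε, F z = G z) :
    ∃ F', IsPrimitiveOn φ F' S.compl := by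
  classical
  -- The slope η is chosen so small that the cone of slope η around the ray beyond σ_k misses the
  -- rays of all the other points.
  have hη : ∀ᶠ η : ℝ in 𝓝[>] 0, ∀ j k, j ≠ k →
      η * |((S.pt j - p) / (S.pt k - p)).re| < |((S.pt j - p) / (S.pt k - p)).im| := by
    simp only [eventually_all]
    intro j k hjk
    have hc : Continuous fun η : ℝ => η * |((S.pt j - p) / (S.pt k - p)).re| := by fun_prop
    have := (hc.tendsto 0).mono_left (nhdsWithin_le_nhds (s := Ioi 0))
    rw [zero_mul] at this
    exact this.eventually_lt_const (abs_pos.2 (hp.2 j k hjk))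
  obtain ⟨η, hη, hη0⟩ := (hη.and self_mem_nhdsWithin).exists
  have hη0 : 0 < η := hη0
  let C : Set ℂ := {w | 0 < w.re ∧ |w.im| < η * w.re}
  have hCc : Convex ℝ C := by
    intro x hx y hy a b ha hb hab
    have key : ∀ u v : ℝ, 0 < u → 0 < v → 0 < a * u + b * v := fun u v hu hv => by
      rcases ha.eq_or_lt with rfl | ha
      · have : b = 1 := by linarith
        subst this; simpa using hv
      · exact add_pos_of_pos_of_nonneg (mul_pos ha hu) (mul_nonneg hb hv.le)
    simp only [C, mem_ofPred_eq, abs_lt] at hx hy ⊢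
    simp only [Complex.add_re, Complex.add_im, Complex.smul_re, Complex.smul_im, smul_eq_mul]
    refine ⟨key _ _ hx.1 hy.1, ?_, ?_⟩
    · have := key (x.im + η * x.re) (y.im + η * y.re) (by linarith [hx.2.1]) (by linarith [hy.2.1])
      linarith
    · have := key (η * x.re - x.im) (η * y.re - y.im) (by linarith [hx.2.2]) (by linarith [hy.2.2])
      linarith
  have hCo : IsOpen C :=
    (isOpen_lt continuous_const Complex.continuous_re).inter
      (isOpen_lt (continuous_abs.comp Complex.continuous_im)
        (continuous_const.mul Complex.continuous_re))
  have hkp : ∀ k, S.pt k - p ≠ 0 := fun k => sub_ne_zero.2 (hp.1 k).symm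
  let V : Fin (n + 1) → Set ℂ := fun k => {z | (z - S.pt k) / (S.pt k - p) ∈ C}
  have hVo : ∀ k, IsOpen (V k) := fun k =>
    hCo.preimage (by fun_prop : Continuous fun z => (z - S.pt k) / (S.pt k - p))
  -- points of `V k` off the other rays
  have hray : ∀ j k, j ≠ k → ∀ z ∈ V k, (z - S.pt j) / (p - S.pt j) ∈ Complex.slitPlane :=
    fun j k hjk z hz => by
      by_contra h
      rw [Complex.mem_slitPlane_iff, not_or, not_lt, not_not] at h
      set t := -((z - S.pt j) / (p - S.pt j)).re with ht
      have ht0 : 0 ≤ t := by linarith [h.1]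
      have hzt : z - S.pt j = t * (S.pt j - p) := by
        have h1 : (z - S.pt j) / (p - S.pt j) = ((-t : ℝ) : ℂ) :=
          Complex.ext (by simp [ht]) (by simp [h.2])
        rw [div_eq_iff (sub_ne_zero.2 (hp.1 j))] at h1
        rw [h1]; push_cast; ring
      -- Measured from p, a common point z of the cone at σ_k and the ray of σ_j gives (1 + t) ρ = 1
      -- + w. Then ρ has slope less than η, against the choice of η.
      set ρ := (S.pt j - p) / (S.pt k - p) with hρ
      set w := (z - S.pt k) / (S.pt k - p) with hw
      have hρw : ((1 + t : ℝ) : ℂ) * ρ = 1 + w := by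
        rw [hρ, hw]
        have := hkp k
        field_simp
        push_cast
        linear_combination -hzt
      have hre := congrArg Complex.re hρw
      have him := congrArg Complex.im hρw
      rw [Complex.re_ofReal_mul, Complex.add_re, Complex.one_re] at hre
      rw [Complex.im_ofReal_mul, Complex.add_im, Complex.one_im, zero_add] at him
      have hw1 : 0 < w.re ∧ |w.im| < η * w.re := hz
      have h3 := hη j k hjk
      have h4 : 0 < ρ.re := by
        have : 0 < (1 + t) * ρ.re := by rw [hre]; linarith [hw1.1]
        exact pos_of_mul_pos_right this (by linarith)
      rw [abs_of_pos h4] at h3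
      have h5 : (1 + t) * |ρ.im| < (1 + t) * (η * ρ.re) := by
        have e1 : (1 + t) * |ρ.im| = |w.im| := by
          rw [← him, abs_mul, abs_of_nonneg (by linarith : (0 : ℝ) ≤ 1 + t)]
        have e2 : (1 + t) * (η * ρ.re) = η * (1 + w.re) := by rw [← hre]; ring
        rw [e1, e2]
        nlinarith [hw1.2]
      nlinarith
  have hVS : ∀ k, V k ⊆ S.compl := by
    rintro k z hz j rfl
    by_cases hjk : j = k
    · subst hjk
      have : 0 < ((S.pt j - S.pt j) / (S.pt j - p)).re := hz.1
      simp at this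
    · have := hray j k hjk _ hz
      simp at this
  have hVD : ∀ k, ∀ z ∈ V k, ((z - S.pt k) / (S.pt k - p)).im ≠ 0 → z ∈ S.slitDomain p :=
    fun k z hz him j => by
      by_cases hjk : j = k
      · subst hjk
        refine Complex.mem_slitPlane_iff.2 (Or.inr ?_)
        rw [← neg_sub (S.pt j) p, div_neg, Complex.neg_im]
        exact neg_ne_zero.2 him
      · exact hray j k hjk z hz
  have hVconv : ∀ k (c : ℂ), (c - S.pt k) / (S.pt k - p) ∈ C → StarConvex ℝ c (V k) := fun k c hc =>
    starConvex_preimage_affine (hCc.starConvex hc)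
  -- The primitive on the cone is normalised to agree with G near σ_k. Through G it agrees with F
  -- near σ_k off the ray, and hence on each of the two halves of the cone that the ray separates.
  have hprim : ∀ k, ∃ F', IsPrimitiveOn φ F' (V k) ∧ ∀ z ∈ V k, z ∈ S.slitDomain p → F' z = F z := by
    intro k
    obtain ⟨ε, hε, G, hG, hFG⟩ := hloc k
    -- scaling into the small disc
    have hscale : ∀ w : ℂ, w ≠ 0 → ∃ r : ℝ, 0 < r ∧ S.pt k + r * w * (S.pt k - p) ∈ S.punctured k ε := by
      intro w hw
      have hw' : w * (S.pt k - p) ≠ 0 := mul_ne_zero hw (hkp k)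
      have hn : 0 < ‖w * (S.pt k - p)‖ := norm_pos_iff.2 hw'
      refine ⟨ε / (2 * ‖w * (S.pt k - p)‖), by positivity, ?_, ?_⟩
      · rw [Metric.mem_ball, dist_eq_norm, add_sub_cancel_left, mul_assoc, norm_mul,
          Complex.norm_real, Real.norm_eq_abs, abs_of_pos (by positivity)]
        field_simp
        linarith
      · simp only [mem_singleton_iff, add_eq_left, mul_assoc, mul_eq_zero, Complex.ofReal_eq_zero]
        rintro (h | h)
        · exact absurd h (by positivity)
        · exact hw' (mul_eq_zero.2 h)
    have hcoord : ∀ w : ℂ, (S.pt k + w * (S.pt k - p) - S.pt k) / (S.pt k - p) = w := fun w => by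
      rw [add_sub_cancel_left, mul_div_cancel_right₀ _ (hkp k)]
    have hCs : ∀ (r : ℝ) (w : ℂ), 0 < r → w ∈ C → (r : ℂ) * w ∈ C := fun r w hr hw => by
      simp only [C, mem_ofPred_eq, Complex.re_ofReal_mul, Complex.im_ofReal_mul, abs_mul,
        abs_of_pos hr] at hw ⊢
      exact ⟨mul_pos hr hw.1, by nlinarith [hw.2]⟩
    obtain ⟨r₀, hr₀, hc₀⟩ := hscale 1 one_ne_zero
    have h1C : (1 : ℂ) ∈ C := by simp [C, hη0]
    set c₀ := S.pt k + r₀ * 1 * (S.pt k - p) with hc₀def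
    have hc₀V : c₀ ∈ V k := by
      simp only [V, mem_ofPred_eq, hc₀def, hcoord]
      exact hCs r₀ 1 hr₀ h1C
    obtain ⟨F', hF', hF'c⟩ := exists_isPrimitiveOn_eq hφ (hVconv k c₀ hc₀V) hc₀V (hVS k) (G c₀)
    -- `F' = G` on the part near `σ_k`
    have hnear : ∀ z ∈ V k, z ∈ S.punctured k ε → F' z = G z := by
      have hst : StarConvex ℝ c₀ (V k ∩ S.punctured k ε) := by
        have : V k ∩ S.punctured k ε = V k ∩ Metric.ball (S.pt k) ε := by
          ext z
          refine ⟨fun h => ⟨h.1, h.2.1⟩, fun h => ⟨h.1, h.2, ?_⟩⟩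
          rintro rfl
          exact hVS k h.1 k rfl
        rw [this]
        exact (hVconv k c₀ hc₀V).inter ((convex_ball _ _).starConvex hc₀.1)
      intro z hz hz'
      exact (hF'.mono inter_subset_left).eqOn' (hG.mono inter_subset_right) hst ⟨hc₀V, hc₀⟩
        (inter_subset_left.trans (hVS k)) hF'c ⟨hz, hz'⟩
    refine ⟨F', hF', fun z hz hzD => ?_⟩
    set w := (z - S.pt k) / (S.pt k - p) with hw
    have him : w.im ≠ 0 := fun him => by
      have h1 := hzD k
      rw [← neg_sub (S.pt k) p, div_neg, ← hw, Complex.mem_slitPlane_iff] at h1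
      have h2 : 0 < w.re := hz.1
      simp [him] at h1
      linarith
    have hw0 : w ≠ 0 := fun h => him (by rw [h]; rfl)
    have hzw : z = S.pt k + w * (S.pt k - p) := by
      rw [hw, div_mul_cancel₀ _ (hkp k)]; ring
    obtain ⟨r, hr, hc⟩ := hscale w hw0
    set c := S.pt k + r * w * (S.pt k - p) with hcdef
    -- the half of `V k` that contains `z`
    let H : Set ℂ := {x | (x - S.pt k) / (S.pt k - p) ∈ C ∩ {y | 0 < w.im * y.im}}
    have hCH : Convex ℝ (C ∩ {y : ℂ | 0 < w.im * y.im}) := by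
      refine hCc.inter ?_
      have : {y : ℂ | 0 < w.im * y.im} = (w.im • Complex.imLm : ℂ →ₗ[ℝ] ℝ) ⁻¹' Ioi 0 := by
        ext y; simp
      rw [this]
      exact (convex_Ioi 0).linear_preimage _
    have hcH : c ∈ H := by
      simp only [H, mem_ofPred_eq, hcdef, hcoord]
      refine ⟨hCs r w hr hz, ?_⟩
      simp only [mem_ofPred_eq, Complex.im_ofReal_mul]
      have := mul_self_pos.2 him
      nlinarith
    have hzH : z ∈ H := ⟨hz, mul_self_pos.2 him⟩
    have hst : StarConvex ℝ c H := starConvex_preimage_affine (hCH.starConvex hcH)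
    have hHV : H ⊆ V k := fun x hx => hx.1
    have hHD : H ⊆ S.slitDomain p := fun x hx => hVD k x hx.1 fun h => by
      have := hx.2
      simp [h] at this
    refine (hF'.mono hHV).eqOn' (hF.mono hHD) hst hcH (hHV.trans (hVS k)) ?_ hzH
    rw [hnear c (hHV hcH) hc, hFG c ⟨hHD hcH, hc⟩]
  choose F' hF' hF'F using hprim
  let Φ : ℂ → ℂ := fun z => if z ∈ S.slitDomain p then F z else
    if h : ∃ k, z ∈ V k then F' h.choose z else 0
  have hΦD : ∀ z ∈ S.slitDomain p, Φ z = F z := fun z hz => if_pos hz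
  have hΦV : ∀ k, ∀ z ∈ V k, Φ z = F' k z := fun k z hz => by
    by_cases hzD : z ∈ S.slitDomain p
    · rw [hΦD z hzD, hF'F k z hz hzD]
    · have h : ∃ k, z ∈ V k := ⟨k, hz⟩
      simp only [Φ, if_neg hzD, dif_pos h]
      -- A point in two different cones lies on no ray at all, so off the slit plane the cone is
      -- unique.
      have : h.choose = k := by
        by_contra hne
        refine hzD fun j => ?_
        by_cases hj : j = k
        · exact hray j h.choose (fun h' => hne (h'.symm.trans hj)) z h.choose_spec
        · exact hray j k hj z hz
      rw [this]
  refine ⟨Φ, IsPrimitiveOn.of_local hφ fun z hz => ?_⟩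
  by_cases hzD : z ∈ S.slitDomain p
  · exact ⟨S.slitDomain p, isOpen_slitDomain p, hzD, (hF.congr hΦD).mono inter_subset_left⟩
  · simp only [slitDomain, mem_ofPred_eq, not_forall] at hzD
    obtain ⟨k, hk⟩ := hzD
    refine ⟨V k, hVo k, ?_, ((hF' k).congr (hΦV k)).mono inter_subset_left⟩
    rw [Complex.mem_slitPlane_iff, not_or, not_lt, not_not] at hk
    have h0 : (z - S.pt k) / (p - S.pt k) ≠ 0 :=
      div_ne_zero (sub_ne_zero.2 (hz k)) (sub_ne_zero.2 (hp.1 k))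
    have h1 : ((z - S.pt k) / (p - S.pt k)).re < 0 :=
      lt_of_le_of_ne hk.1 fun h => h0 (Complex.ext h hk.2)
    have h2 : (z - S.pt k) / (S.pt k - p) = -((z - S.pt k) / (p - S.pt k)) := by
      rw [← neg_sub p (S.pt k), div_neg]
    change (z - S.pt k) / (S.pt k - p) ∈ C
    rw [h2]
    refine ⟨by rw [Complex.neg_re]; linarith, ?_⟩
    rw [Complex.neg_im, Complex.neg_re, hk.2, neg_zero, abs_zero]
    exact mul_pos hη0 (by linarith)

end PointConfig

/-! ### Primitives as solutions of differential equations -/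

/-- The real linear map `v ↦ a v + b v̄`. -/
def formMap (a b : ℂ) : ℂ →L[ℝ] ℂ :=
  a • ContinuousLinearMap.id ℝ ℂ + b • (Complex.conjCLE : ℂ →L[ℝ] ℂ)

@[simp]
theorem formMap_apply (a b v : ℂ) : formMap a b v = a * v + b * (starRingEnd ℂ) v := by
  simp [formMap]

theorem hasFDerivAt_formMap_zero_iff {F : ℂ → ℂ} {a z : ℂ} :
    HasFDerivAt F (formMap a 0) z ↔ HasDerivAt F a z := by
  have h : formMap a 0 = (ContinuousLinearMap.toSpanSingleton ℂ a).restrictScalars ℝ := by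
    ext v; simp [mul_comm]
  rw [h]
  constructor
  · intro hF
    rw [hasFDerivAt_iff_isLittleO] at hF
    rw [hasDerivAt_iff_hasFDerivAt, hasFDerivAt_iff_isLittleO]
    exact hF
  · intro hF
    exact hF.hasFDerivAt.restrictScalars ℝ

theorem HasFDerivAt.del_dbar {F : ℂ → ℂ} {a b z : ℂ} (h : HasFDerivAt F (formMap a b) z) :
    del F z = a ∧ dbar F z = b := by
  rw [del_eq_of_hasFDerivAt h, dbar_eq_of_hasFDerivAt h]
  simp only [formMap_apply, map_one, Complex.conj_I]
  constructor
  · linear_combination (-a / 2 + b / 2) * Complex.I_sq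
  · linear_combination (a / 2 - b / 2) * Complex.I_sq

/-- A function whose increments are integrals of a form that is continuous at `z`. -/
theorem hasFDerivAt_of_integral {G α β : ℂ → ℂ} {z : ℂ} {r : ℝ} (hr : 0 < r)
    (hα : ContinuousOn α (Metric.ball z r)) (hβ : ContinuousOn β (Metric.ball z r))
    (hG : ∀ w ∈ Metric.ball z r, G w - G z = ∫ t in (0 : ℝ)..1,
      (α (z + t * (w - z)) * (w - z) + β (z + t * (w - z)) * (starRingEnd ℂ) (w - z))) :
    HasFDerivAt G (formMap (α z) (β z)) z := by
  rw [hasFDerivAt_iff_isLittleO, Asymptotics.isLittleO_iff]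
  intro c hc
  have hz : Metric.ball z r ∈ 𝓝 z := Metric.ball_mem_nhds z hr
  have h1 : ∀ᶠ w in 𝓝 z, ‖α w - α z‖ < c / 2 ∧ ‖β w - β z‖ < c / 2 := by
    have ha := (hα.continuousAt hz).eventually (Metric.ball_mem_nhds (α z) (half_pos hc))
    have hb := (hβ.continuousAt hz).eventually (Metric.ball_mem_nhds (β z) (half_pos hc))
    filter_upwards [ha, hb] with w hw hw'
    exact ⟨by simpa [dist_eq_norm] using hw, by simpa [dist_eq_norm] using hw'⟩
  obtain ⟨δ, hδ, hδ'⟩ := Metric.eventually_nhds_iff_ball.1 h1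
  filter_upwards [Metric.ball_mem_nhds z hδ, hz] with w hw hwr
  have hseg : ∀ t ∈ Icc (0 : ℝ) 1, ‖z + t * (w - z) - z‖ ≤ ‖w - z‖ := fun t ht => by
    rw [add_sub_cancel_left, norm_mul, Complex.norm_real, Real.norm_eq_abs, abs_of_nonneg ht.1]
    exact mul_le_of_le_one_left (norm_nonneg _) ht.2
  have hmem : ∀ ρ, w ∈ Metric.ball z ρ → ∀ t ∈ Icc (0 : ℝ) 1, z + t * (w - z) ∈ Metric.ball z ρ :=
    fun ρ hρ t ht => by
      rw [Metric.mem_ball, dist_eq_norm] at hρ ⊢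
      exact (hseg t ht).trans_lt hρ
  have hcont : ∀ γ : ℂ → ℂ, ContinuousOn γ (Metric.ball z r) →
      ContinuousOn (fun t : ℝ => γ (z + t * (w - z))) (Icc 0 1) := fun γ hγ =>
    hγ.comp (by fun_prop) (hmem r hwr)
  have hint : IntervalIntegrable (fun t : ℝ => α (z + t * (w - z)) * (w - z) +
      β (z + t * (w - z)) * (starRingEnd ℂ) (w - z)) volume 0 1 :=
    ContinuousOn.intervalIntegrable_of_Icc zero_le_one
      (((hcont α hα).mul continuousOn_const).add ((hcont β hβ).mul continuousOn_const))
  have hconst : formMap (α z) (β z) (w - z) = ∫ _ in (0 : ℝ)..1, formMap (α z) (β z) (w - z) := by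
    simp
  rw [hG w hwr, hconst, ← intervalIntegral.integral_sub hint (by simp)]
  refine (intervalIntegral.norm_integral_le_of_norm_le_const (C := c * ‖w - z‖) ?_).trans (by simp)
  intro t ht
  rw [uIoc_of_le zero_le_one] at ht
  obtain ⟨ha, hb⟩ := hδ' _ (hmem δ hw t (Ioc_subset_Icc_self ht))
  rw [formMap_apply]
  have e : α (z + t * (w - z)) * (w - z) + β (z + t * (w - z)) * (starRingEnd ℂ) (w - z) -
      (α z * (w - z) + β z * (starRingEnd ℂ) (w - z)) =
      (α (z + t * (w - z)) - α z) * (w - z) + (β (z + t * (w - z)) - β z) * (starRingEnd ℂ) (w - z) := by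
    ring
  rw [e]
  refine (norm_add_le _ _).trans ?_
  rw [norm_mul, norm_mul, RCLike.norm_conj]
  have := norm_nonneg (w - z)
  nlinarith

namespace PointConfig

variable {n : ℕ} {S : PointConfig n} {s : Fin (n + 1) → ℝ}

theorem LogSystem.hasDerivAt_log {W : Set ℂ} (l : S.LogSystem W) (k : Fin (n + 1)) {z : ℂ}
    (hW : W ∈ 𝓝 z) : HasDerivAt (l.log k) (1 / (z - S.pt k)) z := by
  have hc := S.factorDeriv_ne_zero k
  have hz := mem_of_mem_nhds hW
  have hzk : z - S.pt k ≠ 0 := sub_ne_zero.2 (l.subset_compl hz k)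
  have hf : HasDerivAt (fun w => Complex.exp w / S.factorDeriv k + S.pt k)
      (z - S.pt k) (l.log k z) := by
    have := ((Complex.hasDerivAt_exp (l.log k z)).div_const (S.factorDeriv k)).add_const (S.pt k)
    rwa [l.exp_log k z hz, factor_eq, mul_div_cancel_left₀ _ hc] at this
  have := HasDerivAt.of_local_left_inverse ((l.continuousOn_log k).continuousAt hW) hf hzk
    (by
      filter_upwards [hW] with y hy
      rw [l.exp_log k y hy, factor_eq, mul_div_cancel_left₀ _ hc, sub_add_cancel])
  rwa [one_div]

theorem LogSystem.hasDerivAt_sec {W : Set ℂ} (l : S.LogSystem W) (s : Fin (n + 1) → ℝ) {z : ℂ}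
    (hW : W ∈ 𝓝 z) : HasDerivAt (l.sec s) (S.connForm s z * l.sec s z) z := by
  have h := HasDerivAt.fun_sum (u := Finset.univ)
    fun k _ => (l.hasDerivAt_log k hW).const_mul (s k : ℂ)
  have h2 := h.cexp
  refine h2.congr_deriv ?_
  rw [connForm, mul_comm]
  simp only [LogSystem.sec, mul_one_div]

theorem LogSystem.segment_map {W : Set ℂ} (l : S.LogSystem W) (s : Fin (n + 1) → ℝ) {p z : ℂ}
    (hW : StarConvex ℝ p W) (hz : z ∈ W) {t : ℝ} (ht : t ∈ Icc (0 : ℝ) 1) :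
    (l.segment s hW hz).map (edge t) = p + t * (z - p) ∧
    (l.segment s hW hz).sec (edge t) = l.sec s (p + t * (z - p)) := by
  have : (edge t).1 1 = t := by rw [edge_coe ht]; rfl
  constructor
  · change p + (((edge t).1 1 : ℝ) : ℂ) * (z - p) = _
    rw [this]
  · change l.sec s (p + (((edge t).1 1 : ℝ) : ℂ) * (z - p)) = _
    rw [this]

theorem LogSystem.segment_mem {W : Set ℂ} (l : S.LogSystem W) (s : Fin (n + 1) → ℝ) {p z : ℂ}
    (hW : StarConvex ℝ p W) (hz : z ∈ W) (q : Simplex 1) : (l.segment s hW hz).map q ∈ W := by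
  have h2 := q.2.2
  rw [Fin.sum_univ_two] at h2
  have := hW hz (q.2.1 0) (q.2.1 1) h2
  convert this using 1
  change p + ((q.1 1 : ℝ) : ℂ) * (z - p) = _
  rw [Complex.real_smul, Complex.real_smul, show q.1 0 = 1 - q.1 1 by linarith]
  push_cast
  ring

/-- The integral of the twisted form `u (α dz + β dz̄)` along a simplex with section `u`. -/
def formIntegral (α β : ℂ → ℂ) (T : S.TwistedSimplex s 1) : ℂ :=
  ∫ t in (0 : ℝ)..1, T.sec (edge t) * (α (T.map (edge t)) * deriv (fun t => T.map (edge t)) t +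
    β (T.map (edge t)) * (starRingEnd ℂ) (deriv (fun t => T.map (edge t)) t))

/-- Primitives of a cochain given by integration of a continuous form solve the corresponding
differential equation. -/
theorem IsPrimitiveOn.hasFDerivAt {φ : S.Cochain s 1} {F α β : ℂ → ℂ} {W : Set ℂ}
    (hF : IsPrimitiveOn φ F W) (hW : IsOpen W) (hWS : W ⊆ S.compl) (hα : ContinuousOn α W)
    (hβ : ContinuousOn β W)
    (hφ : ∀ T : S.TwistedSimplex s 1, (∀ p, T.map p ∈ W) → φ T = formIntegral α β T)
    {z : ℂ} (hz : z ∈ W) :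
    HasFDerivAt F (formMap (α z - S.connForm s z * F z) (β z)) z := by
  obtain ⟨r, hr, hball⟩ := Metric.isOpen_iff.1 hW z hz
  have hst : StarConvex ℝ z (Metric.ball z r) :=
    (convex_ball z r).starConvex (Metric.mem_ball_self hr)
  have hzb : Metric.ball z r ∈ 𝓝 z := Metric.ball_mem_nhds z hr
  obtain ⟨l⟩ := exists_logSystem hst (Metric.mem_ball_self hr) (hball.trans hWS)
  have hsecc : ContinuousOn (l.sec s) (Metric.ball z r) := fun w hw =>
    (l.hasDerivAt_sec s (Metric.isOpen_ball.mem_nhds hw)).continuousAt.continuousWithinAt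
  -- The product of F with the local branch has ordinary line integrals as increments. Dividing by
  -- the branch again produces the connection term.
  have hG : HasFDerivAt (fun w => l.sec s w * F w) (formMap (l.sec s z * α z) (l.sec s z * β z)) z := by
    refine hasFDerivAt_of_integral (α := fun w => l.sec s w * α w) (β := fun w => l.sec s w * β w)
      hr (hsecc.mul (hα.mono hball)) (hsecc.mul (hβ.mono hball)) fun w hw => ?_
    set T := l.segment s hst hw with hT
    have hTm : ∀ p, T.map p ∈ W := fun p => hball (l.segment_mem s hst hw p)
    have h1 := hF T hTm
    rw [hT, bdry_segment, ← hT] at h1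
    rw [← h1, hφ T hTm, formIntegral]
    refine intervalIntegral.integral_congr_Ioo_of_le zero_le_one fun t ht => ?_
    have ht' := Ioo_subset_Icc_self ht
    have hder : deriv (fun t => T.map (edge t)) t = w - z := by
      refine HasDerivAt.deriv (HasDerivAt.congr_of_eventuallyEq (f := fun t : ℝ => z + t * (w - z))
        ?_ ?_)
      · have := ((hasDerivAt_id t).ofReal_comp.mul_const (w - z)).const_add z
        simpa using this
      · filter_upwards [Icc_mem_nhds ht.1 ht.2] with r hr using (l.segment_map s hst hw hr).1
    simp only [hder]
    rw [(l.segment_map s hst hw ht').1, (l.segment_map s hst hw ht').2]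
    ring
  have hsec := (hasFDerivAt_formMap_zero_iff.2 (l.hasDerivAt_sec s hzb))
  have h0 := l.sec_ne_zero (s := s) z
  have hinv := (l.hasDerivAt_sec s hzb).inv h0
  have hprod := hG.mul (hasFDerivAt_formMap_zero_iff.2 hinv)
  have hFG : F = fun w => l.sec s w * F w * (l.sec s w)⁻¹ := by
    ext w
    rw [mul_comm, inv_mul_cancel_left₀ (l.sec_ne_zero w)]
  rw [hFG]
  refine hprod.congr_fderiv ?_
  ext1 v
  simp only [add_apply, smul_apply, formMap_apply, smul_eq_mul, Pi.inv_apply]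
  field_simp
  ring

theorem formIntegral_zero (f : ℂ → ℂ) (T : S.TwistedSimplex s 1) :
    formIntegral f 0 T = T.integral f := by
  simp only [formIntegral, TwistedSimplex.integral, Pi.zero_apply, zero_mul, add_zero, mul_assoc]

theorem continuousOn_regular (f : S.regularFunctions) : ContinuousOn f.1 S.compl := fun _ hz =>
  (S.regularFunctions_differentiableAt f hz).continuousAt.continuousWithinAt

/-- Primitives of the period cochain of `f dz` solve `F' + F ∑ s_k / (z - σ_k) = f`. -/
theorem IsPrimitiveOn.hasDerivAt {f : S.regularFunctions} {F : ℂ → ℂ} {W : Set ℂ}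
    (hF : IsPrimitiveOn (S.periodCochain s f) F W) (hW : IsOpen W) (hWS : W ⊆ S.compl)
    {z : ℂ} (hz : z ∈ W) : HasDerivAt F (f.1 z - S.connForm s z * F z) z :=
  hasFDerivAt_formMap_zero_iff.1 (hF.hasFDerivAt (β := 0) hW hWS ((continuousOn_regular f).mono hWS)
    continuousOn_const (fun T _ => (formIntegral_zero f.1 T).symm) hz)

/-- Along the simplex d(u F) = u f dz. This is the converse of `IsPrimitiveOn.hasDerivAt`: solutions
of the differential equation are primitives. -/
theorem integral_eq_bdry {f : S.regularFunctions} {F : ℂ → ℂ} (T : S.TwistedSimplex s 1)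
    (hF : ∀ p, HasDerivAt F (f.1 (T.map p) - S.connForm s (T.map p) * F (T.map p)) (T.map p)) :
    T.integral f.1 = bdry F T := by
  obtain ⟨U, g, hU, hsub, hgU, hg⟩ := T.smooth
  rw [T.integral_eq_sub f hU hsub hgU hg (H := fun p => T.secExt p * F (g p))]
  · simp only [bdry, ← T.secExt_apply, hg]
  · intro p hp
    have hgd := ((hgU.contDiffAt (hU.mem_nhds (hsub hp))).differentiableAt (by simp)).hasFDerivAt
    have h1 := T.hasFDerivWithinAt_secExt hg hp hgd.hasFDerivWithinAt
    have h2 := (hg ⟨p, hp⟩ ▸ hF ⟨p, hp⟩).comp_hasFDerivAt_of_eq p hgd rfl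
    refine (h1.mul h2.hasFDerivWithinAt).congr_fderiv ?_
    ext v
    simp only [add_apply, smul_apply, smul_eq_mul, Function.comp]
    ring

/-! ### Every class is the class of a logarithmic form -/

variable (S) in
/-- The regular function `p / ∏ (z - σ_k) ^ (m + 1)`. -/
def ofPoly (p : Polynomial ℂ) (m : ℕ) : S.regularFunctions :=
  ⟨fun z => p.eval z / S.denom z ^ (m + 1), p, m, fun _ => rfl⟩

theorem regular_ext {f g : S.regularFunctions} (h : ∀ z ∈ S.compl, f.1 z = g.1 z) : f = g := by
  ext z
  by_cases hz : z ∈ S.compl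
  · exact h z hz
  · rw [S.regularFunctions_apply_of_notMem f hz, S.regularFunctions_apply_of_notMem g hz]

theorem covariantDeriv_apply (f : S.regularFunctions) {z : ℂ} (hz : z ∈ S.compl) :
    (S.covariantDeriv s f).1 z = deriv f.1 z + S.connForm s z * f.1 z :=
  indicator_of_mem hz fun z => deriv f.1 z + S.connForm s z * f.1 z

theorem logForm_apply (a : Fin (n + 1) → ℂ) {z : ℂ} (hz : z ∈ S.compl) :
    (S.logForm a).1 z = ∑ k, a k / (z - S.pt k) :=
  indicator_of_mem hz fun z => ∑ k, a k / (z - S.pt k)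

theorem derivative_denomPoly : Polynomial.derivative S.denomPoly = S.coPoly fun _ => 1 := by
  rw [denomPoly, Polynomial.derivative_prod_finset, coPoly]
  simp

theorem eval_prod_erase_ne_zero (k : Fin (n + 1)) :
    (∏ j ∈ Finset.univ.erase k, (Polynomial.X - Polynomial.C (S.pt j))).eval (S.pt k) ≠ 0 := by
  rw [Polynomial.eval_prod]
  refine Finset.prod_ne_zero_iff.2 fun j hj => ?_
  simp only [Polynomial.eval_sub, Polynomial.eval_X, Polynomial.eval_C]
  exact sub_ne_zero.2 fun h => Finset.ne_of_mem_erase hj (S.injective h).symm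

theorem eval_coPoly (a : Fin (n + 1) → ℂ) (k : Fin (n + 1)) :
    (S.coPoly a).eval (S.pt k) = a k *
      (∏ j ∈ Finset.univ.erase k, (Polynomial.X - Polynomial.C (S.pt j))).eval (S.pt k) := by
  rw [coPoly, Polynomial.eval_finsetSum, Finset.sum_eq_single k]
  · simp
  · intro j _ hj
    rw [Polynomial.eval_mul, Polynomial.eval_prod,
      Finset.prod_eq_zero (Finset.mem_erase.2 ⟨hj.symm, Finset.mem_univ k⟩) (by simp), mul_zero]
  · simp

theorem natDegree_prod_erase (k : Fin (n + 1)) :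
    (∏ j ∈ Finset.univ.erase k, (Polynomial.X - Polynomial.C (S.pt j))).natDegree = n := by
  rw [Polynomial.natDegree_finsetProd_X_sub_C_eq_card, Finset.card_erase_of_mem (Finset.mem_univ k)]
  simp

theorem natDegree_coPoly_le (a : Fin (n + 1) → ℂ) : (S.coPoly a).natDegree ≤ n :=
  Polynomial.natDegree_sum_le_of_forall_le _ _ fun k _ =>
    (Polynomial.natDegree_C_mul_le _ _).trans (natDegree_prod_erase k).le

theorem coeff_coPoly (a : Fin (n + 1) → ℂ) : (S.coPoly a).coeff n = ∑ k, a k := by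
  rw [coPoly, Polynomial.finsetSum_coeff]
  refine Finset.sum_congr rfl fun k _ => ?_
  have h : (∏ j ∈ Finset.univ.erase k, (Polynomial.X - Polynomial.C (S.pt j))).Monic :=
    Polynomial.monic_prod_of_monic _ _ fun j _ => Polynomial.monic_X_sub_C _
  have := h.coeff_natDegree
  rw [natDegree_prod_erase] at this
  rw [Polynomial.coeff_C_mul, this, mul_one]

theorem covariantDeriv_ofPoly (p : Polynomial ℂ) (m : ℕ) :
    S.covariantDeriv s (S.ofPoly p m) =
      S.ofPoly (Polynomial.derivative p * S.denomPoly - (m + 1 : ℕ) * p * S.coPoly (fun _ => 1)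
        + S.coPoly (fun k => (s k : ℂ)) * p) (m + 1) := by
  refine regular_ext fun z hz => ?_
  have hd := S.denom_ne_zero hz
  have hd' : S.denomPoly.eval z ≠ 0 := by rwa [eval_denomPoly]
  have hf : (S.ofPoly p m).1 = fun z => p.eval z / S.denomPoly.eval z ^ (m + 1) := by
    ext z; rw [eval_denomPoly]; rfl
  have hder : deriv (S.ofPoly p m).1 z = ((Polynomial.derivative p).eval z * S.denom z
      - (m + 1 : ℕ) * p.eval z * (Polynomial.derivative S.denomPoly).eval z)
        / S.denom z ^ (m + 2) := by
    rw [hf]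
    have := (p.hasDerivAt z).div ((S.denomPoly.hasDerivAt z).fun_pow (m + 1)) (pow_ne_zero _ hd')
    refine this.deriv.trans ?_
    simp only [eval_denomPoly, Nat.add_sub_cancel]
    field_simp
    ring
  rw [covariantDeriv_apply _ hz, hder, connForm, S.sum_div_eq _ hz]
  simp only [ofPoly, Polynomial.eval_add, Polynomial.eval_sub, Polynomial.eval_mul, eval_denomPoly,
    Polynomial.eval_natCast, derivative_denomPoly]
  field_simp
  ring

theorem ofPoly_denom_mul (p : Polynomial ℂ) (m : ℕ) :
    S.ofPoly (S.denomPoly * p) (m + 1) = S.ofPoly p m := by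
  refine regular_ext fun z hz => ?_
  have hd := S.denom_ne_zero hz
  simp only [ofPoly, Polynomial.eval_mul, eval_denomPoly]
  field_simp
  ring

theorem ofPoly_sub (p q : Polynomial ℂ) (m : ℕ) :
    S.ofPoly (p - q) m = S.ofPoly p m - S.ofPoly q m := by
  refine regular_ext fun z _ => ?_
  simp only [ofPoly, Polynomial.eval_sub, sub_div, AddSubgroupClass.coe_sub, Pi.sub_apply]

theorem denomPoly_dvd {p : Polynomial ℂ} (h : ∀ k, p.eval (S.pt k) = 0) : S.denomPoly ∣ p :=
  Finset.prod_dvd_of_coprime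
    (fun _ _ _ _ hij => Polynomial.pairwise_coprime_X_sub_C S.injective hij)
    fun k _ => Polynomial.dvd_iff_isRoot.2 (h k)

/-- Lowering the order of the poles. -/
theorem exists_ofPoly_sub_mem (hs : ∀ k, |s k| < 1) (p : Polynomial ℂ) (m : ℕ) :
    ∃ q, S.ofPoly p (m + 1) - S.ofPoly q m ∈ LinearMap.range (S.covariantDeriv s) := by
  let e : Fin (n + 1) → ℂ := fun k =>
    (∏ j ∈ Finset.univ.erase k, (Polynomial.X - Polynomial.C (S.pt j))).eval (S.pt k)
  -- Writing D for `denomPoly`, the numerator of ∇ (t / D^{m+1}) over D^{m+2} takes the value (s_k -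
  -- (m + 1)) e_k t(σ_k) at σ_k. Interpolation matches it with p there; the factor is nonzero
  -- because |s_k| < 1.
  let t : Polynomial ℂ := Lagrange.interpolate Finset.univ S.pt
    fun k => p.eval (S.pt k) / (((s k : ℂ) - (m + 1 : ℕ)) * e k)
  have ht : ∀ k, t.eval (S.pt k) = p.eval (S.pt k) / (((s k : ℂ) - (m + 1 : ℕ)) * e k) := fun k =>
    Lagrange.eval_interpolate_at_node _ (S.injective.injOn) (Finset.mem_univ k)
  set t' := Polynomial.derivative t * S.denomPoly - (m + 1 : ℕ) * t * S.coPoly (fun _ => 1)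
        + S.coPoly (fun k => (s k : ℂ)) * t with ht'
  obtain ⟨q, hq⟩ : S.denomPoly ∣ p - t' := by
    refine denomPoly_dvd fun k => ?_
    have hD : S.denomPoly.eval (S.pt k) = 0 := by
      rw [eval_denomPoly]
      exact S.denom_eq_zero fun h => h k rfl
    have he : e k ≠ 0 := eval_prod_erase_ne_zero k
    have hsm : (s k : ℂ) - (m + 1 : ℕ) ≠ 0 := by
      rw [sub_ne_zero]
      intro h
      have h1 : s k = (m + 1 : ℕ) := by exact_mod_cast h
      have h2 := (le_abs_self _).trans_lt (hs k)
      rw [h1] at h2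
      push_cast at h2
      linarith [Nat.cast_nonneg (α := ℝ) m]
    simp only [ht', Polynomial.eval_sub, Polynomial.eval_add, Polynomial.eval_mul, hD, ht,
      eval_coPoly, Polynomial.eval_natCast]
    change _ - (_ - _ * _ * (1 * e k) + _ * e k * _) = 0
    field_simp
    ring
  refine ⟨q, S.ofPoly t m, ?_⟩
  rw [covariantDeriv_ofPoly, ← ofPoly_denom_mul q, ← ofPoly_sub, ← hq]
  congr 1
  ring

/-- Lowering the order of the pole at infinity. -/
theorem exists_ofPoly_natDegree_le (hs : |∑ k, s k| < 1) (N : ℕ) : ∀ p : Polynomial ℂ,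
    p.natDegree ≤ n + N → ∃ q : Polynomial ℂ, q.natDegree ≤ n ∧
      S.ofPoly p 0 - S.ofPoly q 0 ∈ LinearMap.range (S.covariantDeriv s) := by
  induction N with
  | zero => exact fun p hp => ⟨p, hp, by simp⟩
  | succ N ih =>
    intro p hp
    -- The numerator of ∇ X^{N+1} over `denomPoly`. Its coefficient in degree n + N + 1 is N + 1 + ∑
    -- s_k, which is nonzero because |∑ s_k| < 1.
    let Q : Polynomial ℂ := ((N + 1 : ℕ) : Polynomial ℂ) * Polynomial.X ^ N * S.denomPoly +
      S.coPoly (fun k => (s k : ℂ)) * Polynomial.X ^ (N + 1)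
    have hDm : S.denomPoly.Monic := Polynomial.monic_prod_of_monic _ _ fun j _ =>
      Polynomial.monic_X_sub_C _
    have hDn : S.denomPoly.natDegree = n + 1 := by
      rw [denomPoly, Polynomial.natDegree_finsetProd_X_sub_C_eq_card]
      simp
    have hDc : S.denomPoly.coeff (n + 1) = 1 := by
      rw [← hDn]; exact hDm.coeff_natDegree
    have hQd : Q.natDegree ≤ n + (N + 1) := by
      refine Polynomial.natDegree_add_le_of_degree_le ?_ ?_
      · refine (Polynomial.natDegree_mul_le_of_le (m := N) (n := n + 1) ?_ hDn.le).trans (by omega)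
        refine (Polynomial.natDegree_mul_le).trans ?_
        rw [Polynomial.natDegree_natCast, Polynomial.natDegree_X_pow, zero_add]
      · exact Polynomial.natDegree_mul_le_of_le (natDegree_coPoly_le _)
          (Polynomial.natDegree_X_pow_le _)
    have hQc : Q.coeff (n + (N + 1)) = (N + 1 : ℕ) + ∑ k, (s k : ℂ) := by
      have e1 : ((N + 1 : ℕ) : Polynomial ℂ) * Polynomial.X ^ N * S.denomPoly =
          Polynomial.C ((N + 1 : ℕ) : ℂ) * (S.denomPoly * Polynomial.X ^ N) := by
        rw [Polynomial.C_eq_natCast]; ring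
      rw [Polynomial.coeff_add, e1, Polynomial.coeff_C_mul,
        show n + (N + 1) = (n + 1) + N by ring, Polynomial.coeff_mul_X_pow, hDc,
        show n + 1 + N = n + (N + 1) by ring, Polynomial.coeff_mul_X_pow, coeff_coPoly, mul_one]
    have hne : ((N + 1 : ℕ) : ℂ) + ∑ k, (s k : ℂ) ≠ 0 := by
      have : ((N + 1 : ℕ) : ℝ) + ∑ k, s k ≠ 0 := by
        have := (abs_lt.1 hs).1
        push_cast
        linarith [Nat.cast_nonneg (α := ℝ) N]
      exact_mod_cast this
    set c := p.coeff (n + (N + 1)) / ((N + 1 : ℕ) + ∑ k, (s k : ℂ)) with hc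
    have hdeg : (p - Polynomial.C c * Q).natDegree ≤ n + N := by
      have h1 : (p - Polynomial.C c * Q).natDegree ≤ n + (N + 1) :=
        Polynomial.natDegree_sub_le_of_le hp ((Polynomial.natDegree_C_mul_le _ _).trans hQd)
          |>.trans (max_self _).le
      refine (Polynomial.natDegree_le_pred h1 ?_).trans (by omega)
      rw [Polynomial.coeff_sub, Polynomial.coeff_C_mul, hQc, hc, div_mul_cancel₀ _ hne, sub_self]
    obtain ⟨q, hq, hmem⟩ := ih _ hdeg
    refine ⟨q, hq, ?_⟩
    have hQmem : S.ofPoly (Polynomial.C c * Q) 0 ∈ LinearMap.range (S.covariantDeriv s) := by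
      refine ⟨S.ofPoly (Polynomial.C c * Polynomial.X ^ (N + 1) * S.denomPoly) 0, ?_⟩
      rw [covariantDeriv_ofPoly, ← ofPoly_denom_mul (Polynomial.C c * Q) 0]
      congr 1
      simp only [Polynomial.derivative_mul, derivative_denomPoly, Polynomial.derivative_X_pow,
        Polynomial.derivative_C, Q]
      simp only [Polynomial.C_eq_natCast, Nat.add_sub_cancel]
      push_cast
      ring
    have := add_mem hmem hQmem
    rw [ofPoly_sub] at this
    convert this using 1
    abel

/-- Partial fractions: the residue at σ_k is p(σ_k) divided by the product of the σ_k - σ_j, and a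
polynomial of degree at most n is determined by its values at n + 1 points. -/
theorem exists_logForm_eq_ofPoly {p : Polynomial ℂ} (hp : p.natDegree ≤ n) :
    ∃ a, S.logForm a = S.ofPoly p 0 := by
  let a : Fin (n + 1) → ℂ := fun k => p.eval (S.pt k) /
    (∏ j ∈ Finset.univ.erase k, (Polynomial.X - Polynomial.C (S.pt j))).eval (S.pt k)
  have h : S.coPoly a = p := by
    refine Polynomial.eq_of_natDegree_lt_card_of_eval_eq _ _ S.injective (fun k => ?_) ?_
    · rw [eval_coPoly, div_mul_cancel₀ _ (eval_prod_erase_ne_zero k)]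
    · rw [Fintype.card_fin]
      exact Nat.lt_succ_of_le (max_le (natDegree_coPoly_le a) hp)
  refine ⟨a, regular_ext fun z hz => ?_⟩
  rw [logForm_apply _ hz, S.sum_div_eq _ hz, h]
  simp [ofPoly]

/-- Every class in `H¹_dR` is the class of a logarithmic form. -/
theorem exists_logForm (hs : ∀ k, |s k| < 1) (hs' : |∑ k, s k| < 1) (f : S.regularFunctions) :
    ∃ a, f - S.logForm a ∈ LinearMap.range (S.covariantDeriv s) := by
  obtain ⟨p, m, hpm⟩ := f.2
  have hf : f = S.ofPoly p m := Subtype.ext (funext hpm)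
  have h0 : ∀ m p, ∃ q, S.ofPoly p m - S.ofPoly q 0 ∈ LinearMap.range (S.covariantDeriv s) := by
    intro m
    induction m with
    | zero => exact fun p => ⟨p, by simp⟩
    | succ m ih =>
      intro p
      obtain ⟨q, hq⟩ := exists_ofPoly_sub_mem (S := S) hs p m
      obtain ⟨r, hr⟩ := ih q
      exact ⟨r, by simpa using add_mem hq hr⟩
  obtain ⟨q, hq⟩ := h0 m p
  obtain ⟨r, hr, hr'⟩ := exists_ofPoly_natDegree_le (S := S) (s := s) hs' q.natDegree q (by omega)
  obtain ⟨a, ha⟩ := exists_logForm_eq_ofPoly (S := S) hr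
  exact ⟨a, by rw [hf, ha]; simpa using add_mem hq hr'⟩

theorem logForm_add (a b : Fin (n + 1) → ℂ) : S.logForm (a + b) = S.logForm a + S.logForm b := by
  refine regular_ext fun z hz => ?_
  simp only [Submodule.coe_add, Pi.add_apply, logForm_apply _ hz, add_div, Finset.sum_add_distrib]

theorem logForm_smul (c : ℂ) (a : Fin (n + 1) → ℂ) : S.logForm (c • a) = c • S.logForm a := by
  refine regular_ext fun z hz => ?_
  simp only [Submodule.coe_smul, Pi.smul_apply, logForm_apply _ hz, smul_eq_mul, Finset.mul_sum,
    mul_div_assoc]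

variable (S) in
/-- `logForm` as a linear map. -/
def logFormₗ : (Fin (n + 1) → ℂ) →ₗ[ℂ] S.regularFunctions where
  toFun := S.logForm
  map_add' := logForm_add
  map_smul' := logForm_smul

/-- The form is ∇_s 1. The function 1 has to be written as a quotient D/D, because representatives
vanish on Σ. -/
theorem logForm_exponents_mem :
    S.logForm (fun k => (s k : ℂ)) ∈ LinearMap.range (S.covariantDeriv s) := by
  refine ⟨S.ofPoly S.denomPoly 0, regular_ext fun z hz => ?_⟩
  have h1 : ∀ w ∈ S.compl, (S.ofPoly S.denomPoly 0).1 w = 1 := fun w hw => by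
    simp only [ofPoly, eval_denomPoly, zero_add, pow_one]
    exact div_self (S.denom_ne_zero hw)
  have h2 : deriv (S.ofPoly S.denomPoly 0).1 z = 0 := by
    rw [EventuallyEq.deriv_eq (f := fun _ => (1 : ℂ)), deriv_const]
    filter_upwards [S.isOpen_compl.mem_nhds hz] with w hw using h1 w hw
  rw [covariantDeriv_apply _ hz, h2, h1 z hz, logForm_apply _ hz, connForm, zero_add, mul_one]

/-! ### Logarithmic forms near `σ_k` and near infinity -/

variable (S) in
/-- `(z - σ_k) ∑ a_j / (z - σ_j)`, extended to `σ_k`. -/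
def regPart (a : Fin (n + 1) → ℂ) (k : Fin (n + 1)) (z : ℂ) : ℂ :=
  a k + (z - S.pt k) * ∑ j ∈ Finset.univ.erase k, a j / (z - S.pt j)

variable (S) in
/-- `z ∑ a_j / (z - σ_j)` as a function of `w = 1 / z`. -/
def infPart (a : Fin (n + 1) → ℂ) (w : ℂ) : ℂ := ∑ j, a j / (1 - S.pt j * w)

@[simp]
theorem regPart_pt (a : Fin (n + 1) → ℂ) (k : Fin (n + 1)) : S.regPart a k (S.pt k) = a k := by
  simp [regPart]

@[simp]
theorem infPart_zero (a : Fin (n + 1) → ℂ) : S.infPart a 0 = ∑ k, a k := by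
  simp [infPart]

theorem sum_div_eq_regPart (a : Fin (n + 1) → ℂ) (k : Fin (n + 1)) {z : ℂ} (hz : z ∈ S.compl) :
    ∑ j, a j / (z - S.pt j) = S.regPart a k z / (z - S.pt k) := by
  have := sub_ne_zero.2 (hz k)
  rw [← Finset.add_sum_erase _ _ (Finset.mem_univ k), regPart]
  field_simp

theorem sum_div_eq_infPart (a : Fin (n + 1) → ℂ) {z : ℂ} (hz : z ≠ 0) :
    ∑ j, a j / (z - S.pt j) = z⁻¹ * S.infPart a z⁻¹ := by
  rw [infPart, Finset.mul_sum]
  refine Finset.sum_congr rfl fun j _ => ?_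
  have : z - S.pt j = z * (1 - S.pt j * z⁻¹) := by field_simp
  rw [this, div_mul_eq_div_div, div_eq_mul_inv _ z]
  ring

theorem differentiableOn_regPart (a : Fin (n + 1) → ℂ) {ε : ℝ}
    (hε : ∀ j k, j ≠ k → ε ≤ dist (S.pt j) (S.pt k)) (k : Fin (n + 1)) :
    DifferentiableOn ℂ (S.regPart a k) (Metric.ball (S.pt k) ε) := fun z hz => by
  refine ((differentiableAt_const _).add ((differentiableAt_id.sub_const _).mul
    (DifferentiableAt.fun_sum fun j hj => ?_))).differentiableWithinAt
  refine (differentiableAt_const _).div (differentiableAt_id.sub_const _) (sub_ne_zero.2 ?_)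
  rintro rfl
  exact notMem_ball hε (Finset.ne_of_mem_erase hj) hz

theorem one_sub_ne_zero {ρ : ℝ} (hρ : ∀ k, ρ * ‖S.pt k‖ ≤ 1) {w : ℂ}
    (hw : w ∈ Metric.ball (0 : ℂ) ρ) (k : Fin (n + 1)) : 1 - S.pt k * w ≠ 0 := by
  intro h
  have h1 : ‖S.pt k * w‖ = 1 := by rw [← sub_eq_zero.1 h, norm_one]
  rw [norm_mul] at h1
  have h2 : ‖w‖ < ρ := by simpa using hw
  have h3 : 0 < ‖S.pt k‖ := by
    refine lt_of_le_of_ne (norm_nonneg _) fun h0 => ?_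
    rw [← h0, zero_mul] at h1
    exact zero_ne_one h1
  nlinarith [hρ k]

theorem differentiableOn_infPart (a : Fin (n + 1) → ℂ) {ρ : ℝ} (hρ : ∀ k, ρ * ‖S.pt k‖ ≤ 1) :
    DifferentiableOn ℂ (S.infPart a) (Metric.ball 0 ρ) := fun w hw => by
  refine (DifferentiableAt.fun_sum fun k _ => ?_).differentiableWithinAt
  exact (differentiableAt_const _).div ((differentiableAt_const _).sub
    ((differentiableAt_const _).mul differentiableAt_id)) (one_sub_ne_zero hρ hw k)

variable (S) in
theorem exists_radius_infty : ∃ ρ > 0, ∀ k, ρ * ‖S.pt k‖ ≤ 1 := by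
  have h : ∀ᶠ ρ : ℝ in 𝓝[>] 0, ∀ k, ρ * ‖S.pt k‖ ≤ 1 := by
    rw [eventually_all]
    intro k
    have hc : Continuous fun ρ : ℝ => ρ * ‖S.pt k‖ := by fun_prop
    have := (hc.tendsto 0).mono_left (nhdsWithin_le_nhds (s := Ioi 0))
    rw [zero_mul] at this
    exact this.eventually_le_const one_pos
  obtain ⟨ρ, h1, h2⟩ := (h.and self_mem_nhdsWithin).exists
  exact ⟨ρ, h2, h1⟩

theorem mem_compl_of_inv_mem {ρ : ℝ} (hρ : ∀ k, ρ * ‖S.pt k‖ ≤ 1) {z : ℂ}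
    (hz : z⁻¹ ∈ Metric.ball (0 : ℂ) ρ) (hz0 : z ≠ 0) : z ∈ S.compl := by
  rintro k rfl
  have := one_sub_ne_zero hρ hz k
  rw [mul_inv_cancel₀ hz0, sub_self] at this
  exact this rfl

/-- Solutions of `F' + F ∑ s_k / (z - σ_k) = ∑ a_k / (z - σ_k)` extend to `σ_k`. -/
theorem exists_extension {F : ℂ → ℂ} {a : Fin (n + 1) → ℂ} {ε : ℝ} (hε0 : 0 < ε)
    (hε : ∀ j k, j ≠ k → ε ≤ dist (S.pt j) (S.pt k)) (k : Fin (n + 1)) (hs : |s k| < 1)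
    (hF : ∀ z ∈ S.punctured k ε, HasDerivAt F ((S.logForm a).1 z - S.connForm s z * F z) z) :
    ∃ G : ℂ → ℂ, DifferentiableOn ℂ G (Metric.ball (S.pt k) ε) ∧ (s k : ℂ) * G (S.pt k) = a k ∧
      ∀ z ∈ S.punctured k ε, G z = F z := by
  obtain ⟨G, h1, h2, h3⟩ := exists_extension_of_simple_pole (F := F) hε0
    (differentiableOn_regPart (fun k => (s k : ℂ)) hε k) (differentiableOn_regPart a hε k)
    (by rw [regPart_pt, Complex.norm_real]; exact hs) fun z hz => by
      have hzc := punctured_subset hε k hz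
      have := hF z hz
      rw [logForm_apply _ hzc, connForm, sum_div_eq_regPart a k hzc,
        sum_div_eq_regPart _ k hzc] at this
      convert this using 1
      ring
  rw [regPart_pt, regPart_pt] at h2
  exact ⟨G, h1, h2, h3⟩

/-- Solutions of `F' + F ∑ s_k / (z - σ_k) = ∑ a_k / (z - σ_k)` extend to infinity. -/
theorem exists_extension_infty {F : ℂ → ℂ} {a : Fin (n + 1) → ℂ} {ρ : ℝ} (hρ0 : 0 < ρ)
    (hρ : ∀ k, ρ * ‖S.pt k‖ ≤ 1) (hs : |∑ k, s k| < 1)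
    (hF : ∀ z, z ≠ 0 → z⁻¹ ∈ Metric.ball (0 : ℂ) ρ →
      HasDerivAt F ((S.logForm a).1 z - S.connForm s z * F z) z) :
    ∃ G : ℂ → ℂ, DifferentiableOn ℂ G (Metric.ball 0 ρ) ∧ (∑ k, (s k : ℂ)) * G 0 = ∑ k, a k ∧
      ∀ z, z ≠ 0 → z⁻¹ ∈ Metric.ball (0 : ℂ) ρ → F z = G z⁻¹ := by
  -- In the coordinate w = 1/z the connection has residue -∑ s_k at w = 0, which explains the signs
  -- and the bound on ∑ s_k.
  obtain ⟨G, h1, h2, h3⟩ := exists_extension_of_simple_pole (F := fun w => F w⁻¹)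
    (A := fun w => -S.infPart (fun k => (s k : ℂ)) w) (B := fun w => -S.infPart a w) hρ0
    (differentiableOn_infPart _ hρ).neg (differentiableOn_infPart a hρ).neg
    (by
      rw [infPart_zero, norm_neg, ← Complex.ofReal_sum, Complex.norm_real]
      exact hs) fun w hw => by
      have hw0 : w ≠ 0 := hw.2
      have hwi : (w⁻¹)⁻¹ ∈ Metric.ball (0 : ℂ) ρ := by rw [inv_inv]; exact hw.1
      have hzc := mem_compl_of_inv_mem hρ hwi (inv_ne_zero hw0)
      have h := hF w⁻¹ (inv_ne_zero hw0) hwi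
      rw [logForm_apply _ hzc, connForm, sum_div_eq_infPart a (inv_ne_zero hw0),
        sum_div_eq_infPart _ (inv_ne_zero hw0), inv_inv] at h
      refine (h.comp w (hasDerivAt_inv hw0)).congr_deriv ?_
      simp only [sub_zero]
      field_simp
      ring
  simp only [infPart_zero] at h2
  refine ⟨G, h1, by linear_combination -h2, fun z hz hzρ => ?_⟩
  rw [h3 _ ⟨hzρ, inv_ne_zero hz⟩, inv_inv]

/-! ### Injectivity of the comparison map -/

/-- The exponents are generic: neither the `s_k` nor `∑ s_k` vanish, and all are small. -/
structure IsGeneric (s : Fin (n + 1) → ℝ) : Prop where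
  ne_zero : ∀ k, s k ≠ 0
  abs_lt : ∀ k, |s k| < 1 / 2
  sum_ne_zero : ∑ k, s k ≠ 0
  abs_sum_lt : |∑ k, s k| < 1 / 2

theorem IsGeneric.of_pos (hpos : ∀ k, 0 < s k) (hsum : ∑ k, s k < 1 / 2) : IsGeneric s := by
  have h0 : 0 < ∑ k, s k := Finset.sum_pos (fun k _ => hpos k) Finset.univ_nonempty
  refine ⟨fun k => (hpos k).ne', fun k => ?_, h0.ne', by rwa [abs_of_pos h0]⟩
  rw [abs_of_pos (hpos k)]
  exact (Finset.single_le_sum (fun j _ => (hpos j).le) (Finset.mem_univ k)).trans_lt hsum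

theorem IsGeneric.neg (hs : IsGeneric s) : IsGeneric (-s) where
  ne_zero k := neg_ne_zero.2 (hs.ne_zero k)
  abs_lt k := by simpa using hs.abs_lt k
  sum_ne_zero := by simpa using hs.sum_ne_zero
  abs_sum_lt := by simpa using hs.abs_sum_lt

theorem IsGeneric.abs_lt_one (hs : IsGeneric s) (k : Fin (n + 1)) : |s k| < 1 :=
  (hs.abs_lt k).trans (by norm_num)

theorem IsGeneric.abs_sum_lt_one (hs : IsGeneric s) : |∑ k, s k| < 1 :=
  hs.abs_sum_lt.trans (by norm_num)

/-- A logarithmic form with a global primitive is a multiple of the connection form. -/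
theorem exists_eq_smul_of_primitive (hs : IsGeneric s) {a : Fin (n + 1) → ℂ} {F : ℂ → ℂ}
    (hF : IsPrimitiveOn (S.periodCochain s (S.logForm a)) F S.compl) :
    ∃ c : ℂ, ∀ k, a k = c * s k := by
  classical
  have hd := fun z (hz : z ∈ S.compl) => hF.hasDerivAt S.isOpen_compl subset_rfl hz
  obtain ⟨ε, hε0, hε⟩ := S.exists_radius
  obtain ⟨ρ, hρ0, hρ⟩ := S.exists_radius_infty
  choose G hG1 hG2 hG3 using fun k => exists_extension hε0 hε k (hs.abs_lt_one k)
    fun z hz => hd z (punctured_subset hε k hz)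
  obtain ⟨H, hH1, -, hH3⟩ := exists_extension_infty hρ0 hρ hs.abs_sum_lt_one
    fun z hz hz' => hd z (mem_compl_of_inv_mem hρ hz' hz)
  -- F glued with its extensions over the σ_k is entire with a limit at infinity, so it is constant
  -- by Liouville. Its value c satisfies s_k c = a_k at every σ_k.
  let Φ : ℂ → ℂ := fun z => if h : ∃ k, z = S.pt k then G h.choose z else F z
  have hΦF : ∀ z ∈ S.compl, Φ z = F z := fun z hz => dif_neg (by rintro ⟨k, hk⟩; exact hz k hk)
  have hΦG : ∀ k, ∀ z ∈ Metric.ball (S.pt k) ε, Φ z = G k z := fun k z hz => by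
    by_cases hzk : z = S.pt k
    · have h : ∃ k, z = S.pt k := ⟨k, hzk⟩
      simp only [Φ, dif_pos h]
      rw [S.injective (h.choose_spec.symm.trans hzk)]
    · rw [hΦF z (punctured_subset hε k ⟨hz, hzk⟩), hG3 k z ⟨hz, hzk⟩]
  have hdiff : Differentiable ℂ Φ := fun z => by
    by_cases hz : z ∈ S.compl
    · refine (hd z hz).differentiableAt.congr_of_eventuallyEq ?_
      filter_upwards [S.isOpen_compl.mem_nhds hz] with w hw using hΦF w hw
    · simp only [compl, mem_ofPred_eq, not_forall, not_not] at hz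
      obtain ⟨k, rfl⟩ := hz
      have hb := Metric.ball_mem_nhds (S.pt k) hε0
      refine ((hG1 k).differentiableAt hb).congr_of_eventuallyEq ?_
      filter_upwards [hb] with w hw using hΦG k w hw
  have hlim : Tendsto Φ (cocompact ℂ) (𝓝 (H 0)) := by
    have h1 : Tendsto (fun z : ℂ => z⁻¹) (cocompact ℂ) (𝓝 0) := by
      rw [← Metric.cobounded_eq_cocompact]
      exact tendsto_inv₀_cobounded
    have hb := Metric.ball_mem_nhds (0 : ℂ) hρ0
    refine (((hH1.differentiableAt hb).continuousAt.tendsto.comp h1)).congr' ?_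
    filter_upwards [h1.eventually hb, (isCompact_singleton (x := (0 : ℂ))).compl_mem_cocompact]
      with z hz hz0
    rw [hΦF z (mem_compl_of_inv_mem hρ hz hz0), hH3 z hz0 hz, Function.comp]
  refine ⟨H 0, fun k => ?_⟩
  have := hdiff.apply_eq_of_tendsto_cocompact (S.pt k) hlim
  rw [hΦG k _ (Metric.mem_ball_self hε0)] at this
  rw [← hG2 k, this, mul_comm]

theorem mk_comparison (f : S.regularFunctions) : S.comparison s (Submodule.Quotient.mk f) =
    Submodule.Quotient.mk ⟨S.periodCochain s f, S.periodCochain_mem s f⟩ := rfl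

theorem comparison_mk_eq_zero {f : S.regularFunctions}
    (h : S.comparison s (Submodule.Quotient.mk f) = 0) :
    ∃ F, IsPrimitiveOn (S.periodCochain s f) F S.compl := by
  rw [mk_comparison, Submodule.Quotient.mk_eq_zero] at h
  exact mem_range_coboundary_iff.1 h

theorem comparison_injective (hs : IsGeneric s) : Function.Injective (S.comparison s) := by
  refine (injective_iff_map_eq_zero _).2 fun η hη => ?_
  obtain ⟨f, rfl⟩ := Submodule.Quotient.mk_surjective _ η
  obtain ⟨a, ha⟩ := exists_logForm hs.abs_lt_one hs.abs_sum_lt_one f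
  have hfa : (Submodule.Quotient.mk f : S.DeRham s) = Submodule.Quotient.mk (S.logForm a) :=
    (Submodule.Quotient.eq _).2 ha
  rw [hfa] at hη ⊢
  obtain ⟨F, hF⟩ := comparison_mk_eq_zero hη
  obtain ⟨c, hc⟩ := exists_eq_smul_of_primitive hs hF
  rw [Submodule.Quotient.mk_eq_zero, show a = c • fun k => (s k : ℂ) from funext hc, logForm_smul]
  exact Submodule.smul_mem _ _ logForm_exponents_mem

/-! ### The periods of a cocycle along paths between the `σ_k` -/

/-- `c` are the jumps of the primitives of `φ` between the slit plane and the punctured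
neighbourhoods of the `σ_k`. -/
def IsJump {p : ℂ} (l : S.LogSystem (S.slitDomain p)) (φ : S.Cochain s 1) (c : Fin (n + 1) → ℂ) :
    Prop :=
  ∃ F, IsPrimitiveOn φ F (S.slitDomain p) ∧ ∀ k, ∃ ε > 0, ∃ G, IsPrimitiveOn φ G (S.punctured k ε) ∧
    ∀ z ∈ S.slitDomain p ∩ S.punctured k ε, l.sec s z * (F z - G z) = c k

theorem IsPrimitiveOn.add {φ ψ : S.Cochain s 1} {F G : ℂ → ℂ} {W : Set ℂ}
    (hF : IsPrimitiveOn φ F W) (hG : IsPrimitiveOn ψ G W) : IsPrimitiveOn (φ + ψ) (F + G) W :=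
  fun T hT => by
    rw [Cochain.add_apply, hF T hT, hG T hT, bdry, bdry, bdry, Pi.add_apply, Pi.add_apply]
    ring

theorem IsPrimitiveOn.smul {φ : S.Cochain s 1} {F : ℂ → ℂ} {W : Set ℂ} (c : ℂ)
    (hF : IsPrimitiveOn φ F W) : IsPrimitiveOn (c • φ) (c • F) W :=
  fun T hT => by
    rw [Cochain.smul_apply, hF T hT, bdry, bdry, Pi.smul_apply, Pi.smul_apply, smul_eq_mul,
      smul_eq_mul]
    ring

theorem isPrimitiveOn_zero {W : Set ℂ} : IsPrimitiveOn (0 : S.Cochain s 1) 0 W := fun T _ => by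
  change (0 : ℂ) = _
  simp [bdry]

theorem punctured_mono {k : Fin (n + 1)} {ε ε' : ℝ} (h : ε ≤ ε') :
    S.punctured k ε ⊆ S.punctured k ε' :=
  sdiff_subset_sdiff_left (Metric.ball_subset_ball h)

variable {p : ℂ} {l : S.LogSystem (S.slitDomain p)}

theorem IsJump.add {φ ψ : S.Cochain s 1} {c d : Fin (n + 1) → ℂ} (h : IsJump l φ c)
    (h' : IsJump l ψ d) : IsJump l (φ + ψ) (c + d) := by
  obtain ⟨F, hF, hG⟩ := h
  obtain ⟨F', hF', hG'⟩ := h'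
  refine ⟨F + F', hF.add hF', fun k => ?_⟩
  obtain ⟨ε, hε, G, hG1, hG2⟩ := hG k
  obtain ⟨ε', hε', G', hG1', hG2'⟩ := hG' k
  have h1 : S.punctured k (min ε ε') ⊆ S.punctured k ε := punctured_mono (min_le_left _ _)
  have h2 : S.punctured k (min ε ε') ⊆ S.punctured k ε' := punctured_mono (min_le_right _ _)
  refine ⟨min ε ε', lt_min hε hε', G + G', (hG1.mono h1).add (hG1'.mono h2), fun z hz => ?_⟩
  rw [Pi.add_apply, Pi.add_apply, Pi.add_apply, ← hG2 z ⟨hz.1, h1 hz.2⟩, ← hG2' z ⟨hz.1, h2 hz.2⟩]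
  ring

theorem IsJump.smul {φ : S.Cochain s 1} {c : Fin (n + 1) → ℂ} (x : ℂ) (h : IsJump l φ c) :
    IsJump l (x • φ) (x • c) := by
  obtain ⟨F, hF, hG⟩ := h
  refine ⟨x • F, hF.smul x, fun k => ?_⟩
  obtain ⟨ε, hε, G, hG1, hG2⟩ := hG k
  refine ⟨ε, hε, x • G, hG1.smul x, fun z hz => ?_⟩
  rw [Pi.smul_apply, Pi.smul_apply, Pi.smul_apply, smul_eq_mul, smul_eq_mul, smul_eq_mul,
    ← hG2 z hz]
  ring

/-- Adding x / sec to the primitive on the slit plane shifts all jumps by x. So jumps are determined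
at best up to a common constant. -/
theorem isJump_const (l : S.LogSystem (S.slitDomain p)) (x : ℂ) :
    IsJump l (0 : S.Cochain s 1) fun _ => x := by
  refine ⟨fun z => 0 + x / l.sec s z, isPrimitiveOn_zero.add_const_div l x, fun k =>
    ⟨1, one_pos, 0, isPrimitiveOn_zero, fun z _ => ?_⟩⟩
  have := l.sec_ne_zero (s := s) z
  simp only [zero_add, Pi.zero_apply, sub_zero]
  field_simp

/-- Primitives on the punctured discs exist because the exponents are not integers. Near σ_k the
slit disc is star-shaped, so the difference of the two primitives there is one constant times the
flat section. -/
theorem exists_isJump (hp : S.IsGenericBase p) (l : S.LogSystem (S.slitDomain p))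
    (hs : IsGeneric s) {φ : S.Cochain s 1} (hφ : φ ∈ S.Cocycle s) : ∃ c, IsJump l φ c := by
  obtain ⟨F, hF⟩ := exists_isPrimitiveOn hφ l hp.starConvex hp.mem_slitDomain
  obtain ⟨ε, hε0, hε⟩ := S.exists_radius
  have h : ∀ k, ∃ c, ∃ ε > 0, ∃ G, IsPrimitiveOn φ G (S.punctured k ε) ∧
      ∀ z ∈ S.slitDomain p ∩ S.punctured k ε, l.sec s z * (F z - G z) = c := fun k => by
    obtain ⟨δ, hδ0, hδ⟩ := hp.exists_slitDisc k
    obtain ⟨G, hG⟩ := exists_isPrimitiveOn_punctured hφ hε0 hε k (hs.ne_zero k) (hs.abs_lt_one k)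
    obtain ⟨c, hc, hst⟩ := hδ (min ε δ) (min_le_right _ _) (lt_min hε0 hδ0)
    have hG' := hG.mono (punctured_mono (min_le_left ε δ))
    exact ⟨_, _, lt_min hε0 hδ0, G, hG', fun z hz => (hF.mono inter_subset_left).sub_eq_sub
      (hG'.mono inter_subset_right) (l.mono inter_subset_left) hst hz⟩
  choose c hc using h
  exact ⟨c, F, hF, hc⟩

/-- When the jumps vanish, the primitive on the slit plane agrees with those on the punctured discs
and extends across the rays. -/
theorem IsJump.mem_range (hp : S.IsGenericBase p) {φ : S.Cochain s 1} (hφ : φ ∈ S.Cocycle s)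
    (h : IsJump l φ 0) : φ ∈ LinearMap.range (S.coboundary s 0) := by
  obtain ⟨F, hF, hG⟩ := h
  refine mem_range_coboundary_iff.2 (hp.exists_global_primitive hφ hF fun k => ?_)
  obtain ⟨ε, hε, G, hG1, hG2⟩ := hG k
  exact ⟨ε, hε, G, hG1, fun z hz =>
    sub_eq_zero.1 ((mul_eq_zero.1 (hG2 z hz)).resolve_left (l.sec_ne_zero z))⟩

/-- Every vector of jumps is attained by a logarithmic form. -/
theorem exists_logForm_isJump (hp : S.IsGenericBase p) (l : S.LogSystem (S.slitDomain p))
    (hs : IsGeneric s) (c : Fin (n + 1) → ℂ) :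
    ∃ a, IsJump l (S.periodCochain s (S.logForm a)) c := by
  let V : Submodule ℂ ((Fin (n + 1) → ℂ) × (Fin (n + 1) → ℂ)) :=
    { carrier := {x | IsJump l (S.periodCochain s (S.logForm x.1)) x.2}
      zero_mem' := by
        have := isJump_const (s := s) l 0
        change IsJump l (S.periodCochain s (S.logFormₗ 0)) 0
        rwa [map_zero, map_zero]
      add_mem' := fun {x y} hx hy => by
        change IsJump l (S.periodCochain s (S.logForm (x.1 + y.1))) (x.2 + y.2)
        rw [logForm_add, map_add]
        exact IsJump.add hx hy
      smul_mem' := fun t x hx => by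
        change IsJump l (S.periodCochain s (S.logForm (t • x.1))) (t • x.2)
        rw [logForm_smul, map_smul]
        exact IsJump.smul t hx }
  let f₁ : V →ₗ[ℂ] (Fin (n + 1) → ℂ) := (LinearMap.fst ℂ _ _).comp V.subtype
  let f₂ : V →ₗ[ℂ] (Fin (n + 1) → ℂ) := (LinearMap.snd ℂ _ _).comp V.subtype
  have hf₁ : Function.Surjective f₁ := fun a => by
    obtain ⟨c, hc⟩ := exists_isJump hp l hs (S.periodCochain_mem s (S.logForm a))
    exact ⟨⟨(a, c), hc⟩, rfl⟩
  have h1 := LinearMap.finrank_range_add_finrank_ker f₁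
  have h2 := LinearMap.finrank_range_add_finrank_ker f₂
  have hk1 : 1 ≤ Module.finrank ℂ (LinearMap.ker f₁) := by
    have hmem : ((0, fun _ => 1) : (Fin (n + 1) → ℂ) × (Fin (n + 1) → ℂ)) ∈ V := by
      have := isJump_const (s := s) l 1
      change IsJump l (S.periodCochain s (S.logFormₗ 0)) fun _ => 1
      rwa [map_zero, map_zero]
    refine Nat.one_le_iff_ne_zero.2 fun h0 => ?_
    have h3 := Submodule.finrank_eq_zero.1 h0
    have h4 : (⟨_, hmem⟩ : V) ∈ LinearMap.ker f₁ := rfl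
    rw [h3, Submodule.mem_bot] at h4
    have := congrFun (congrArg (fun x : V => x.1.2) h4) 0
    exact one_ne_zero this
  have hk2 : Module.finrank ℂ (LinearMap.ker f₂) ≤ 1 := by
    have hker : ∀ x ∈ LinearMap.ker f₂, ∃ t : ℂ, ∀ k, x.1.1 k = t * s k := fun x hx => by
      have hx0 : x.1.2 = 0 := hx
      have h3 : IsJump l (S.periodCochain s (S.logForm x.1.1)) x.1.2 := x.2
      rw [hx0] at h3
      obtain ⟨F, hF⟩ := mem_range_coboundary_iff.1 (h3.mem_range hp (S.periodCochain_mem s _))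
      exact exists_eq_smul_of_primitive hs hF
    have hev : Function.Injective
        (((LinearMap.proj (R := ℂ) (φ := fun _ : Fin (n + 1) => ℂ) 0).comp f₁).comp
          (LinearMap.ker f₂).subtype) := by
      refine (injective_iff_map_eq_zero _).2 fun x hx => ?_
      obtain ⟨t, ht⟩ := hker x.1 x.2
      have h0 : x.1.1.1 0 = 0 := hx
      rw [ht 0, mul_eq_zero] at h0
      have ht0 : t = 0 := h0.resolve_right (by exact_mod_cast hs.ne_zero 0)
      have hx2 : x.1.1.2 = 0 := x.2
      refine Subtype.ext (Subtype.ext (Prod.ext (funext fun k => ?_) hx2))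
      rw [ht k, ht0, zero_mul]
      rfl
    simpa using LinearMap.finrank_le_finrank_of_injective hev
  have hr1 : Module.finrank ℂ (LinearMap.range f₁) = n + 1 := by
    rw [LinearMap.range_eq_top.2 hf₁, finrank_top]
    simp
  have hr2 : LinearMap.range f₂ = ⊤ := by
    refine Submodule.eq_top_of_finrank_eq ?_
    have := Submodule.finrank_le (LinearMap.range f₂)
    simp only [Module.finrank_fin_fun] at this ⊢
    omega
  obtain ⟨x, hx⟩ := LinearMap.range_eq_top.1 hr2 c
  exact ⟨x.1.1, hx ▸ x.2⟩

variable (S) in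
theorem exists_logSystem_slitDomain : ∃ p, S.IsGenericBase p ∧ Nonempty (S.LogSystem (S.slitDomain p)) := by
  obtain ⟨p, hp⟩ := S.exists_isGenericBase
  exact ⟨p, hp, exists_logSystem hp.starConvex hp.mem_slitDomain (slitDomain_subset p)⟩

/-- Every Betti class is the image of a logarithmic form. -/
theorem exists_logForm_comparison (hs : IsGeneric s) (c : S.Betti s) :
    ∃ a, S.comparison s (Submodule.Quotient.mk (S.logForm a)) = c := by
  obtain ⟨φ, rfl⟩ := Submodule.Quotient.mk_surjective _ c
  obtain ⟨p, hp, ⟨l⟩⟩ := S.exists_logSystem_slitDomain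
  obtain ⟨c, hc⟩ := exists_isJump hp l hs φ.2
  obtain ⟨a, ha⟩ := exists_logForm_isJump hp l hs c
  refine ⟨a, ?_⟩
  rw [mk_comparison, Submodule.Quotient.eq]
  -- The cocycle and the logarithmic form have the same jumps, so their difference is exact.
  refine IsJump.mem_range (l := l) hp (sub_mem (S.periodCochain_mem s _) φ.2) ?_
  have := ha.add (hc.smul (-1))
  rw [show c + (-1 : ℂ) • c = 0 by simp] at this
  convert this using 1
  simp only [neg_smul, one_smul, ← sub_eq_add_neg]
  rfl

theorem comparison_bijective (hs : IsGeneric s) : Function.Bijective (S.comparison s) :=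
  ⟨comparison_injective hs, fun c => by
    obtain ⟨a, ha⟩ := exists_logForm_comparison hs c
    exact ⟨_, ha⟩⟩

end PointConfig

/-! ### Compactly supported representatives -/

theorem contDiff_bump_mul {h : ℂ → ℂ} {U : Set ℂ} (hU : IsOpen U) (hh : DifferentiableOn ℂ h U)
    {χ : ℂ → ℝ} (hχ : ContDiff ℝ ∞ χ) (hsupp : tsupport χ ⊆ U) :
    ContDiff ℝ ∞ fun z => (χ z : ℂ) * h z := by
  refine contDiff_iff_contDiffAt.2 fun z => ?_
  by_cases hz' : z ∈ tsupport χ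
  swap
  · refine (contDiffAt_const (c := (0 : ℂ))).congr_of_eventuallyEq ?_
    filter_upwards [(isClosed_tsupport χ).isOpen_compl.mem_nhds hz'] with w hw
    rw [image_eq_zero_of_notMem_tsupport hw, Complex.ofReal_zero, zero_mul]
  exact (Complex.ofRealCLM.contDiff.comp hχ).contDiffAt.mul
    (((hh.contDiffOn hU).restrict_scalars ℝ).contDiffAt (hU.mem_nhds (hsupp hz')))

namespace PointConfig

variable {n : ℕ} {S : PointConfig n} {s : Fin (n + 1) → ℝ}

/-- A local potential with ∇_s h equal to minus the logarithmic form: adding ∇_s of a cut-off of h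
to the form kills it near σ_k. It exists because s_k is nonzero and larger than -1. -/
theorem exists_local_solution (hs : IsGeneric s) (a : Fin (n + 1) → ℂ) {ε : ℝ} (hε0 : 0 < ε)
    (hε : ∀ j k, j ≠ k → ε ≤ dist (S.pt j) (S.pt k)) (k : Fin (n + 1)) :
    ∃ h : ℂ → ℂ, DifferentiableOn ℂ h (Metric.ball (S.pt k) ε) ∧ ∀ z ∈ S.punctured k ε,
      HasDerivAt h (-(S.logForm a).1 z - S.connForm s z * h z) z := by
  obtain ⟨h, hh⟩ := exists_solution_of_simple_pole (s := s k) hε0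
    (differentiableOn_regPart (fun k => (s k : ℂ)) hε k) (differentiableOn_regPart (-a) hε k)
    (by rw [regPart_pt]) (by linarith [(abs_lt.1 (hs.abs_lt_one k)).1]) (hs.ne_zero k)
  refine ⟨h, fun z hz => ?_, fun z hz => ?_⟩
  · obtain ⟨h', h1, -⟩ := hh z hz
    exact h1.differentiableAt.differentiableWithinAt
  · obtain ⟨h', h1, h2⟩ := hh z hz.1
    have hzc := punctured_subset hε k hz
    have hzk := sub_ne_zero.2 (hzc k)
    convert h1 using 1
    rw [show (S.logForm a).1 z = -∑ j, (-a) j / (z - S.pt j) by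
      rw [logForm_apply _ hzc]; simp [neg_div], connForm, sum_div_eq_regPart _ k hzc,
      sum_div_eq_regPart _ k hzc]
    field_simp
    linear_combination -h2

/-- The same potential at infinity. In the coordinate 1/z the exponent is -∑ s_k, which is again
nonzero and larger than -1. -/
theorem exists_local_solution_infty (hs : IsGeneric s) (a : Fin (n + 1) → ℂ) {ρ : ℝ} (hρ0 : 0 < ρ)
    (hρ : ∀ k, ρ * ‖S.pt k‖ ≤ 1) :
    ∃ h : ℂ → ℂ, DifferentiableOn ℂ h {z | z ≠ 0 ∧ z⁻¹ ∈ Metric.ball (0 : ℂ) ρ} ∧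
      ∀ z, z ≠ 0 → z⁻¹ ∈ Metric.ball (0 : ℂ) ρ →
        HasDerivAt h (-(S.logForm a).1 z - S.connForm s z * h z) z := by
  obtain ⟨h, hh⟩ := exists_solution_of_simple_pole (s := -∑ k, s k)
    (A := fun w => -S.infPart (fun k => (s k : ℂ)) w) hρ0
    (differentiableOn_infPart _ hρ).neg (differentiableOn_infPart a hρ)
    (by simp) (by linarith [(abs_lt.1 hs.abs_sum_lt_one).2]) (neg_ne_zero.2 hs.sum_ne_zero)
  have key : ∀ z, z ≠ 0 → z⁻¹ ∈ Metric.ball (0 : ℂ) ρ →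
      HasDerivAt (fun z => h z⁻¹) (-(S.logForm a).1 z - S.connForm s z * h z⁻¹) z := by
    intro z hz hzρ
    obtain ⟨h', h1, h2⟩ := hh _ hzρ
    have hzc := mem_compl_of_inv_mem hρ hzρ hz
    refine (h1.comp z (hasDerivAt_inv hz)).congr_deriv ?_
    rw [logForm_apply _ hzc, connForm, sum_div_eq_infPart _ hz, sum_div_eq_infPart _ hz]
    field_simp
    field_simp at h2
    linear_combination -h2
  exact ⟨fun z => h z⁻¹, fun z hz => (key z hz.1 hz.2).differentiableAt.differentiableWithinAt, key⟩

/-- A logarithmic form is cohomologous to a smooth form with compact support. -/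
theorem exists_cutoff (hs : IsGeneric s) (a : Fin (n + 1) → ℂ) :
    ∃ (φ : ℂ → ℂ) (K : Set ℂ), ContDiff ℝ ∞ φ ∧ IsCompact K ∧ K ⊆ S.compl ∧
      ∀ z ∈ S.compl \ K, HasDerivAt φ (-(S.logForm a).1 z - S.connForm s z * φ z) z := by
  obtain ⟨ε, hε0, hε⟩ := S.exists_radius
  obtain ⟨ρ, hρ0, hρ⟩ := S.exists_radius_infty
  choose h hh1 hh2 using exists_local_solution (S := S) hs a hε0 hε
  obtain ⟨H, hH1, hH2⟩ := exists_local_solution_infty (S := S) hs a hρ0 hρ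
  -- The region |z| ≥ R lies in the domain of the solution at infinity, and it does not meet the
  -- discs of radius ε around the σ_k.
  obtain ⟨R, hRρ, hR⟩ : ∃ R > ρ⁻¹, ∀ k, ‖S.pt k‖ + ε ≤ R := by
    have h1 : ∀ᶠ R : ℝ in atTop, ∀ k, ‖S.pt k‖ + ε ≤ R :=
      eventually_all.2 fun k => eventually_ge_atTop _
    obtain ⟨R, h2, h3⟩ := (h1.and (eventually_gt_atTop ρ⁻¹)).exists
    exact ⟨R, h3, h2⟩
  have hR0 : 0 < R := (inv_pos.2 hρ0).trans hRρ
  let χ : ∀ k, ContDiffBump (S.pt k) := fun k => ⟨ε / 4, ε / 2, by linarith, by linarith⟩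
  let χ' : ContDiffBump (0 : ℂ) := ⟨R, R + 1, hR0, by linarith⟩
  have hinf : ∀ z : ℂ, R ≤ ‖z‖ → z ≠ 0 ∧ z⁻¹ ∈ Metric.ball (0 : ℂ) ρ := fun z hz => by
    have h0 : 0 < ‖z‖ := hR0.trans_le hz
    refine ⟨norm_pos_iff.1 h0, ?_⟩
    rw [mem_ball_zero_iff, norm_inv]
    exact inv_lt_of_inv_lt₀ hρ0 (hRρ.trans_le hz)
  have hopen : IsOpen {z : ℂ | z ≠ 0 ∧ z⁻¹ ∈ Metric.ball (0 : ℂ) ρ} := by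
    have h1 : ContinuousOn (fun z : ℂ => z⁻¹) {0}ᶜ := continuousOn_inv₀
    exact h1.isOpen_inter_preimage isOpen_compl_singleton Metric.isOpen_ball
  have hχs : ContDiff ℝ ∞ fun z => 1 - χ' z := contDiff_const.sub χ'.contDiff
  have hχ'supp : ∀ z ∈ tsupport fun z => 1 - χ' z, R ≤ ‖z‖ := by
    have hcl : IsClosed {z : ℂ | R ≤ ‖z‖} := isClosed_le continuous_const continuous_norm
    refine fun z hz => closure_minimal (fun w hw => ?_) hcl hz
    by_contra hlt
    refine hw ?_
    have : χ' w = 1 := χ'.one_of_mem_closedBall (by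
      rw [mem_closedBall_zero_iff]
      exact (not_le.1 hlt).le)
    simp [this]
  -- φ equals the local solution on the disc of radius ε/4 around each σ_k and on |z| > R + 1. The
  -- compact set is the remaining region.
  let φ : ℂ → ℂ := fun z => ∑ k, (χ k z : ℂ) * h k z + ((1 - χ' z : ℝ) : ℂ) * H z
  have hφk : ∀ k, ∀ z ∈ Metric.ball (S.pt k) (ε / 4), φ z = h k z := fun k z hz => by
    have hzk : ‖z - S.pt k‖ < ε / 4 := by simpa [dist_eq_norm] using hz
    have h1 : χ k z = 1 := (χ k).one_of_mem_closedBall (Metric.ball_subset_closedBall hz)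
    have h2 : ∀ j, j ≠ k → χ j z = 0 := fun j hj => (χ j).zero_of_le_dist (by
      have h3 := hε j k hj
      have h4 := dist_triangle (S.pt j) z (S.pt k)
      rw [dist_comm (S.pt j) z] at h4
      rw [Metric.mem_ball] at hz
      change ε / 2 ≤ _
      linarith)
    have h3 : χ' z = 1 := χ'.one_of_mem_closedBall (by
      rw [mem_closedBall_zero_iff]
      have h5 := norm_add_le (z - S.pt k) (S.pt k)
      rw [sub_add_cancel] at h5
      change _ ≤ R
      linarith [hR k])
    simp only [φ, h3, sub_self, Complex.ofReal_zero, zero_mul, add_zero]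
    rw [Finset.sum_eq_single k, h1, Complex.ofReal_one, one_mul]
    · intro j _ hj
      rw [h2 j hj, Complex.ofReal_zero, zero_mul]
    · simp
  have hφH : ∀ z, R + 1 < ‖z‖ → φ z = H z := fun z hz => by
    have h2 : ∀ j, χ j z = 0 := fun j => (χ j).zero_of_le_dist (by
      have h5 := norm_add_le (z - S.pt j) (S.pt j)
      rw [sub_add_cancel] at h5
      rw [dist_eq_norm]
      change ε / 2 ≤ _
      linarith [hR j])
    have h3 : χ' z = 0 := χ'.zero_of_le_dist (by rw [dist_zero_right]; exact hz.le)
    simp [φ, h2, h3]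
  refine ⟨φ, {z | ‖z‖ ≤ R + 1 ∧ ∀ k, ε / 4 ≤ ‖z - S.pt k‖}, ?_, ?_, ?_, ?_⟩
  · refine (ContDiff.sum fun k _ => contDiff_bump_mul Metric.isOpen_ball (hh1 k) (χ k).contDiff ?_).add
      (contDiff_bump_mul hopen hH1 hχs fun z hz => hinf z (hχ'supp z hz))
    rw [(χ k).tsupport_eq]
    exact Metric.closedBall_subset_ball (by change ε / 2 < ε; linarith)
  · refine (isCompact_closedBall (0 : ℂ) (R + 1)).of_isClosed_subset ?_ fun z hz => by
      simpa using hz.1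
    refine (isClosed_le continuous_norm continuous_const).inter ?_
    change IsClosed {z | ∀ k, ε / 4 ≤ ‖z - S.pt k‖}
    rw [show {z | ∀ k, ε / 4 ≤ ‖z - S.pt k‖} = ⋂ k, {z | ε / 4 ≤ ‖z - S.pt k‖} by ext; simp]
    exact isClosed_iInter fun k => isClosed_le continuous_const (by fun_prop)
  · rintro z hz k rfl
    have := hz.2 k
    rw [sub_self, norm_zero] at this
    linarith
  · rintro z ⟨hz, hzK⟩
    by_cases h1 : ‖z‖ ≤ R + 1
    · have h2 : ∃ k, ‖z - S.pt k‖ < ε / 4 := by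
        by_contra! h3
        exact hzK ⟨h1, h3⟩
      obtain ⟨k, hk⟩ := h2
      have hzb : z ∈ Metric.ball (S.pt k) (ε / 4) := by rwa [Metric.mem_ball, dist_eq_norm]
      rw [hφk k z hzb]
      refine (hh2 k z ⟨Metric.ball_subset_ball (by linarith) hzb, hz k⟩).congr_of_eventuallyEq ?_
      filter_upwards [Metric.isOpen_ball.mem_nhds hzb] with w hw using hφk k w hw
    · rw [not_le] at h1
      rw [hφH z h1]
      obtain ⟨h2, h3⟩ := hinf z (by linarith)
      refine (hH2 z h2 h3).congr_of_eventuallyEq ?_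
      filter_upwards [(isOpen_lt continuous_const continuous_norm).mem_nhds h1] with w hw using
        hφH w hw

/-- Vanishing of the dz̄ coefficient is the Cauchy–Riemann equation for φ. Given this, vanishing of
the dz coefficient is the differential equation ∇_s φ = -f. -/
theorem addCovariantDeriv_eq_zero_iff {f φ : ℂ → ℂ} {z : ℂ} (hφ : DifferentiableAt ℝ φ z) :
    ((S.addCovariantDeriv s f φ).dz z = 0 ∧ (S.addCovariantDeriv s f φ).dzbar z = 0) ↔
      HasDerivAt φ (-f z - S.connForm s z * φ z) z := by
  change (f z + del φ z + S.connForm s z * φ z = 0 ∧ dbar φ z = 0) ↔ _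
  constructor
  · rintro ⟨h1, h2⟩
    have := hasDerivAt_of_dbar_eq_zero hφ h2
    rwa [show del φ z = -f z - S.connForm s z * φ z by linear_combination h1] at this
  · intro h
    rw [del_eq_deriv h.differentiableAt, dbar_eq_zero_of_differentiableAt h.differentiableAt, h.deriv]
    exact ⟨by ring, rfl⟩

end PointConfig

theorem tendsto_norm_sub_rpow (σ : ℂ) {r : ℝ} (hr : 0 < r) :
    Tendsto (fun z => ‖z - σ‖ ^ r) (𝓝[≠] σ) (𝓝 0) := by
  have hc : Continuous fun z : ℂ => ‖z - σ‖ ^ r :=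
    (continuous_norm.comp (continuous_id.sub continuous_const)).rpow_const fun _ => Or.inr hr.le
  have := (hc.tendsto σ).mono_left (nhdsWithin_le_nhds (s := {σ}ᶜ))
  rwa [sub_self, norm_zero, Real.zero_rpow hr.ne'] at this

theorem tendsto_norm_rpow_cocompact {r : ℝ} (hr : r < 0) :
    Tendsto (fun z : ℂ => ‖z‖ ^ r) (cocompact ℂ) (𝓝 0) := by
  have := (tendsto_rpow_neg_atTop (neg_pos.2 hr)).comp (tendsto_norm_cocompact_atTop (E := ℂ))
  rwa [neg_neg] at this

theorem eventually_cocompact_ne_zero : ∀ᶠ z : ℂ in cocompact ℂ, z ≠ 0 :=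
  (isCompact_singleton (x := (0 : ℂ))).compl_mem_cocompact

theorem tendsto_inv_cocompact : Tendsto (fun z : ℂ => z⁻¹) (cocompact ℂ) (𝓝 0) := by
  rw [← Metric.cobounded_eq_cocompact]
  exact tendsto_inv₀_cobounded

namespace PointConfig

variable {n : ℕ} {S : PointConfig n} {s : Fin (n + 1) → ℝ}

/-! ### Growth near `σ_k` and near infinity -/

theorem eventually_mem_compl (k : Fin (n + 1)) : ∀ᶠ z in 𝓝[≠] (S.pt k), z ∈ S.compl := by
  obtain ⟨ε, hε0, hε⟩ := S.exists_radius
  filter_upwards [sdiff_mem_nhdsWithin_compl (Metric.ball_mem_nhds (S.pt k) hε0) {S.pt k}] with z hz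
    using punctured_subset hε k hz

variable (S) in
theorem eventually_cocompact_mem_compl : ∀ᶠ z in cocompact ℂ, z ∈ S.compl := by
  have := (finite_range S.pt).isCompact.compl_mem_cocompact
  filter_upwards [this] with z hz k h using hz ⟨k, h.symm⟩

theorem factor_pt_ne_zero {j k : Fin (n + 1)} (h : j ≠ k) : S.factor j (S.pt k) ≠ 0 := by
  rw [factor_eq]
  exact mul_ne_zero (S.factorDeriv_ne_zero j) (sub_ne_zero.2 fun h' => h (S.injective h').symm)

theorem continuous_factor (k : Fin (n + 1)) : Continuous (S.factor k) := by
  rw [show S.factor k = fun z => S.factorDeriv k * (z - S.pt k) from funext (S.factor_eq k)]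
  fun_prop

theorem weight_isBigO (s : Fin (n + 1) → ℝ) (k : Fin (n + 1)) :
    S.weight s =O[𝓝 (S.pt k)] fun z => ‖z - S.pt k‖ ^ (2 * s k) := by
  have h : S.weight s = fun z => (‖S.factorDeriv k‖ ^ (2 * s k) *
      ∏ j ∈ Finset.univ.erase k, ‖S.factor j z‖ ^ (2 * s j)) * ‖z - S.pt k‖ ^ (2 * s k) := by
    ext z
    rw [weight, ← Finset.mul_prod_erase _ _ (Finset.mem_univ k), factor_eq, norm_mul,
      Real.mul_rpow (norm_nonneg _) (norm_nonneg _)]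
    ring
  rw [h]
  have hc : ContinuousAt (fun z => ‖S.factorDeriv k‖ ^ (2 * s k) *
      ∏ j ∈ Finset.univ.erase k, ‖S.factor j z‖ ^ (2 * s j)) (S.pt k) := by
    refine continuousAt_const.mul (tendsto_finsetProd _ fun j hj => ?_)
    exact ((continuous_factor j).norm.continuousAt).rpow_const
      (Or.inl (norm_ne_zero_iff.2 (factor_pt_ne_zero (Finset.ne_of_mem_erase hj))))
  simpa using (hc.isBigO_one ℝ).mul (isBigO_refl (fun z => ‖z - S.pt k‖ ^ (2 * s k)) (𝓝 (S.pt k)))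

theorem weight_isBigO_infty (s : Fin (n + 1) → ℝ) :
    S.weight s =O[cocompact ℂ] fun z => ‖z‖ ^ (2 * ∑ k, s k) := by
  have h1 : ∀ k, (fun z => ‖S.factor k z‖ ^ (2 * s k)) =O[cocompact ℂ] fun z => ‖z‖ ^ (2 * s k) := by
    intro k
    have h2 : Tendsto (fun z => ‖S.factorDeriv k * (1 - S.pt k * z⁻¹)‖ ^ (2 * s k)) (cocompact ℂ)
        (𝓝 (‖S.factorDeriv k * (1 - S.pt k * 0)‖ ^ (2 * s k))) := by
      refine Tendsto.rpow_const ?_ (Or.inl ?_)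
      · exact (tendsto_const_nhds.mul (tendsto_const_nhds.sub
          (tendsto_const_nhds.mul tendsto_inv_cocompact))).norm
      · simpa using S.factorDeriv_ne_zero k
    have h3 := (h2.isBigO_one ℝ).mul (isBigO_refl (fun z : ℂ => ‖z‖ ^ (2 * s k)) (cocompact ℂ))
    simp only [one_mul] at h3
    refine h3.congr' ?_ EventuallyEq.rfl
    filter_upwards [eventually_cocompact_ne_zero] with z hz
    rw [← Real.mul_rpow (norm_nonneg _) (norm_nonneg _), ← norm_mul, factor_eq]
    congr 2
    field_simp
  have h4 := IsBigO.finsetProd (s := Finset.univ) fun k _ => h1 k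
  refine (h4.congr_left fun z => rfl).congr' EventuallyEq.rfl ?_
  filter_upwards [eventually_cocompact_ne_zero] with z hz
  rw [Finset.mul_sum, Real.rpow_sum_of_pos (norm_pos_iff.2 hz)]

theorem logForm_isBigO (a : Fin (n + 1) → ℂ) (k : Fin (n + 1)) :
    (S.logForm a).1 =O[𝓝[≠] (S.pt k)] fun z => ‖z - S.pt k‖ ^ (-1 : ℝ) := by
  obtain ⟨ε, hε0, hε⟩ := S.exists_radius
  have hc := ((differentiableOn_regPart a hε k).differentiableAt
    (Metric.ball_mem_nhds _ hε0)).continuousAt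
  have h1 := (hc.isBigO_one ℝ).mono (nhdsWithin_le_nhds (s := {S.pt k}ᶜ))
  have h2 : (fun z => (z - S.pt k)⁻¹) =O[𝓝[≠] (S.pt k)] fun z => ‖z - S.pt k‖ ^ (-1 : ℝ) := by
    refine IsBigO.of_norm_le fun z => ?_
    rw [Real.rpow_neg_one, norm_inv]
  have h3 := h1.mul h2
  simp only [one_mul] at h3
  refine h3.congr' ?_ EventuallyEq.rfl
  filter_upwards [eventually_mem_compl k] with z hz
  rw [logForm_apply _ hz, sum_div_eq_regPart a k hz, div_eq_mul_inv]

theorem logForm_isBigO_infty (a : Fin (n + 1) → ℂ) :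
    (S.logForm a).1 =O[cocompact ℂ] fun z => ‖z‖ ^ (-1 : ℝ) := by
  obtain ⟨ρ, hρ0, hρ⟩ := S.exists_radius_infty
  have hc := ((differentiableOn_infPart a hρ).differentiableAt
    (Metric.ball_mem_nhds _ hρ0)).continuousAt
  have h1 := (hc.isBigO_one ℝ).comp_tendsto tendsto_inv_cocompact
  have h2 : (fun z : ℂ => z⁻¹) =O[cocompact ℂ] fun z => ‖z‖ ^ (-1 : ℝ) := by
    refine IsBigO.of_norm_le fun z => ?_
    rw [Real.rpow_neg_one, norm_inv]
  have h3 := h2.mul h1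
  simp only [Function.comp_def, mul_one] at h3
  refine h3.congr' ?_ EventuallyEq.rfl
  filter_upwards [S.eventually_cocompact_mem_compl, eventually_cocompact_ne_zero] with z hz hz0
  rw [logForm_apply _ hz, sum_div_eq_infPart a hz0]

theorem logForm_isBigO_infty_of_sum_eq_zero {a : Fin (n + 1) → ℂ} (ha : ∑ k, a k = 0) :
    (S.logForm a).1 =O[cocompact ℂ] fun z => ‖z‖ ^ (-2 : ℝ) := by
  obtain ⟨ρ, hρ0, hρ⟩ := S.exists_radius_infty
  have hd := ((differentiableOn_infPart a hρ).differentiableAt (Metric.ball_mem_nhds _ hρ0)).isBigO_sub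
  simp only [infPart_zero, ha, sub_zero] at hd
  have h1 := hd.comp_tendsto tendsto_inv_cocompact
  have h2 : (fun z : ℂ => z⁻¹ * z⁻¹) =O[cocompact ℂ] fun z => ‖z‖ ^ (-2 : ℝ) := by
    refine IsBigO.of_norm_le fun z => ?_
    rw [Real.rpow_neg (norm_nonneg z), Real.rpow_two, norm_mul, norm_inv, sq, mul_inv]
  have h3 := ((isBigO_refl (fun z : ℂ => z⁻¹) (cocompact ℂ)).mul h1).trans h2
  refine h3.congr' ?_ EventuallyEq.rfl
  filter_upwards [S.eventually_cocompact_mem_compl, eventually_cocompact_ne_zero] with z hz hz0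
  rw [logForm_apply _ hz, sum_div_eq_infPart a hz0, Function.comp]

/-- The modulus of a branch is a product of powers with exponents s_k, whereas the weight has
exponents 2 s_k. This makes the growth estimates for the weight available for branches. -/
theorem ofReal_weight_half {l : Fin (n + 1) → ℂ} {z : ℂ}
    (h : ∀ k, Complex.exp (l k) = S.factor k z) :
    ‖Complex.exp (∑ k, (s k : ℂ) * l k)‖ = S.weight (fun k => s k / 2) z := by
  rw [Complex.norm_exp, weight, Complex.re_sum, Real.exp_sum]
  refine Finset.prod_congr rfl fun k _ => ?_
  rw [← h k, Complex.norm_exp, ← Real.exp_mul, Complex.re_ofReal_mul]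
  congr 1
  ring

/-! ### Pairing with paths -/

theorem coboundary_zeroCochain_mem (F : ℂ → ℂ) :
    S.coboundary s 0 (S.zeroCochain s F) ∈ S.Cocycle s := by
  rw [LinearMap.mem_ker]
  refine Cochain.ext fun T => ?_
  change ∑ i : Fin 3, (-1 : ℂ) ^ (i : ℕ) * S.coboundary s 0 (S.zeroCochain s F) (T.face i) = 0
  have hv : ∀ (i : Fin 3) (j : Fin 2), faceMap i (stdSimplex.vertex j) =
      stdSimplex.vertex (S := ℝ) (i.succAbove j) := fun i j => stdSimplex.map_vertex _ _
  have hb : ∀ i : Fin 3, S.coboundary s 0 (S.zeroCochain s F) (T.face i) =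
      T.sec (stdSimplex.vertex (i.succAbove 1)) * F (T.map (stdSimplex.vertex (i.succAbove 1))) -
      T.sec (stdSimplex.vertex (i.succAbove 0)) * F (T.map (stdSimplex.vertex (i.succAbove 0))) := by
    intro i
    rw [coboundary_zeroCochain, ← hv, ← hv]
    rfl
  simp only [hb, Fin.sum_univ_three]
  rw [show (0 : Fin 3).succAbove (0 : Fin 2) = 1 from rfl,
    show (0 : Fin 3).succAbove (1 : Fin 2) = 2 from rfl,
    show (1 : Fin 3).succAbove (0 : Fin 2) = 0 from rfl,
    show (1 : Fin 3).succAbove (1 : Fin 2) = 2 from rfl,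
    show (2 : Fin 3).succAbove (0 : Fin 2) = 0 from rfl,
    show (2 : Fin 3).succAbove (1 : Fin 2) = 1 from rfl]
  simp

namespace BranchedPath

variable {i : Fin n} (δ : S.BranchedPath i)

variable (s) in
/-- The integrand `u f dz` along a path. -/
def integrand (f : ℂ → ℂ) (t : ℝ) : ℂ := δ.branch s t * f (δ.path t) * deriv δ.path t

theorem continuousOn_branch : ContinuousOn (δ.branch s) (Ioo 0 1) :=
  Complex.continuous_exp.comp_continuousOn (continuousOn_finsetSum _ fun k _ =>
    continuousOn_const.mul (δ.continuousOn_log k))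

theorem continuousOn_integrand (f : S.regularFunctions) :
    ContinuousOn (δ.integrand s f.1) (Ioo 0 1) :=
  (δ.continuousOn_branch.mul ((continuousOn_regular f).comp δ.smooth.continuousOn δ.mem)).mul
    (δ.smooth.continuousOn_deriv_of_isOpen isOpen_Ioo (by simp))

theorem intervalIntegrable_integrand (f : S.regularFunctions) {a b : ℝ} (ha : a ∈ Ioo (0 : ℝ) 1)
    (hb : b ∈ Ioo (0 : ℝ) 1) : IntervalIntegrable (δ.integrand s f.1) volume a b :=
  ((δ.continuousOn_integrand f).mono ((ordConnected_Ioo).uIcc_subset ha hb)).intervalIntegrable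

theorem periodCochain_segment (f : S.regularFunctions) {a b : ℝ} (ha : 0 < a) (hab : a ≤ b)
    (hb : b < 1) : S.periodCochain s f (δ.segment s a b ha hab hb) =
      ∫ t in a..b, δ.integrand s f.1 t := by
  have hpt : ∀ t ∈ Icc (0 : ℝ) 1, a * (edge t).1 0 + b * (edge t).1 1 = t * (b - a) + a := by
    intro t ht
    rw [edge_coe ht]
    simp
    ring
  have hmem : ∀ t ∈ Icc (0 : ℝ) 1, t * (b - a) + a ∈ Ioo (0 : ℝ) 1 := fun t ht =>
    ⟨by nlinarith [ht.1], by nlinarith [ht.2]⟩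
  have h1 := intervalIntegral.smul_integral_comp_mul_add (a := 0) (b := 1)
    (δ.integrand s f.1) (b - a) a
  simp only [mul_comm (b - a)] at h1
  rw [zero_mul, zero_add, one_mul, sub_add_cancel] at h1
  rw [← h1, ← intervalIntegral.integral_smul]
  refine intervalIntegral.integral_congr_Ioo_of_le zero_le_one fun t ht => ?_
  have ht' := Ioo_subset_Icc_self ht
  have hm : ∀ r ∈ Icc (0 : ℝ) 1, (δ.segment s a b ha hab hb).map (edge r) =
      δ.path (r * (b - a) + a) := fun r hr => congrArg δ.path (hpt r hr)
  have hsec : (δ.segment s a b ha hab hb).sec (edge t) = δ.branch s (t * (b - a) + a) :=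
    congrArg (δ.branch s) (hpt t ht')
  have hder : deriv (fun r => (δ.segment s a b ha hab hb).map (edge r)) t =
      (b - a : ℝ) * deriv δ.path (t * (b - a) + a) := by
    have hd := ((δ.smooth.contDiffAt (isOpen_Ioo.mem_nhds (hmem t ht'))).differentiableAt
      (by simp)).hasDerivAt
    have hl : HasDerivAt (fun r : ℝ => r * (b - a) + a) (b - a) t := by
      simpa using ((hasDerivAt_id t).mul_const (b - a)).add_const a
    have h2 := hd.scomp t hl
    rw [Complex.real_smul] at h2
    refine HasDerivAt.deriv (h2.congr_of_eventuallyEq ?_)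
    filter_upwards [Icc_mem_nhds ht.1 ht.2] with r hr using hm r hr
  simp only [hder, hm t ht', hsec, integrand, Complex.real_smul]
  push_cast
  ring

theorem bdry_path_segment (F : ℂ → ℂ) {a b : ℝ} (ha : 0 < a) (hab : a ≤ b) (hb : b < 1) :
    bdry F (δ.segment s a b ha hab hb) =
      δ.branch s b * F (δ.path b) - δ.branch s a * F (δ.path a) := by
  have h1 : a * (stdSimplex.vertex (S := ℝ) (1 : Fin 2)).1 0 +
      b * (stdSimplex.vertex (S := ℝ) (1 : Fin 2)).1 1 = b := by simp
  have h0 : a * (stdSimplex.vertex (S := ℝ) (0 : Fin 2)).1 0 +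
      b * (stdSimplex.vertex (S := ℝ) (0 : Fin 2)).1 1 = a := by simp
  change δ.branch s (a * (stdSimplex.vertex (S := ℝ) (1 : Fin 2)).1 0 +
      b * (stdSimplex.vertex (S := ℝ) (1 : Fin 2)).1 1) * F (δ.path (a *
      (stdSimplex.vertex (S := ℝ) (1 : Fin 2)).1 0 +
      b * (stdSimplex.vertex (S := ℝ) (1 : Fin 2)).1 1)) - δ.branch s (a *
      (stdSimplex.vertex (S := ℝ) (0 : Fin 2)).1 0 +
      b * (stdSimplex.vertex (S := ℝ) (0 : Fin 2)).1 1) * F (δ.path (a *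
      (stdSimplex.vertex (S := ℝ) (0 : Fin 2)).1 0 +
      b * (stdSimplex.vertex (S := ℝ) (0 : Fin 2)).1 1)) = _
  rw [h1, h0]

theorem tendsto_zero_punctured : Tendsto δ.path (𝓝[>] 0) (𝓝[≠] (S.pt 0)) := by
  refine tendsto_nhdsWithin_iff.2 ⟨by rw [S.pt_zero]; exact δ.tendsto_zero, ?_⟩
  filter_upwards [Ioo_mem_nhdsGT (zero_lt_one (α := ℝ))] with t ht using δ.mem t ht 0

theorem tendsto_one_punctured : Tendsto δ.path (𝓝[<] 1) (𝓝[≠] (S.pt i.succ)) := by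
  refine tendsto_nhdsWithin_iff.2 ⟨δ.tendsto_one, ?_⟩
  filter_upwards [Ioo_mem_nhdsLT (zero_lt_one (α := ℝ))] with t ht using δ.mem t ht _

theorem norm_branch {t : ℝ} (ht : t ∈ Ioo (0 : ℝ) 1) :
    ‖δ.branch s t‖ = S.weight (fun k => s k / 2) (δ.path t) :=
  ofReal_weight_half fun k => δ.exp_log k t ht

theorem branch_isBigO {k : Fin (n + 1)} {L : Filter ℝ} (hL : Ioo (0 : ℝ) 1 ∈ L)
    (h : Tendsto δ.path L (𝓝[≠] (S.pt k))) :
    δ.branch s =O[L] fun t => ‖δ.path t - S.pt k‖ ^ s k := by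
  have h1 := ((weight_isBigO (S := S) (fun k => s k / 2) k).mono
    (nhdsWithin_le_nhds (s := {S.pt k}ᶜ))).comp_tendsto h
  refine IsBigO.trans (IsBigO.of_norm_eventuallyLE ?_) (h1.congr_right fun t => ?_)
  · filter_upwards [hL] with t ht
    rw [δ.norm_branch ht, Function.comp]
  · rw [Function.comp]
    congr 1
    ring

/-- The branch is O(|z - σ_k|^{s_k}), so the product is O(|z - σ_k|^{s_k + 1}). Hence corrections of
order z - σ_k do not affect limits along the path, even when s_k is negative and the branch itself
blows up. -/
theorem tendsto_branch_mul {k : Fin (n + 1)} {L : Filter ℝ} (hL : Ioo (0 : ℝ) 1 ∈ L)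
    (h : Tendsto δ.path L (𝓝[≠] (S.pt k))) (hs : -1 < s k) {F : ℂ → ℂ}
    (hF : F =O[𝓝[≠] (S.pt k)] fun z => z - S.pt k) :
    Tendsto (fun t => δ.branch s t * F (δ.path t)) L (𝓝 0) := by
  have h1 := (δ.branch_isBigO (s := s) hL h).mul (hF.norm_right.comp_tendsto h)
  have h2 : Tendsto (fun z => ‖z - S.pt k‖ ^ (s k + 1)) (𝓝[≠] (S.pt k)) (𝓝 0) :=
    tendsto_norm_sub_rpow _ (by linarith)
  refine (h1.congr' EventuallyEq.rfl ?_).trans_tendsto (h2.comp h)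
  have h3 : ∀ᶠ t in L, δ.path t ∈ {S.pt k}ᶜ := h (self_mem_nhdsWithin (s := {S.pt k}ᶜ))
  filter_upwards [h3] with t ht
  have h4 : 0 < ‖δ.path t - S.pt k‖ := norm_pos_iff.2 (sub_ne_zero.2 ht)
  rw [Function.comp, Function.comp, Real.rpow_add_one h4.ne']

variable (s) in
/-- The regularised integral of a logarithmic form along a portion of the path. -/
def regIntegral (a : Fin (n + 1) → ℂ) (ab : ℝ × ℝ) : ℂ :=
  (∫ t in ab.1..ab.2, δ.integrand s (S.logForm a).1 t) - a i.succ / s i.succ * δ.branch s ab.2 +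
    a 0 / s 0 * δ.branch s ab.1

/-- The pairing with the class of a logarithmic form is a regularised integral. -/
theorem IsPairing.tendsto (hs : IsGeneric s) {a : Fin (n + 1) → ℂ} {v : ℂ}
    (h : δ.IsPairing s (S.comparison s (Submodule.Quotient.mk (S.logForm a))) v) :
    Tendsto (δ.regIntegral s a) (𝓝[>] 0 ×ˢ 𝓝[<] 1) (𝓝 v) := by
  obtain ⟨φ, K, hφ, hK, hKS, hφK, a₀, b₀, ha₀, hab, hb₀, haK, hbK, rfl⟩ := h
  rw [mk_comparison, Submodule.Quotient.eq] at hφ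
  obtain ⟨F, hF⟩ := mem_range_coboundary_iff.1 hφ
  have hval : ∀ T : S.TwistedSimplex s 1, φ.1 T = S.periodCochain s (S.logForm a) T + bdry F T :=
    fun T => by
      have h1 : φ.1 T - S.periodCochain s (S.logForm a) T = bdry F T := hF T T.mem
      linear_combination h1
  -- the behaviour of `F` near `σ_k`
  have hFk : ∀ k, (fun z => F z + a k / s k) =O[𝓝[≠] (S.pt k)] fun z => z - S.pt k := fun k => by
    obtain ⟨ε, hε0, hε⟩ := S.exists_radius
    have hKk : S.pt k ∉ K := fun h => hKS h k rfl
    obtain ⟨η, hη0, hη⟩ := Metric.isOpen_iff.1 hK.isClosed.isOpen_compl _ hKk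
    have hε' : ∀ j k, j ≠ k → min ε η ≤ dist (S.pt j) (S.pt k) := fun j k h =>
      (min_le_left _ _).trans (hε j k h)
    -- Near σ_k the cocycle φ vanishes, so -F is a primitive of the period cochain there. It extends
    -- over σ_k with the value a_k/s_k.
    have hprim : IsPrimitiveOn (S.periodCochain s (S.logForm a)) (-F) (S.punctured k (min ε η)) := by
      intro T hT
      have h1 := hφK T fun p hp => hη (Metric.ball_subset_ball (min_le_right _ _) (hT p).1) hp
      rw [hval] at h1
      rw [eq_neg_of_add_eq_zero_left h1, bdry, bdry, Pi.neg_apply, Pi.neg_apply]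
      ring
    have hopen : IsOpen (S.punctured k (min ε η)) :=
      Metric.isOpen_ball.sdiff isClosed_singleton
    obtain ⟨G, hG1, hG2, hG3⟩ := exists_extension (lt_min hε0 hη0) hε' k (hs.abs_lt_one k)
      fun z hz => hprim.hasDerivAt hopen (punctured_subset hε' k) hz
    have hb := Metric.ball_mem_nhds (S.pt k) (lt_min hε0 hη0)
    have h2 := ((hG1.differentiableAt hb).isBigO_sub.mono
      (nhdsWithin_le_nhds (s := {S.pt k}ᶜ))).neg_left
    refine h2.congr' ?_ EventuallyEq.rfl
    filter_upwards [sdiff_mem_nhdsWithin_compl hb {S.pt k}] with z hz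
    have hsk : (s k : ℂ) ≠ 0 := by exact_mod_cast hs.ne_zero k
    rw [hG3 z hz, ← hG2, mul_div_cancel_left₀ _ hsk, Pi.neg_apply]
    ring
  -- the value of the cocycle on portions of the path
  let I : ℝ → ℝ → ℂ := fun x y => ∫ t in x..y, δ.integrand s (S.logForm a).1 t
  let Q : ℝ → ℂ := fun t => δ.branch s t * F (δ.path t)
  have hseg : ∀ x y (hx : 0 < x) (hxy : x ≤ y) (hy : y < 1),
      φ.1 (δ.segment s x y hx hxy hy) = I x y + Q y - Q x := fun x y hx hxy hy => by
    rw [hval, periodCochain_segment, bdry_path_segment]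
    ring
  have hcombo : ∀ {x y : ℝ} (hx : 0 < x) (hxy : x ≤ y) (hy : y < 1) (p : Simplex 1),
      x * p.1 0 + y * p.1 1 ∈ Icc x y := fun {x y} hx hxy hy p => by
    have h0 := p.2.1 0
    have h1 := p.2.1 1
    have h2 : p.1 0 + p.1 1 = 1 := by
      have := p.2.2
      rwa [Fin.sum_univ_two] at this
    constructor <;> nlinarith
  -- Enlarging the segment only adds portions of the path that avoid K, on which φ vanishes.
  have hmain : ∀ x ∈ Ioc 0 a₀, ∀ y ∈ Ico b₀ 1,
      φ.1 (δ.segment s a₀ b₀ ha₀ hab hb₀) = I x y + Q y - Q x := fun x hx y hy => by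
    have h1 : I x a₀ + Q a₀ - Q x = 0 := by
      rw [← hseg x a₀ hx.1 hx.2 (hab.trans_lt hb₀)]
      refine hφK _ fun p => haK _ ?_
      have := hcombo hx.1 hx.2 (hab.trans_lt hb₀) p
      exact ⟨hx.1.trans_le this.1, this.2⟩
    have h2 : I b₀ y + Q y - Q b₀ = 0 := by
      rw [← hseg b₀ y (ha₀.trans_le hab) hy.1 hy.2]
      refine hφK _ fun p => hbK _ ?_
      have := hcombo (ha₀.trans_le hab) hy.1 hy.2 p
      exact ⟨this.1, this.2.trans_lt hy.2⟩
    have hx1 : x ∈ Ioo (0 : ℝ) 1 := ⟨hx.1, by linarith [hx.2]⟩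
    have ha1 : a₀ ∈ Ioo (0 : ℝ) 1 := ⟨ha₀, by linarith⟩
    have hb1 : b₀ ∈ Ioo (0 : ℝ) 1 := ⟨by linarith, hb₀⟩
    have hy1 : y ∈ Ioo (0 : ℝ) 1 := ⟨by linarith [hy.1], hy.2⟩
    have h3 : I x a₀ + I a₀ b₀ + I b₀ y = I x y := by
      simp only [I]
      rw [intervalIntegral.integral_add_adjacent_intervals, intervalIntegral.integral_add_adjacent_intervals]
      all_goals exact δ.intervalIntegrable_integrand _ (by assumption) (by assumption)
    rw [hseg]
    linear_combination -h1 - h2 - h3 * (-1)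
  have hlim1 := δ.tendsto_branch_mul (s := s) (Ioo_mem_nhdsLT (zero_lt_one (α := ℝ)))
    δ.tendsto_one_punctured (by linarith [(abs_lt.1 (hs.abs_lt_one i.succ)).1]) (hFk i.succ)
  have hlim0 := δ.tendsto_branch_mul (s := s) (Ioo_mem_nhdsGT (zero_lt_one (α := ℝ)))
    δ.tendsto_zero_punctured (by linarith [(abs_lt.1 (hs.abs_lt_one 0)).1]) (hFk 0)
  have hlim := ((tendsto_const_nhds (x := φ.1 (δ.segment s a₀ b₀ ha₀ hab hb₀))).sub
    (hlim1.comp tendsto_snd)).add (hlim0.comp (tendsto_fst (f := 𝓝[>] (0 : ℝ)) (g := 𝓝[<] (1 : ℝ))))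
  rw [sub_zero, add_zero] at hlim
  refine hlim.congr' ?_
  have hev : ∀ᶠ ab : ℝ × ℝ in 𝓝[>] 0 ×ˢ 𝓝[<] 1, ab.1 ∈ Ioc 0 a₀ ∧ ab.2 ∈ Ico b₀ 1 :=
    (eventually_mem_set.2 (Ioc_mem_nhdsGT ha₀)).prod_mk (eventually_mem_set.2 (Ico_mem_nhdsLT hb₀))
  filter_upwards [hev] with ab hab'
  rw [hmain ab.1 hab'.1 ab.2 hab'.2]
  simp only [regIntegral, Function.comp, I, Q]
  ring

/-- Adding the boundary of the cut-off potential to the period cochain gives a cocycle in the same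
class. It vanishes off K because there the potential, up to sign, is a primitive of the period
cochain. -/
theorem exists_isPairing (hs : IsGeneric s) (c : S.Betti s) : ∃ v, δ.IsPairing s c v := by
  obtain ⟨a, rfl⟩ := exists_logForm_comparison hs c
  obtain ⟨φ, K, -, hK, hKS, hφ⟩ := exists_cutoff (S := S) hs a
  have hKc : ∀ k, Kᶜ ∈ 𝓝[≠] (S.pt k) := fun k =>
    mem_nhdsWithin_of_mem_nhds (hK.isClosed.isOpen_compl.mem_nhds fun h => hKS h k rfl)
  have h0 := (mem_nhdsGT_iff_exists_Ioc_subset).1 (δ.tendsto_zero_punctured (hKc 0))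
  have h1 := (mem_nhdsLT_iff_exists_Ico_subset).1 (δ.tendsto_one_punctured (hKc i.succ))
  obtain ⟨x, hx0, hx⟩ := h0
  obtain ⟨y, hy1, hy⟩ := h1
  have hx0 : 0 < x := hx0
  have hy1 : y < 1 := hy1
  let ψ : S.Cocycle s := ⟨S.periodCochain s (S.logForm a) + S.coboundary s 0 (S.zeroCochain s φ),
    add_mem (S.periodCochain_mem s _) (coboundary_zeroCochain_mem φ)⟩
  -- The minimum and the maximum with 1/2 keep the two parameters in the right order.
  refine ⟨_, ψ, K, ?_, hK, hKS, fun T hT => ?_, min x (1 / 2), max y (1 / 2),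
    lt_min hx0 (by norm_num), (min_le_right _ _).trans (le_max_right _ _),
    max_lt hy1 (by norm_num), fun t ht => hx ⟨ht.1, ht.2.trans (min_le_left _ _)⟩,
    fun t ht => hy ⟨(le_max_left _ _).trans ht.1, ht.2⟩, rfl⟩
  · rw [mk_comparison, Submodule.Quotient.eq]
    refine ⟨S.zeroCochain s φ, ?_⟩
    change _ = S.periodCochain s (S.logForm a) + S.coboundary s 0 (S.zeroCochain s φ) -
      S.periodCochain s (S.logForm a)
    rw [add_sub_cancel_left]
  · change T.integral (S.logForm a).1 + S.coboundary s 0 (S.zeroCochain s φ) T = 0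
    rw [coboundary_zeroCochain, integral_eq_bdry (F := -φ) T fun p => ?_]
    · simp only [bdry, Pi.neg_apply]
      ring
    · refine (hφ _ ⟨T.mem p, hT p⟩).neg.congr_deriv ?_
      rw [Pi.neg_apply]
      ring

theorem isPairing_pairing (hs : IsGeneric s) (c : S.Betti s) : δ.IsPairing s c (δ.pairing s c) :=
  Classical.epsilon_spec (δ.exists_isPairing hs c)

theorem pairing_tendsto (hs : IsGeneric s) (a : Fin (n + 1) → ℂ) :
    Tendsto (δ.regIntegral s a) (𝓝[>] 0 ×ˢ 𝓝[<] 1)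
      (𝓝 (δ.pairing s (S.comparison s (Submodule.Quotient.mk (S.logForm a))))) :=
  IsPairing.tendsto δ hs (δ.isPairing_pairing hs _)

/-- Every value of the pairing is the limit of the same regularised integrals, so the value does not
depend on the cocycle, the compact set or the portion of the path. -/
theorem IsPairing.eq (hs : IsGeneric s) {c : S.Betti s} {v : ℂ} (h : δ.IsPairing s c v) :
    δ.pairing s c = v := by
  obtain ⟨a, rfl⟩ := exists_logForm_comparison hs c
  exact tendsto_nhds_unique (δ.pairing_tendsto hs a) (IsPairing.tendsto δ hs h)

end BranchedPath

end PointConfig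

/-! ### Integrability of powers and calculus of real derivatives -/

theorem integrableAtFilter_norm_rpow (σ : ℂ) {r : ℝ} (hr : -2 < r) :
    IntegrableAtFilter (fun z : ℂ => ‖z - σ‖ ^ r) (𝓝 σ) := by
  have h0 : IntegrableOn (fun z : ℂ => ‖z‖ ^ r) (Metric.ball 0 1) := by
    rw [integrableOn_fun_norm_addHaar volume (f := fun y => y ^ r), Complex.finrank_real_complex]
    have h1 : IntegrableOn (fun y : ℝ => y ^ (r + 1)) (Ioo 0 1) :=
      ((intervalIntegral.integrableOn_Ioo_rpow_iff one_pos).2 (by linarith))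
    refine h1.congr_fun (fun y hy => ?_) measurableSet_Ioo
    simp only [Nat.add_one_sub_one, pow_one, smul_eq_mul]
    rw [Real.rpow_add_one hy.1.ne', mul_comm]
  refine ⟨Metric.ball σ 1, Metric.ball_mem_nhds σ one_pos, ?_⟩
  have h2 := (measurePreserving_sub_right volume σ).integrableOn_comp_preimage
    (measurableEmbedding_subRight σ) (f := fun z : ℂ => ‖z‖ ^ r) (s := Metric.ball 0 1)
  have h3 : (fun z : ℂ => z - σ) ⁻¹' Metric.ball 0 1 = Metric.ball σ 1 := by
    ext z; simp [dist_eq_norm]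
  rw [h3] at h2
  exact h2.2 h0

theorem hasFDerivAt_conj {F : ℂ → ℂ} {a b z : ℂ} (h : HasFDerivAt F (formMap a b) z) :
    HasFDerivAt (fun z => (starRingEnd ℂ) (F z))
      (formMap ((starRingEnd ℂ) b) ((starRingEnd ℂ) a)) z := by
  have := (Complex.conjCLE : ℂ →L[ℝ] ℂ).hasFDerivAt.comp z h
  refine this.congr_fderiv ?_
  ext1 v
  simp
  ring

theorem hasFDerivAt_mul {F G : ℂ → ℂ} {a b c d z : ℂ} (hF : HasFDerivAt F (formMap a b) z)
    (hG : HasFDerivAt G (formMap c d) z) : HasFDerivAt (fun z => F z * G z)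
      (formMap (a * G z + F z * c) (b * G z + F z * d)) z := by
  refine (hF.mul hG).congr_fderiv ?_
  ext1 v
  simp
  ring

theorem hasFDerivAt_formMap {F : ℂ → ℂ} {z : ℂ} (h : DifferentiableAt ℝ F z) :
    HasFDerivAt F (formMap (del F z) (dbar F z)) z := by
  refine h.hasFDerivAt.congr_fderiv ?_
  ext1 v
  rw [fderiv_apply_eq, formMap_apply]

theorem contDiffOn_one_of_hasFDerivAt {F a b : ℂ → ℂ} {U : Set ℂ} (hU : IsOpen U)
    (ha : ContinuousOn a U) (hb : ContinuousOn b U)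
    (h : ∀ z ∈ U, HasFDerivAt F (formMap (a z) (b z)) z) : ContDiffOn ℝ 1 F U := by
  rw [show (1 : WithTop ℕ∞) = 0 + 1 by rfl, contDiffOn_succ_iff_fderiv_of_isOpen hU]
  refine ⟨fun z hz => (h z hz).differentiableAt.differentiableWithinAt, by simp, ?_⟩
  rw [contDiffOn_zero]
  have : ContinuousOn (fun z => formMap (a z) (b z)) U :=
    (ha.smul continuousOn_const).add (hb.smul continuousOn_const)
  exact this.congr fun z hz => (h z hz).fderiv

theorem dbar_del_comm {φ : ℂ → ℂ} {U : Set ℂ} (hU : IsOpen U) (hφ : ContDiffOn ℝ ∞ φ U) {z : ℂ}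
    (hz : z ∈ U) : dbar (del φ) z = del (dbar φ) z := by
  have hc : ContDiffAt ℝ ∞ φ z := hφ.contDiffAt (hU.mem_nhds hz)
  have h2 : HasFDerivAt (fderiv ℝ φ) (fderiv ℝ (fderiv ℝ φ) z) z :=
    ((hc.fderiv_right (m := ∞) (by simp)).differentiableAt (by simp)).hasFDerivAt
  have hs := hc.isSymmSndFDerivAt (by simp only [minSmoothness_of_isRCLikeNormedField]; exact WithTop.coe_le_coe.2 le_top)
    1 Complex.I
  have hv : ∀ v : ℂ, HasFDerivAt (fun w => fderiv ℝ φ w v)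
      ((ContinuousLinearMap.apply ℝ ℂ v).comp (fderiv ℝ (fderiv ℝ φ) z)) z := fun v =>
    (ContinuousLinearMap.apply ℝ ℂ v).hasFDerivAt.comp z h2
  have h1 := ((hv 1).sub ((hv Complex.I).const_mul Complex.I)).mul_const (2 : ℂ)⁻¹
  have h1' := ((hv 1).add ((hv Complex.I).const_mul Complex.I)).mul_const (2 : ℂ)⁻¹
  rw [dbar_eq_of_hasFDerivAt (φ := del φ) h1, del_eq_of_hasFDerivAt (φ := dbar φ) h1']
  simp only [smul_apply, sub_apply, add_apply, ContinuousLinearMap.comp_apply,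
    ContinuousLinearMap.apply_apply, smul_eq_mul]
  rw [hs]
  ring

theorem contDiffOn_del_dbar {φ : ℂ → ℂ} {U : Set ℂ} (hU : IsOpen U) (hφ : ContDiffOn ℝ ∞ φ U) :
    ContDiffOn ℝ ∞ (del φ) U ∧ ContDiffOn ℝ ∞ (dbar φ) U := by
  have h : ∀ v : ℂ, ContDiffOn ℝ ∞ (fun z => fderiv ℝ φ z v) U := fun v =>
    (hφ.fderiv_of_isOpen (m := ∞) hU (by simp)).clm_apply contDiffOn_const
  exact ⟨((h 1).sub (contDiffOn_const.mul (h Complex.I))).div_const 2,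
    ((h 1).add (contDiffOn_const.mul (h Complex.I))).div_const 2⟩

/-- The integral of `∂ψ` vanishes if `ψ` has no residues. -/
theorem integral_del_eq_zero {ι : Type*} [Fintype ι] {σ : ι → ℂ}
    (hσ : Function.Injective σ) {ψ : ℂ → ℂ} (hψ : ContDiffOn ℝ 1 ψ {z | ∀ k, z ≠ σ k})
    (hint : Integrable (del ψ))
    (hc : ∀ k, Tendsto (fun z => ‖z - σ k‖ * ‖ψ z‖) (𝓝[≠] (σ k)) (𝓝 0))
    (hd : Tendsto (fun z => ‖z‖ * ‖ψ z‖) (cocompact ℂ) (𝓝 0)) : ∫ z, del ψ z = 0 := by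
  have hopen : IsOpen {z | ∀ k, z ≠ σ k} := by
    rw [show {z | ∀ k, z ≠ σ k} = (range σ)ᶜ by ext z; simp [eq_comm]]
    exact (finite_range σ).isClosed.isOpen_compl
  have hae : ∀ᵐ z : ℂ, z ∈ {z | ∀ k, z ≠ σ k} := by
    have : {z | ∀ k, z ≠ σ k}ᶜ = range σ := by ext z; simp [eq_comm]
    rw [ae_iff]
    change volume {z | ∀ k, z ≠ σ k}ᶜ = 0
    rw [this]
    exact (finite_range σ).measure_zero _
  have hdel : del ψ =ᵐ[volume] fun z => (starRingEnd ℂ) (dbar (fun z => (starRingEnd ℂ) (ψ z)) z) := by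
    filter_upwards [hae] with z hz
    exact del_conj_conj ((hψ.contDiffAt (hopen.mem_nhds hz)).differentiableAt one_ne_zero)
  have hint' : Integrable (dbar fun z => (starRingEnd ℂ) (ψ z)) := by
    have h1 := hint.congr hdel
    have h2 : Integrable fun z => (starRingEnd ℂ) ((starRingEnd ℂ)
        (dbar (fun z => (starRingEnd ℂ) (ψ z)) z)) := Complex.conjCLE.toContinuousLinearMap.integrable_comp h1
    simpa using h2
  rw [integral_congr_ae hdel, integral_conj,
    integral_dbar_eq_of_residues (ψ := fun z => (starRingEnd ℂ) (ψ z)) hσ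
      (Complex.conjCLE.contDiff.comp_contDiffOn hψ) hint'
      (c := 0) (d := 0)]
  · simp
  · intro k
    rw [Pi.zero_apply, tendsto_zero_iff_norm_tendsto_zero]
    refine (hc k).congr fun z => ?_
    rw [norm_mul, RCLike.norm_conj]
  · rw [tendsto_zero_iff_norm_tendsto_zero]
    refine hd.congr fun z => ?_
    rw [norm_mul, RCLike.norm_conj]

namespace PointConfig

variable {n : ℕ} {S : PointConfig n} {s : Fin (n + 1) → ℝ}

variable (S) in
theorem ae_mem_compl : ∀ᵐ z : ℂ, z ∈ S.compl := by
  have : S.complᶜ = range S.pt := by ext z; simp [compl, eq_comm]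
  rw [ae_iff]
  change volume S.complᶜ = 0
  rw [this]
  exact (finite_range S.pt).measure_zero _

theorem aestronglyMeasurable_of_continuousOn {f : ℂ → ℂ} (hf : ContinuousOn f S.compl) :
    AEStronglyMeasurable f := by
  have h := hf.aestronglyMeasurable (μ := volume) S.isOpen_compl.measurableSet
  rwa [Measure.restrict_eq_self_of_ae_mem S.ae_mem_compl] at h

/-- In real dimension 2, a power |z - σ|^r is integrable at σ when r > -2, and |z|^q is integrable
at infinity when q < -2. -/
theorem integrable_of_isBigO {f : ℂ → ℂ} (hf : ContinuousOn f S.compl) {r : Fin (n + 1) → ℝ}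
    {q : ℝ} (hr : ∀ k, -2 < r k) (hq : q < -2)
    (hk : ∀ k, f =O[𝓝[≠] (S.pt k)] fun z => ‖z - S.pt k‖ ^ r k)
    (hinf : f =O[cocompact ℂ] fun z => ‖z‖ ^ q) : Integrable f := by
  have hm := aestronglyMeasurable_of_continuousOn hf
  have hloc : LocallyIntegrable f := by
    intro z
    by_cases hz : z ∈ S.compl
    · have hc := hf.continuousAt (S.isOpen_compl.mem_nhds hz)
      exact (hc.isBigO_one ℝ).integrableAtFilter hm.stronglyMeasurableAtFilter
        ((continuous_const (y := (1 : ℝ))).locallyIntegrable z)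
    · simp only [compl, mem_ofPred_eq, not_forall, not_not] at hz
      obtain ⟨k, rfl⟩ := hz
      have : IsMeasurablyGenerated (𝓝[≠] (S.pt k)) :=
        (measurableSet_singleton _).compl.nhdsWithin_isMeasurablyGenerated _
      obtain ⟨t, ht, htf⟩ := (hk k).integrableAtFilter hm.stronglyMeasurableAtFilter
        ((integrableAtFilter_norm_rpow (S.pt k) (hr k)).filter_mono nhdsWithin_le_nhds)
      refine ⟨insert (S.pt k) t, insert_mem_nhds_iff.2 ht, ?_⟩
      rw [insert_eq, integrableOn_union]
      exact ⟨by simp, htf⟩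
  refine hloc.integrable_of_isBigO_cocompact (g := fun z : ℂ => (1 + ‖z‖) ^ q) ?_ ?_
  · refine hinf.trans ?_
    refine IsBigO.of_bound ((1 / 2) ^ q) ?_
    filter_upwards [(tendsto_norm_cocompact_atTop (E := ℂ)).eventually_ge_atTop 1] with z hz
    have h1 : 0 < ‖z‖ := by linarith
    rw [Real.norm_eq_abs, Real.norm_eq_abs, abs_of_pos (Real.rpow_pos_of_pos h1 _),
      abs_of_pos (Real.rpow_pos_of_pos (by linarith) _), ← Real.mul_rpow (by norm_num) (by linarith)]
    exact Real.rpow_le_rpow_of_nonpos (by linarith) (by linarith) (by linarith)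
  · have h1 := integrable_one_add_norm (E := ℂ) (μ := volume) (r := -q) (by
      rw [Complex.finrank_real_complex]; push_cast; linarith)
    rw [neg_neg] at h1
    exact h1.integrableAtFilter _

theorem continuousOn_weight : ContinuousOn (S.weight s) S.compl := by
  refine continuousOn_finsetProd _ fun k _ => ?_
  exact ((continuous_factor k).norm.continuousOn).rpow_const fun z hz =>
    Or.inl (norm_ne_zero_iff.2 (factor_ne_zero hz))

theorem continuousOn_connForm : ContinuousOn (S.connForm s) S.compl :=
  continuousOn_finsetSum _ fun k _ => continuousOn_const.div
    (continuousOn_id.sub continuousOn_const) fun _ hz => sub_ne_zero.2 (hz k)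

theorem differentiableAt_connForm {z : ℂ} (hz : z ∈ S.compl) :
    DifferentiableAt ℂ (S.connForm s) z :=
  DifferentiableAt.fun_sum fun k _ => (differentiableAt_const _).div
    (differentiableAt_id.sub_const _) (sub_ne_zero.2 (hz k))

/-- Locally the weight is u ū with u a holomorphic branch, and u' is u times the connection
coefficient. -/
theorem hasFDerivAt_weight {z : ℂ} (hz : z ∈ S.compl) :
    HasFDerivAt (fun z => (S.weight s z : ℂ)) (formMap (S.connForm s z * S.weight s z)
      ((starRingEnd ℂ) (S.connForm s z) * S.weight s z)) z := by
  obtain ⟨r, hr, hball⟩ := Metric.isOpen_iff.1 S.isOpen_compl z hz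
  have hzb : Metric.ball z r ∈ 𝓝 z := Metric.ball_mem_nhds z hr
  obtain ⟨l⟩ := exists_logSystem ((convex_ball z r).starConvex (Metric.mem_ball_self hr))
    (Metric.mem_ball_self hr) hball
  have hW : ∀ w ∈ Metric.ball z r, (S.weight s w : ℂ) = l.sec s w * (starRingEnd ℂ) (l.sec s w) :=
    fun w hw => by
      rw [norm_factor_rpow s fun k => l.exp_log k w hw, LogSystem.sec, ← Complex.exp_conj,
        ← Complex.exp_add, map_sum, ← Finset.sum_add_distrib]
      congr 1
      refine Finset.sum_congr rfl fun k _ => ?_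
      rw [map_mul, Complex.conj_ofReal]
      ring
  have h1 := hasFDerivAt_formMap_zero_iff.2 (l.hasDerivAt_sec s hzb)
  have h2 := hasFDerivAt_mul h1 (hasFDerivAt_conj h1)
  refine (h2.congr_of_eventuallyEq ?_).congr_fderiv ?_
  · filter_upwards [hzb] with w hw using hW w hw
  · ext1 v
    simp only [formMap_apply, hW z (mem_of_mem_nhds hzb), map_zero, map_mul]
    ring

/-! ### The intersection pairing as an integral -/

/-- Extension by zero of a function that vanishes off a compact subset of `ℂ \ Σ`. -/
theorem contDiff_indicator {P : ℂ → ℂ} {K : Set ℂ} (hP : ContDiffOn ℝ 1 P S.compl)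
    (hK : IsCompact K) (hKS : K ⊆ S.compl) (h0 : ∀ z ∈ S.compl \ K, P z = 0) :
    ContDiff ℝ 1 (S.compl.indicator P) ∧ HasCompactSupport (S.compl.indicator P) ∧
      tsupport (S.compl.indicator P) ⊆ S.compl := by
  have hz : ∀ z ∉ K, S.compl.indicator P z = 0 := fun z hz => by
    by_cases hzS : z ∈ S.compl
    · rw [indicator_of_mem hzS, h0 z ⟨hzS, hz⟩]
    · exact indicator_of_notMem hzS _
  have hsub : tsupport (S.compl.indicator P) ⊆ K :=
    closure_minimal (fun z h => by_contra fun h' => h (hz z h')) hK.isClosed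
  refine ⟨contDiff_iff_contDiffAt.2 fun z => ?_, HasCompactSupport.intro hK hz, hsub.trans hKS⟩
  by_cases hzS : z ∈ S.compl
  · refine (hP.contDiffAt (S.isOpen_compl.mem_nhds hzS)).congr_of_eventuallyEq ?_
    filter_upwards [S.isOpen_compl.mem_nhds hzS] with w hw using indicator_of_mem hw _
  · refine (contDiffAt_const (c := (0 : ℂ))).congr_of_eventuallyEq ?_
    filter_upwards [hK.isClosed.isOpen_compl.mem_nhds fun h => hzS (hKS h)] with w hw using hz w hw

theorem contDiffOn_of_differentiableAt {f : ℂ → ℂ} {m : WithTop ℕ∞}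
    (hf : ∀ z ∈ S.compl, DifferentiableAt ℂ f z) : ContDiffOn ℝ m f S.compl :=
  (DifferentiableOn.contDiffOn (fun z hz => (hf z hz).differentiableWithinAt)
    S.isOpen_compl).restrict_scalars ℝ

theorem contDiffOn_regular (f : S.regularFunctions) {m : WithTop ℕ∞} :
    ContDiffOn ℝ m f.1 S.compl :=
  contDiffOn_of_differentiableAt fun _ hz => S.regularFunctions_differentiableAt f hz

theorem del_eq_of_eqOn {φ ψ : ℂ → ℂ} (h : EqOn φ ψ S.compl) {z : ℂ} (hz : z ∈ S.compl) :
    del φ z = del ψ z ∧ dbar φ z = dbar ψ z := by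
  have : fderiv ℝ φ z = fderiv ℝ ψ z := by
    refine EventuallyEq.fderiv_eq ?_
    filter_upwards [S.isOpen_compl.mem_nhds hz] with w hw using h hw
  simp only [del, dbar, this, and_self]

/-- Stokes' formula for a compactly supported representative and a primitive of the second
factor. -/
theorem wedgeIntegral_eq_of_primitive {f h : S.regularFunctions} {φ F m : ℂ → ℂ} {K : Set ℂ}
    (hφ : ContDiffOn ℝ ∞ φ S.compl) (hK : IsCompact K) (hKS : K ⊆ S.compl)
    (hvan : ∀ z ∈ S.compl \ K, (S.addCovariantDeriv s f.1 φ).dz z = 0 ∧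
      (S.addCovariantDeriv s f.1 φ).dzbar z = 0) (hm : ContinuousOn m S.compl)
    (hF : ∀ z ∈ S.compl, HasFDerivAt F (formMap (h.1 z + S.connForm s z * F z) (-m z)) z) :
    Integrable (fun z => (S.addCovariantDeriv s f.1 φ).dz z * m z) ∧
    wedgeIntegral (S.addCovariantDeriv s f.1 φ) (holForm h.1) =
      -(2 * Complex.I) * ∫ z, (S.addCovariantDeriv s f.1 φ).dz z * m z := by
  set P := (S.addCovariantDeriv s f.1 φ).dz with hPdef
  set Q := (S.addCovariantDeriv s f.1 φ).dzbar with hQdef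
  have hPe : ∀ z, P z = f.1 z + del φ z + S.connForm s z * φ z := fun z => rfl
  have hQe : Q = dbar φ := rfl
  obtain ⟨hdel, hdbar⟩ := contDiffOn_del_dbar S.isOpen_compl hφ
  have hAs : ContDiffOn ℝ 1 (S.connForm s) S.compl :=
    contDiffOn_of_differentiableAt fun z hz => differentiableAt_connForm hz
  have hφ1 : ContDiffOn ℝ 1 φ S.compl := hφ.of_le (by simp)
  have hdel1 : ContDiffOn ℝ 1 (del φ) S.compl := hdel.of_le (by simp)
  have hQ1 : ContDiffOn ℝ 1 Q S.compl := hdbar.of_le (by simp)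
  have hP1 : ContDiffOn ℝ 1 P S.compl := ((contDiffOn_regular f).add hdel1).add (hAs.mul hφ1)
  -- Nothing is known about φ on Σ. The coefficients are therefore replaced by their extensions by
  -- zero, which are C¹ on the plane and agree with them almost everywhere.
  obtain ⟨hP0, hPc, hPt⟩ := contDiff_indicator hP1 hK hKS fun z hz => (hvan z hz).1
  obtain ⟨hQ0, hQc, hQt⟩ := contDiff_indicator hQ1 hK hKS fun z hz => (hvan z hz).2
  have hFc : ContinuousOn F S.compl := fun z hz => (hF z hz).continuousAt.continuousWithinAt
  have hF1 : ContDiffOn ℝ 1 F S.compl :=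
    contDiffOn_one_of_hasFDerivAt S.isOpen_compl
      ((continuousOn_regular h).add (continuousOn_connForm.mul hFc)) hm.neg hF
  have hdF : ∀ z ∈ S.compl, del F z = h.1 z + S.connForm s z * F z ∧ dbar F z = -m z :=
    fun z hz => HasFDerivAt.del_dbar (hF z hz)
  -- the differential equation satisfied by a closed form
  have hclosed : ∀ z ∈ S.compl, dbar P z = del Q z + S.connForm s z * Q z := fun z hz => by
    have hn := S.isOpen_compl.mem_nhds hz
    have d1 := hasFDerivAt_formMap (((contDiffOn_regular f (m := 1)).contDiffAt hn).differentiableAt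
      one_ne_zero)
    have d2 := hasFDerivAt_formMap ((hdel1.contDiffAt hn).differentiableAt one_ne_zero)
    have d3 := hasFDerivAt_formMap ((hφ1.contDiffAt hn).differentiableAt one_ne_zero)
    have d4 := hasFDerivAt_formMap ((hAs.contDiffAt hn).differentiableAt one_ne_zero)
    have d5 := (d1.add d2).add (hasFDerivAt_mul d4 d3)
    rw [dbar_eq_zero_of_differentiableAt (S.regularFunctions_differentiableAt f hz),
      dbar_eq_zero_of_differentiableAt (differentiableAt_connForm hz),
      dbar_del_comm S.isOpen_compl hφ hz] at d5
    have d6 : HasFDerivAt P (formMap (del f.1 z + del (del φ) z +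
      (del (S.connForm s) z * φ z + S.connForm s z * del φ z))
      (del (dbar φ) z + S.connForm s z * dbar φ z)) z := by
      refine d5.congr_fderiv ?_
      ext1 v
      simp only [add_apply, formMap_apply]
      ring
    rw [(HasFDerivAt.del_dbar d6).2, hQe]
  have hclosed0 : ∀ z, dbar (S.compl.indicator P) z * F z =
      del (S.compl.indicator Q) z * F z + S.compl.indicator Q z * (S.connForm s z * F z) := by
    intro z
    by_cases hz : z ∈ S.compl
    · rw [(del_eq_of_eqOn (ψ := P) (fun w hw => indicator_of_mem hw P) hz).2,
        (del_eq_of_eqOn (ψ := Q) (fun w hw => indicator_of_mem hw Q) hz).1, hclosed z hz,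
        indicator_of_mem hz]
      ring
    · have h1 : ∀ R : ℂ → ℂ, tsupport (S.compl.indicator R) ⊆ S.compl →
          fderiv ℝ (S.compl.indicator R) z = 0 := fun R hR =>
        image_eq_zero_of_notMem_tsupport fun h => hz (hR (tsupport_fderiv_subset ℝ h))
      simp [del, dbar, h1 P hPt, h1 Q hQt, indicator_of_notMem hz]
  -- Stokes' formula for F (P dz + Q dz̄), as two integrations by parts: ∂ is moved off F against Q,
  -- and ∂/∂z̄ off F against P. By `hclosed0` the two results differ by the connection term, which
  -- cancels the one in ∂F. So the integral of Q h equals minus the integral of P m.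
  have e1 := integral_mul_del S.isOpen_compl hQ0 hQc hQt hF1
  have e2 := integral_mul_dbar S.isOpen_compl hP0 hPc hPt hF1
  have i1 : Integrable fun z => S.compl.indicator Q z * (h.1 z + S.connForm s z * F z) :=
    integrable_mul_of_hasCompactSupport hQ0.continuous hQc hQt
    ((continuousOn_regular h).add (continuousOn_connForm (s := s).mul hFc))
  have i2 : Integrable fun z => S.compl.indicator Q z * (S.connForm s z * F z) :=
    integrable_mul_of_hasCompactSupport hQ0.continuous hQc hQt
    (continuousOn_connForm (s := s).mul hFc)
  have i3 := integrable_mul_of_hasCompactSupport hP0.continuous hPc hPt hm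
  have i5 : Integrable fun z => del (S.compl.indicator Q) z * F z := by
    have h1 := (integral_mul_fderiv S.isOpen_compl hQ0 hQc hQt hF1 1).2.1
    have h2 := (integral_mul_fderiv S.isOpen_compl hQ0 hQc hQt hF1 Complex.I).2.1
    refine ((h1.sub (h2.const_mul Complex.I)).mul_const (2 : ℂ)⁻¹).congr (ae_of_all _ fun z => ?_)
    simp only [del, Pi.sub_apply]
    ring
  have a1 : (fun z => P z * m z) =ᵐ[volume] fun z => S.compl.indicator P z * m z := by
    filter_upwards [S.ae_mem_compl] with z hz
    rw [indicator_of_mem hz]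
  refine ⟨i3.congr a1.symm, ?_⟩
  have a2 : ∫ z, S.compl.indicator Q z * del F z =
      ∫ z, S.compl.indicator Q z * (h.1 z + S.connForm s z * F z) := by
    refine integral_congr_ae ?_
    filter_upwards [S.ae_mem_compl] with z hz
    rw [(hdF z hz).1]
  have a3 : ∫ z, S.compl.indicator P z * dbar F z = -∫ z, S.compl.indicator P z * m z := by
    rw [← integral_neg]
    refine integral_congr_ae ?_
    filter_upwards [S.ae_mem_compl] with z hz
    rw [(hdF z hz).2]
    ring
  have a4 : ∫ z, dbar (S.compl.indicator P) z * F z = (∫ z, del (S.compl.indicator Q) z * F z) +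
      ∫ z, S.compl.indicator Q z * (S.connForm s z * F z) := by
    rw [← integral_add i5 i2]
    exact integral_congr_ae (ae_of_all _ hclosed0)
  have a5 : ∫ z, S.compl.indicator Q z * h.1 z =
      (∫ z, S.compl.indicator Q z * (h.1 z + S.connForm s z * F z)) -
      ∫ z, S.compl.indicator Q z * (S.connForm s z * F z) := by
    rw [← integral_sub i1 i2]
    exact integral_congr_ae (ae_of_all _ fun z => by simp only; ring)
  have a6 : wedgeIntegral (S.addCovariantDeriv s f.1 φ) (holForm h.1) =
      2 * Complex.I * ∫ z, S.compl.indicator Q z * h.1 z := by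
    rw [wedgeIntegral, ← integral_const_mul]
    refine integral_congr_ae ?_
    filter_upwards [S.ae_mem_compl] with z hz
    rw [wedgeDensity, indicator_of_mem hz, ← hQdef]
    simp only [holForm, Pi.zero_apply]
    ring
  rw [a6, a5, ← a2, e1, integral_congr_ae a1]
  linear_combination (2 * Complex.I) * (a4 + a3 - e2)

end PointConfig

/-! ### From compactly supported forms to logarithmic forms -/

theorem isBigO_mul_rpow {u v : ℂ → ℂ} {w : ℂ → ℝ} {L : Filter ℂ} {p q : ℝ}
    (hw : ∀ᶠ z in L, 0 < w z) (hu : u =O[L] fun z => w z ^ p) (hv : v =O[L] fun z => w z ^ q) :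
    (fun z => u z * v z) =O[L] fun z => w z ^ (p + q) := by
  refine (hu.mul hv).congr' EventuallyEq.rfl ?_
  filter_upwards [hw] with z hz
  rw [Real.rpow_add hz]

theorem isBigO_conj {u : ℂ → ℂ} {w : ℂ → ℝ} {L : Filter ℂ} (h : u =O[L] w) :
    (fun z => (starRingEnd ℂ) (u z)) =O[L] w :=
  (isBigO_norm_left.1 (by simpa only [RCLike.norm_conj] using h.norm_left))

theorem isBigO_ofReal {u w : ℂ → ℝ} {L : Filter ℂ} (h : u =O[L] w) :
    (fun z => (u z : ℂ)) =O[L] w :=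
  (isBigO_norm_left.1 (by simpa only [Complex.norm_real] using h.norm_left))

namespace PointConfig

variable {n : ℕ} {S : PointConfig n} {s : Fin (n + 1) → ℝ}

theorem eventually_norm_pos (σ : ℂ) : ∀ᶠ z in 𝓝[≠] σ, 0 < ‖z - σ‖ := by
  filter_upwards [self_mem_nhdsWithin] with z hz using norm_pos_iff.2 (sub_ne_zero.2 hz)

theorem eventually_cocompact_norm_pos : ∀ᶠ z : ℂ in cocompact ℂ, 0 < ‖z‖ := by
  filter_upwards [eventually_cocompact_ne_zero] with z hz using norm_pos_iff.2 hz

variable (S s) in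
/-- The antiholomorphic form `W conj(ℓ)` with `W` the weight and `ℓ` a logarithmic form. -/
def weightedConj (a : Fin (n + 1) → ℂ) (z : ℂ) : ℂ :=
  S.weight s z * (starRingEnd ℂ) ((S.logForm a).1 z)

theorem weightedConj_isBigO (a : Fin (n + 1) → ℂ) (k : Fin (n + 1)) :
    S.weightedConj s a =O[𝓝[≠] (S.pt k)] fun z => ‖z - S.pt k‖ ^ (2 * s k + -1) :=
  isBigO_mul_rpow (eventually_norm_pos _)
    (isBigO_ofReal ((weight_isBigO s k).mono nhdsWithin_le_nhds)) (isBigO_conj (logForm_isBigO a k))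

theorem weightedConj_isBigO_infty (a : Fin (n + 1) → ℂ) :
    S.weightedConj s a =O[cocompact ℂ] fun z => ‖z‖ ^ (2 * ∑ k, s k + -1) :=
  isBigO_mul_rpow eventually_cocompact_norm_pos
    (isBigO_ofReal (weight_isBigO_infty s)) (isBigO_conj (logForm_isBigO_infty a))

theorem continuousOn_weightedConj (a : Fin (n + 1) → ℂ) :
    ContinuousOn (S.weightedConj s a) S.compl :=
  (Complex.continuous_ofReal.comp_continuousOn continuousOn_weight).mul
    (Complex.continuous_conj.comp_continuousOn (continuousOn_regular _))

/-- The conjugate of ℓ is antiholomorphic, so ∂ only differentiates the weight. Consequently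
multiplication by m = W conj(ℓ) turns ∂Φ + Φ ∑ s_k/(z - σ_k) into the plain derivative ∂(Φ m). -/
theorem hasFDerivAt_weightedConj (a : Fin (n + 1) → ℂ) {z : ℂ} (hz : z ∈ S.compl) :
    ∃ b, HasFDerivAt (S.weightedConj s a)
      (formMap (S.connForm s z * S.weightedConj s a z) b) z := by
  have h1 := hasFDerivAt_conj (hasFDerivAt_formMap_zero_iff.2
    (S.regularFunctions_differentiableAt (S.logForm a) hz).hasDerivAt)
  have h2 := hasFDerivAt_mul (hasFDerivAt_weight (s := s) hz) h1
  refine ⟨_, h2.congr_fderiv (congrArg (formMap · _) ?_)⟩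
  simp only [weightedConj, map_zero]
  ring

theorem contDiffOn_weightedConj (a : Fin (n + 1) → ℂ) :
    ContDiffOn ℝ 1 (S.weightedConj s a) S.compl := by
  refine ContDiffOn.mul ?_ (Complex.conjCLE.contDiff.comp_contDiffOn (contDiffOn_regular _))
  refine contDiffOn_one_of_hasFDerivAt S.isOpen_compl ?_ ?_ fun z hz => hasFDerivAt_weight hz
  · exact continuousOn_connForm.mul (Complex.continuous_ofReal.comp_continuousOn continuousOn_weight)
  · exact (Complex.continuous_conj.comp_continuousOn continuousOn_connForm).mul
      (Complex.continuous_ofReal.comp_continuousOn continuousOn_weight)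

/-- The exponent is 2 s_k - 2 > -2 at σ_k because s_k > 0. At infinity the vanishing of the residue
gains a power and the exponent is 2 ∑ s_k - 3 < -2, because ∑ s_k < 1/2. -/
theorem integrable_logForm_mul_weightedConj (hpos : ∀ k, 0 < s k) (hsum : ∑ k, s k < 1 / 2)
    (a : Fin (n + 1) → ℂ) {b : Fin (n + 1) → ℂ} (hb : ∑ k, b k = 0) :
    Integrable fun z => (S.logForm b).1 z * S.weightedConj s a z := by
  refine integrable_of_isBigO (S := S) (r := fun k => -1 + (2 * s k + -1))
    (q := -2 + (2 * ∑ k, s k + -1)) ((continuousOn_regular _).mul (continuousOn_weightedConj a))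
    (fun k => by linarith [hpos k]) (by linarith) (fun k => ?_) ?_
  · exact isBigO_mul_rpow (eventually_norm_pos _) (logForm_isBigO b k) (weightedConj_isBigO a k)
  · exact isBigO_mul_rpow eventually_cocompact_norm_pos (logForm_isBigO_infty_of_sum_eq_zero hb)
      (weightedConj_isBigO_infty a)

theorem logForm_neg_apply (b : Fin (n + 1) → ℂ) {z : ℂ} (hz : z ∈ S.compl) :
    (S.logForm (-b)).1 z = -(S.logForm b).1 z := by
  rw [logForm_apply _ hz, logForm_apply _ hz]
  simp [neg_div]

/-- Solutions off a compact set extend to `σ_k`. -/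
theorem exists_extension_of_isCompact (hs : IsGeneric s) {b : Fin (n + 1) → ℂ} {Φ : ℂ → ℂ}
    {K : Set ℂ} (hK : IsCompact K) (hKS : K ⊆ S.compl)
    (hvan : ∀ z ∈ S.compl \ K, HasDerivAt Φ (-(S.logForm b).1 z - S.connForm s z * Φ z) z)
    (k : Fin (n + 1)) : ∃ G : ℂ → ℂ, DifferentiableAt ℂ G (S.pt k) ∧ (s k : ℂ) * G (S.pt k) = -b k ∧
      G =ᶠ[𝓝[≠] (S.pt k)] Φ := by
  obtain ⟨ε, hε0, hε⟩ := S.exists_radius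
  obtain ⟨η, hη0, hη⟩ := Metric.isOpen_iff.1 hK.isClosed.isOpen_compl _ fun h => hKS h k rfl
  have hε' : ∀ j k, j ≠ k → min ε η ≤ dist (S.pt j) (S.pt k) := fun j k h =>
    (min_le_left _ _).trans (hε j k h)
  obtain ⟨G, hG1, hG2, hG3⟩ := exists_extension (a := -b) (lt_min hε0 hη0) hε' k (hs.abs_lt_one k)
    fun z hz => by
      rw [logForm_neg_apply b (punctured_subset hε' k hz)]
      exact hvan z ⟨punctured_subset hε' k hz,
        hη (Metric.ball_subset_ball (min_le_right _ _) hz.1)⟩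
  have hbn := Metric.ball_mem_nhds (S.pt k) (lt_min hε0 hη0)
  refine ⟨G, hG1.differentiableAt hbn, hG2, ?_⟩
  filter_upwards [sdiff_mem_nhdsWithin_compl hbn {S.pt k}] with z hz using hG3 z hz

/-- The extension of Φ to infinity takes a value whose product with ∑ s_k is -∑ b_k = 0. So it
vanishes at infinity and is O(1/|z|), being holomorphic in 1/z. -/
theorem isBigO_infty_of_isCompact (hs : IsGeneric s) {b : Fin (n + 1) → ℂ} {Φ : ℂ → ℂ}
    {K : Set ℂ} (hK : IsCompact K) (hb : ∑ k, b k = 0)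
    (hvan : ∀ z ∈ S.compl \ K, HasDerivAt Φ (-(S.logForm b).1 z - S.connForm s z * Φ z) z) :
    Φ =O[cocompact ℂ] fun z => ‖z‖ ^ (-1 : ℝ) := by
  obtain ⟨ρ, hρ0, hρ⟩ := S.exists_radius_infty
  obtain ⟨R, hR⟩ := hK.isBounded.exists_norm_le
  obtain ⟨r, hr0, hr⟩ : ∃ r > 0, ∀ z : ℂ, z ≠ 0 → z⁻¹ ∈ Metric.ball (0 : ℂ) r →
      z⁻¹ ∈ Metric.ball (0 : ℂ) ρ ∧ z ∉ K := by
    -- If 1/z has modulus less than 1/max(R, 1), then z is outside K. The 1 only keeps the radius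
    -- positive and finite.
    refine ⟨min ρ (max R 1)⁻¹, lt_min hρ0 (by positivity), fun z hz0 hz => ⟨?_, fun hzK => ?_⟩⟩
    · exact Metric.ball_subset_ball (min_le_left _ _) hz
    · have h1 : ‖z‖⁻¹ < (max R 1)⁻¹ := by
        have := (mem_ball_zero_iff.1 hz).trans_le (min_le_right _ _)
        rwa [norm_inv] at this
      have h2 := (inv_lt_inv₀ (norm_pos_iff.2 hz0) (by positivity)).1 h1
      exact absurd ((hR z hzK).trans (le_max_left R 1)) (not_le.2 h2)
  have hρr : ∀ k, min r ρ * ‖S.pt k‖ ≤ 1 := fun k =>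
    (mul_le_mul_of_nonneg_right (min_le_right _ _) (norm_nonneg _)).trans (hρ k)
  obtain ⟨G, hG1, hG2, hG3⟩ := exists_extension_infty (F := Φ) (a := -b) (lt_min hr0 hρ0) hρr
    hs.abs_sum_lt_one fun z hz0 hz => by
      rw [logForm_neg_apply b (mem_compl_of_inv_mem hρr hz hz0)]
      exact hvan z ⟨mem_compl_of_inv_mem hρr hz hz0,
      (hr z hz0 (Metric.ball_subset_ball (min_le_left _ _) hz)).2⟩
  have hG0 : G 0 = 0 := by
    have h1 : (∑ k, (s k : ℂ)) ≠ 0 := by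
      rw [← Complex.ofReal_sum]
      exact_mod_cast hs.sum_ne_zero
    refine (mul_eq_zero.1 (hG2.trans ?_)).resolve_left h1
    simp [hb]
  have hbn := Metric.ball_mem_nhds (0 : ℂ) (lt_min hr0 hρ0)
  have h1 := (hG1.differentiableAt hbn).isBigO_sub
  simp only [hG0, sub_zero] at h1
  have h2 : (fun z : ℂ => z⁻¹) =O[cocompact ℂ] fun z => ‖z‖ ^ (-1 : ℝ) :=
    IsBigO.of_norm_le fun z => by rw [Real.rpow_neg_one, norm_inv]
  refine ((h1.comp_tendsto tendsto_inv_cocompact).trans h2).congr' ?_ EventuallyEq.rfl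
  filter_upwards [eventually_cocompact_ne_zero, tendsto_inv_cocompact.eventually
    (eventually_mem_set.2 hbn)] with z hz0 hz
  rw [Function.comp, hG3 z hz0 hz]

/-- The integral of a compactly supported representative against `W conj(ℓ)` depends only on the
class of the form. -/
theorem integral_mul_weightedConj (hpos : ∀ k, 0 < s k) (hsum : ∑ k, s k < 1 / 2)
    (a : Fin (n + 1) → ℂ) {b : Fin (n + 1) → ℂ} (hb : ∑ k, b k = 0) {Φ P : ℂ → ℂ} {K : Set ℂ}
    (hΦ : ContDiffOn ℝ 1 Φ S.compl) (hK : IsCompact K) (hKS : K ⊆ S.compl)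
    (hvan : ∀ z ∈ S.compl \ K, HasDerivAt Φ (-(S.logForm b).1 z - S.connForm s z * Φ z) z)
    (hP : ∀ z ∈ S.compl, P z = (S.logForm b).1 z + del Φ z + S.connForm s z * Φ z)
    (hPi : Integrable fun z => P z * S.weightedConj s a z) :
    ∫ z, P z * S.weightedConj s a z = ∫ z, (S.logForm b).1 z * S.weightedConj s a z := by
  have hs := IsGeneric.of_pos hpos hsum
  set m := S.weightedConj s a with hm
  have hNi := integrable_logForm_mul_weightedConj (S := S) hpos hsum a hb
  have hdel : ∀ z ∈ S.compl, del (fun z => Φ z * m z) z =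
      P z * m z - (S.logForm b).1 z * m z := fun z hz => by
    obtain ⟨c, hc⟩ := hasFDerivAt_weightedConj (s := s) a hz
    have h1 := hasFDerivAt_mul (hasFDerivAt_formMap
      ((hΦ.contDiffAt (S.isOpen_compl.mem_nhds hz)).differentiableAt one_ne_zero)) hc
    rw [(HasFDerivAt.del_dbar h1).1, hP z hz]
    ring
  have hae : del (fun z => Φ z * m z) =ᵐ[volume] fun z => P z * m z - (S.logForm b).1 z * m z := by
    filter_upwards [S.ae_mem_compl] with z hz using hdel z hz
  have hΦk : ∀ k, Φ =O[𝓝[≠] (S.pt k)] fun z => ‖z - S.pt k‖ ^ (0 : ℝ) := fun k => by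
    obtain ⟨G, hG1, -, hG3⟩ := exists_extension_of_isCompact hs hK hKS hvan k
    simp only [Real.rpow_zero]
    exact ((hG1.continuousAt.isBigO_one ℝ).mono (nhdsWithin_le_nhds (s := {S.pt k}ᶜ))).congr'
      hG3 EventuallyEq.rfl
  have hΦinf := isBigO_infty_of_isCompact hs hK hb hvan
  -- The two integrands differ by ∂(Φ m). As Φ is bounded at the σ_k and O(1/|z|) at infinity, |z -
  -- σ_k| |Φ m| is O(|z - σ_k|^{2 s_k}) and |z| |Φ m| is O(|z|^{2 ∑ s_k - 1}). Both tend to zero, so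
  -- there are no residues.
  have hzero := integral_del_eq_zero (ψ := fun z => Φ z * m z) S.injective
    (hΦ.mul (contDiffOn_weightedConj a)) ((hPi.sub hNi).congr hae.symm) (fun k => ?_) ?_
  · rw [integral_congr_ae hae, integral_sub hPi hNi] at hzero
    exact sub_eq_zero.1 hzero
  · have h1 := isBigO_mul_rpow (eventually_norm_pos _) (hΦk k) (weightedConj_isBigO (s := s) a k)
    have h2 := (isBigO_refl (fun z => ‖z - S.pt k‖) (𝓝[≠] (S.pt k))).mul h1.norm_left
    refine (h2.congr' EventuallyEq.rfl ?_).trans_tendsto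
      (tendsto_norm_sub_rpow (S.pt k) (r := 2 * s k) (by linarith [hpos k]))
    filter_upwards [eventually_norm_pos (S.pt k)] with z hz
    rw [← Real.rpow_one_add' hz.le (by linarith [hpos k])]
    congr 1
    ring
  · have h1 := isBigO_mul_rpow eventually_cocompact_norm_pos hΦinf (weightedConj_isBigO_infty (S := S) (s := s) a)
    have h2 := (isBigO_refl (fun z : ℂ => ‖z‖) (cocompact ℂ)).mul h1.norm_left
    refine (h2.congr' EventuallyEq.rfl ?_).trans_tendsto
      (tendsto_norm_rpow_cocompact (r := 2 * ∑ k, s k - 1) (by linarith))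
    filter_upwards [eventually_cocompact_norm_pos] with z hz
    rw [← Real.rpow_one_add' hz.le (by linarith)]
    congr 1
    ring

/-- Values of the intersection pairing of a logarithmic form without pole at infinity with a class
that has a primitive with antiholomorphic derivative `-W conj(ℓ)`. -/
theorem wedgeIntegral_eq_integral_logForm (hpos : ∀ k, 0 < s k) (hsum : ∑ k, s k < 1 / 2)
    (a : Fin (n + 1) → ℂ) {b : Fin (n + 1) → ℂ} (hb : ∑ k, b k = 0)
    {f h : S.regularFunctions} {φ F : ℂ → ℂ} {K : Set ℂ}
    (hf : f - S.logForm b ∈ LinearMap.range (S.covariantDeriv s))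
    (hφ : ContDiffOn ℝ ∞ φ S.compl) (hK : IsCompact K) (hKS : K ⊆ S.compl)
    (hvan : ∀ z ∈ S.compl \ K, (S.addCovariantDeriv s f.1 φ).dz z = 0 ∧
      (S.addCovariantDeriv s f.1 φ).dzbar z = 0)
    (hF : ∀ z ∈ S.compl, HasFDerivAt F (formMap (h.1 z + S.connForm s z * F z)
      (-S.weightedConj s a z)) z) :
    wedgeIntegral (S.addCovariantDeriv s f.1 φ) (holForm h.1) =
      -(2 * Complex.I) * ∫ z, (S.logForm b).1 z * S.weightedConj s a z := by
  obtain ⟨h1, h2⟩ := wedgeIntegral_eq_of_primitive hφ hK hKS hvan (continuousOn_weightedConj a) hF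
  obtain ⟨ψ, hψ⟩ := hf
  have hψ' : ∀ z ∈ S.compl, f.1 z = (S.logForm b).1 z + deriv ψ.1 z + S.connForm s z * ψ.1 z :=
    fun z hz => by
      have := congrArg (fun g : S.regularFunctions => g.1 z) hψ
      simp only [covariantDeriv_apply ψ hz, AddSubgroupClass.coe_sub, Pi.sub_apply] at this
      linear_combination -this
  have hφd : ∀ z ∈ S.compl, DifferentiableAt ℝ φ z := fun z hz =>
    (hφ.contDiffAt (S.isOpen_compl.mem_nhds hz)).differentiableAt (by simp)
  have hψd := fun z (hz : z ∈ S.compl) => S.regularFunctions_differentiableAt ψ hz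
  -- f dz is the logarithmic form plus ∇_s ψ, so φ + ψ is a cut-off potential for the logarithmic
  -- form itself, with the same compactly supported representative.
  rw [h2, integral_mul_weightedConj hpos hsum a hb (Φ := fun z => φ z + ψ.1 z)
    ((hφ.of_le (by simp)).add (contDiffOn_regular ψ)) hK hKS (fun z hz => ?_) (fun z hz => ?_) h1]
  · have h3 := (addCovariantDeriv_eq_zero_iff (hφd z hz.1)).1 (hvan z hz)
    refine (h3.add (hψd z hz.1).hasDerivAt).congr_deriv ?_
    rw [hψ' z hz.1]
    ring
  · have h3 := (hasFDerivAt_formMap (hφd z hz)).add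
      (hasFDerivAt_formMap_zero_iff.2 (hψd z hz).hasDerivAt)
    have h4 : HasFDerivAt (fun z => φ z + ψ.1 z)
        (formMap (del φ z + deriv ψ.1 z) (dbar φ z)) z := by
      refine h3.congr_fderiv ?_
      ext1 v
      simp only [add_apply, formMap_apply]
      ring
    rw [(HasFDerivAt.del_dbar h4).1]
    change f.1 z + del φ z + S.connForm s z * φ z = _
    rw [hψ' z hz]
    ring

/-! ### The real Frobenius and complex conjugation -/

theorem weight_bar (s : Fin (n + 1) → ℝ) (z : ℂ) :
    S.bar.weight s z = S.weight s ((starRingEnd ℂ) z) := by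
  simp only [weight, factor_bar, RCLike.norm_conj]

theorem conjRegular_logForm (a : Fin (n + 1) → ℂ) :
    S.conjRegular (S.logForm a) = S.bar.logForm fun k => (starRingEnd ℂ) (a k) := by
  refine regular_ext fun z hz => ?_
  change (starRingEnd ℂ) ((S.logForm a).1 ((starRingEnd ℂ) z)) = _
  rw [logForm_apply _ hz, logForm_apply _ (S.mem_compl_bar.1 hz)]
  simp [bar]

theorem logForm_bar_apply (a : Fin (n + 1) → ℂ) (z : ℂ) :
    (S.bar.logForm fun k => (starRingEnd ℂ) (a k)).1 z =
      (starRingEnd ℂ) ((S.logForm a).1 ((starRingEnd ℂ) z)) := by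
  rw [← conjRegular_logForm]
  rfl

theorem connForm_neg (s : Fin (n + 1) → ℝ) (z : ℂ) : S.connForm (-s) z = -S.connForm s z := by
  simp [connForm, neg_div]

theorem deriv_bar_edge (T : S.bar.TwistedSimplex (-s) 1) (t : ℝ) :
    deriv (fun t => T.bar.map (edge t)) t = (starRingEnd ℂ) (deriv (fun t => T.map (edge t)) t) :=
  deriv.star

/-- Conjugating the simplex turns dz into dz̄ and the coefficient of ℓ into its conjugate, while the
transported section brings in the weight. So the Frobenius of a period cochain is integration of an
antiholomorphic form. -/
theorem integral_sub_integral_bar (h : S.bar.regularFunctions) (a : Fin (n + 1) → ℂ)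
    (T : S.bar.TwistedSimplex (-s) 1) :
    T.integral h.1 - T.bar.integral (S.logForm a).1 =
      formIntegral h.1 (fun z => -S.bar.weightedConj s (fun k => (starRingEnd ℂ) (a k)) z) T := by
  rw [TwistedSimplex.integral, TwistedSimplex.integral,
    ← intervalIntegral.integral_sub (T.intervalIntegrable h) (T.bar.intervalIntegrable _)]
  refine intervalIntegral.integral_congr fun t _ => ?_
  simp only [deriv_bar_edge]
  simp only [TwistedSimplex.bar, weightedConj, weight_bar, logForm_bar_apply, Complex.conj_conj]
  ring

/-- A de Rham class that is carried to the Frobenius of the class of `ℓ` has a primitive whose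
antiholomorphic derivative is `-W conj(ℓ)`. -/
theorem exists_frobenius_primitive {a : Fin (n + 1) → ℂ} {h : S.bar.regularFunctions}
    (hh : S.bar.comparison (-s) (Submodule.Quotient.mk h) =
      S.frobenius s (S.comparison s (Submodule.Quotient.mk (S.logForm a)))) :
    ∃ F : ℂ → ℂ, ∀ z ∈ S.bar.compl, HasFDerivAt F (formMap (h.1 z + S.bar.connForm s z * F z)
      (-S.bar.weightedConj s (fun k => (starRingEnd ℂ) (a k)) z)) z := by
  have h1 : (⟨S.bar.periodCochain (-s) h, S.bar.periodCochain_mem (-s) h⟩ : S.bar.Cocycle (-s)) -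
      S.frobeniusCocycle s ⟨S.periodCochain s (S.logForm a), S.periodCochain_mem s _⟩ ∈
        S.bar.Coboundaries (-s) := (Submodule.Quotient.eq _).1 hh
  obtain ⟨F, hF⟩ := mem_range_coboundary_iff.1 h1
  refine ⟨F, fun z hz => ?_⟩
  have h2 := hF.hasFDerivAt S.bar.isOpen_compl le_rfl
    (continuousOn_regular h) (continuousOn_weightedConj _).neg
    (fun T _ => integral_sub_integral_bar h a T) hz
  rwa [connForm_neg, neg_mul, sub_neg_eq_add] at h2

/-! ### The single-valued period pairing -/

/-- The comparison map for -s is onto, so `Function.invFun` is a genuine right inverse. -/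
theorem comparison_svPeriodMap (hs : IsGeneric s) (η : S.DeRham s) :
    S.bar.comparison (-s) (S.svPeriodMap s η) = S.frobenius s (S.comparison s η) :=
  Function.invFun_eq ((comparison_bijective hs.neg).2 _)

theorem exists_isDeRhamPairing (hs : IsGeneric s) (b : Fin (n + 1) → ℂ) (η : S.DeRham (-s)) :
    ∃ v, S.IsDeRhamPairing s (Submodule.Quotient.mk (S.logForm b)) η v := by
  obtain ⟨φ, K, hφ, hK, hKS, hvan⟩ := exists_cutoff (S := S) hs b
  obtain ⟨h, rfl⟩ := Submodule.Quotient.mk_surjective _ η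
  exact ⟨_, S.logForm b, h, φ, K, rfl, rfl, hφ.contDiffOn, hK, hKS, fun z hz =>
    (addCovariantDeriv_eq_zero_iff (hφ.differentiable (by simp) z)).2 (hvan z hz), rfl⟩

/-- The values of the intersection pairing with a single-valued period. -/
theorem IsDeRhamPairing.eq_integral (hpos : ∀ k, 0 < s k) (hsum : ∑ k, s k < 1 / 2)
    {a b : Fin (n + 1) → ℂ} (hb : ∑ k, b k = 0) {v : ℂ}
    (hv : S.bar.IsDeRhamPairing s (Submodule.Quotient.mk (S.bar.logForm b))
      (S.svPeriodMap s (Submodule.Quotient.mk (S.logForm a))) v) :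
    v = -(1 / Real.pi) * ∫ z, (S.bar.logForm b).1 z *
      S.bar.weightedConj s (fun k => (starRingEnd ℂ) (a k)) z := by
  obtain ⟨f, h, φ, K, hf, hh, hφ, hK, hKS, hvan, rfl⟩ := hv
  have h1 := comparison_svPeriodMap (S := S) (IsGeneric.of_pos hpos hsum)
    (Submodule.Quotient.mk (S.logForm a))
  rw [← hh] at h1
  obtain ⟨F, hF⟩ := exists_frobenius_primitive h1
  rw [wedgeIntegral_eq_integral_logForm hpos hsum _ hb ((Submodule.Quotient.eq _).1 hf) hφ hK hKS
    hvan hF]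
  have := Real.pi_ne_zero
  field_simp

/-- The value picked by `Classical.epsilon` is genuine because the cutoff construction provides one.
-/
theorem isDeRhamPairing_svPairing (hs : IsGeneric s) (b : Fin (n + 1) → ℂ) (η : S.DeRham s) :
    S.bar.IsDeRhamPairing s
      (Submodule.Quotient.mk (S.bar.logForm fun k => (starRingEnd ℂ) (b k))) (S.svPeriodMap s η)
      (S.svPairing s (Submodule.Quotient.mk (S.logForm b)) η) := by
  rw [← conjRegular_logForm]
  refine Classical.epsilon_spec (p := S.bar.IsDeRhamPairing s _ _) ?_
  change ∃ v, S.bar.IsDeRhamPairing s (Submodule.Quotient.mk (S.conjRegular (S.logForm b))) _ v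
  rw [conjRegular_logForm]
  exact exists_isDeRhamPairing hs _ _

theorem wedgeDensity_logForm (a b : Fin (n + 1) → ℂ) (z : ℂ) :
    wedgeDensity (conjForm (S.logForm b).1) (holForm fun z => S.weight s z * (S.logForm a).1 z) z =
      2 * Complex.I * ((S.bar.logForm fun k => (starRingEnd ℂ) (b k)).1 ((starRingEnd ℂ) z) *
        S.bar.weightedConj s (fun k => (starRingEnd ℂ) (a k)) ((starRingEnd ℂ) z)) := by
  simp only [wedgeDensity, conjForm, holForm, weightedConj, weight_bar, logForm_bar_apply,
    Complex.conj_conj, Pi.zero_apply]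
  ring

theorem measurePreserving_conj : MeasurePreserving (starRingEnd ℂ : ℂ → ℂ) :=
  Complex.conjLIE.measurePreserving

theorem measurableEmbedding_conj : MeasurableEmbedding (starRingEnd ℂ : ℂ → ℂ) :=
  Complex.conjLIE.toHomeomorph.measurableEmbedding

/-- The single-valued period pairing of logarithmic forms as an absolutely convergent integral. -/
theorem svPairing_logForm (hpos : ∀ k, 0 < s k) (hsum : ∑ k, s k < 1 / 2)
    (a : Fin (n + 1) → ℂ) {b : Fin (n + 1) → ℂ} (hb : ∑ k, b k = 0) :
    Integrable (wedgeDensity (conjForm (S.logForm b).1)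
      (holForm fun z => S.weight s z * (S.logForm a).1 z)) ∧
    S.svPairing s (Submodule.Quotient.mk (S.logForm b)) (Submodule.Quotient.mk (S.logForm a)) =
      -(1 / (2 * Real.pi * Complex.I)) * wedgeIntegral (conjForm (S.logForm b).1)
        (holForm fun z => S.weight s z * (S.logForm a).1 z) := by
  have hb' : ∑ k, (starRingEnd ℂ) (b k) = 0 := by rw [← map_sum, hb, map_zero]
  constructor
  · have h1 := integrable_logForm_mul_weightedConj (S := S.bar) hpos hsum
      (fun k => (starRingEnd ℂ) (a k)) hb'
    have h2 := (measurePreserving_conj.integrable_comp_emb measurableEmbedding_conj).2 h1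
    exact (h2.const_mul (2 * Complex.I)).congr (ae_of_all _ fun z => (wedgeDensity_logForm a b z).symm)
  -- The substitution z ↦ z̄ carries the integral over the conjugate configuration back to Σ.
  · rw [(isDeRhamPairing_svPairing (IsGeneric.of_pos hpos hsum) b _).eq_integral hpos hsum hb',
      wedgeIntegral, integral_congr_ae (ae_of_all _ (wedgeDensity_logForm a b)),
      integral_const_mul, measurePreserving_conj.integral_comp measurableEmbedding_conj
        fun z => (S.bar.logForm fun k => (starRingEnd ℂ) (b k)).1 z *
          S.bar.weightedConj s (fun k => (starRingEnd ℂ) (a k)) z]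
    have := Real.pi_ne_zero
    field_simp

/-! ### The intersection pairing of logarithmic forms -/

theorem tendsto_sub_mul_logForm (a : Fin (n + 1) → ℂ) (k : Fin (n + 1)) :
    Tendsto (fun z => (z - S.pt k) * (S.logForm a).1 z) (𝓝[≠] (S.pt k)) (𝓝 (a k)) := by
  obtain ⟨ε, hε0, hε⟩ := S.exists_radius
  have hc := ((differentiableOn_regPart a hε k).differentiableAt
    (Metric.ball_mem_nhds _ hε0)).continuousAt.tendsto.mono_left
      (nhdsWithin_le_nhds (s := {S.pt k}ᶜ))
  rw [regPart_pt] at hc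
  refine hc.congr' ?_
  filter_upwards [eventually_mem_compl k] with z hz
  rw [logForm_apply _ hz, sum_div_eq_regPart a k hz, mul_div_cancel₀]
  exact sub_ne_zero.2 (hz k)

/-- The dz̄ part of the representative is ∂φ/∂z̄, so the pairing is an integral of ∂(φ ℓ_c)/∂z̄ with
ℓ_c the second form. The cut-off potential φ has the value -b_k/s_k at σ_k, so the residues are -b_k
c_k/s_k. There is none at infinity, since ∑ b_k = 0 makes φ decay like 1/|z|. -/
theorem isDeRhamPairing_logForm (hs : IsGeneric s) {b : Fin (n + 1) → ℂ} (hb : ∑ k, b k = 0)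
    (c : Fin (n + 1) → ℂ) :
    S.IsDeRhamPairing s (Submodule.Quotient.mk (S.logForm b)) (Submodule.Quotient.mk (S.logForm c))
      (∑ k, b k * c k / s k) := by
  obtain ⟨φ, K, hφ, hK, hKS, hvan⟩ := exists_cutoff (S := S) hs b
  refine ⟨S.logForm b, S.logForm c, φ, K, rfl, rfl, hφ.contDiffOn, hK, hKS, fun z hz =>
    (addCovariantDeriv_eq_zero_iff (hφ.differentiable (by simp) z)).2 (hvan z hz), ?_⟩
  have hφk : ∀ k, φ (S.pt k) = -b k / s k := fun k => by
    obtain ⟨G, hG1, hG2, hG3⟩ := exists_extension_of_isCompact hs hK hKS hvan k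
    have h1 := hG1.continuousAt.tendsto.mono_left (nhdsWithin_le_nhds (s := {S.pt k}ᶜ))
    have h2 := (hφ.continuous.tendsto (S.pt k)).mono_left (nhdsWithin_le_nhds (s := {S.pt k}ᶜ))
    rw [tendsto_nhds_unique h2 (h1.congr' hG3), ← hG2,
      mul_div_cancel_left₀ _ (Complex.ofReal_ne_zero.2 (hs.ne_zero k))]
  have hdbar : ∀ z ∈ S.compl, dbar (fun z => φ z * (S.logForm c).1 z) z =
      dbar φ z * (S.logForm c).1 z := fun z hz => by
    have hd := S.regularFunctions_differentiableAt (S.logForm c) hz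
    rw [dbar_mul (hφ.differentiable (by simp) z) (hd.restrictScalars ℝ),
      dbar_eq_zero_of_differentiableAt hd, mul_zero, zero_add]
  have hint : Integrable fun z => dbar φ z * (S.logForm c).1 z := by
    have h1 := contDiff_indicator (P := fun z => dbar φ z * (S.logForm c).1 z)
      (((contDiffOn_del_dbar S.isOpen_compl hφ.contDiffOn).2.of_le (by simp)).mul
        (contDiffOn_regular _)) hK hKS fun z hz => by
          rw [dbar_eq_zero_of_differentiableAt (hvan z hz).differentiableAt, zero_mul]
    refine (h1.1.continuous.integrable_of_hasCompactSupport h1.2.1).congr ?_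
    filter_upwards [S.ae_mem_compl] with z hz using indicator_of_mem hz _
  have hae : dbar (fun z => φ z * (S.logForm c).1 z) =ᵐ[volume]
      fun z => dbar φ z * (S.logForm c).1 z := by
    filter_upwards [S.ae_mem_compl] with z hz using hdbar z hz
  have hres := integral_dbar_eq_of_residues (ψ := fun z => φ z * (S.logForm c).1 z) S.injective
    ((hφ.contDiffOn.of_le (by simp)).mul (contDiffOn_regular _)) (hint.congr hae.symm)
    (c := fun k => -b k / s k * c k) (d := 0) (fun k => ?_) ?_
  · rw [integral_congr_ae hae] at hres
    have h2 : wedgeIntegral (S.addCovariantDeriv s (S.logForm b).1 φ) (holForm (S.logForm c).1) =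
        2 * Complex.I * ∫ z, dbar φ z * (S.logForm c).1 z := by
      rw [wedgeIntegral, ← integral_const_mul]
      refine integral_congr_ae (ae_of_all _ fun z => ?_)
      change ((_ : ℂ) * 0 - dbar φ z * (S.logForm c).1 z) * (-2 * Complex.I) = _
      ring
    rw [h2, hres]
    have h3 : ∑ k, -b k / s k * c k = -∑ k, b k * c k / s k := by
      rw [← Finset.sum_neg_distrib]
      exact Finset.sum_congr rfl fun k _ => by ring
    rw [h3]
    have := Real.pi_ne_zero
    field_simp
    ring
  · have h1 := ((hφ.continuous.tendsto (S.pt k)).mono_left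
      (nhdsWithin_le_nhds (s := {S.pt k}ᶜ))).mul (tendsto_sub_mul_logForm c k)
    rw [hφk] at h1
    exact h1.congr fun z => by ring
  · have h1 := isBigO_mul_rpow eventually_cocompact_norm_pos
      (isBigO_infty_of_isCompact hs hK hb hvan) (logForm_isBigO_infty (S := S) c)
    have h2 := (isBigO_refl (fun z : ℂ => z) (cocompact ℂ)).norm_right.mul h1
    refine (h2.congr' EventuallyEq.rfl ?_).trans_tendsto
      (tendsto_norm_rpow_cocompact (r := -1) (by norm_num))
    filter_upwards [eventually_cocompact_norm_pos] with z hz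
    rw [← Real.rpow_one_add' hz.le (by norm_num)]
    norm_num

namespace BranchedPath

variable {i : Fin n} (δ : S.BranchedPath i)

/-! ### Conjugate paths -/

/-- In exponents this is -s l̄ + s (l + l̄) = s l. The weight is what turns the conjugate branch for
-s into the original one. -/
theorem bar_branch_mul_weight {t : ℝ} (ht : t ∈ Ioo (0 : ℝ) 1) :
    δ.bar.branch (-s) t * (S.weight s (δ.path t) : ℝ) = δ.branch s t := by
  rw [norm_factor_rpow s fun k => δ.exp_log k t ht, branch, branch, ← Complex.exp_add,
    ← Finset.sum_add_distrib]
  congr 1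
  refine Finset.sum_congr rfl fun k _ => ?_
  simp only [bar, Pi.neg_apply, Complex.ofReal_neg]
  ring

theorem bar_segment {a b : ℝ} (ha : 0 < a) (hab : a ≤ b) (hb : b < 1) :
    (δ.bar.segment (-s) a b ha hab hb).bar = δ.segment s a b ha hab hb := by
  refine TwistedSimplex.ext_of (fun p => Complex.conj_conj _) fun p => ?_
  change δ.bar.branch (-s) (a * p.1 0 + b * p.1 1) * (S.weight s ((starRingEnd ℂ)
    ((starRingEnd ℂ) (δ.path (a * p.1 0 + b * p.1 1)))) : ℝ) = _
  rw [Complex.conj_conj]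
  exact δ.bar_branch_mul_weight (combo_mem ha hab hb p)

/-- The transform of the cocycle vanishes off the conjugate of K. On the conjugate segment it is the
original cocycle evaluated on the original segment. -/
theorem isPairing_frobenius {c : S.Betti s} {v : ℂ} (h : δ.IsPairing s c v) :
    δ.bar.IsPairing (-s) (S.frobenius s c) v := by
  obtain ⟨φ, K, rfl, hK, hKS, hφK, a, b, ha, hab, hb, haK, hbK, rfl⟩ := h
  have hpath : ∀ t, δ.bar.path t ∈ (starRingEnd ℂ) ⁻¹' K ↔ δ.path t ∈ K := fun t => by
    rw [mem_preimage]
    exact iff_of_eq (congrArg (· ∈ K) (Complex.conj_conj _))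
  refine ⟨S.frobeniusCocycle s φ, (starRingEnd ℂ) ⁻¹' K, rfl,
    Complex.conjLIE.toHomeomorph.isCompact_preimage.2 hK,
    fun z hz => S.mem_compl_bar.2 (hKS hz), fun T hT => hφK T.bar hT, a, b, ha, hab, hb,
    fun t ht h => haK t ht ((hpath t).1 h), fun t ht h => hbK t ht ((hpath t).1 h), ?_⟩
  change _ = φ.1 (δ.bar.segment (-s) a b ha hab hb).bar
  rw [bar_segment]

theorem pairing_bar (hs : IsGeneric s) (c : S.Betti s) :
    δ.bar.pairing (-s) (S.frobenius s c) = δ.pairing s c :=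
  IsPairing.eq δ.bar hs.neg (δ.isPairing_frobenius (δ.isPairing_pairing hs c))

/-! ### Periods of logarithmic forms -/

theorem eventually_mem_Ioo : ∀ᶠ ab : ℝ × ℝ in 𝓝[>] 0 ×ˢ 𝓝[<] 1,
    ab.1 ∈ Ioo (0 : ℝ) 1 ∧ ab.2 ∈ Ioo (0 : ℝ) 1 :=
  (eventually_mem_set.2 (Ioo_mem_nhdsGT zero_lt_one)).prod_mk
    (eventually_mem_set.2 (Ioo_mem_nhdsLT zero_lt_one))

variable (s) in
/-- The period of a logarithmic form along a path, as a linear function of the residues. -/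
def logPairing (hs : IsGeneric s) : (Fin (n + 1) → ℂ) →ₗ[ℂ] ℂ where
  toFun a := δ.pairing s (S.comparison s (Submodule.Quotient.mk (S.logForm a)))
  map_add' a b := by
    refine tendsto_nhds_unique (δ.pairing_tendsto hs (a + b))
      (((δ.pairing_tendsto hs a).add (δ.pairing_tendsto hs b)).congr' ?_)
    filter_upwards [eventually_mem_Ioo] with ab hab
    have h := intervalIntegral.integral_add
      (δ.intervalIntegrable_integrand (s := s) (S.logForm a) hab.1 hab.2)
      (δ.intervalIntegrable_integrand (s := s) (S.logForm b) hab.1 hab.2)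
    have h' : ∀ t, δ.integrand s (S.logForm (a + b)).1 t =
        δ.integrand s (S.logForm a).1 t + δ.integrand s (S.logForm b).1 t := fun t => by
      simp only [integrand, logForm_add, Submodule.coe_add, Pi.add_apply]
      ring
    simp only [regIntegral, h', h, Pi.add_apply]
    ring
  map_smul' c a := by
    refine tendsto_nhds_unique (δ.pairing_tendsto hs (c • a))
      (((δ.pairing_tendsto hs a).const_mul c).congr fun ab => ?_)
    have h' : ∀ t, δ.integrand s (S.logForm (c • a)).1 t =
        c * δ.integrand s (S.logForm a).1 t := fun t => by
      simp only [integrand, logForm_smul, Submodule.coe_smul, Pi.smul_apply, smul_eq_mul]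
      ring
    simp only [regIntegral, h', intervalIntegral.integral_const_mul, Pi.smul_apply, smul_eq_mul]
    ring

end BranchedPath

/-! ### The Lauricella matrices -/

variable (δ : ∀ i : Fin n, S.BranchedPath i)

theorem lauricella_apply (hs : IsGeneric s) (i j : Fin n) :
    lauricella s δ i j = (δ i).logPairing s hs (-(s j.succ : ℂ) • Pi.single j.succ 1) := rfl

/-- The entries of the Lauricella matrix as finite parts of integrals. -/
theorem tendsto_lauricella (hs : IsGeneric s) (i j : Fin n) :
    Tendsto (fun ab : ℝ × ℝ => -(s j.succ : ℂ) * (∫ t in ab.1..ab.2,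
        (δ i).branch s t * (deriv (δ i).path t / ((δ i).path t - S.pt j.succ)))
        + if i = j then (δ i).branch s ab.2 else 0)
      (𝓝[>] 0 ×ˢ 𝓝[<] 1) (𝓝 (lauricella s δ i j)) := by
  refine ((δ i).pairing_tendsto hs _).congr' ?_
  filter_upwards [BranchedPath.eventually_mem_Ioo] with ab hab
  have h1 : (∫ t in ab.1..ab.2, (δ i).integrand s
      (S.logForm (-(s j.succ : ℂ) • Pi.single j.succ 1)).1 t) =
      -(s j.succ : ℂ) * ∫ t in ab.1..ab.2,
        (δ i).branch s t * (deriv (δ i).path t / ((δ i).path t - S.pt j.succ)) := by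
    rw [← intervalIntegral.integral_const_mul]
    refine intervalIntegral.integral_congr fun t ht => ?_
    have hm := (δ i).mem t (ordConnected_Ioo.uIcc_subset hab.1 hab.2 ht)
    simp only [BranchedPath.integrand, logForm_apply _ hm, Pi.smul_apply, smul_eq_mul,
      Pi.single_apply, mul_ite, mul_one, mul_zero, ite_div, zero_div, Finset.sum_ite_eq',
      Finset.mem_univ, if_true]
    ring
  have h2 : (s i.succ : ℂ) ≠ 0 := Complex.ofReal_ne_zero.2 (hs.ne_zero _)
  rw [BranchedPath.regIntegral, h1]
  by_cases hij : i = j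
  · subst hij
    simp [(Fin.succ_ne_zero i).symm, h2]
  · simp [(Fin.succ_ne_zero j).symm, hij]

/-- For positive exponents the integrals converge. -/
theorem tendsto_lauricella_of_pos (hs : IsGeneric s) (hpos : ∀ k, 0 < s k) (i j : Fin n) :
    Tendsto (fun ab : ℝ × ℝ => -(s j.succ : ℂ) * ∫ t in ab.1..ab.2,
        (δ i).branch s t * (deriv (δ i).path t / ((δ i).path t - S.pt j.succ)))
      (𝓝[>] 0 ×ˢ 𝓝[<] 1) (𝓝 (lauricella s δ i j)) := by
  -- The boundary term of the finite part disappears, because the branch is O(|z - σ_i|^{s_i}) with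
  -- s_i > 0.
  have h1 : Tendsto ((δ i).branch s) (𝓝[<] 1) (𝓝 0) :=
    ((δ i).branch_isBigO (Ioo_mem_nhdsLT zero_lt_one) (δ i).tendsto_one_punctured).trans_tendsto
      ((tendsto_norm_sub_rpow _ (hpos _)).comp (δ i).tendsto_one_punctured)
  have h2 : Tendsto (fun ab : ℝ × ℝ => if i = j then (δ i).branch s ab.2 else 0)
      (𝓝[>] 0 ×ˢ 𝓝[<] 1) (𝓝 0) := by
    split_ifs
    · exact h1.comp tendsto_snd
    · exact tendsto_const_nhds
  simpa using (tendsto_lauricella δ hs i j).sub h2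

/-- Every class is the class of a logarithmic form without residue at `0`. -/
theorem exists_eq_logForm_cons (hs : IsGeneric s) (η : S.DeRham s) :
    ∃ c : Fin n → ℂ, η = Submodule.Quotient.mk (S.logForm (Fin.cons 0 c)) := by
  obtain ⟨f, rfl⟩ := Submodule.Quotient.mk_surjective _ η
  obtain ⟨a, ha⟩ := exists_logForm hs.abs_lt_one hs.abs_sum_lt_one f
  have h0 : (s 0 : ℂ) ≠ 0 := Complex.ofReal_ne_zero.2 (hs.ne_zero _)
  -- Subtracting the multiple a 0 / s 0 of the exact form ∑ s_k ω_k removes the residue at 0.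
  refine ⟨fun k => a k.succ - a 0 / s 0 * s k.succ, (Submodule.Quotient.eq _).2 ?_⟩
  have h1 : a = Fin.cons 0 (fun k : Fin n => a k.succ - a 0 / s 0 * s k.succ) +
      (a 0 / s 0) • fun k => (s k : ℂ) := by
    refine funext (Fin.cases ?_ fun k => ?_)
    · simp [h0]
    · simp
  have h2 := add_mem ha (Submodule.smul_mem _ (a 0 / s 0) (logForm_exponents_mem (S := S) (s := s)))
  rw [h1, logForm_add, logForm_smul] at h2
  convert h2 using 1
  simp only [← h1]
  abel

/-- In terms of the forms -s_k ω_k the form ∑ c_k ω_k has the coordinates -c_k/s_k. -/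
theorem logPairing_cons (hs : IsGeneric s) (c : Fin n → ℂ) (i : Fin n) :
    (δ i).logPairing s hs (Fin.cons 0 c) = ∑ k, lauricella s δ i k * (-c k / s k.succ) := by
  have h : (Fin.cons 0 c : Fin (n + 1) → ℂ) =
      ∑ k : Fin n, (-c k / s k.succ) • (-(s k.succ : ℂ) • Pi.single k.succ 1) := by
    have h0 : ∀ k : Fin n, (s k.succ : ℂ) ≠ 0 := fun k => Complex.ofReal_ne_zero.2 (hs.ne_zero _)
    refine funext (Fin.cases ?_ fun k => ?_)
    · simp [Finset.sum_apply, (Fin.succ_ne_zero _).symm]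
    · simp [Finset.sum_apply, Pi.single_apply, h0]
  rw [h, map_sum]
  refine Finset.sum_congr rfl fun k _ => ?_
  rw [map_smul, lauricella_apply δ hs, smul_eq_mul, mul_comm]

/-- The single-valued Lauricella matrix is the matrix of the single-valued period map. -/
theorem svLauricella_apply (hpos : ∀ k, 0 < s k) (hsum : ∑ k, s k < 1 / 2) {c : Fin n → ℂ}
    (i j : Fin n)
    (hc : S.svPeriodMap s (Submodule.Quotient.mk (S.logForm (-(s j.succ : ℂ) • Pi.single j.succ 1))) =
      Submodule.Quotient.mk (S.bar.logForm (Fin.cons 0 c))) :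
    S.svLauricella s i j = c i / s i.succ := by
  have hs := IsGeneric.of_pos hpos hsum
  set a : Fin (n + 1) → ℂ := -(s j.succ : ℂ) • Pi.single j.succ 1 with ha
  -- Pairing with ω_i - ω_0 reads off c_i/s_i, because the second form is normalised to have no
  -- residue at 0.
  set b : Fin (n + 1) → ℂ := Pi.single i.succ 1 - Pi.single 0 1 with hbdef
  have hb : ∑ k, b k = 0 := by simp [hbdef, Finset.sum_sub_distrib]
  have hb' : (fun k => (starRingEnd ℂ) (b k)) = b := by
    ext k
    simp only [hbdef, Pi.sub_apply, Pi.single_apply, map_sub, apply_ite (starRingEnd ℂ), map_one,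
      map_zero]
  have h1 := isDeRhamPairing_svPairing hs b (Submodule.Quotient.mk (S.logForm a))
  have h2 := isDeRhamPairing_logForm (S := S.bar) hs hb (Fin.cons 0 c)
  rw [← hc] at h2
  rw [hb'] at h1
  -- The residue sum and the single-valued pairing are two values of one and the same pairing, and
  -- every value equals the same integral.
  have h3 := (h1.eq_integral hpos hsum hb).trans (h2.eq_integral hpos hsum hb).symm
  rw [(svPairing_logForm hpos hsum a hb).2, Fin.sum_univ_succ] at h3
  have h4 : wedgeIntegral (conjForm (S.logForm b).1) (holForm fun z => S.weight s z * (S.logForm a).1 z) =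
      -(s j.succ : ℂ) * wedgeIntegral (conjForm fun z => 1 / (z - S.pt i.succ) - 1 / z)
        (holForm fun z => S.weight s z * (1 / (z - S.pt j.succ))) := by
    rw [wedgeIntegral, wedgeIntegral, ← integral_const_mul]
    refine integral_congr_ae ?_
    filter_upwards [S.ae_mem_compl] with z hz
    have e1 : (S.logForm b).1 z = 1 / (z - S.pt i.succ) - 1 / z := by
      simp [logForm_apply _ hz, hbdef, sub_div, Finset.sum_sub_distrib, Pi.single_apply, ite_div,
        S.pt_zero]
    have e2 : (S.logForm a).1 z = -(s j.succ : ℂ) * (1 / (z - S.pt j.succ)) := by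
      simp [logForm_apply _ hz, ha, Pi.single_apply, div_eq_mul_inv]
    simp only [wedgeDensity, conjForm, holForm, e1, e2, Pi.zero_apply]
    ring
  rw [h4] at h3
  have h5 : ∑ k : Fin n, b k.succ * (Fin.cons 0 c : Fin (n + 1) → ℂ) k.succ / (s k.succ : ℂ) =
      c i / s i.succ := by
    rw [Finset.sum_eq_single i]
    · simp [hbdef]
    · intro k _ hk
      simp [hbdef, hk]
    · simp
  rw [h5] at h3
  simp only [Fin.cons_zero, mul_zero, zero_div, zero_add] at h3
  rw [← h3, svLauricella, Matrix.of_apply]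
  ring

/-- The double copy identity. -/
theorem lauricella_mul_svLauricella (hpos : ∀ k, 0 < s k) (hsum : ∑ k, s k < 1 / 2) :
    lauricella (-s) (fun i => (δ i).bar) * S.svLauricella s = lauricella s δ := by
  have hs := IsGeneric.of_pos hpos hsum
  ext i j
  -- The image of -s_j ω_j under 𝐬 is written as ∑ c_k ω_k. For the exponents -s the forms entering
  -- the matrix are s_k ω_k, so its coordinates are c_k/s_k, the entries of the single-valued
  -- matrix. The conjugate path pairs with it as δ_i pairs with -s_j ω_j.
  obtain ⟨c, hc⟩ := exists_eq_logForm_cons hs.neg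
    (S.svPeriodMap s (Submodule.Quotient.mk (S.logForm (-(s j.succ : ℂ) • Pi.single j.succ 1))))
  have h1 := logPairing_cons (fun i => (δ i).bar) hs.neg c i
  have h2 : (δ i).bar.logPairing (-s) hs.neg (Fin.cons 0 c) = lauricella s δ i j := by
    change (δ i).bar.pairing (-s) (S.bar.comparison (-s) (Submodule.Quotient.mk _)) = _
    rw [← hc, comparison_svPeriodMap hs, (δ i).pairing_bar hs]
    rfl
  rw [Matrix.mul_apply, ← h2, h1]
  refine Finset.sum_congr rfl fun k _ => ?_
  rw [svLauricella_apply hpos hsum k j hc]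
  simp

/-- A vector in the kernel gives a logarithmic form without residue at 0 all of whose periods along
the δ_i vanish. Its Betti class is then 0, so the form is a multiple of ∑ s_k ω_k. As s_0 ≠ 0, the
missing residue at 0 makes it zero. -/
theorem isUnit_det_lauricella (hs : IsGeneric s) (hδ : IsBettiBasis s δ) :
    IsUnit (lauricella s δ).det := by
  rw [isUnit_iff_ne_zero]
  intro h
  obtain ⟨v, hv0, hv⟩ := Matrix.exists_mulVec_eq_zero_iff.2 h
  have h0 : ∀ k, (s k : ℂ) ≠ 0 := fun k => Complex.ofReal_ne_zero.2 (hs.ne_zero _)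
  set a : Fin (n + 1) → ℂ := Fin.cons 0 fun k => -(s k.succ * v k) with ha
  have h1 : ∀ i, (δ i).logPairing s hs a = 0 := fun i => by
    rw [logPairing_cons]
    refine Eq.trans ?_ (congrFun hv i)
    refine Finset.sum_congr rfl fun k _ => ?_
    rw [neg_neg, mul_div_cancel_left₀ _ (h0 _)]
  have h2 : S.comparison s (Submodule.Quotient.mk (S.logForm a)) = 0 := by
    have h3 : S.comparison s (Submodule.Quotient.mk (S.logForm 0)) = 0 := by
      rw [show S.logForm 0 = 0 from map_zero S.logFormₗ, Submodule.Quotient.mk_zero, map_zero]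
    rw [← h3]
    refine hδ.1 (funext fun i => (h1 i).trans ?_)
    exact (map_zero ((δ i).logPairing s hs)).symm
  obtain ⟨F, hF⟩ := comparison_mk_eq_zero h2
  obtain ⟨c, hc⟩ := exists_eq_smul_of_primitive hs hF
  have hc0 : c = 0 := by
    have := hc 0
    rw [ha, Fin.cons_zero] at this
    exact (mul_eq_zero.1 this.symm).resolve_right (h0 0)
  refine hv0 (funext fun k => ?_)
  have := hc k.succ
  rw [ha, Fin.cons_succ, hc0, zero_mul, neg_eq_zero] at this
  exact (mul_eq_zero.1 this).resolve_left (h0 _)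

end PointConfig

namespace PointConfig

variable {n : ℕ} {S : PointConfig n} {s : Fin (n + 1) → ℝ} {p : ℂ}

/-! ### Paths whose classes form a basis -/

theorem exists_extension_of_isPrimitiveOn (hs : IsGeneric s) {a : Fin (n + 1) → ℂ} {G : ℂ → ℂ}
    {k : Fin (n + 1)} {ε : ℝ} (hε0 : 0 < ε)
    (hG : IsPrimitiveOn (S.periodCochain s (S.logForm a)) G (S.punctured k ε)) :
    (fun z => G z - a k / s k) =O[𝓝[≠] (S.pt k)] fun z => z - S.pt k := by
  obtain ⟨η, hη0, hη⟩ := S.exists_radius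
  have hη' : ∀ i j, i ≠ j → min ε η ≤ dist (S.pt i) (S.pt j) := fun i j h =>
    (min_le_right _ _).trans (hη i j h)
  have hopen : IsOpen (S.punctured k (min ε η)) := Metric.isOpen_ball.sdiff isClosed_singleton
  have hG' := hG.mono (punctured_mono (min_le_left ε η))
  obtain ⟨H, hH1, hH2, hH3⟩ := exists_extension (a := a) (lt_min hε0 hη0) hη' k (hs.abs_lt_one k)
    fun z hz => hG'.hasDerivAt hopen (punctured_subset hη' k) hz
  have hbn := Metric.ball_mem_nhds (S.pt k) (lt_min hε0 hη0)
  have hHk : H (S.pt k) = a k / s k := by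
    rw [← hH2, mul_div_cancel_left₀ _ (Complex.ofReal_ne_zero.2 (hs.ne_zero k))]
  have h1 := (hH1.differentiableAt hbn).isBigO_sub.mono (nhdsWithin_le_nhds (s := {S.pt k}ᶜ))
  rw [hHk] at h1
  refine h1.congr' ?_ EventuallyEq.rfl
  filter_upwards [sdiff_mem_nhdsWithin_compl hbn {S.pt k}] with z hz
  rw [hH3 z hz]

theorem punctured_mem_nhdsWithin {k : Fin (n + 1)} {ε : ℝ} (hε : 0 < ε) :
    S.punctured k ε ∈ 𝓝[≠] (S.pt k) :=
  sdiff_mem_nhdsWithin_compl (Metric.ball_mem_nhds _ hε) _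

/-- The period of a logarithmic form along a path in the slit plane is a difference of jumps. -/
theorem BranchedPath.pairing_eq_of_isJump (hs : IsGeneric s) {i : Fin n} (δ : S.BranchedPath i)
    {l : S.LogSystem (S.slitDomain p)} (hmem : ∀ t ∈ Ioo (0 : ℝ) 1, δ.path t ∈ S.slitDomain p)
    (hl : ∀ t, δ.branch s t = l.sec s (δ.path t)) {a c : Fin (n + 1) → ℂ}
    (h : IsJump l (S.periodCochain s (S.logForm a)) c) :
    δ.pairing s (S.comparison s (Submodule.Quotient.mk (S.logForm a))) = c i.succ - c 0 := by
  obtain ⟨F, hF, hG⟩ := h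
  choose ε hε0 G hG1 hG2 using hG
  have hlim : ∀ (k : Fin (n + 1)) (L : Filter ℝ), Ioo (0 : ℝ) 1 ∈ L →
      Tendsto δ.path L (𝓝[≠] (S.pt k)) →
      Tendsto (fun t => δ.branch s t * (F (δ.path t) - a k / s k)) L (𝓝 (c k)) := fun k L hL h => by
    have h1 := δ.tendsto_branch_mul (s := s) hL h (abs_lt.1 (hs.abs_lt_one k)).1
      (exists_extension_of_isPrimitiveOn hs (hε0 k) (hG1 k))
    have h2 := h1.add_const (c k)
    rw [zero_add] at h2
    refine h2.congr' ?_
    filter_upwards [hL, h (punctured_mem_nhdsWithin (hε0 k))] with t ht ht'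
    rw [← hG2 k _ ⟨hmem t ht, ht'⟩, hl]
    ring
  refine tendsto_nhds_unique (δ.pairing_tendsto hs a) ((((hlim i.succ _ (Ioo_mem_nhdsLT zero_lt_one)
    δ.tendsto_one_punctured).comp tendsto_snd).sub ((hlim 0 _ (Ioo_mem_nhdsGT zero_lt_one)
    δ.tendsto_zero_punctured).comp tendsto_fst)).congr' ?_)
  have hev : ∀ᶠ ab : ℝ × ℝ in 𝓝[>] 0 ×ˢ 𝓝[<] 1, ab.1 ∈ Ioc (0 : ℝ) (1 / 2) ∧
      ab.2 ∈ Ico (1 / 2 : ℝ) 1 :=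
    (eventually_mem_set.2 (Ioc_mem_nhdsGT (by norm_num))).prod_mk
      (eventually_mem_set.2 (Ico_mem_nhdsLT (by norm_num)))
  filter_upwards [hev] with ab hab
  have hle := hab.1.2.trans hab.2.1
  have h1 := hF (δ.segment s ab.1 ab.2 hab.1.1 hle hab.2.2)
    fun q => hmem _ (combo_mem hab.1.1 hle hab.2.2 q)
  rw [periodCochain_segment, bdry_path_segment] at h1
  simp only [regIntegral, Function.comp, h1]
  ring

/-- The line through p and σ_k meets the slits only from σ_k onwards: it crosses the line through p
and another σ_j only at p, and p is off all the rays. -/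
theorem IsGenericBase.add_mul_mem_slitDomain (hp : S.IsGenericBase p) (k : Fin (n + 1)) {r : ℝ}
    (hr : r < 1) : p + r * (S.pt k - p) ∈ S.slitDomain p := fun j => by
  have hj : p - S.pt j ≠ 0 := sub_ne_zero.2 (hp.1 j)
  have hj' : S.pt j - p ≠ 0 := sub_ne_zero.2 (hp.1 j).symm
  have h1 : (p + r * (S.pt k - p) - S.pt j) / (p - S.pt j) =
      1 - r * ((S.pt k - p) / (S.pt j - p)) := by
    field_simp
    ring
  rw [h1]
  by_cases hkj : k = j
  · subst hkj
    rw [div_self hj', mul_one]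
    exact Or.inl (by simpa using hr)
  · by_cases hr0 : r = 0
    · simp [hr0, Complex.one_mem_slitPlane]
    · refine Or.inr ?_
      rw [Complex.sub_im, Complex.one_im, Complex.im_ofReal_mul, zero_sub, neg_ne_zero]
      exact mul_ne_zero hr0 (hp.2 k j hkj)

/-- The smooth path from `0` to `σ_i` that follows the segments from `0` to `p` and from `p` to
`σ_i`. -/
def bentPath (S : PointConfig n) (p : ℂ) (i : Fin n) (t : ℝ) : ℂ :=
  p + (Real.smoothTransition (1 - 2 * t) : ℝ) * (S.pt 0 - p) +
    (Real.smoothTransition (2 * t - 1) : ℝ) * (S.pt i.succ - p)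

theorem contDiff_bentPath (i : Fin n) : ContDiff ℝ ∞ (S.bentPath p i) := by
  have h : ∀ {f : ℝ → ℝ} (σ : ℂ), ContDiff ℝ ∞ f →
      ContDiff ℝ ∞ fun t => (Real.smoothTransition (f t) : ℂ) * σ := fun σ hf =>
    (Complex.ofRealCLM.contDiff.comp (Real.smoothTransition.contDiff.comp hf)).mul contDiff_const
  exact (contDiff_const.add (h _ (by fun_prop))).add (h _ (by fun_prop))

theorem bentPath_mem (hp : S.IsGenericBase p) (i : Fin n) {t : ℝ} (ht : t ∈ Ioo (0 : ℝ) 1) :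
    S.bentPath p i t ∈ S.slitDomain p := by
  rcases le_total t (1 / 2) with h | h
  · have h1 : Real.smoothTransition (2 * t - 1) = 0 :=
      Real.smoothTransition.zero_of_nonpos (by linarith)
    rw [bentPath, h1, Complex.ofReal_zero, zero_mul, add_zero]
    exact hp.add_mul_mem_slitDomain 0 (Real.smoothTransition.lt_one_of_lt_one (by linarith [ht.1]))
  · have h1 : Real.smoothTransition (1 - 2 * t) = 0 :=
      Real.smoothTransition.zero_of_nonpos (by linarith)
    rw [bentPath, h1, Complex.ofReal_zero, zero_mul, add_zero]
    exact hp.add_mul_mem_slitDomain _ (Real.smoothTransition.lt_one_of_lt_one (by linarith [ht.2]))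

/-- A bent path with the branches given by a system of logarithms on the slit plane. -/
def bentBranchedPath (hp : S.IsGenericBase p) (l : S.LogSystem (S.slitDomain p)) (i : Fin n) :
    S.BranchedPath i where
  path := S.bentPath p i
  smooth := (contDiff_bentPath i).contDiffOn
  mem _ ht := slitDomain_subset p (bentPath_mem hp i ht)
  tendsto_zero := by
    have h := ((contDiff_bentPath (S := S) (p := p) i).continuous.tendsto 0).mono_left
      (nhdsWithin_le_nhds (s := Ioi 0))
    convert h using 2
    simp [bentPath, S.pt_zero, Real.smoothTransition.zero_of_nonpos]
  tendsto_one := by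
    have h := ((contDiff_bentPath (S := S) (p := p) i).continuous.tendsto 1).mono_left
      (nhdsWithin_le_nhds (s := Iio 1))
    convert h using 2
    norm_num [bentPath, Real.smoothTransition.zero_of_nonpos]
  log k t := l.log k (S.bentPath p i t)
  continuousOn_log k := (l.continuousOn_log k).comp (contDiff_bentPath i).continuous.continuousOn
    fun _ ht => bentPath_mem hp i ht
  exp_log k _ ht := l.exp_log k _ (bentPath_mem hp i ht)

/-- Along the bent path to σ_i the period is the difference of the jumps at σ_i and at 0. Jumps
modulo constants determine a class, and all vectors of jumps occur, so these differences are
coordinates on Betti cohomology. -/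
theorem exists_isBettiBasis (hs : IsGeneric s) :
    ∃ δ : ∀ i : Fin n, S.BranchedPath i, IsBettiBasis s δ := by
  obtain ⟨p, hp, ⟨l⟩⟩ := S.exists_logSystem_slitDomain
  have hpair : ∀ {a c : Fin (n + 1) → ℂ} (i : Fin n),
      IsJump l (S.periodCochain s (S.logForm a)) c →
      (bentBranchedPath hp l i).logPairing s hs a = c i.succ - c 0 := fun i h =>
    (bentBranchedPath hp l i).pairing_eq_of_isJump hs (fun _ ht => bentPath_mem hp i ht)
      (fun _ => rfl) h
  refine ⟨bentBranchedPath hp l, fun c c' hcc => ?_, fun v => ?_⟩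
  · obtain ⟨a, rfl⟩ := exists_logForm_comparison hs c
    obtain ⟨a', rfl⟩ := exists_logForm_comparison hs c'
    obtain ⟨d, hd⟩ := exists_isJump hp l hs (S.periodCochain_mem s (S.logForm (a - a')))
    have h1 : ∀ i : Fin n, d i.succ = d 0 := fun i => by
      rw [← sub_eq_zero, ← hpair i hd, map_sub, sub_eq_zero]
      exact congrFun hcc i
    -- Equal periods make the jumps of the difference constant, and a constant can be shifted to
    -- zero.
    have h2 : d + (-1 : ℂ) • (fun _ => d 0) = 0 := by
      refine funext (Fin.cases ?_ fun i => ?_)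
      · simp
      · simp [h1]
    have h3 := hd.add ((isJump_const l (d 0)).smul (-1))
    rw [h2, smul_zero, add_zero] at h3
    have h4 := h3.mem_range hp (S.periodCochain_mem s _)
    rw [← sub_eq_zero, ← map_sub, ← Submodule.Quotient.mk_sub]
    have h5 : S.logForm a - S.logForm a' = S.logForm (a - a') := (map_sub S.logFormₗ a a').symm
    rw [h5, mk_comparison, Submodule.Quotient.mk_eq_zero]
    exact h4
  · obtain ⟨a, ha⟩ := exists_logForm_isJump hp l hs (Fin.cons 0 v)
    refine ⟨S.comparison s (Submodule.Quotient.mk (S.logForm a)), funext fun i => ?_⟩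
    refine (hpair i ha).trans ?_
    simp

end PointConfig
end
end Lauricella

/-! ### The main theorem -/

theorem mainTheorem9 {n : ℕ} (S : Lauricella.PointConfig n) (s : Fin (n + 1) → ℝ)
    (hpos : ∀ k, 0 < s k) (hsum : ∑ k, s k < 1 / 2) :
    -- the comparison maps that enter the single-valued period map are isomorphisms
    (Function.Bijective (S.comparison s) ∧ Function.Bijective (S.bar.comparison (-s))) ∧
    -- the single-valued pairing of logarithmic forms, the first of them without pole at infinity
    (∀ a b : Fin (n + 1) → ℂ, ∑ k, b k = 0 →
      MeasureTheory.Integrable (Lauricella.wedgeDensity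
        (Lauricella.conjForm (S.logForm b).1)
        (Lauricella.holForm fun z => S.weight s z * (S.logForm a).1 z)) ∧
      S.svPairing s (Submodule.Quotient.mk (S.logForm b)) (Submodule.Quotient.mk (S.logForm a)) =
        -(1 / (2 * Real.pi * Complex.I)) * Lauricella.wedgeIntegral
          (Lauricella.conjForm (S.logForm b).1)
          (Lauricella.holForm fun z => S.weight s z * (S.logForm a).1 z)) ∧
    -- there are paths whose classes form a basis of locally finite homology
    (∃ δ : ∀ i : Fin n, S.BranchedPath i, Lauricella.PointConfig.IsBettiBasis s δ) ∧
    ∀ δ : ∀ i : Fin n, S.BranchedPath i,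
      -- the entries of `L_Σ(s)` are the Lauricella integrals
      (∀ i j : Fin n, Filter.Tendsto
        (fun ab : ℝ × ℝ => -(s j.succ : ℂ) * ∫ t in ab.1..ab.2,
          (δ i).branch s t * (deriv (δ i).path t / ((δ i).path t - S.pt j.succ)))
        (nhdsWithin 0 (Set.Ioi 0) ×ˢ nhdsWithin 1 (Set.Iio 1))
        (nhds (Lauricella.PointConfig.lauricella s δ i j))) ∧
      -- the entries of `L_Σ̄(-s)`, along the conjugate paths, are the finite parts of the
      -- Lauricella integrals (the integrals themselves off the diagonal)
      (∀ i j : Fin n, Filter.Tendsto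
        (fun ab : ℝ × ℝ => (s j.succ : ℂ) * (∫ t in ab.1..ab.2,
          (δ i).bar.branch (-s) t * (deriv (δ i).bar.path t / ((δ i).bar.path t - S.bar.pt j.succ)))
          + if i = j then (δ i).bar.branch (-s) ab.2 else 0)
        (nhdsWithin 0 (Set.Ioi 0) ×ˢ nhdsWithin 1 (Set.Iio 1))
        (nhds (Lauricella.PointConfig.lauricella (-s) (fun i => (δ i).bar) i j))) ∧
      -- the double copy identity
      Lauricella.PointConfig.lauricella (-s) (fun i => (δ i).bar) * S.svLauricella s =
        Lauricella.PointConfig.lauricella s δ ∧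
      (Lauricella.PointConfig.IsBettiBasis s δ →
        IsUnit (Lauricella.PointConfig.lauricella (-s) (fun i => (δ i).bar)).det ∧
        S.svLauricella s = (Lauricella.PointConfig.lauricella (-s) (fun i => (δ i).bar))⁻¹ *
          Lauricella.PointConfig.lauricella s δ) := by
  have hs := Lauricella.PointConfig.IsGeneric.of_pos hpos hsum
  refine ⟨⟨Lauricella.PointConfig.comparison_bijective hs,
    Lauricella.PointConfig.comparison_bijective hs.neg⟩,
    fun a b hb => Lauricella.PointConfig.svPairing_logForm hpos hsum a hb,
    Lauricella.PointConfig.exists_isBettiBasis hs, fun δ => ?_⟩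
  have hmul := Lauricella.PointConfig.lauricella_mul_svLauricella δ hpos hsum
  refine ⟨Lauricella.PointConfig.tendsto_lauricella_of_pos δ hs hpos, fun i j => ?_, hmul,
    fun hδ => ?_⟩
  · simpa using Lauricella.PointConfig.tendsto_lauricella (fun i => (δ i).bar) hs.neg i j
  -- Invertibility is known for L_Σ(s). By the double copy identity its determinant is a product
  -- with that of L_Σ̄(-s) as a factor, so L_Σ̄(-s) is invertible as well.
  · have h1 := Lauricella.PointConfig.isUnit_det_lauricella δ hs hδ
    rw [← hmul, Matrix.det_mul] at h1
    have h2 := isUnit_of_mul_isUnit_left h1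
    exact ⟨h2, by rw [← hmul, Matrix.nonsing_inv_mul_cancel_left _ _ h2]⟩
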